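/- **Contour.** Let $Y=\bigcup_{j=1}^9Y_j\subset\mathbb C$, where $Y_1,\dots,Y_4$ are the rays $Y_j=\{re^{i(j-1)\pi/2}: r\ge1\}$ and $Y_5,\dots,Y_9$ are the arcs $\{e^{i\varphi}\}$ of the unit circle with $\varphi\in[-\frac\pi2,0]$, $[0,\frac\pi2]$, $[\frac\pi2,\pi]$, $[\pi,\frac{5\pi}4]$, $[-\frac{3\pi}4,-\frac\pi2]$, respectively. $Y_1,Y_2$ are oriented away from the origin, $Y_3,Y_4$ towards the origin, and the circle counterclockwise. Powers $\lambda^a=e^{a\ln\lambda}$ use the branch of the logarithm with $\arg\lambda\in(-\frac{3\pi}4,\frac{5\pi}4]$, i.e. with cut along $\arg\lambda=-\frac{3\pi}{4}$ and $\ln\lambda$ real for $\lambda>0$. Put $\sigma_3=\mathrm{diag}(1,-1)$. **Riemann–Hilbert problem.** For $y\in\mathbb R$ and $\tilde\nu\in\mathbb C\setminus i\mathbb Z$ let $p=e^{2\pi\tilde\nu}-1$, $q=\frac{p}{1+p}$, $e_\pm=e^{\pm(\lambda^2+2y\lambda)}$, and let the jump matrix $v^Y(y,\tilde\nu,\lambda)$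 on $Y_1,\dots,Y_9$ be, respectively, $$\begin{pmatrix}1&0\\ q\lambda^{2i\tilde\nu}e_-&1\end{pmatrix},\quad \begin{pmatrix}1&-\lambda^{-2i\tilde\nu}e_+\\0&1\end{pmatrix},\quad \begin{pmatrix}1&0\\ p\lambda^{2i\tilde\nu}e_-&1\end{pmatrix},\quad \begin{pmatrix}1&-(1+p)\lambda^{-2i\tilde\nu}e_+\\0&1\end{pmatrix},$$ $$\lambda^{-i\tilde\nu\sigma_3},\quad \lambda^{-i\tilde\nu\sigma_3}\begin{pmatrix}1&0\\-qe_-&1\end{pmatrix},\quad \lambda^{-i\tilde\nu\sigma_3}\begin{pmatrix}\frac1{1+p}&e_+\\-qe_-&1\end{pmatrix},\quad \lambda^{-i\tilde\nu\sigma_3}\begin{pmatrix}\frac1{1+p}&e_+\\0&1+p\end{pmatrix},\quad \lambda^{-i\tilde\nu\sigma_3}\begin{pmatrix}1&(1+p)e_+\\0&1\end{pmatrix}.$$ The problem is to find a $2\times2$-matrix valued function $m$ with $$m\in I+\dot E^2(\mathbb C\setminus Y),\qquad m_+=m_-v^Y(y,\tilde\nu,\cdot)\ \text{ a.e. on } Y,$$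 where $m_\pm$ are the nontangential boundary values from the left/right of $Y$. Here $f\in\dot E^2(\mathbb C\setminus Y)$ means that $f$ is analytic in $\mathbb C\setminus Y$ and, for every connected component $D_j$, there are rectifiable Jordan curves $C_n\subset D_j$ which eventually surround each compact subset of $D_j$ and satisfy $\sup_n\|f\|_{L^2(C_n)}<\infty$ (for matrices: entrywise). **Explicit function.** Let $D_a(z)$ be the parabolic cylinder function and, with the principal branch of $(2i)^{i\tilde\nu+1}$, $$\beta^Y(\tilde\nu)=\frac{(2i)^{i\tilde\nu+1}\sqrt\pi\,e^{5\pi\tilde\nu/2}}{(e^{2\pi\tilde\nu}-1)\Gamma(i\tilde\nu)},\qquad m_1^Y(y,\tilde\nu)=\begin{pmatrix}-i\tilde\nu y&-\frac{\beta^Y(\tilde\nu)}2e^{-y^2}\\-\frac{i\tilde\nu}{\beta^Y(\tilde\nu)}e^{y^2}&i\tilde\nu y\end{pmatrix},$$ $$\psi=e^{-\frac{y^2}2\sigma_3}\begin{pmatrix}e^{-\frac{\pi\tilde\nu}2}D_{-i\tilde\nu}(i\sqrt2(y+\lambda))&-\frac{\beta^Y}{\sqrt2}D_{i\tilde\nu-1}(\sqrt2(y+\lambda))\\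 \frac{\sqrt2}{\beta^Y}e^{-\frac{\pi\tilde\nu}2}\tilde\nu D_{-i\tilde\nu-1}(i\sqrt2(y+\lambda))&D_{i\tilde\nu}(\sqrt2(y+\lambda))\end{pmatrix}2^{\frac{i\tilde\nu}2\sigma_3},$$ $$R_1=\begin{pmatrix}1&0\\q&1\end{pmatrix},\quad R_2=\begin{pmatrix}1&-1\\0&1\end{pmatrix},\quad R_3=\begin{pmatrix}1&0\\p&1\end{pmatrix},\quad R_4=\begin{pmatrix}1&-(1+p)\\0&1\end{pmatrix}.$$ For $\lambda\in\mathbb C\setminus Y$ define $m^Y(y,\tilde\nu,\lambda)=\psi\,e^{-(\frac{\lambda^2}2+y\lambda)\sigma_3}$ if $|\lambda|<1$ and $m^Y(y,\tilde\nu,\lambda)=\psi\,R\,e^{-(\frac{\lambda^2}2+y\lambda)\sigma_3}\lambda^{i\tilde\nu\sigma_3}$ if $|\lambda|>1$, where $R=R_4,\ I,\ R_1,\ R_1R_2,\ R_1R_2R_3^{-1}$ according as $\arg\lambda$ lies in $(-\frac{3\pi}4,-\frac\pi2)$, $(-\frac\pi2,0)$, $(0,\frac\pi2)$, $(\frac\pi2,\pi)$,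 $(\pi,\frac{5\pi}4]$. **Theorem.** For every $y\in\mathbb R$ and $\tilde\nu\in\mathbb C\setminus i\mathbb Z$ the function $m^Y(y,\tilde\nu,\cdot)$ is a solution of the Riemann–Hilbert problem, and it is the only one. For all compact sets $K_1\subset\mathbb R$ and $K_2\subset\mathbb C\setminus i\mathbb Z$, $$m^Y(y,\tilde\nu,\lambda)=I+\frac{m_1^Y(y,\tilde\nu)}{\lambda}+O(\lambda^{-2}),\qquad \lambda\to\infty,\ \lambda\in\mathbb C\setminus Y,$$ uniformly with respect to $\arg\lambda$, $y\in K_1$ and $\tilde\nu\in K_2$, and $$\sup_{y\in K_1}\sup_{\tilde\nu\in K_2}\sup_{\lambda\in\mathbb C\setminus Y}|m^Y(y,\tilde\nu,\lambda)|<\infty.$$ -/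

import Mathlib

open Set Filter Topology MeasureTheory

/-! ### Smirnoff classes -/

/-- A rectifiable Jordan curve, given by a Lipschitz parametrization on `[0, 1]`
(every rectifiable curve has one, proportional to its arclength). -/
structure IsRectifiableJordanCurve (γ : ℝ → ℂ) : Prop where
  lipschitz : ∃ K, LipschitzOnWith K γ (Icc 0 1)
  closed : γ 0 = γ 1
  simple : InjOn γ (Ico 0 1)

/-- The closed curve `γ` surrounds the set `K`: it does not meet `K` and it has winding number `1`
about every point of `K`. -/
def Surrounds (γ : ℝ → ℂ) (K : Set ℂ) : Prop :=
  ∀ z ∈ K, z ∉ γ '' Icc 0 1 ∧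
    (2 * Real.pi * Complex.I)⁻¹ * ∫ t in (0 : ℝ)..1, deriv γ t / (γ t - z) = 1

/-- The Smirnoff class `Ė²(D)`, for an open set `D ⊆ ℂ` (so `∞` is not an interior point of `D`):
`f` is analytic in `D`, and for every connected component of `D` there are rectifiable Jordan curves
`γ 0, γ 1, …` in that component which eventually surround each of its compact subsets and on which
the `L²` norms of `f` with respect to arclength are bounded. -/
def IsSmirnoffE2 (D : Set ℂ) (f : ℂ → ℂ) : Prop :=
  DifferentiableOn ℂ f D ∧
  ∀ z₀ ∈ D, ∃ γ : ℕ → ℝ → ℂ,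
    (∀ n, IsRectifiableJordanCurve (γ n)) ∧
    (∀ n, γ n '' Icc 0 1 ⊆ connectedComponentIn D z₀) ∧
    (∀ K ⊆ connectedComponentIn D z₀, IsCompact K → ∃ N, ∀ n ≥ N, Surrounds (γ n) K) ∧
    ∃ C : ℝ, ∀ n, ∫ t in (0 : ℝ)..1, ‖f (γ n t)‖ ^ 2 * ‖deriv (γ n) t‖ ≤ C

/-! ### Riemann–Hilbert problems -/

/-- An oriented smooth arc, parametrized by arclength in the direction of its orientation. -/
structure OrientedArc where
  param : ℝ → ℂ
  dom : Set ℝ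

/-- The set of points of an oriented arc. -/
def OrientedArc.carrier (Γ : OrientedArc) : Set ℂ := Γ.param '' Γ.dom

/-- `L` is the nontangential limit of `m` at `p` from the left of an oriented contour with unit
tangent vector `τ` at `p`: the limit of `m` in every sector at `p` that is symmetric about the left
normal and has half-opening less than `π / 2`. The limit from the right is that for `-τ`. -/
def HasLeftBoundaryValue (m : ℂ → Matrix (Fin 2) (Fin 2) ℂ) (p τ : ℂ)
    (L : Matrix (Fin 2) (Fin 2) ℂ) : Prop :=
  ∀ κ ∈ Ioo (0 : ℝ) 1,
    Tendsto m (𝓝[{z | κ * ‖z - p‖ < ((z - p) * (starRingEnd ℂ) τ).im}] p) (𝓝 L)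

/-- `m` solves the `L²` Riemann–Hilbert problem with contour `Γ = ⋃ j, Γ j` and jump matrix `v j`
on `Γ j`: `m ∈ I + Ė²(ℂ ∖ Γ)`, and `m₊ = m₋ v` almost everywhere on `Γ` (with respect to arclength)
for the nontangential boundary values `m₊` from the left and `m₋` from the right. -/
structure IsRHSolution {ι : Type} (Γ : ι → OrientedArc)
    (v : ι → ℂ → Matrix (Fin 2) (Fin 2) ℂ) (m : ℂ → Matrix (Fin 2) (Fin 2) ℂ) : Prop where
  smirnoff : ∀ i k, IsSmirnoffE2 (⋃ j, (Γ j).carrier)ᶜ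
    (fun z => m z i k - (1 : Matrix (Fin 2) (Fin 2) ℂ) i k)
  jump : ∀ j, ∀ᵐ s ∂(volume.restrict (Γ j).dom), ∃ mplus mminus : Matrix (Fin 2) (Fin 2) ℂ,
    HasLeftBoundaryValue m ((Γ j).param s) (deriv (Γ j).param s) mplus ∧
    HasLeftBoundaryValue m ((Γ j).param s) (-deriv (Γ j).param s) mminus ∧
    mplus = mminus * v j ((Γ j).param s)

/-! ### The model problem -/

/-- The oriented arcs `Y₁, …, Y₉` (with indices `0, …, 8`). The rays `Y₁`, `Y₂` are oriented away
from the origin, the rays `Y₃`, `Y₄` towards the origin, the arcs of the circle counterclockwise. -/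
noncomputable def arcY : Fin 9 → OrientedArc :=
  ![⟨fun s => (s : ℂ), Ici 1⟩,
    ⟨fun s => s * Complex.I, Ici 1⟩,
    ⟨fun s => (s : ℂ), Iic (-1)⟩,
    ⟨fun s => s * Complex.I, Iic (-1)⟩,
    ⟨fun s => Complex.exp (s * Complex.I), Icc (-(Real.pi / 2)) 0⟩,
    ⟨fun s => Complex.exp (s * Complex.I), Icc 0 (Real.pi / 2)⟩,
    ⟨fun s => Complex.exp (s * Complex.I), Icc (Real.pi / 2) Real.pi⟩,
    ⟨fun s => Complex.exp (s * Complex.I), Icc Real.pi (5 * Real.pi / 4)⟩,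
    ⟨fun s => Complex.exp (s * Complex.I), Icc (-(3 * Real.pi / 4)) (-(Real.pi / 2))⟩]

/-- The contour `Y`: four rays and the unit circle. -/
def contourY : Set ℂ := ⋃ j, (arcY j).carrier

/-- The logarithm with branch cut along the ray `arg λ = -3π/4`, real for `λ > 0`; its imaginary
part lies in `(-3π/4, 5π/4]`. -/
noncomputable def logC (l : ℂ) : ℂ :=
  Complex.log (l * Complex.exp (-(Real.pi / 4 * Complex.I))) + Real.pi / 4 * Complex.I

/-- The power `λ ^ a` for the branch `logC` of the logarithm. -/
noncomputable def powC (l a : ℂ) : ℂ := Complex.exp (a * logC l)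

/-- `e ^ (a σ₃)`, where `σ₃ = diag(1, -1)`. -/
noncomputable def expSigma3 (a : ℂ) : Matrix (Fin 2) (Fin 2) ℂ :=
  !![Complex.exp a, 0; 0, Complex.exp (-a)]

/-- `λ ^ (a σ₃)`, for the branch `logC` of the logarithm. -/
noncomputable def powSigma3 (l a : ℂ) : Matrix (Fin 2) (Fin 2) ℂ := expSigma3 (a * logC l)

/-- The quantity `ρρ* = e ^ (2πν) - 1`. -/
noncomputable def rhoSq (ν : ℂ) : ℂ := Complex.exp (2 * Real.pi * ν) - 1

/-- The jump matrix `v^Y(y, ν, λ)` on the arcs `Y₁, …, Y₉` (with indices `0, …, 8`). -/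
noncomputable def jumpY (y : ℝ) (ν : ℂ) (j : Fin 9) (l : ℂ) : Matrix (Fin 2) (Fin 2) ℂ :=
  let p : ℂ := rhoSq ν
  let e : ℂ := Complex.exp (l ^ 2 + 2 * y * l)
  let e' : ℂ := Complex.exp (-l ^ 2 - 2 * y * l)
  ![!![1, 0; p / (1 + p) * powC l (2 * Complex.I * ν) * e', 1],
    !![1, -powC l (-2 * Complex.I * ν) * e; 0, 1],
    !![1, 0; p * powC l (2 * Complex.I * ν) * e', 1],
    !![1, -(1 + p) * powC l (-2 * Complex.I * ν) * e; 0, 1],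
    powSigma3 l (-Complex.I * ν),
    powSigma3 l (-Complex.I * ν) * !![1, 0; -(p / (1 + p)) * e', 1],
    powSigma3 l (-Complex.I * ν) * !![1 / (1 + p), e; -(p / (1 + p)) * e', 1],
    powSigma3 l (-Complex.I * ν) * !![1 / (1 + p), e; 0, 1 + p],
    powSigma3 l (-Complex.I * ν) * !![1, (1 + p) * e; 0, 1]] j

/-- The function `β^Y(ν)`. -/
noncomputable def betaY (ν : ℂ) : ℂ :=
  (2 * Complex.I) ^ (Complex.I * ν + 1) * (Real.sqrt Real.pi : ℂ) *
      Complex.exp (5 * Real.pi * ν / 2) /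
    ((Complex.exp (2 * Real.pi * ν) - 1) * Complex.Gamma (Complex.I * ν))

/-- The coefficient `m₁^Y(y, ν)`. -/
noncomputable def m1Y (y : ℝ) (ν : ℂ) : Matrix (Fin 2) (Fin 2) ℂ :=
  !![-Complex.I * ν * y, -(betaY ν / 2) * Complex.exp (-(y : ℂ) ^ 2);
     -(Complex.I * ν / betaY ν) * Complex.exp ((y : ℂ) ^ 2), Complex.I * ν * y]

/-! ### The explicit solution -/

/-- Kummer's function `₁F₁(a; b; z)`, for `b ∉ {0, -1, -2, …}`. -/
noncomputable def kummerM (a b z : ℂ) : ℂ :=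
  Complex.Gamma b * Complex.regularizedHGFun {a} {b} z

/-- The parabolic cylinder function `D_a(z)`. (`Complex.Gamma` vanishes at the poles of `Γ`, so the
factors `1 / Γ` are the entire ones.) -/
noncomputable def parabolicCylinderD (a z : ℂ) : ℂ :=
  2 ^ (a / 2) * Complex.exp (-z ^ 2 / 4) * (Real.sqrt Real.pi : ℂ) *
    (1 / Complex.Gamma ((1 - a) / 2) * kummerM (-a / 2) (1 / 2) (z ^ 2 / 2) -
      (Real.sqrt 2 : ℂ) * z / Complex.Gamma (-a / 2) *
        kummerM ((1 - a) / 2) (3 / 2) (z ^ 2 / 2))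

/-- The entire matrix function `ψ(y, ν, λ)`. -/
noncomputable def psiY (y : ℝ) (ν l : ℂ) : Matrix (Fin 2) (Fin 2) ℂ :=
  let r : ℂ := (Real.sqrt 2 : ℂ)
  expSigma3 (-(y : ℂ) ^ 2 / 2) *
    !![Complex.exp (-(Real.pi * ν / 2)) *
          parabolicCylinderD (-Complex.I * ν) (Complex.I * r * (y + l)),
        -(betaY ν / r) * parabolicCylinderD (Complex.I * ν - 1) (r * (y + l));
       r / betaY ν * Complex.exp (-(Real.pi * ν / 2)) * ν *
          parabolicCylinderD (-Complex.I * ν - 1) (Complex.I * r * (y + l)),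
        parabolicCylinderD (Complex.I * ν) (r * (y + l))] *
    expSigma3 (Complex.I * ν / 2 * (Real.log 2 : ℂ))

/-- The constant right factors of `ψ` outside the unit circle: `R₄` for `-3π/4 < arg λ < -π/2`,
`I` for `-π/2 < arg λ < 0`, `R₁` for `0 < arg λ < π/2`, `R₁R₂` for `π/2 < arg λ < π` and
`R₁R₂R₃⁻¹` for `π < arg λ ≤ 5π/4`. -/
noncomputable def sectorFactor (ν l : ℂ) : Matrix (Fin 2) (Fin 2) ℂ :=
  let p : ℂ := rhoSq ν
  let R₁ : Matrix (Fin 2) (Fin 2) ℂ := !![1, 0; p / (1 + p), 1]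
  let R₂ : Matrix (Fin 2) (Fin 2) ℂ := !![1, -1; 0, 1]
  let R₃ : Matrix (Fin 2) (Fin 2) ℂ := !![1, 0; p, 1]
  let R₄ : Matrix (Fin 2) (Fin 2) ℂ := !![1, -(1 + p); 0, 1]
  if (logC l).im < -(Real.pi / 2) then R₄
  else if (logC l).im < 0 then 1
  else if (logC l).im < Real.pi / 2 then R₁
  else if (logC l).im < Real.pi then R₁ * R₂
  else R₁ * R₂ * R₃⁻¹

/-- The function `m^Y(y, ν, λ)` given by parabolic cylinder functions, for `λ ∉ Y` (the values
on `Y` carry no meaning). On the branch cut outside the unit circle, which is not part of `Y`, it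
takes the limiting value from the side `arg λ < 5π/4`. -/
noncomputable def mY (y : ℝ) (ν l : ℂ) : Matrix (Fin 2) (Fin 2) ℂ :=
  if ‖l‖ < 1 then psiY y ν l * expSigma3 (-(l ^ 2 / 2 + y * l))
  else psiY y ν l * sectorFactor ν l * expSigma3 (-(l ^ 2 / 2 + y * l)) *
    powSigma3 l (Complex.I * ν)

/-! ### Gamma integrals with complex scaling -/

/-! Existence. Since `ν ∉ iℤ`, the orders `±iν` and `±iν - 1` are not integers, so every Gamma
factor is finite and nonzero and `ψ` is entire in `λ`. On each side of an arc, `m^Y` is `ψ` times a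
constant matrix times elementary factors, so the jump relations reduce to identities between
explicit 2×2 matrices (`sideY_jump_ray`, `psiY_jump_circle`). The analytic content lies in the
choice of the constant factors. The function `D_a(z)` has its standard asymptotics `z^a e^{-z²/4}`
in a half plane. By the connection formula `parabolicCylinderD_connection`, right multiplication by
the factor of a sector replaces the columns of `ψ` by those parabolic cylinder functions whose
standard asymptotics are valid there (`psiCol_zero_relations`, `psiY_mul_factors`). Hence `m^Y` is
given in each quadrant outside the circle by one formula (`mY_eq_outerY`). In the third quadrant the
two sides of the branch cut give the same formula, so the cut carries no jump. The asymptotics,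
uniform in `a`, come from the Laplace integral of `D_a` for `Re a < 0` along a suitable ray, and
from the three-term recurrence for all other orders (`exists_norm_pcRatio_sub_one_le`). A Taylor
expansion in the shift `y` then gives the coefficient of `1/λ` (`exists_norm_pcNormalized_sub_le`).
Consequently `m^Y - I` is bounded and `O(1/λ)`. This puts it in the Smirnoff class, with the images
of rectangles under the exponential as curves in the quadrants and concentric circles in the disc
(`isSmirnoffE2_of_decay`). Uniqueness. The Wronskian gives `det m^Y = 1`. If `m` is another
solution, then `G = (m - m^Y) (m^Y)⁻¹` has equal nontangential limits from both sides almost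
everywhere on `Y`. Two consequences of the Smirnoff condition are used. Cauchy's formula for `f²`
gives `|f| ≤ C / √dist` (`SmirnoffData.norm_sq_le`). The same formula with the Cauchy kernel of a
reflected point subtracted, which leaves a Poisson type kernel, gives `L²` bounds on curves parallel
to the contour (`SmirnoffData.integral_expChart_le`). Both bounds pass to `G`, because `m^Y` is
bounded. A theorem of Painlevé type (`exists_differentiableOn_extension`) extends `G` across the
open arcs: its primitives on the two sides are continuous up to the arc, differ there by a constant,
and are glued by Morera's theorem. At the corners the bound by the distance to the arcs is turned by
the maximum principle into `O(|λ - p|^{-1/2})`, so these singularities are removable. The entire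
function obtained is zero by a Liouville argument of the same kind. -/

theorem norm_ofReal_cpow_mul_exp {s : ℝ} (hs : 0 < s) (b r : ℂ) :
    ‖(s : ℂ) ^ b * Complex.exp (-(r * s))‖ = s ^ b.re * Real.exp (-(r.re * s)) := by
  rw [norm_mul, Complex.norm_cpow_eq_rpow_re_of_pos hs, Complex.norm_exp]
  simp

theorem integrableOn_rpow_mul_exp_neg_mul {b r : ℝ} (hb : 0 < b) (hr : 0 < r) :
    IntegrableOn (fun s : ℝ => s ^ (b - 1) * Real.exp (-(r * s))) (Ioi 0) := by
  have := integrableOn_rpow_mul_exp_neg_mul_rpow (s := b - 1) (p := 1) (b := r)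
    (by linarith) one_pos hr
  simpa using this

theorem integrableOn_cpow_mul_exp_neg_mul {b r : ℂ} (hb : 0 < b.re) (hr : 0 < r.re) :
    IntegrableOn (fun s : ℝ => (s : ℂ) ^ (b - 1) * Complex.exp (-(r * s))) (Ioi 0) := by
  refine (integrableOn_rpow_mul_exp_neg_mul hb hr).mono' (by fun_prop) ?_
  filter_upwards [ae_restrict_mem measurableSet_Ioi] with s hs
  rw [norm_ofReal_cpow_mul_exp hs]
  simp

/-- Holomorphy in the rate is what allows the Gamma integral to be continued from real to complex
rates. The derivative is dominated by a Gamma integrand with half the real part of the rate. -/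
theorem differentiableAt_integral_cpow_mul_exp {b r : ℂ} (hb : 0 < b.re) (hr : 0 < r.re) :
    DifferentiableAt ℂ (fun r : ℂ =>
      ∫ s in Ioi (0 : ℝ), (s : ℂ) ^ (b - 1) * Complex.exp (-(r * s))) r := by
  have hs : {x : ℂ | r.re / 2 < x.re} ∈ 𝓝 r :=
    (isOpen_lt continuous_const Complex.continuous_re).mem_nhds (by simp; linarith)
  refine (hasDerivAt_integral_of_dominated_loc_of_deriv_le
    (F := fun (r : ℂ) (s : ℝ) => (s : ℂ) ^ (b - 1) * Complex.exp (-(r * s)))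
    (F' := fun (r : ℂ) (s : ℝ) => (s : ℂ) ^ (b - 1) * (Complex.exp (-(r * s)) * -(s : ℂ)))
    (bound := fun s : ℝ => s ^ ((b.re + 1) - 1) * Real.exp (-(r.re / 2 * s))) hs
    (Eventually.of_forall fun x => by fun_prop)
    (integrableOn_cpow_mul_exp_neg_mul hb hr) (by fun_prop) ?_
    (integrableOn_rpow_mul_exp_neg_mul (by linarith) (by linarith)) ?_).2.differentiableAt
  · filter_upwards [ae_restrict_mem measurableSet_Ioi] with s hs x hx
    have hs : 0 < s := hs
    rw [← mul_assoc, norm_mul, norm_ofReal_cpow_mul_exp hs, norm_neg, Complex.norm_real,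
      Real.norm_of_nonneg hs.le]
    have : s ^ (b.re + 1 - 1) = s ^ (b - 1).re * s := by
      rw [← Real.rpow_add_one hs.ne']; simp
    rw [this, mul_right_comm]
    gcongr
  · refine Eventually.of_forall fun s x _ => ?_
    have h1 : HasDerivAt (fun x : ℂ => -(x * s)) (-(s : ℂ)) x := by
      simpa using ((hasDerivAt_id' x).mul_const (s : ℂ)).fun_neg
    exact (h1.cexp).const_mul _

/-- The Gamma integral with a complex scaling parameter. -/
theorem integral_cpow_mul_exp_neg_mul_Ioi_complex {b r : ℂ} (hb : 0 < b.re) (hr : 0 < r.re) :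
    ∫ s in Ioi (0 : ℝ), (s : ℂ) ^ (b - 1) * Complex.exp (-(r * s)) =
      r ^ (-b) * Complex.Gamma b := by
  set U : Set ℂ := {x : ℂ | 0 < x.re}
  have hU : IsOpen U := isOpen_lt continuous_const Complex.continuous_re
  have hconv : Convex ℝ U := convex_halfSpace_re_gt 0
  have h1 : AnalyticOnNhd ℂ (fun r : ℂ =>
      ∫ s in Ioi (0 : ℝ), (s : ℂ) ^ (b - 1) * Complex.exp (-(r * s))) U :=
    DifferentiableOn.analyticOnNhd (fun x hx =>
      (differentiableAt_integral_cpow_mul_exp hb hx).differentiableWithinAt) hU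
  have h2 : AnalyticOnNhd ℂ (fun r : ℂ => r ^ (-b) * Complex.Gamma b) U := by
    refine DifferentiableOn.analyticOnNhd (fun x hx => ?_) hU
    refine (DifferentiableAt.mul_const ?_ _).differentiableWithinAt
    exact differentiableAt_id.cpow_const (Or.inl hx)
  -- Identity theorem: the formula is known for real rates, and the real points `1 + 1/(n+1)`
  -- accumulate at `1`.
  refine h1.eqOn_of_preconnected_of_frequently_eq h2 hconv.isPreconnected
    (z₀ := 1) (by simp [U]) ?_ hr
  have h3 : Tendsto (fun n : ℕ => (1 : ℂ) + ((1 / ((n : ℝ) + 1) : ℝ) : ℂ)) atTop (𝓝[≠] 1) := by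
    refine tendsto_nhdsWithin_iff.2 ⟨?_, Eventually.of_forall fun n => ?_⟩
    · have := (Complex.continuous_ofReal.tendsto 0).comp
        (tendsto_one_div_add_atTop_nhds_zero_nat (𝕜 := ℝ))
      simpa using this.const_add (1 : ℂ)
    · have : (0 : ℝ) < 1 / ((n : ℝ) + 1) := by positivity
      simp only [mem_compl_iff, mem_singleton_iff, add_eq_left, Complex.ofReal_eq_zero]
      exact this.ne'
  refine h3.frequently (Frequently.of_forall fun n => ?_)
  have hp : (0 : ℝ) < 1 + 1 / ((n : ℝ) + 1) := by positivity
  have := Complex.integral_cpow_mul_exp_neg_mul_Ioi hb hp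
  rw [Complex.ofReal_add, Complex.ofReal_one] at this
  rw [this]
  congr 1
  rw [one_div, Complex.inv_cpow _ _ (by
    rw [← Complex.ofReal_one, ← Complex.ofReal_add, Complex.arg_ofReal_of_nonneg hp.le]; exact Real.pi_pos.ne), Complex.cpow_neg]

/-- The Gaussian moments, with a complex scaling parameter. -/
theorem integral_cpow_mul_exp_neg_mul_sq_Ioi {b r : ℂ} (hb : 0 < b.re) (hr : 0 < r.re) :
    ∫ s in Ioi (0 : ℝ), (s : ℂ) ^ (b - 1) * Complex.exp (-(r * (s : ℂ) ^ 2 / 2)) =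
      2 ^ (b / 2 - 1) * r ^ (-(b / 2)) * Complex.Gamma (b / 2) := by
  have hb2 : 0 < (b / 2).re := by simpa using hb
  have hr2 : 0 < (r / 2).re := by simpa using hr
  have h1 := integral_cpow_mul_exp_neg_mul_Ioi_complex hb2 hr2
  -- The substitution `s ↦ s²` turns the Gamma integral of exponent `b/2` and rate `r/2` into the
  -- Gaussian moment.
  rw [← integral_comp_rpow_Ioi_of_pos (p := 2) two_pos] at h1
  have h2 : ∫ s in Ioi (0 : ℝ), ((2 : ℝ) * s ^ ((2 : ℝ) - 1)) •
      (((s ^ (2 : ℝ) : ℝ) : ℂ) ^ (b / 2 - 1) * Complex.exp (-(r / 2 * ((s ^ (2 : ℝ) : ℝ) : ℂ)))) =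
      2 * ∫ s in Ioi (0 : ℝ), (s : ℂ) ^ (b - 1) * Complex.exp (-(r * (s : ℂ) ^ 2 / 2)) := by
    rw [← integral_const_mul]
    refine setIntegral_congr_fun measurableSet_Ioi fun s hs => ?_
    have hs : 0 < s := hs
    have hs0 : (s : ℂ) ≠ 0 := Complex.ofReal_ne_zero.2 hs.ne'
    have e1 : s ^ ((2 : ℝ) - 1) = s := by norm_num
    have e2 : ((s ^ (2 : ℝ) : ℝ) : ℂ) = (s : ℂ) ^ 2 := by norm_num
    have e3 : ((s : ℂ) ^ 2) ^ (b / 2 - 1) = (s : ℂ) ^ (b - 2) := by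
      rw [← e2, Complex.ofReal_cpow hs.le, ← Complex.cpow_mul]
      · congr 1; push_cast; ring
      all_goals
        rw [← Complex.ofReal_log hs.le]; norm_cast
        simp [Real.pi_pos, Real.pi_pos.le]
    have e4 : (s : ℂ) ^ (b - 1) = s * (s : ℂ) ^ (b - 2) := by
      rw [show b - 1 = 1 + (b - 2) by ring, Complex.cpow_add _ _ hs0, Complex.cpow_one]
    simp only [e1, e2, e3, e4, Complex.real_smul]
    push_cast
    rw [show r / 2 * (s : ℂ) ^ 2 = r * (s : ℂ) ^ 2 / 2 by ring]
    ring
  rw [h2] at h1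
  have h3 : (r / 2) ^ (-(b / 2)) = r ^ (-(b / 2)) * 2 ^ (b / 2) := by
    rw [div_eq_mul_inv r 2, Complex.cpow_def_of_ne_zero (by
      intro h; simp at h; simp [h] at hr), Complex.cpow_def_of_ne_zero (by
      intro h; simp [h] at hr), Complex.cpow_def_of_ne_zero two_ne_zero]
    have : Complex.log (r * 2⁻¹) = Complex.log r - Complex.log 2 := by
      have h4 := Complex.log_mul_ofReal (2⁻¹ : ℝ) (by norm_num) r (by
        intro h; simp [h] at hr)
      push_cast at h4
      rw [h4, Real.log_inv, Complex.ofReal_neg, Complex.ofReal_log two_pos.le]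
      push_cast
      ring
    rw [this, ← Complex.exp_add]
    congr 1; ring
  rw [h3] at h1
  have h5 : (2 : ℂ) ^ (b / 2 - 1) = 2 ^ (b / 2) / 2 := by
    rw [Complex.cpow_sub _ _ two_ne_zero, Complex.cpow_one]
  rw [h5]
  linear_combination h1 / 2


/-! ### The power series of the parabolic cylinder functions -/

/-- Completing the square gives `Rs - cs²/2 ≤ R²/c - cs²/4`: half of the Gaussian decay absorbs the
linear growth. -/
theorem integrableOn_rpow_mul_exp_linear_sub_sq {p c : ℝ} (R : ℝ) (hp : 0 < p) (hc : 0 < c) :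
    IntegrableOn (fun s : ℝ => s ^ (p - 1) * Real.exp (R * s - c * s ^ 2 / 2)) (Ioi 0) := by
  have h := (integrableOn_rpow_mul_exp_neg_mul_sq (b := c / 4) (by positivity)
    (s := p - 1) (by linarith)).const_mul (Real.exp (R ^ 2 / c))
  refine Integrable.mono' h (by fun_prop) ?_
  filter_upwards [ae_restrict_mem measurableSet_Ioi] with s hs
  have hs : 0 < s := hs
  have h1 : R * s - c * s ^ 2 / 2 ≤ R ^ 2 / c + -(c / 4) * s ^ 2 := by
    have : R ^ 2 / c + -(c / 4) * s ^ 2 - (R * s - c * s ^ 2 / 2) = (R - c * s / 2) ^ 2 / c := by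
      field_simp; ring
    have : 0 ≤ (R - c * s / 2) ^ 2 / c := by positivity
    linarith
  have h2 := Real.exp_le_exp.2 h1
  rw [Real.exp_add] at h2
  have h3 : 0 ≤ s ^ (p - 1) := by positivity
  rw [Real.norm_of_nonneg (by positivity)]
  calc s ^ (p - 1) * Real.exp (R * s - c * s ^ 2 / 2)
      ≤ s ^ (p - 1) * (Real.exp (R ^ 2 / c) * Real.exp (-(c / 4) * s ^ 2)) := by gcongr
    _ = _ := by ring

/-- The Taylor coefficients of `t ↦ ∫ s in Ioi 0, s ^ (-a - 1) * exp (-s ^ 2 / 2 - t * s)`. -/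
noncomputable def pcCoeff (n : ℕ) (a : ℂ) : ℂ :=
  2 ^ ((n - a) / 2 - 1) * Complex.Gamma ((n - a) / 2)

/-- The terms of the power series of `Γ(-a) exp (z ^ 2 / 4) D_a(z)`. -/
noncomputable def pcTerm (a z : ℂ) (n : ℕ) : ℂ := (-z) ^ n / n.factorial * pcCoeff n a

/-- The entire function `Γ(-a) exp (z ^ 2 / 4) D_a(z)`. -/
noncomputable def pcSeries (a z : ℂ) : ℂ := ∑' n, pcTerm a z n

/-- Only `n - a` enters, so a shift of the index is a shift of the order. The derivative formula and
the passage from `Re a < 0` to arbitrary orders rest on this. -/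
theorem pcCoeff_succ (n : ℕ) (a : ℂ) : pcCoeff (n + 1) a = pcCoeff n (a - 1) := by
  unfold pcCoeff
  congr 3 <;> (push_cast; ring_nf)

theorem log_sq_of_re_pos {w : ℂ} (hw : 0 < w.re) : Complex.log (w ^ 2) = 2 * Complex.log w := by
  have h := Complex.abs_arg_lt_pi_div_two_iff.2 (Or.inl hw)
  rw [abs_lt] at h
  rw [sq, (Complex.log_mul_eq_add_log_iff (by rintro rfl; simp at hw) (by rintro rfl; simp at hw)).2
    ⟨by linarith, by linarith⟩]
  ring

/-- The Laplace integral along the ray through `w`. After expansion of `e^{-zws}`, the `n`-th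
Gaussian moment contributes `(w²)^{-(n-a)/2}`. This equals `w^{-(n-a)}` because `Re w > 0`, and it
cancels the factor `w^{n-a}` in front. So the sum does not depend on `w`, and the path of
integration is rotated without Cauchy's theorem. -/
theorem hasSum_pcTerm_integral {a w : ℂ} (z : ℂ) (ha : a.re < 0) (hw : 0 < w.re)
    (hw2 : 0 < (w ^ 2).re) :
    HasSum (pcTerm a z) (w ^ (-a) * ∫ s in Ioi (0 : ℝ), (s : ℂ) ^ (-a - 1) *
      Complex.exp (-(z * w * s)) * Complex.exp (-(w ^ 2 * (s : ℂ) ^ 2 / 2))) := by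
  have hw0 : w ≠ 0 := by rintro rfl; simp at hw
  set c : ℝ := (w ^ 2).re
  set F : ℕ → ℝ → ℂ := fun n s => (-z) ^ n / n.factorial * w ^ ((n : ℂ) - a) *
    ((s : ℂ) ^ ((n : ℂ) - a - 1) * Complex.exp (-(w ^ 2 * (s : ℂ) ^ 2 / 2)))
  set B : ℕ → ℝ → ℝ := fun n s => ‖w ^ (-a)‖ * (s ^ (-a.re - 1) * Real.exp (-(c * s ^ 2 / 2))) *
    ((‖z‖ * ‖w‖ * s) ^ n / n.factorial)
  have hF : ∀ n, ∀ s : ℝ, 0 < s → F n s = w ^ (-a) * ((s : ℂ) ^ (-a - 1) *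
      Complex.exp (-(w ^ 2 * (s : ℂ) ^ 2 / 2))) * ((-(z * w * s)) ^ n / n.factorial) := by
    intro n s hs
    have hs0 : (s : ℂ) ≠ 0 := Complex.ofReal_ne_zero.2 hs.ne'
    simp only [F]
    rw [show (n : ℂ) - a = n + -a by ring, Complex.cpow_add _ _ hw0, Complex.cpow_natCast,
      show (n : ℂ) + -a - 1 = n + (-a - 1) by ring, Complex.cpow_add _ _ hs0, Complex.cpow_natCast,
      show -(z * w * s) = (-z) * w * s by ring, mul_pow, mul_pow]
    ring
  have hB : ∀ n, ∀ s : ℝ, 0 < s → ‖F n s‖ = B n s := by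
    intro n s hs
    rw [hF n s hs]
    simp only [B, norm_mul, norm_div, norm_pow, norm_neg, Complex.norm_exp, Complex.norm_real,
      Complex.norm_natCast, Real.norm_of_nonneg hs.le]
    rw [Complex.norm_cpow_eq_rpow_re_of_pos hs]
    congr 4
    have : (w ^ 2 * (s : ℂ) ^ 2 / 2) = ((s ^ 2 / 2 : ℝ) : ℂ) * w ^ 2 := by push_cast; ring
    rw [this, Complex.neg_re, Complex.re_ofReal_mul]
    simp only [c]; ring
  have hsum : ∀ s : ℝ, HasSum (fun n => B n s) (‖w ^ (-a)‖ *
      (s ^ (-a.re - 1) * Real.exp (-(c * s ^ 2 / 2))) * Real.exp (‖z‖ * ‖w‖ * s)) := by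
    intro s
    refine HasSum.mul_left _ ?_
    rw [Real.exp_eq_exp_ℝ]
    exact NormedSpace.expSeries_div_hasSum_exp _
  have key := hasSum_integral_of_dominated_convergence (μ := volume.restrict (Ioi (0 : ℝ)))
    (F := F) (f := fun s => w ^ (-a) * ((s : ℂ) ^ (-a - 1) *
      Complex.exp (-(w ^ 2 * (s : ℂ) ^ 2 / 2))) * Complex.exp (-(z * w * s))) B
    (fun n => by fun_prop)
    (fun n => by
      filter_upwards [ae_restrict_mem measurableSet_Ioi] with s hs
      exact (hB n s hs).le)
    (Eventually.of_forall fun s => (hsum s).summable)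
    (by
      simp_rw [fun s => (hsum s).tsum_eq]
      have := (integrableOn_rpow_mul_exp_linear_sub_sq (p := -a.re) (‖z‖ * ‖w‖) (by linarith)
        hw2).const_mul ‖w ^ (-a)‖
      refine this.congr (Eventually.of_forall fun s => ?_)
      simp only
      rw [sub_eq_add_neg (‖z‖ * ‖w‖ * s), Real.exp_add]
      ring)
    (by
      filter_upwards [ae_restrict_mem measurableSet_Ioi] with s hs
      simp_rw [fun n => hF n s hs]
      refine HasSum.mul_left _ ?_
      rw [Complex.exp_eq_exp_ℂ]
      exact NormedSpace.expSeries_div_hasSum_exp _)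
  have e1 : ∀ n, ∫ s in Ioi (0 : ℝ), F n s = pcTerm a z n := by
    intro n
    simp only [F]
    rw [integral_const_mul, integral_cpow_mul_exp_neg_mul_sq_Ioi (b := (n : ℂ) - a)
      (by simp; linarith [(n.cast_nonneg : (0 : ℝ) ≤ n)]) hw2]
    have : (w ^ 2) ^ (-(((n : ℂ) - a) / 2)) = w ^ (-((n : ℂ) - a)) := by
      rw [Complex.cpow_def_of_ne_zero (pow_ne_zero 2 hw0), Complex.cpow_def_of_ne_zero hw0,
        log_sq_of_re_pos hw]
      congr 1; ring
    rw [this, pcTerm, pcCoeff]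
    have : w ^ ((n : ℂ) - a) * w ^ (-((n : ℂ) - a)) = 1 := by
      rw [← Complex.cpow_add _ _ hw0]; simp
    linear_combination ((-z) ^ n / n.factorial * (2 ^ (((n : ℂ) - a) / 2 - 1) *
      Complex.Gamma (((n : ℂ) - a) / 2))) * this
  simp_rw [e1] at key
  convert! key using 1
  rw [← integral_const_mul]
  congr 1; ext s; ring

theorem pcSeries_eq_integral {a w : ℂ} (z : ℂ) (ha : a.re < 0) (hw : 0 < w.re)
    (hw2 : 0 < (w ^ 2).re) :
    pcSeries a z = w ^ (-a) * ∫ s in Ioi (0 : ℝ), (s : ℂ) ^ (-a - 1) *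
      Complex.exp (-(z * w * s)) * Complex.exp (-(w ^ 2 * (s : ℂ) ^ 2 / 2)) :=
  (hasSum_pcTerm_integral z ha hw hw2).tsum_eq

theorem norm_pcSeries_le {a z : ℂ} (ha : a.re < 0) :
    ‖pcSeries a z‖ ≤
      ∫ s in Ioi (0 : ℝ), s ^ (-a.re - 1) * Real.exp (‖z‖ * s - 1 * s ^ 2 / 2) := by
  rw [pcSeries_eq_integral (w := 1) z ha (by simp) (by simp), Complex.one_cpow, one_mul]
  refine norm_integral_le_of_norm_le
    (integrableOn_rpow_mul_exp_linear_sub_sq ‖z‖ (by linarith) one_pos) ?_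
  filter_upwards [ae_restrict_mem measurableSet_Ioi] with s hs
  have hs : 0 < s := hs
  rw [mul_assoc, ← Complex.exp_add, norm_mul, Complex.norm_cpow_eq_rpow_re_of_pos hs,
    Complex.norm_exp]
  simp only [Complex.sub_re, Complex.neg_re, Complex.one_re]
  gcongr
  have h1 : (-(z * 1 * s) + -(1 ^ 2 * (s : ℂ) ^ 2 / 2) : ℂ) =
      ((s : ℝ) : ℂ) * (-z) - ((s ^ 2 / 2 : ℝ) : ℂ) := by push_cast; ring
  rw [h1, Complex.sub_re, Complex.re_ofReal_mul, Complex.ofReal_re]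
  have := Complex.re_le_norm (-z)
  rw [norm_neg] at this
  nlinarith

theorem summable_pow_div_factorial_mul_pcCoeff_of_re_neg {a : ℂ} (ha : a.re < 0) (R : ℝ) :
    Summable fun n : ℕ => R ^ n / n.factorial * ‖pcCoeff n a‖ := by
  have h := (hasSum_pcTerm_integral (w := 1) (-R : ℂ) ha (by simp) (by simp)).summable.norm
  refine Summable.of_norm (h.congr fun n => ?_)
  simp [pcTerm]

/-- For `Re a < 0` this is part of the expansion of the convergent integral. Larger real parts are
reached by induction: dropping the first term lowers the order by one. -/
theorem summable_pow_div_factorial_mul_pcCoeff (a : ℂ) (R : ℝ) :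
    Summable fun n : ℕ => R ^ n / n.factorial * ‖pcCoeff n a‖ := by
  obtain ⟨N, hN⟩ := exists_nat_gt a.re
  suffices H : ∀ N : ℕ, ∀ a : ℂ, a.re < N → ∀ R : ℝ,
      Summable fun n : ℕ => R ^ n / n.factorial * ‖pcCoeff n a‖ from H N a hN R
  intro N
  induction N with
  | zero => intro a ha; exact summable_pow_div_factorial_mul_pcCoeff_of_re_neg (by simpa using ha)
  | succ N ih =>
    intro a ha R
    have h := (ih (a - 1) (by simp at ha ⊢; linarith) |R|).mul_left |R|
    rw [← summable_nat_add_iff 1]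
    refine Summable.of_norm_bounded h fun n => ?_
    rw [pcCoeff_succ, norm_mul, norm_div, norm_pow, norm_norm, Real.norm_eq_abs, RCLike.norm_natCast,
      ← mul_assoc]
    gcongr
    rw [pow_succ', ← mul_div_assoc]
    gcongr
    exact n.le_succ

theorem summable_pcTerm (a z : ℂ) : Summable (pcTerm a z) := by
  refine Summable.of_norm ((summable_pow_div_factorial_mul_pcCoeff a ‖z‖).congr fun n => ?_)
  simp [pcTerm]

/-- Termwise differentiation: the derivative of the term of index `n + 1` and order `a` is minus the
term of index `n` and order `a - 1`. -/
theorem hasDerivAt_pcSeries (a z : ℂ) : HasDerivAt (pcSeries a) (-pcSeries (a - 1) z) z := by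
  have hb := (summable_pow_div_factorial_mul_pcCoeff (a - 1) (‖z‖ + 1))
  have hd : ∀ n, ∀ y : ℂ, HasDerivAt (fun z => pcTerm a z (n + 1)) (-pcTerm (a - 1) y n) y := by
    intro n y
    have h1 : HasDerivAt (fun z : ℂ => (-z) ^ (n + 1)) ((n + 1 : ℕ) * (-y) ^ n * (-1)) y :=
      (hasDerivAt_neg y).fun_pow (n + 1)
    have h2 := (h1.div_const ((n + 1).factorial : ℂ)).mul_const (pcCoeff (n + 1) a)
    refine h2.congr_deriv ?_
    rw [pcTerm, pcCoeff_succ, Nat.factorial_succ]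
    have : (n.factorial : ℂ) ≠ 0 := Nat.cast_ne_zero.2 n.factorial_ne_zero
    have : ((n : ℂ) + 1) ≠ 0 := Nat.cast_add_one_ne_zero n
    push_cast
    field_simp
  have key : HasDerivAt (fun z => ∑' n, pcTerm a z (n + 1)) (∑' n, -pcTerm (a - 1) z n) z := by
    refine hasDerivAt_tsum_of_isPreconnected hb (Metric.isOpen_ball (x := (0 : ℂ)) (ε := ‖z‖ + 1))
      (convex_ball _ _).isPreconnected (fun n y _ => hd n y) (fun n y hy => ?_) (y₀ := 0)
      (by simp; positivity) ?_ (by simp)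
    · rw [norm_neg, pcTerm, norm_mul, norm_div, norm_pow, norm_neg, RCLike.norm_natCast]
      have : ‖y‖ ≤ ‖z‖ + 1 := by simpa using (mem_ball_zero_iff.1 hy).le
      gcongr
    · exact (summable_nat_add_iff 1).2 (summable_pcTerm a 0)
  rw [tsum_neg] at key
  have h0 : pcSeries a = fun z => pcCoeff 0 a + ∑' n, pcTerm a z (n + 1) := by
    ext z
    rw [pcSeries, (summable_pcTerm a z).tsum_eq_zero_add]
    simp [pcTerm]
  rw [h0]
  exact key.const_add _

theorem pcCoeff_add_two {a : ℂ} (n : ℕ) (h : (n : ℂ) - a ≠ 0) :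
    pcCoeff n (a - 2) = (n - a) * pcCoeff n a := by
  unfold pcCoeff
  rw [show ((n : ℂ) - (a - 2)) / 2 = (n - a) / 2 + 1 by ring,
    Complex.Gamma_add_one _ (by simpa [sub_eq_zero] using h),
    show ((n : ℂ) - a) / 2 + 1 - 1 = ((n - a) / 2 - 1) + 1 by ring,
    Complex.cpow_add _ _ two_ne_zero, Complex.cpow_one]
  ring

/-- Multiplying the `n`-th term by `n` is the operator `z d/dz`, which yields `-z` times the series
of order `a - 1`. Multiplying it by `n - a` lowers the order by two, by the functional equation of
`Γ`. Comparing the two gives the three-term recurrence. -/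
theorem pcSeries_recurrence {a : ℂ} (h : ∀ n : ℕ, a ≠ n) (z : ℂ) :
    a * pcSeries a z + z * pcSeries (a - 1) z + pcSeries (a - 2) z = 0 := by
  have h1 : HasSum (fun n : ℕ => n * pcTerm a z n) (-(z * pcSeries (a - 1) z)) := by
    rw [← hasSum_nat_add_iff' 1]
    have := ((summable_pcTerm (a - 1) z).hasSum.mul_left z).neg
    simp only [Finset.range_one, Finset.sum_singleton, Nat.cast_zero, zero_mul, sub_zero]
    convert! this using 2 with n
    rw [pcTerm, pcTerm, pcCoeff_succ, Nat.factorial_succ]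
    have : (n.factorial : ℂ) ≠ 0 := Nat.cast_ne_zero.2 n.factorial_ne_zero
    have : ((n : ℂ) + 1) ≠ 0 := Nat.cast_add_one_ne_zero n
    push_cast
    field_simp
    ring
  have h2 := h1.sub ((summable_pcTerm a z).hasSum.mul_left a)
  have h3 : HasSum (pcTerm (a - 2) z) (pcSeries (a - 2) z) := (summable_pcTerm _ z).hasSum
  have h4 : (fun n : ℕ => (n : ℂ) * pcTerm a z n - a * pcTerm a z n) = pcTerm (a - 2) z := by
    ext n
    rw [pcTerm, pcTerm, pcCoeff_add_two n (sub_ne_zero.2 (h n).symm)]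
    ring
  rw [h4] at h2
  have := h2.unique h3
  change -(z * pcSeries (a - 1) z) - a * pcSeries a z = _ at this
  linear_combination -this


/-! ### Parabolic cylinder functions of non-integral order -/

theorem hasSum_kummerM (a b z : ℂ) :
    HasSum (fun n : ℕ => Complex.Gamma b * ((ascPochhammer ℂ n).eval a /
      (n.factorial * Complex.Gamma (b + n)) * z ^ n)) (kummerM a b z) := by
  refine HasSum.mul_left _ ?_
  have hr : (Complex.regularizedHGFunSeries {a} {b}).radius = ⊤ :=
    Complex.radius_regularizedHGFunSeries_eq_top (by simp)
  have h := (Complex.regularizedHGFunSeries {a} {b}).hasSum (x := z) (by rw [hr]; simp)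
  convert! h using 2 with n
  simp [Complex.regularizedHGFunSeries, Complex.regularizedHGFunCoeff, mul_comm]

theorem Gamma_add_nat_eq {s : ℂ} (n : ℕ) (hs : ∀ k : ℕ, s ≠ -k) :
    Complex.Gamma (s + n) = (ascPochhammer ℂ n).eval s * Complex.Gamma s := by
  rw [← Complex.Gamma_add_nat_div_Gamma_eq s hs, div_mul_cancel₀ _ (Complex.Gamma_ne_zero hs)]

theorem Gamma_half_complex : Complex.Gamma (1 / 2) = (Real.sqrt Real.pi : ℂ) := by
  have := Complex.Gamma_mul_Gamma_add_half (1 / 2)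
  norm_num at this
  simpa using this

theorem Gamma_three_half_complex : Complex.Gamma (3 / 2) = (Real.sqrt Real.pi : ℂ) / 2 := by
  rw [show (3 / 2 : ℂ) = 1 / 2 + 1 by norm_num, Complex.Gamma_add_one _ (by norm_num),
    Gamma_half_complex]
  ring

theorem sqrt_pi_ne_zero_complex : (Real.sqrt Real.pi : ℂ) ≠ 0 :=
  Complex.ofReal_ne_zero.2 (Real.sqrt_pos.2 Real.pi_pos).ne'

/-- The duplication formula at `k + 1/2`. It converts the denominators of Kummer's series with `b =
1/2` into the factorials `(2k)!` of the even part of `pcSeries`. The analogue for `3/2` serves the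
odd part. -/
theorem factorial_mul_Gamma_half_add (k : ℕ) :
    (k.factorial : ℂ) * Complex.Gamma (1 / 2 + k) =
      (2 * k).factorial * (Real.sqrt Real.pi : ℂ) / 4 ^ k := by
  have h := Complex.Gamma_mul_Gamma_add_half (k + 1 / 2)
  rw [show (k : ℂ) + 1 / 2 + 1 / 2 = k + 1 by ring, Complex.Gamma_nat_eq_factorial,
    show 2 * ((k : ℂ) + 1 / 2) = ((2 * k : ℕ) : ℂ) + 1 by push_cast; ring,
    Complex.Gamma_nat_eq_factorial, show (1 : ℂ) - (((2 * k : ℕ) : ℂ) + 1) = -((2 * k : ℕ) : ℂ) by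
      ring, Complex.cpow_neg, Complex.cpow_natCast, pow_mul] at h
  rw [add_comm, mul_comm, h]
  norm_num
  ring

theorem factorial_mul_Gamma_three_half_add (k : ℕ) :
    (k.factorial : ℂ) * Complex.Gamma (3 / 2 + k) =
      (2 * k + 1).factorial * (Real.sqrt Real.pi : ℂ) / (2 * 4 ^ k) := by
  have h := Complex.Gamma_mul_Gamma_add_half (k + 1)
  rw [show (k : ℂ) + 1 + 1 / 2 = 3 / 2 + k by ring, Complex.Gamma_nat_eq_factorial,
    show 2 * ((k : ℂ) + 1) = ((2 * k + 1 : ℕ) : ℂ) + 1 by push_cast; ring,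
    Complex.Gamma_nat_eq_factorial,
    show (1 : ℂ) - (((2 * k + 1 : ℕ) : ℂ) + 1) = -((2 * k + 1 : ℕ) : ℂ) by ring,
    Complex.cpow_neg, Complex.cpow_natCast, pow_succ, pow_mul] at h
  rw [h]
  norm_num
  ring

theorem ne_neg_nat_of_ne_int {a : ℂ} (ha : ∀ n : ℤ, a ≠ n) (k : ℕ) : -a ≠ -k := fun h =>
  ha k (by rw [neg_inj] at h; simpa using h)

theorem neg_half_ne_neg_nat {a : ℂ} (ha : ∀ n : ℤ, a ≠ n) (k : ℕ) : -a / 2 ≠ -k := fun h =>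
  ha (2 * k) (by push_cast; linear_combination (-2) * h)

theorem one_sub_half_ne_neg_nat {a : ℂ} (ha : ∀ n : ℤ, a ≠ n) (k : ℕ) : (1 - a) / 2 ≠ -k := fun h =>
  ha (2 * k + 1) (by push_cast; linear_combination (-2) * h)

theorem two_cpow_half_add (a : ℂ) (k : ℕ) : (2 : ℂ) ^ (a + k) = 2 ^ a * 2 ^ k := by
  rw [Complex.cpow_add _ _ two_ne_zero, Complex.cpow_natCast]

/-- The Pochhammer symbols of Kummer's series come from `Γ(-a/2 + k) = (-a/2)_k Γ(-a/2)`. -/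
theorem hasSum_pcTerm_even {a : ℂ} (ha : ∀ n : ℤ, a ≠ n) (z : ℂ) :
    HasSum (fun k => pcTerm a z (2 * k)) (2 ^ (-a / 2 - 1) * Complex.Gamma (-a / 2) *
      kummerM (-a / 2) (1 / 2) (z ^ 2 / 2)) := by
  convert! (hasSum_kummerM (-a / 2) (1 / 2) (z ^ 2 / 2)).mul_left
    ((2 : ℂ) ^ (-a / 2 - 1) * Complex.Gamma (-a / 2)) using 2 with k
  rw [factorial_mul_Gamma_half_add, Gamma_half_complex, pcTerm, pcCoeff,
    show (((2 * k : ℕ) : ℂ) - a) / 2 = -a / 2 + k by push_cast; ring,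
    Gamma_add_nat_eq k (neg_half_ne_neg_nat ha), show -a / 2 + (k : ℂ) - 1 = -a / 2 - 1 + k by ring,
    two_cpow_half_add, pow_mul, neg_sq, div_pow, show (4 : ℂ) = 2 * 2 by norm_num, mul_pow]
  have := sqrt_pi_ne_zero_complex
  have : ((2 * k).factorial : ℂ) ≠ 0 := Nat.cast_ne_zero.2 (Nat.factorial_ne_zero _)
  field_simp

theorem hasSum_pcTerm_odd {a : ℂ} (ha : ∀ n : ℤ, a ≠ n) (z : ℂ) :
    HasSum (fun k => pcTerm a z (2 * k + 1)) (-z * 2 ^ ((1 - a) / 2 - 1) *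
      Complex.Gamma ((1 - a) / 2) * kummerM ((1 - a) / 2) (3 / 2) (z ^ 2 / 2)) := by
  convert! (hasSum_kummerM ((1 - a) / 2) (3 / 2) (z ^ 2 / 2)).mul_left
    (-z * (2 : ℂ) ^ ((1 - a) / 2 - 1) * Complex.Gamma ((1 - a) / 2)) using 2 with k
  rw [factorial_mul_Gamma_three_half_add, Gamma_three_half_complex, pcTerm, pcCoeff,
    show (((2 * k + 1 : ℕ) : ℂ) - a) / 2 = (1 - a) / 2 + k by push_cast; ring,
    Gamma_add_nat_eq k (one_sub_half_ne_neg_nat ha),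
    show (1 - a) / 2 + (k : ℂ) - 1 = (1 - a) / 2 - 1 + k by ring,
    two_cpow_half_add, pow_succ, pow_mul, neg_sq, div_pow, show (4 : ℂ) = 2 * 2 by norm_num, mul_pow]
  have := sqrt_pi_ne_zero_complex
  have : ((2 * k + 1).factorial : ℂ) ≠ 0 := Nat.cast_ne_zero.2 (Nat.factorial_ne_zero _)
  field_simp

theorem sqrt_two_eq_cpow : (Real.sqrt 2 : ℂ) = 2 ^ (1 / 2 : ℂ) := by
  rw [Real.sqrt_eq_rpow, Complex.ofReal_cpow two_pos.le]
  norm_num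

theorem sqrt_two_sq_complex : (Real.sqrt 2 : ℂ) ^ 2 = 2 := by
  rw [← Complex.ofReal_pow, Real.sq_sqrt two_pos.le]; norm_num

theorem Gamma_neg_ne_zero {a : ℂ} (ha : ∀ n : ℤ, a ≠ n) : Complex.Gamma (-a) ≠ 0 :=
  Complex.Gamma_ne_zero (ne_neg_nat_of_ne_int ha)

/-- The two Kummer functions in the definition are the even and the odd part of the series, and the
constants agree by the duplication formula for `Γ(-a/2) Γ((1-a)/2)`. Non-integrality of `a` keeps
all Gamma values finite and nonzero. The differential relations, the recurrence and the estimates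
are read off from this series. -/
theorem parabolicCylinderD_eq {a : ℂ} (ha : ∀ n : ℤ, a ≠ n) (z : ℂ) :
    parabolicCylinderD a z = Complex.exp (-z ^ 2 / 4) * (pcSeries a z / Complex.Gamma (-a)) := by
  have h := ((hasSum_pcTerm_even ha z).even_add_odd (hasSum_pcTerm_odd ha z)).tsum_eq
  rw [pcSeries, h, parabolicCylinderD]
  have hd := Complex.Gamma_mul_Gamma_add_half (-a / 2)
  rw [show -a / 2 + 1 / 2 = (1 - a) / 2 by ring, show 2 * (-a / 2) = -a by ring] at hd
  have g0 := Gamma_neg_ne_zero ha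
  have g1 := Complex.Gamma_ne_zero (neg_half_ne_neg_nat ha)
  have g2 := Complex.Gamma_ne_zero (one_sub_half_ne_neg_nat ha)
  have t0 : (2 : ℂ) ^ (a / 2) ≠ 0 := by simp [Complex.cpow_eq_zero_iff]
  have e1 : (2 : ℂ) ^ (-a / 2 - 1) = (2 ^ (a / 2))⁻¹ / 2 := by
    rw [Complex.cpow_sub _ _ two_ne_zero, neg_div, Complex.cpow_neg, Complex.cpow_one]
  have e2 : (2 : ℂ) ^ (1 - -a) = 2 * (2 ^ (a / 2)) ^ 2 := by
    rw [show (1 : ℂ) - -a = 1 + (a / 2 + a / 2) by ring, Complex.cpow_add _ _ two_ne_zero,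
      Complex.cpow_add _ _ two_ne_zero, Complex.cpow_one, sq]
  have e3 : (2 : ℂ) ^ ((1 - a) / 2 - 1) = (2 ^ (a / 2))⁻¹ * (Real.sqrt 2 : ℂ) / 2 := by
    rw [show (1 - a) / 2 - 1 = 1 / 2 - a / 2 - 1 by ring, Complex.cpow_sub _ _ two_ne_zero,
      Complex.cpow_sub _ _ two_ne_zero, Complex.cpow_one, sqrt_two_eq_cpow]
    ring
  rw [e2] at hd
  rw [e1, e3]
  set t := (2 : ℂ) ^ (a / 2)
  set G0 := Complex.Gamma (-a)
  set G1 := Complex.Gamma (-a / 2)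
  set G2 := Complex.Gamma ((1 - a) / 2)
  have k1 : t⁻¹ / 2 * G1 / G0 = t * (Real.sqrt Real.pi : ℂ) / G2 := by
    field_simp
    linear_combination hd
  have k2 : t⁻¹ / 2 * G2 / G0 = t * (Real.sqrt Real.pi : ℂ) / G1 := by
    field_simp
    linear_combination hd
  rw [add_div]
  linear_combination (-Complex.exp (-z ^ 2 / 4)) * (kummerM (-a / 2) (1 / 2) (z ^ 2 / 2)) * k1 +
    Complex.exp (-z ^ 2 / 4) * (kummerM ((1 - a) / 2) (3 / 2) (z ^ 2 / 2)) *
      z * (Real.sqrt 2 : ℂ) * k2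

theorem ne_int_sub_one {a : ℂ} (ha : ∀ n : ℤ, a ≠ n) (n : ℤ) : a - 1 ≠ n := fun h =>
  ha (n + 1) (by push_cast; linear_combination h)

theorem ne_int_add_one {a : ℂ} (ha : ∀ n : ℤ, a ≠ n) (n : ℤ) : a + 1 ≠ n := fun h =>
  ha (n - 1) (by push_cast; linear_combination h)

theorem ne_int_neg {a : ℂ} (ha : ∀ n : ℤ, a ≠ n) (n : ℤ) : -a ≠ n := fun h =>
  ha (-n) (by push_cast; linear_combination -h)

theorem Gamma_one_sub_eq {a : ℂ} (ha : ∀ n : ℤ, a ≠ n) :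
    Complex.Gamma (-(a - 1)) = -a * Complex.Gamma (-a) := by
  rw [← Complex.Gamma_add_one (-a) (by simpa using ha 0)]
  congr 1; ring

theorem hasDerivAt_parabolicCylinderD {a : ℂ} (ha : ∀ n : ℤ, a ≠ n) (z : ℂ) :
    HasDerivAt (parabolicCylinderD a)
      (-z / 2 * parabolicCylinderD a z + a * parabolicCylinderD (a - 1) z) z := by
  have h1 : HasDerivAt (fun z : ℂ => Complex.exp (-z ^ 2 / 4))
      (Complex.exp (-z ^ 2 / 4) * (-z / 2)) z := by
    refine HasDerivAt.cexp ?_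
    refine ((hasDerivAt_pow 2 z).fun_neg.div_const 4).congr_deriv ?_
    push_cast; ring
  have h2 := h1.mul ((hasDerivAt_pcSeries a z).div_const (Complex.Gamma (-a)))
  rw [funext (parabolicCylinderD_eq ha)]
  refine h2.congr_deriv ?_
  have h0 : a ≠ 0 := by simpa using ha 0
  have := Gamma_neg_ne_zero ha
  beta_reduce
  rw [parabolicCylinderD_eq (ne_int_sub_one ha), Gamma_one_sub_eq ha]
  field_simp

theorem parabolicCylinderD_add_one {a : ℂ} (ha : ∀ n : ℤ, a ≠ n) (z : ℂ) :
    parabolicCylinderD (a + 1) z =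
      z * parabolicCylinderD a z - a * parabolicCylinderD (a - 1) z := by
  have hr := pcSeries_recurrence (a := a + 1) (fun n h => ha (n - 1) (by
    push_cast; linear_combination h)) z
  rw [show a + 1 - 1 = a by ring, show a + 1 - 2 = a - 1 by ring] at hr
  have h0 : a ≠ 0 := by simpa using ha 0
  have g0 := Gamma_neg_ne_zero ha
  have g1 := Gamma_neg_ne_zero (ne_int_add_one ha)
  have hg := Gamma_one_sub_eq (ne_int_add_one ha)
  rw [show -(a + 1 - 1) = -a by ring] at hg
  rw [parabolicCylinderD_eq ha, parabolicCylinderD_eq (ne_int_sub_one ha), Gamma_one_sub_eq ha,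
    parabolicCylinderD_eq (ne_int_add_one ha), hg]
  have h1 : a + 1 ≠ 0 := by simpa using ne_int_add_one ha 0
  field_simp
  linear_combination hr

theorem hasDerivAt_parabolicCylinderD' {a : ℂ} (ha : ∀ n : ℤ, a ≠ n) (z : ℂ) :
    HasDerivAt (parabolicCylinderD a)
      (z / 2 * parabolicCylinderD a z - parabolicCylinderD (a + 1) z) z := by
  refine (hasDerivAt_parabolicCylinderD ha z).congr_deriv ?_
  rw [parabolicCylinderD_add_one ha]; ring

theorem parabolicCylinderD_zero (a : ℂ) : parabolicCylinderD a 0 =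
    2 ^ (a / 2) * (Real.sqrt Real.pi : ℂ) / Complex.Gamma ((1 - a) / 2) := by
  have : kummerM (-a / 2) (1 / 2) 0 = 1 := by
    refine (hasSum_kummerM (-a / 2) (1 / 2) 0).unique ?_
    convert! hasSum_ite_eq (0 : ℕ) (1 : ℂ) using 2 with n
    split_ifs with h
    · subst h
      have : Complex.Gamma (1 / 2) ≠ 0 := by
        rw [Gamma_half_complex]; exact sqrt_pi_ne_zero_complex
      rw [one_div] at this
      simp [this]
    · simp [h]
  rw [parabolicCylinderD, show (0 : ℂ) ^ 2 / 2 = 0 by norm_num, this]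
  simp
  ring


/-! ### Uniqueness for Weber's equation, the Wronskian and the connection formula. -/

/-- Along the segment `t ↦ tz` the pair `(w, w')` satisfies a linear first-order system with bounded
coefficients and zero initial value, so Grönwall's inequality applies. -/
theorem eq_zero_of_second_order_ode {w w' g : ℂ → ℂ} (hg : Continuous g)
    (h1 : ∀ z, HasDerivAt w (w' z) z) (h2 : ∀ z, HasDerivAt w' (g z * w z) z)
    (hw : w 0 = 0) (hw' : w' 0 = 0) (z : ℂ) : w z = 0 := by
  set f : ℝ → ℂ × ℂ := fun t => (w (t * z), w' (t * z))
  have hl : ∀ t : ℝ, HasDerivAt (fun t : ℝ => (t : ℂ) * z) z t := fun t => by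
    simpa using (Complex.ofRealCLM.hasDerivAt (x := t)).mul_const z
  have hf : ∀ t : ℝ, HasDerivAt f (w' (t * z) * z, g (t * z) * w (t * z) * z) t := fun t =>
    ((h1 _).comp t (hl t)).prodMk ((h2 _).comp t (hl t))
  obtain ⟨M, hM⟩ := (isCompact_Icc (a := (0 : ℝ)) (b := 1)).exists_bound_of_continuousOn
    (f := fun t : ℝ => g (t * z)) (by fun_prop)
  have hM0 : 0 ≤ M := (norm_nonneg _).trans (hM 0 (by simp))
  have key := norm_le_gronwallBound_of_norm_deriv_right_le (f := f) (δ := 0) (ε := 0)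
    (K := (1 + M) * ‖z‖) (a := 0) (b := 1)
    (continuousOn_of_forall_continuousAt fun t _ => (hf t).continuousAt)
    (fun t _ => (hf t).hasDerivWithinAt) (by simp [f, hw, hw'])
    (fun t ht => by
      have hMt := hM t ⟨ht.1, ht.2.le⟩
      have a1 : ‖w (t * z)‖ ≤ ‖f t‖ := norm_fst_le (f t)
      have a2 : ‖w' (t * z)‖ ≤ ‖f t‖ := norm_snd_le (f t)
      rw [add_zero, Prod.norm_def, max_le_iff]
      simp only [norm_mul]
      constructor
      · calc _ ≤ ‖f t‖ * ‖z‖ := by gcongr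
          _ ≤ (1 + M) * ‖z‖ * ‖f t‖ := by
            nlinarith [mul_nonneg hM0 (mul_nonneg (norm_nonneg (f t)) (norm_nonneg z))]
      · calc _ ≤ M * ‖f t‖ * ‖z‖ := by gcongr
          _ ≤ (1 + M) * ‖z‖ * ‖f t‖ := by nlinarith [mul_nonneg (norm_nonneg (f t)) (norm_nonneg z)])
    1 (by simp)
  rw [gronwallBound_ε0_δ0, norm_le_zero_iff] at key
  simpa [f] using congrArg Prod.fst key

theorem hasDerivAt_deriv_parabolicCylinderD {a : ℂ} (ha : ∀ n : ℤ, a ≠ n) (z : ℂ) :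
    HasDerivAt (fun z => -z / 2 * parabolicCylinderD a z + a * parabolicCylinderD (a - 1) z)
      ((z ^ 2 / 4 - a - 1 / 2) * parabolicCylinderD a z) z := by
  have h1 : HasDerivAt (fun z : ℂ => -z / 2) (-1 / 2) z := (hasDerivAt_neg z).div_const 2
  have h2 := hasDerivAt_parabolicCylinderD' (ne_int_sub_one ha) z
  refine ((h1.mul (hasDerivAt_parabolicCylinderD ha z)).add (h2.const_mul a)).congr_deriv ?_
  rw [sub_add_cancel]
  ring

theorem cos_ne_zero_of_ne_int {a : ℂ} (ha : ∀ n : ℤ, a ≠ n) : Complex.cos (Real.pi * a / 2) ≠ 0 := by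
  intro h
  obtain ⟨k, hk⟩ := Complex.cos_eq_zero_iff.1 h
  have : (Real.pi : ℂ) ≠ 0 := Complex.ofReal_ne_zero.2 Real.pi_ne_zero
  refine ha (2 * k + 1) ?_
  push_cast
  field_simp at hk
  linear_combination hk

theorem sin_ne_zero_of_ne_int {a : ℂ} (ha : ∀ n : ℤ, a ≠ n) : Complex.sin (Real.pi * a / 2) ≠ 0 := by
  intro h
  obtain ⟨k, hk⟩ := Complex.sin_eq_zero_iff.1 h
  have : (Real.pi : ℂ) ≠ 0 := Complex.ofReal_ne_zero.2 Real.pi_ne_zero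
  refine ha (2 * k) ?_
  push_cast
  field_simp at hk
  linear_combination hk

theorem Gamma_half_mul_Gamma_half {a : ℂ} :
    Complex.Gamma ((1 + a) / 2) * Complex.Gamma ((1 - a) / 2) =
      Real.pi / Complex.cos (Real.pi * a / 2) := by
  have := Complex.Gamma_mul_Gamma_one_sub ((1 + a) / 2)
  rw [show 1 - (1 + a) / 2 = (1 - a) / 2 by ring,
    show (Real.pi : ℂ) * ((1 + a) / 2) = Real.pi * a / 2 + Real.pi / 2 by ring,
    Complex.sin_add_pi_div_two] at this
  exact this

theorem Gamma_half_add_one_mul_Gamma {a : ℂ} (ha : a ≠ 0) :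
    Complex.Gamma (1 + a / 2) * Complex.Gamma (1 - a / 2) =
      a / 2 * (Real.pi / Complex.sin (Real.pi * a / 2)) := by
  have := Complex.Gamma_mul_Gamma_one_sub (a / 2)
  rw [show (Real.pi : ℂ) * (a / 2) = Real.pi * a / 2 by ring] at this
  rw [add_comm 1 (a / 2), Complex.Gamma_add_one _ (by simpa using ha), mul_assoc, this]

theorem pi_eq_sqrt_sq_complex : (Real.pi : ℂ) = (Real.sqrt Real.pi : ℂ) ^ 2 := by
  rw [← Complex.ofReal_pow, Real.sq_sqrt Real.pi_pos.le]

theorem parabolicCylinderD_zero_mul {a : ℂ} (ha : ∀ n : ℤ, a ≠ n) :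
    parabolicCylinderD (-a) 0 * parabolicCylinderD a 0 = Complex.cos (Real.pi * a / 2) := by
  rw [parabolicCylinderD_zero, parabolicCylinderD_zero, neg_div, Complex.cpow_neg, sub_neg_eq_add]
  have h := Gamma_half_mul_Gamma_half (a := a)
  have hc := cos_ne_zero_of_ne_int ha
  have g1 := Complex.Gamma_ne_zero (one_sub_half_ne_neg_nat ha)
  have g2 := Complex.Gamma_ne_zero (one_sub_half_ne_neg_nat (ne_int_neg ha))
  rw [sub_neg_eq_add] at g2
  have t0 : (2 : ℂ) ^ (a / 2) ≠ 0 := by simp [Complex.cpow_eq_zero_iff]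
  generalize Complex.cos (Real.pi * a / 2) = c at h hc ⊢
  generalize Complex.Gamma ((1 - a) / 2) = x at *
  generalize Complex.Gamma ((1 + a) / 2) = y at *
  rw [pi_eq_sqrt_sq_complex] at h
  field_simp at h ⊢
  linear_combination -h

theorem parabolicCylinderD_sub_one_zero_mul {a : ℂ} (ha : ∀ n : ℤ, a ≠ n) :
    a * parabolicCylinderD (-a - 1) 0 * parabolicCylinderD (a - 1) 0 =
      Complex.sin (Real.pi * a / 2) := by
  rw [parabolicCylinderD_zero, parabolicCylinderD_zero, show (-a - 1) / 2 = -(a / 2) - 1 / 2 by ring,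
    show (1 - (-a - 1)) / 2 = 1 + a / 2 by ring, show (1 - (a - 1)) / 2 = 1 - a / 2 by ring,
    show (a - 1) / 2 = a / 2 - 1 / 2 by ring, Complex.cpow_sub _ _ two_ne_zero,
    Complex.cpow_sub _ _ two_ne_zero, Complex.cpow_neg, ← sqrt_two_eq_cpow]
  have h0 : a ≠ 0 := by simpa using ha 0
  have h := Gamma_half_add_one_mul_Gamma h0
  have hc := sin_ne_zero_of_ne_int ha
  have g1 : Complex.Gamma (1 + a / 2) ≠ 0 := Complex.Gamma_ne_zero fun k hk =>
    ha (-2 * k - 2) (by push_cast; linear_combination 2 * hk)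
  have g2 : Complex.Gamma (1 - a / 2) ≠ 0 := Complex.Gamma_ne_zero fun k hk =>
    ha (2 * k + 2) (by push_cast; linear_combination (-2) * hk)
  have t0 : (2 : ℂ) ^ (a / 2) ≠ 0 := by simp [Complex.cpow_eq_zero_iff]
  have r0 : (Real.sqrt 2 : ℂ) ≠ 0 := Complex.ofReal_ne_zero.2 (by positivity)
  have r2 := sqrt_two_sq_complex
  generalize Complex.sin (Real.pi * a / 2) = c at h hc ⊢
  generalize Complex.Gamma (1 + a / 2) = x at *
  generalize Complex.Gamma (1 - a / 2) = y at *
  rw [pi_eq_sqrt_sq_complex] at h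
  field_simp at h ⊢
  rw [r2]
  linear_combination -h

/-- The Wronskian relation. -/
theorem parabolicCylinderD_wronskian {a : ℂ} (ha : ∀ n : ℤ, a ≠ n) (z : ℂ) :
    parabolicCylinderD (-a) (Complex.I * z) * parabolicCylinderD a z -
      Complex.I * a * parabolicCylinderD (-a - 1) (Complex.I * z) * parabolicCylinderD (a - 1) z =
      Complex.exp (-(Complex.I * Real.pi * a / 2)) := by
  set A := fun z => parabolicCylinderD (-a) (Complex.I * z)
  set B := fun z => parabolicCylinderD (-a - 1) (Complex.I * z)
  set C := fun z => parabolicCylinderD a z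
  set E := fun z => parabolicCylinderD (a - 1) z
  have hI : ∀ z : ℂ, HasDerivAt (fun z : ℂ => Complex.I * z) Complex.I z := fun z => by
    simpa using (hasDerivAt_id' z).const_mul Complex.I
  have hA : ∀ z, HasDerivAt A (z / 2 * A z - Complex.I * a * B z) z := fun z => by
    refine ((hasDerivAt_parabolicCylinderD (ne_int_neg ha) (Complex.I * z)).comp z
      (hI z)).congr_deriv ?_
    simp only [A, B]
    linear_combination (-z / 2 * parabolicCylinderD (-a) (Complex.I * z)) * Complex.I_sq
  have hB : ∀ z, HasDerivAt B (-z / 2 * B z - Complex.I * A z) z := fun z => by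
    refine ((hasDerivAt_parabolicCylinderD' (ne_int_sub_one (ne_int_neg ha)) (Complex.I * z)).comp z
      (hI z)).congr_deriv ?_
    simp only [A, B, sub_add_cancel]
    linear_combination (z / 2 * parabolicCylinderD (-a - 1) (Complex.I * z)) * Complex.I_sq
  have hC : ∀ z, HasDerivAt C (-z / 2 * C z + a * E z) z := hasDerivAt_parabolicCylinderD ha
  have hE : ∀ z, HasDerivAt E (z / 2 * E z - C z) z := fun z => by
    have := hasDerivAt_parabolicCylinderD' (ne_int_sub_one ha) z
    rwa [sub_add_cancel] at this
  -- The first-order relations for `D_a` make `W` constant. At `0` the reflection formula evaluates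
  -- the two products as `cos (πa/2)` and `sin (πa/2)`, which combine to the exponential.
  set W := fun z => A z * C z - Complex.I * a * (B z * E z)
  have hW : ∀ z, HasDerivAt W 0 z := fun z => by
    refine (((hA z).mul (hC z)).sub (((hB z).mul (hE z)).const_mul (Complex.I * a))).congr_deriv ?_
    linear_combination (a * A z * E z) * Complex.I_sq
  have hW0 : W z = W 0 := is_const_of_deriv_eq_zero (fun z => (hW z).differentiableAt)
    (fun z => (hW z).deriv) z 0
  have h1 := parabolicCylinderD_zero_mul ha
  have h2 := parabolicCylinderD_sub_one_zero_mul ha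
  have h3 : W 0 = Complex.exp (-(Complex.I * Real.pi * a / 2)) := by
    rw [show -(Complex.I * Real.pi * a / 2) = (-(Real.pi * a / 2)) * Complex.I by ring,
      Complex.exp_mul_I, Complex.cos_neg, Complex.sin_neg]
    simp only [W, A, B, C, E, mul_zero]
    linear_combination h1 - Complex.I * h2
  rw [← h3, ← hW0]
  simp only [W]; ring

/-- The connection formula. -/
theorem parabolicCylinderD_connection {a : ℂ} (ha : ∀ n : ℤ, a ≠ n) (z : ℂ) :
    parabolicCylinderD a z = Complex.Gamma (a + 1) / ((Real.sqrt 2 : ℂ) * (Real.sqrt Real.pi : ℂ)) *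
      (Complex.exp (Complex.I * Real.pi * a / 2) * parabolicCylinderD (-a - 1) (Complex.I * z) +
       Complex.exp (-(Complex.I * Real.pi * a / 2)) *
        parabolicCylinderD (-a - 1) (-Complex.I * z)) := by
  have hb : ∀ n : ℤ, -a - 1 ≠ n := ne_int_sub_one (ne_int_neg ha)
  set κ := Complex.Gamma (a + 1) / ((Real.sqrt 2 : ℂ) * (Real.sqrt Real.pi : ℂ))
  set e₁ := Complex.exp (Complex.I * Real.pi * a / 2)
  set e₂ := Complex.exp (-(Complex.I * Real.pi * a / 2))
  set D' : ℂ → ℂ → ℂ := fun a z => -z / 2 * parabolicCylinderD a z + a * parabolicCylinderD (a - 1) z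
  have hI : ∀ c z : ℂ, HasDerivAt (fun z : ℂ => c * z) c z := fun c z => by
    simpa using (hasDerivAt_id' z).const_mul c
  have d1 : ∀ c z, HasDerivAt (fun z => parabolicCylinderD (-a - 1) (c * z))
      (c * D' (-a - 1) (c * z)) z := fun c z =>
    ((hasDerivAt_parabolicCylinderD hb (c * z)).comp z (hI c z)).congr_deriv (mul_comm _ _)
  have d2 : ∀ c z, c ^ 2 = -1 → HasDerivAt (fun z => c * D' (-a - 1) (c * z))
      ((z ^ 2 / 4 - a - 1 / 2) * parabolicCylinderD (-a - 1) (c * z)) z := fun c z hc => by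
    refine (((hasDerivAt_deriv_parabolicCylinderD hb (c * z)).comp z
      (hI c z)).const_mul c).congr_deriv ?_
    linear_combination (parabolicCylinderD (-a - 1) (c * z) * (z ^ 2 / 4 * (c ^ 2 - 1) + a + 1 / 2)) * hc
  have hIs : Complex.I ^ 2 = -1 := Complex.I_sq
  have hIn : (-Complex.I) ^ 2 = -1 := by rw [neg_sq, Complex.I_sq]
  have hI0 : ∀ n : ℤ, a + 1 ≠ n := ne_int_add_one ha
  set t := (2 : ℂ) ^ (a / 2) with ht
  have t0 : t ≠ 0 := by simp [ht, Complex.cpow_eq_zero_iff]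
  have r0 : (Real.sqrt 2 : ℂ) ≠ 0 := Complex.ofReal_ne_zero.2 (by positivity)
  have r2 := sqrt_two_sq_complex
  have p0 := sqrt_pi_ne_zero_complex
  have p2 := pi_eq_sqrt_sq_complex
  have hX : Complex.Gamma ((1 + a) / 2) ≠ 0 := Complex.Gamma_ne_zero fun k hk =>
    ha (-2 * k - 1) (by push_cast; linear_combination 2 * hk)
  have hY : Complex.Gamma (1 + a / 2) ≠ 0 := Complex.Gamma_ne_zero fun k hk =>
    ha (-2 * k - 2) (by push_cast; linear_combination 2 * hk)
  have hZ := Complex.Gamma_ne_zero (one_sub_half_ne_neg_nat ha)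
  have hV : Complex.Gamma (1 - a / 2) ≠ 0 := Complex.Gamma_ne_zero fun k hk =>
    ha (2 * k + 2) (by push_cast; linear_combination (-2) * hk)
  have hXZ := Gamma_half_mul_Gamma_half (a := a)
  have hYV := Gamma_half_add_one_mul_Gamma (a := a) (by simpa using ha 0)
  have hc := cos_ne_zero_of_ne_int ha
  have hs := sin_ne_zero_of_ne_int ha
  have hd := Complex.Gamma_mul_Gamma_add_half ((1 + a) / 2)
  rw [show (1 + a) / 2 + 1 / 2 = 1 + a / 2 by ring, show 2 * ((1 + a) / 2) = a + 1 by ring,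
    show 1 - (a + 1) = -(a / 2 + a / 2) by ring, Complex.cpow_neg, Complex.cpow_add _ _ two_ne_zero,
    ← ht] at hd
  have ha1 : 1 + a ≠ 0 := by rw [add_comm]; simpa using hI0 0
  have he : e₁ + e₂ = 2 * Complex.cos (Real.pi * a / 2) := by
    have h1 : Complex.exp (-(Real.pi * a / 2) * Complex.I) = e₂ := by congr 1; ring
    have h2 : Complex.exp (Real.pi * a / 2 * Complex.I) = e₁ := by congr 1; ring
    rw [Complex.two_cos, h1, h2]
  have he' : Complex.I * (e₁ - e₂) = -2 * Complex.sin (Real.pi * a / 2) := by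
    rw [neg_mul, Complex.two_sin]
    have h1 : Complex.exp (-(Real.pi * a / 2) * Complex.I) = e₂ := by congr 1; ring
    have h2 : Complex.exp (Real.pi * a / 2 * Complex.I) = e₁ := by congr 1; ring
    rw [h1, h2]; ring
  have hκ : κ = t ^ 2 * Complex.Gamma ((1 + a) / 2) * Complex.Gamma (1 + a / 2) /
      ((Real.sqrt 2 : ℂ) * (Real.sqrt Real.pi : ℂ) ^ 2) := by
    rw [show κ = Complex.Gamma (a + 1) / ((Real.sqrt 2 : ℂ) * (Real.sqrt Real.pi : ℂ)) from rfl]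
    generalize Complex.Gamma ((1 + a) / 2) = X at hd ⊢
    generalize Complex.Gamma (1 + a / 2) = Y at hd ⊢
    field_simp at hd ⊢
    linear_combination -hd
  have hκ1 : parabolicCylinderD a 0 = κ * ((e₁ + e₂) * parabolicCylinderD (-a - 1) 0) := by
    rw [he, hκ, parabolicCylinderD_zero, parabolicCylinderD_zero,
      show (-a - 1) / 2 = -(a / 2) - 1 / 2 by ring, show (1 - (-a - 1)) / 2 = 1 + a / 2 by ring,
      Complex.cpow_sub _ _ two_ne_zero, Complex.cpow_neg, ← sqrt_two_eq_cpow, ← ht]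
    clear_value κ e₁ e₂ t
    clear hd hκ he he' d1 d2
    generalize Complex.cos (Real.pi * a / 2) = c at *
    generalize Complex.sin (Real.pi * a / 2) = s at *
    generalize Complex.Gamma ((1 + a) / 2) = X at *
    generalize Complex.Gamma (1 + a / 2) = Y at *
    generalize Complex.Gamma ((1 - a) / 2) = Z at *
    generalize Complex.Gamma (1 - a / 2) = V at *
    rw [p2] at hXZ hYV
    field_simp at hXZ ⊢
    rw [r2]
    linear_combination (-2) * hXZ
  have hκ2 : a * parabolicCylinderD (a - 1) 0 =
      κ * (Complex.I * (e₁ - e₂) * ((-a - 1) * parabolicCylinderD (-a - 1 - 1) 0)) := by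
    rw [he', hκ, parabolicCylinderD_zero, parabolicCylinderD_zero,
      show (-a - 1 - 1) / 2 = -(a / 2) - 1 by ring,
      show (1 - (-a - 1 - 1)) / 2 = (1 + a) / 2 + 1 by ring,
      Complex.Gamma_add_one _ (div_ne_zero ha1 two_ne_zero), show (1 - (a - 1)) / 2 = 1 - a / 2 by ring,
      show (a - 1) / 2 = a / 2 - 1 / 2 by ring,
      Complex.cpow_sub _ _ two_ne_zero, Complex.cpow_sub _ _ two_ne_zero, Complex.cpow_neg,
      Complex.cpow_one, ← sqrt_two_eq_cpow, ← ht]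
    clear_value κ e₁ e₂ t
    clear hd hκ he he' d1 d2
    generalize Complex.cos (Real.pi * a / 2) = c at *
    generalize Complex.sin (Real.pi * a / 2) = s at *
    generalize Complex.Gamma ((1 + a) / 2) = X at *
    generalize Complex.Gamma (1 + a / 2) = Y at *
    generalize Complex.Gamma ((1 - a) / 2) = Z at *
    generalize Complex.Gamma (1 - a / 2) = V at *
    rw [p2] at hXZ hYV
    field_simp at hYV ⊢
    linear_combination (-1 - a) * hYV
  -- Both sides satisfy the same Weber equation: the chain rule contributes `(±i)² = -1`, and
  -- passing from `a` to `-a - 1` changes the sign of `a + 1/2`. It remains to compare the values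
  -- and the first derivatives at `0`, which are `hκ1` and `hκ2`.
  have key := eq_zero_of_second_order_ode (g := fun z => z ^ 2 / 4 - a - 1 / 2)
    (w := fun z => parabolicCylinderD a z - κ * (e₁ * parabolicCylinderD (-a - 1) (Complex.I * z) +
       e₂ * parabolicCylinderD (-a - 1) (-Complex.I * z)))
    (w' := fun z => D' a z - κ * (e₁ * (Complex.I * D' (-a - 1) (Complex.I * z)) +
       e₂ * (-Complex.I * D' (-a - 1) (-Complex.I * z)))) (by fun_prop)
    (fun z => (hasDerivAt_parabolicCylinderD ha z).sub
      ((((d1 Complex.I z).const_mul e₁).add ((d1 (-Complex.I) z).const_mul e₂)).const_mul κ))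
    (fun z => by
      refine ((hasDerivAt_deriv_parabolicCylinderD ha z).sub
        ((((d2 Complex.I z hIs).const_mul e₁).add ((d2 (-Complex.I) z hIn).const_mul e₂)).const_mul
          κ)).congr_deriv ?_
      ring)
    (by
      simp only [mul_zero]
      linear_combination hκ1)
    (by
      simp only [D', mul_zero, neg_zero, zero_div, zero_mul, zero_add]
      linear_combination hκ2) z
  exact sub_eq_zero.1 key


/-! ### Asymptotics of parabolic cylinder functions -/

/-- Mean value inequality: the segment from `0` to `-u` lies in the left half plane, where the
exponential has modulus at most `1`. -/
theorem norm_exp_neg_sub_one_le {u : ℂ} (hu : 0 ≤ u.re) : ‖Complex.exp (-u) - 1‖ ≤ ‖u‖ := by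
  have h := (convex_halfSpace_re_le 0).norm_image_sub_le_of_norm_deriv_le (f := Complex.exp) (C := 1)
    (fun x _ => Complex.differentiable_exp x) (fun x hx => by
      rw [Complex.deriv_exp, Complex.norm_exp]
      exact Real.exp_le_one_iff.2 hx) (x := 0) (y := -u) (by simp) (by simpa using hu)
  simpa using h

/-- With the Gaussian factor replaced by `1`, the integral along the ray through `w` is a Gamma
integral and equals the leading term exactly; `hlog` makes the powers of `z` and `w` multiply. The
error of this replacement is at most `|w²s²/2|`, and the additional `s²` gains two powers of
`1/|z|`. -/
theorem norm_pcSeries_sub_le {a w z : ℂ} (ha : a.re < 0) (hw : 0 < w.re) (hw2 : 0 < (w ^ 2).re)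
    (hw1 : ‖w‖ = 1) (hz : z ≠ 0) (hzw : 2 / 5 * ‖z‖ ≤ (z * w).re)
    (hlog : Complex.log (z * w) = Complex.log z + Complex.log w) :
    ‖pcSeries a z - z ^ a * Complex.Gamma (-a)‖ ≤
      ‖w ^ (-a)‖ * (1 / 2 * ((1 / (2 / 5 * ‖z‖)) ^ (2 - a.re) * Real.Gamma (2 - a.re))) := by
  have hw0 : w ≠ 0 := by rintro rfl; simp at hw
  have hz0 : 0 < ‖z‖ := norm_pos_iff.2 hz
  have hr : 0 < (z * w).re := lt_of_lt_of_le (by positivity) hzw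
  have hb : 0 < (-a).re := by simpa using ha
  have h1 := integral_cpow_mul_exp_neg_mul_Ioi_complex hb hr
  rw [neg_neg] at h1
  have h2 : w ^ (-a) * (z * w) ^ a = z ^ a := by
    rw [Complex.cpow_def_of_ne_zero (mul_ne_zero hz hw0), hlog, Complex.cpow_def_of_ne_zero hz,
      Complex.cpow_def_of_ne_zero hw0, ← Complex.exp_add]
    congr 1; ring
  have h3 : z ^ a * Complex.Gamma (-a) = w ^ (-a) * ∫ s in Ioi (0 : ℝ),
      (s : ℂ) ^ (-a - 1) * Complex.exp (-(z * w * s)) := by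
    rw [h1, ← mul_assoc, h2]
  have hi1 := integrableOn_cpow_mul_exp_neg_mul hb hr
  have hsq : ∀ s : ℝ, 0 ≤ (w ^ 2 * (s : ℂ) ^ 2 / 2).re := fun s => by
    have : w ^ 2 * (s : ℂ) ^ 2 / 2 = ((s ^ 2 / 2 : ℝ) : ℂ) * w ^ 2 := by push_cast; ring
    rw [this, Complex.re_ofReal_mul]; positivity
  have hi2 : IntegrableOn (fun s : ℝ => (s : ℂ) ^ (-a - 1) * Complex.exp (-(z * w * s)) *
      Complex.exp (-(w ^ 2 * (s : ℂ) ^ 2 / 2))) (Ioi 0) := by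
    refine hi1.norm.mono' (by fun_prop) (Eventually.of_forall fun s => ?_)
    rw [norm_mul _ (Complex.exp (-(w ^ 2 * (s : ℂ) ^ 2 / 2)))]
    refine mul_le_of_le_one_right (norm_nonneg _) ?_
    rw [Complex.norm_exp, Real.exp_le_one_iff]
    simpa using hsq s
  rw [pcSeries_eq_integral z ha hw hw2, h3, ← mul_sub, ← integral_sub hi2 hi1, norm_mul]
  gcongr
  have hm := Real.integral_rpow_mul_exp_neg_mul_Ioi (a := 2 - a.re) (r := 2 / 5 * ‖z‖)
    (by linarith) (by positivity)
  rw [← hm, ← integral_const_mul]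
  refine norm_integral_le_of_norm_le ((integrableOn_rpow_mul_exp_neg_mul (b := 2 - a.re)
    (r := 2 / 5 * ‖z‖) (by linarith) (by positivity)).const_mul _) ?_
  filter_upwards [ae_restrict_mem measurableSet_Ioi] with s hs
  have hs : 0 < s := hs
  rw [← mul_sub_one, norm_mul, norm_ofReal_cpow_mul_exp hs]
  have h5 := norm_exp_neg_sub_one_le (hsq s)
  have h6 : ‖w ^ 2 * (s : ℂ) ^ 2 / 2‖ = s ^ 2 / 2 := by
    rw [norm_div, norm_mul, norm_pow, hw1, norm_pow, Complex.norm_real, Real.norm_of_nonneg hs.le]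
    simp
  rw [h6] at h5
  have h7 : s ^ (2 - a.re - 1) = s ^ (-a - 1).re * s ^ 2 := by
    rw [← Real.rpow_natCast, ← Real.rpow_add hs]
    congr 1; simp; ring
  have h8 : Real.exp (-((z * w).re * s)) ≤ Real.exp (-(2 / 5 * ‖z‖ * s)) := by
    gcongr
  calc s ^ (-a - 1).re * Real.exp (-((z * w).re * s)) *
        ‖Complex.exp (-(w ^ 2 * (s : ℂ) ^ 2 / 2)) - 1‖
      ≤ s ^ (-a - 1).re * Real.exp (-(2 / 5 * ‖z‖ * s)) * (s ^ 2 / 2) := by gcongr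
    _ = _ := by rw [h7]; ring

theorem norm_cpow_le_of_ne_zero {z : ℂ} (hz : z ≠ 0) (a : ℂ) :
    ‖z ^ a‖ ≤ ‖z‖ ^ a.re * Real.exp (Real.pi * |a.im|) := by
  rw [Complex.norm_cpow_of_ne_zero hz, div_eq_mul_inv, ← Real.exp_neg]
  gcongr
  calc -(z.arg * a.im) ≤ |z.arg * a.im| := neg_le_abs _
    _ = |z.arg| * |a.im| := abs_mul _ _
    _ ≤ _ := by gcongr; exact Complex.abs_arg_le_pi z

/-- The directions of integration used for the asymptotics. -/
theorem exists_direction {z : ℂ} (hz : z ≠ 0) (h : -‖z‖ / 8 ≤ z.re) :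
    ∃ w : ℂ, 0 < w.re ∧ 0 < (w ^ 2).re ∧ ‖w‖ = 1 ∧ 2 / 5 * ‖z‖ ≤ (z * w).re ∧
      Complex.log (z * w) = Complex.log z + Complex.log w := by
  have habs := Complex.norm_le_abs_re_add_abs_im z
  have hw1 : ∀ e : ℝ, e = 1 ∨ e = -1 → ‖(⟨4 / 5, e * (3 / 5)⟩ : ℂ)‖ = 1 := fun e he => by
    rw [Complex.norm_def, Complex.normSq_mk]
    rcases he with rfl | rfl <;> norm_num
  -- The unit vector `w = (4 ± 3i)/5` turns `z` towards the positive axis, and `Re w² = 7/25 > 0`.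
  -- If `Re z < 0`, then `Re (zw) ≥ (3/5)|z| - (7/5)|Re z| ≥ (17/40)|z|`, which exceeds `(2/5)|z|`.
  have key : ∀ e : ℝ, e = 1 ∨ e = -1 → 0 ≤ -(e * z.im) →
      2 / 5 * ‖z‖ ≤ (z * (⟨4 / 5, e * (3 / 5)⟩ : ℂ)).re := fun e he hi => by
    rw [Complex.mul_re]
    have : |z.im| = -(e * z.im) := by
      rcases he with rfl | rfl
      · rw [abs_of_nonpos (by linarith)]; ring
      · rw [abs_of_nonneg (by linarith)]; ring
    rw [this] at habs
    simp only
    rcases le_or_gt 0 z.re with h0 | h0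
    · rw [abs_of_nonneg h0] at habs; nlinarith
    · rw [abs_of_neg h0] at habs; nlinarith
  rcases le_or_gt 0 z.im with hi | hi
  · have hk := key (-1) (Or.inr rfl) (by linarith)
    refine ⟨⟨4 / 5, -1 * (3 / 5)⟩, by norm_num, by norm_num [sq], hw1 _ (Or.inr rfl), hk, ?_⟩
    refine (Complex.log_mul_eq_add_log_iff hz (fun h => by simp [Complex.ext_iff] at h)).2 ?_
    have h1 := Complex.arg_nonneg_iff.2 hi
    have h2 := Complex.arg_le_pi z
    have h3 := abs_lt.1 (Complex.abs_arg_lt_pi_div_two_iff (z := ⟨4 / 5, -1 * (3 / 5)⟩) |>.2 (Or.inl (by norm_num)))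
    have h4 : (⟨4 / 5, -1 * (3 / 5)⟩ : ℂ).arg < 0 := Complex.arg_neg_iff.2 (by norm_num)
    constructor <;> linarith [Real.pi_pos]
  · have hk := key 1 (Or.inl rfl) (by linarith)
    refine ⟨⟨4 / 5, 1 * (3 / 5)⟩, by norm_num, by norm_num [sq], hw1 _ (Or.inl rfl), hk, ?_⟩
    refine (Complex.log_mul_eq_add_log_iff hz (fun h => by simp [Complex.ext_iff] at h)).2 ?_
    have h1 := Complex.arg_neg_iff.2 hi
    have h2 := Complex.neg_pi_lt_arg z
    have h3 := abs_lt.1 (Complex.abs_arg_lt_pi_div_two_iff (z := ⟨4 / 5, 1 * (3 / 5)⟩) |>.2 (Or.inl (by norm_num)))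
    have h4 : 0 ≤ (⟨4 / 5, 1 * (3 / 5)⟩ : ℂ).arg := Complex.arg_nonneg_iff.2 (by norm_num)
    constructor <;> linarith [Real.pi_pos]

/-- `D_a(z)` divided by its leading asymptotics. -/
noncomputable def pcRatio (a z : ℂ) : ℂ :=
  Complex.exp (z ^ 2 / 4) * parabolicCylinderD a z * z ^ (-a)

/-- The powers `|z|^{Re a - 2}` from the error and `|z|^{-Re a}` from the normalization leave
`|z|^{-2}`. The constant is written out because its continuity in `a` gives uniformity on compact
sets. -/
theorem norm_pcRatio_sub_one_le {a z : ℂ} (ha : a.re < 0) (hai : ∀ n : ℤ, a ≠ n) (hz : z ≠ 0)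
    (h : -‖z‖ / 8 ≤ z.re) :
    ‖pcRatio a z - 1‖ ≤ (Real.exp (Real.pi * |a.im|) ^ 2 * (1 / 2) * (5 / 2) ^ (2 - a.re) *
      Real.Gamma (2 - a.re) * ‖(Complex.Gamma (-a))⁻¹‖) / ‖z‖ ^ 2 := by
  obtain ⟨w, hw, hw2, hw1, hzw, hlog⟩ := exists_direction hz h
  have hw0 : w ≠ 0 := by rintro rfl; simp at hw
  have hz0 : 0 < ‖z‖ := norm_pos_iff.2 hz
  have h1 := norm_pcSeries_sub_le ha hw hw2 hw1 hz hzw hlog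
  have g0 := Gamma_neg_ne_zero hai
  have h2 : pcRatio a z - 1 =
      (pcSeries a z - z ^ a * Complex.Gamma (-a)) * z ^ (-a) * (Complex.Gamma (-a))⁻¹ := by
    have e1 : Complex.exp (z ^ 2 / 4) * Complex.exp (-z ^ 2 / 4) = 1 := by
      rw [← Complex.exp_add]; ring_nf; simp
    have e2 : z ^ a * z ^ (-a) = 1 := by rw [← Complex.cpow_add _ _ hz]; simp
    have e3 : Complex.Gamma (-a) * (Complex.Gamma (-a))⁻¹ = 1 := mul_inv_cancel₀ g0
    rw [pcRatio, parabolicCylinderD_eq hai]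
    linear_combination (pcSeries a z / Complex.Gamma (-a) * z ^ (-a)) * e1 +
      (Complex.Gamma (-a) * (Complex.Gamma (-a))⁻¹) * e2 + e3
  have h3 := norm_cpow_le_of_ne_zero hz (-a)
  have h4 := norm_cpow_le_of_ne_zero hw0 (-a)
  rw [hw1, Real.one_rpow, one_mul] at h4
  simp only [Complex.neg_re, Complex.neg_im, abs_neg] at h3 h4
  rw [h2, norm_mul, norm_mul]
  have hG : 0 < Real.Gamma (2 - a.re) := Real.Gamma_pos_of_pos (by linarith)
  calc _ ≤ Real.exp (Real.pi * |a.im|) *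
        (1 / 2 * ((1 / (2 / 5 * ‖z‖)) ^ (2 - a.re) * Real.Gamma (2 - a.re))) *
        (‖z‖ ^ (-a.re) * Real.exp (Real.pi * |a.im|)) * ‖(Complex.Gamma (-a))⁻¹‖ := by
        gcongr
        exact h1.trans (by gcongr)
    _ = _ := by
      have : (1 / (2 / 5 * ‖z‖)) ^ (2 - a.re) * ‖z‖ ^ (-a.re) = (5 / 2) ^ (2 - a.re) / ‖z‖ ^ 2 := by
        rw [show 1 / (2 / 5 * ‖z‖) = (5 / 2) / ‖z‖ by field_simp, Real.div_rpow (by norm_num) hz0.le,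
          sub_eq_add_neg 2 a.re, Real.rpow_add hz0]
        have : ‖z‖ ^ (-a.re) ≠ 0 := (Real.rpow_pos_of_pos hz0 _).ne'
        norm_num
        field_simp
      calc _ = Real.exp (Real.pi * |a.im|) ^ 2 * (1 / 2) * Real.Gamma (2 - a.re) *
          ‖(Complex.Gamma (-a))⁻¹‖ * ((1 / (2 / 5 * ‖z‖)) ^ (2 - a.re) * ‖z‖ ^ (-a.re)) := by ring
        _ = _ := by rw [this]; ring

theorem pcRatio_add_one {a z : ℂ} (ha : ∀ n : ℤ, a ≠ n) (hz : z ≠ 0) :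
    pcRatio a z = pcRatio (a - 1) z - (a - 1) * (z ^ 2)⁻¹ * pcRatio (a - 2) z := by
  have h := parabolicCylinderD_add_one (ne_int_sub_one ha) z
  rw [sub_add_cancel, show a - 1 - 1 = a - 2 by ring] at h
  have e1 : z ^ (-(a - 1)) = z * z ^ (-a) := by
    rw [show -(a - 1) = 1 + -a by ring, Complex.cpow_add _ _ hz, Complex.cpow_one]
  have e2 : z ^ (-(a - 2)) = z ^ 2 * z ^ (-a) := by
    rw [show -(a - 2) = (2 : ℕ) + -a by push_cast; ring, Complex.cpow_add _ _ hz,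
      Complex.cpow_natCast]
  rw [pcRatio, pcRatio, pcRatio, h, e1, e2]
  field_simp

/-- The asymptotics of `D_a(z)`, uniformly for `a` in compact sets. -/
theorem exists_norm_pcRatio_sub_one_le {K : Set ℂ} (hK : IsCompact K)
    (hKi : ∀ a ∈ K, ∀ n : ℤ, a ≠ n) :
    ∃ C : ℝ, 0 ≤ C ∧ ∀ a ∈ K, ∀ z : ℂ, 1 ≤ ‖z‖ → -‖z‖ / 8 ≤ z.re →
      ‖pcRatio a z - 1‖ ≤ C / ‖z‖ ^ 2 := by
  -- Induction on an upper bound for `Re a`. The base case is the Laplace integral, and the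
  -- recurrence expresses the order `a` by the orders `a - 1` and `a - 2`, so the compact set is
  -- translated along.
  suffices H : ∀ N : ℕ, ∀ K : Set ℂ, IsCompact K → (∀ a ∈ K, ∀ n : ℤ, a ≠ n) →
      (∀ a ∈ K, a.re < N) → ∃ C : ℝ, 0 ≤ C ∧ ∀ a ∈ K, ∀ z : ℂ, 1 ≤ ‖z‖ → -‖z‖ / 8 ≤ z.re →
        ‖pcRatio a z - 1‖ ≤ C / ‖z‖ ^ 2 by
    obtain ⟨M, hM⟩ := hK.exists_bound_of_continuousOn (f := fun a : ℂ => a.re)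
      Complex.continuous_re.continuousOn
    obtain ⟨N, hN⟩ := exists_nat_gt M
    exact H N K hK hKi fun a ha => ((le_abs_self _).trans (hM a ha)).trans_lt hN
  intro N
  induction N with
  | zero =>
    intro K hK hKi hre
    simp only [Nat.cast_zero] at hre
    obtain ⟨C, hC⟩ := hK.exists_bound_of_continuousOn (f := fun a : ℂ =>
      (Real.exp (Real.pi * |a.im|) ^ 2 * (1 / 2) * (5 / 2) ^ (2 - a.re) *
      Real.Gamma (2 - a.re) * ‖(Complex.Gamma (-a))⁻¹‖)) (by
        intro a ha
        have h1 : ContinuousAt (fun a : ℂ => Real.Gamma (2 - a.re)) a := by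
          refine ContinuousAt.comp (g := Real.Gamma) (f := fun a : ℂ => 2 - a.re) ?_ (by fun_prop)
          refine (Real.differentiableAt_Gamma fun m h => ?_).continuousAt
          have := hre a ha
          have : (0 : ℝ) ≤ m := m.cast_nonneg
          linarith
        have h2 : ContinuousAt (fun a : ℂ => (Complex.Gamma (-a))⁻¹) a :=
          (Complex.differentiable_one_div_Gamma.continuous.comp continuous_neg).continuousAt
        have h3 : ContinuousAt (fun a : ℂ => (5 / 2 : ℝ) ^ (2 - a.re)) a :=
          ContinuousAt.rpow continuousAt_const (by fun_prop) (Or.inl (by norm_num))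
        exact (((by fun_prop : ContinuousAt (fun a : ℂ => Real.exp (Real.pi * |a.im|) ^ 2 *
          (1 / 2)) a).mul h3).mul h1 |>.mul h2.norm).continuousWithinAt)
    refine ⟨|C|, abs_nonneg _, fun a ha z hz h => ?_⟩
    refine (norm_pcRatio_sub_one_le (hre a ha) (hKi a ha) (norm_pos_iff.1 (by linarith)) h).trans ?_
    gcongr
    exact (le_abs_self _).trans ((hC a ha).trans (le_abs_self _))
  | succ N ih =>
    intro K hK hKi hre
    obtain ⟨C₁, h1, hC₁⟩ := ih ((fun a => a - 1) '' K) (hK.image (by fun_prop))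
      (by rintro _ ⟨a, ha, rfl⟩; exact ne_int_sub_one (hKi a ha))
      (by rintro _ ⟨a, ha, rfl⟩; have := hre a ha; push_cast at this; simp; linarith)
    obtain ⟨C₂, h2, hC₂⟩ := ih ((fun a => a - 2) '' K) (hK.image (by fun_prop))
      (by rintro _ ⟨a, ha, rfl⟩; exact fun n hn => hKi a ha (n + 2) (by
            push_cast; linear_combination hn))
      (by rintro _ ⟨a, ha, rfl⟩; have := hre a ha; push_cast at this; simp; linarith)
    obtain ⟨M, hM⟩ := hK.exists_bound_of_continuousOn (f := fun a : ℂ => a - 1) (by fun_prop)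
    refine ⟨C₁ + |M| * (C₂ + 1), by positivity, fun a ha z hz h => ?_⟩
    have hz0 : 0 < ‖z‖ := by linarith
    have b1 := hC₁ _ ⟨a, ha, rfl⟩ z hz h
    have b2 := hC₂ _ ⟨a, ha, rfl⟩ z hz h
    have b3 : ‖pcRatio (a - 2) z‖ ≤ C₂ + 1 := by
      calc _ = ‖(pcRatio (a - 2) z - 1) + 1‖ := by rw [sub_add_cancel]
        _ ≤ ‖pcRatio (a - 2) z - 1‖ + ‖(1 : ℂ)‖ := norm_add_le _ _
        _ ≤ C₂ / ‖z‖ ^ 2 + 1 := by rw [norm_one]; gcongr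
        _ ≤ _ := by gcongr; exact div_le_self h2 (one_le_pow₀ hz)
    rw [pcRatio_add_one (hKi a ha) (norm_pos_iff.1 hz0)]
    calc _ = ‖(pcRatio (a - 1) z - 1) - (a - 1) * (z ^ 2)⁻¹ * pcRatio (a - 2) z‖ := by
          congr 1; ring
      _ ≤ ‖pcRatio (a - 1) z - 1‖ + ‖(a - 1) * (z ^ 2)⁻¹ * pcRatio (a - 2) z‖ := norm_sub_le _ _
      _ ≤ C₁ / ‖z‖ ^ 2 + |M| * (‖z‖ ^ 2)⁻¹ * (C₂ + 1) := by
        rw [norm_mul, norm_mul, norm_inv, norm_pow]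
        gcongr
        exact (hM a ha).trans (le_abs_self _)
      _ = _ := by ring

/-- Parabolic cylinder functions are bounded on compact sets of parameters and arguments. -/
theorem exists_norm_parabolicCylinderD_le {K : Set ℂ} (hK : IsCompact K)
    (hKi : ∀ a ∈ K, ∀ n : ℤ, a ≠ n) (R : ℝ) :
    ∃ C : ℝ, ∀ a ∈ K, ∀ z : ℂ, ‖z‖ ≤ R → ‖parabolicCylinderD a z‖ ≤ C := by
  suffices H : ∀ N : ℕ, ∀ K : Set ℂ, IsCompact K → (∀ a ∈ K, ∀ n : ℤ, a ≠ n) →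
      (∀ a ∈ K, a.re < N) → ∃ C : ℝ, ∀ a ∈ K, ∀ z : ℂ, ‖z‖ ≤ R → ‖parabolicCylinderD a z‖ ≤ C by
    obtain ⟨M, hM⟩ := hK.exists_bound_of_continuousOn (f := fun a : ℂ => a.re)
      Complex.continuous_re.continuousOn
    obtain ⟨N, hN⟩ := exists_nat_gt M
    exact H N K hK hKi fun a ha => ((le_abs_self _).trans (hM a ha)).trans_lt hN
  intro N
  induction N with
  | zero =>
    intro K hK hKi hre
    simp only [Nat.cast_zero] at hre
    rcases K.eq_empty_or_nonempty with rfl | hne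
    · exact ⟨0, by simp⟩
    obtain ⟨a₀, ha₀, hmax⟩ := hK.exists_isMaxOn hne (f := fun a : ℂ => a.re)
      Complex.continuous_re.continuousOn
    obtain ⟨a₁, ha₁, hmin⟩ := hK.exists_isMinOn hne (f := fun a : ℂ => a.re)
      Complex.continuous_re.continuousOn
    obtain ⟨G, hG⟩ := hK.exists_bound_of_continuousOn (f := fun a : ℂ => (Complex.Gamma (-a))⁻¹)
      (Complex.differentiable_one_div_Gamma.continuous.comp continuous_neg).continuousOn
    have i0 := integrableOn_rpow_mul_exp_linear_sub_sq (p := -a₀.re) (c := 1) R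
      (by linarith [hre a₀ ha₀]) one_pos
    have i1 := integrableOn_rpow_mul_exp_linear_sub_sq (p := -a₁.re) (c := 1) R
      (by linarith [hre a₁ ha₁]) one_pos
    refine ⟨Real.exp (R ^ 2 / 4) * ((∫ s in Ioi (0 : ℝ),
      (s ^ (-a₀.re - 1) * Real.exp (R * s - 1 * s ^ 2 / 2) +
        s ^ (-a₁.re - 1) * Real.exp (R * s - 1 * s ^ 2 / 2))) * G), fun a ha z hz => ?_⟩

    rw [parabolicCylinderD_eq (hKi a ha), norm_mul, div_eq_mul_inv (pcSeries a z), norm_mul]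
    have hS : ‖pcSeries a z‖ ≤ _ := norm_pcSeries_le (hre a ha)
    have hi : (∫ s in Ioi (0 : ℝ), s ^ (-a.re - 1) * Real.exp (‖z‖ * s - 1 * s ^ 2 / 2)) ≤
        ∫ s in Ioi (0 : ℝ), (s ^ (-a₀.re - 1) * Real.exp (R * s - 1 * s ^ 2 / 2) +
        s ^ (-a₁.re - 1) * Real.exp (R * s - 1 * s ^ 2 / 2)) := by
      refine setIntegral_mono_on (integrableOn_rpow_mul_exp_linear_sub_sq ‖z‖
        (by linarith [hre a ha]) one_pos) (i0.add i1) measurableSet_Ioi fun s hs => ?_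
      have hs : 0 < s := hs
      rw [← add_mul]
      have h0 : a.re ≤ a₀.re := hmax ha
      have h1 : a₁.re ≤ a.re := hmin ha
      gcongr ?_ * ?_
      -- For `s ≤ 1` the power belonging to the largest real part dominates, for `s ≥ 1` the one
      -- belonging to the smallest. Their sum is an integrable majorant for all orders in `K` at
      -- once.
      · rcases le_total s 1 with h | h
        · have := Real.rpow_le_rpow_of_exponent_ge hs h (by linarith : -a₀.re - 1 ≤ -a.re - 1)
          have := Real.rpow_nonneg hs.le (-a₁.re - 1)
          linarith
        · have := Real.rpow_le_rpow_of_exponent_le h (by linarith : -a.re - 1 ≤ -a₁.re - 1)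
          have := Real.rpow_nonneg hs.le (-a₀.re - 1)
          linarith
      · gcongr
    have hI0 : 0 ≤ ‖pcSeries a z‖ := norm_nonneg _
    gcongr
    · rw [Complex.norm_exp]
      gcongr
      refine (Complex.re_le_norm _).trans ?_
      rw [norm_div, norm_neg, norm_pow]
      norm_num
      gcongr
    · exact (norm_nonneg _).trans (hS.trans hi)
    · exact hS.trans hi
    · exact hG a ha
  | succ N ih =>
    intro K hK hKi hre
    obtain ⟨C₁, hC₁⟩ := ih ((fun a => a - 1) '' K) (hK.image (by fun_prop))
      (by rintro _ ⟨a, ha, rfl⟩; exact ne_int_sub_one (hKi a ha))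
      (by rintro _ ⟨a, ha, rfl⟩; have := hre a ha; push_cast at this; simp; linarith)
    obtain ⟨C₂, hC₂⟩ := ih ((fun a => a - 2) '' K) (hK.image (by fun_prop))
      (by rintro _ ⟨a, ha, rfl⟩; exact fun n hn => hKi a ha (n + 2) (by
            push_cast; linear_combination hn))
      (by rintro _ ⟨a, ha, rfl⟩; have := hre a ha; push_cast at this; simp; linarith)
    obtain ⟨M, hM⟩ := hK.exists_bound_of_continuousOn (f := fun a : ℂ => a - 1) (by fun_prop)
    refine ⟨R * C₁ + M * C₂, fun a ha z hz => ?_⟩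
    have h := parabolicCylinderD_add_one (ne_int_sub_one (hKi a ha)) z
    rw [sub_add_cancel, show a - 1 - 1 = a - 2 by ring] at h
    rw [h]
    refine (norm_sub_le _ _).trans ?_
    rw [norm_mul, norm_mul]
    have b1 := hC₁ _ ⟨a, ha, rfl⟩ z hz
    have b2 := hC₂ _ ⟨a, ha, rfl⟩ z hz
    have b3 := hM a ha
    have := (norm_nonneg z).trans hz
    have := (norm_nonneg (a - 1)).trans b3
    gcongr


/-! ### Asymptotics with a bounded shift of the argument. -/

/-- `D_a(√2 (w + l))`, normalized to tend to `1` as `l → ∞` in the right half plane. -/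
noncomputable def pcNormalized (a w l : ℂ) : ℂ :=
  Complex.exp ((w + l) ^ 2 / 2) * parabolicCylinderD a ((Real.sqrt 2 : ℂ) * (w + l)) *
    2 ^ (-a / 2) * l ^ (-a)

/-- Second-order Taylor bounds for the logarithm and for the exponential, composed. The smallness of
`u` ensures `|a log(1+u)| ≤ 1`. The linear term `au` becomes the coefficient of `1/λ`. -/
theorem norm_exp_mul_log_one_add_sub_le {a u : ℂ} {M : ℝ} (ha : ‖a‖ ≤ M)
    (hu : ‖u‖ * (M + 1) ≤ 1 / 4) :
    ‖Complex.exp (a * Complex.log (1 + u)) - 1 - a * u‖ ≤ (9 / 4 * M ^ 2 + M) * ‖u‖ ^ 2 := by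
  have hM : 0 ≤ M := (norm_nonneg a).trans ha
  have hu0 := norm_nonneg u
  have hu2 : ‖u‖ ≤ 1 / 4 := by nlinarith
  have h1 := Complex.norm_log_one_add_sub_self_le (z := u) (by linarith)
  have h2 : ‖Complex.log (1 + u) - u‖ ≤ ‖u‖ ^ 2 := by
    refine h1.trans ?_
    have : (1 - ‖u‖)⁻¹ ≤ 2 := by
      rw [inv_le_comm₀ (by linarith) two_pos]; linarith
    nlinarith [sq_nonneg ‖u‖]
  have h3 := Complex.norm_log_one_add_half_le_self (z := u) (by linarith)
  set x := a * Complex.log (1 + u)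
  have hx : ‖x‖ ≤ M * (3 / 2 * ‖u‖) := by
    rw [norm_mul]; gcongr
  have hx1 : ‖x‖ ≤ 1 := by nlinarith
  have h4 := Complex.norm_exp_sub_one_sub_id_le hx1
  have h5 : ‖x - a * u‖ ≤ M * ‖u‖ ^ 2 := by
    rw [← mul_sub, norm_mul]; gcongr
  calc _ = ‖(Complex.exp x - 1 - x) + (x - a * u)‖ := by congr 1; ring
    _ ≤ ‖Complex.exp x - 1 - x‖ + ‖x - a * u‖ := norm_add_le _ _
    _ ≤ (M * (3 / 2 * ‖u‖)) ^ 2 + M * ‖u‖ ^ 2 := by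
      gcongr
      exact h4.trans (by gcongr)
    _ = _ := by ring

/-- The argument of `l` is at most `π/2` in modulus and that of `1 + w/l` is smaller than `π/2`, so
the principal logarithm is additive on `w + l = l(1 + w/l)`. -/
theorem pcNormalized_eq {a w l : ℂ} (hl : l ≠ 0) (hre : 0 ≤ l.re) (hw : ‖w / l‖ ≤ 1 / 4) :
    pcNormalized a w l = pcRatio a ((Real.sqrt 2 : ℂ) * (w + l)) *
      Complex.exp (a * Complex.log (1 + w / l)) := by
  set u := w / l
  have hu : 0 < (1 + u).re := by
    have := (abs_le.1 (Complex.abs_re_le_norm u)).1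
    simp; linarith
  have hu0 : 1 + u ≠ 0 := by intro h; simp [h] at hu
  have e1 : w + l = l * (1 + u) := by simp only [u]; field_simp; ring
  have h2 : (0 : ℝ) < Real.sqrt 2 := by positivity
  have hlog : Complex.log ((Real.sqrt 2 : ℂ) * (w + l)) =
      (Real.log (Real.sqrt 2) : ℂ) + (Complex.log l + Complex.log (1 + u)) := by
    rw [Complex.log_ofReal_mul h2 (by rw [e1]; exact mul_ne_zero hl hu0), e1,
      (Complex.log_mul_eq_add_log_iff hl hu0).2]
    have a1 := abs_le.1 (Complex.abs_arg_le_pi_div_two_iff.2 hre)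
    have a2 := abs_lt.1 (Complex.abs_arg_lt_pi_div_two_iff.2 (Or.inl hu))
    constructor <;> linarith
  have h0 : (Real.sqrt 2 : ℂ) * (w + l) ≠ 0 :=
    mul_ne_zero (Complex.ofReal_ne_zero.2 h2.ne') (by rw [e1]; exact mul_ne_zero hl hu0)
  have e2 : ((Real.sqrt 2 : ℂ) * (w + l)) ^ 2 / 4 = (w + l) ^ 2 / 2 := by
    rw [mul_pow, sqrt_two_sq_complex]; ring
  have e3 : (2 : ℂ) ^ (-a / 2) * l ^ (-a) = ((Real.sqrt 2 : ℂ) * (w + l)) ^ (-a) *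
      Complex.exp (a * Complex.log (1 + u)) := by
    rw [Complex.cpow_def_of_ne_zero two_ne_zero, Complex.cpow_def_of_ne_zero hl,
      Complex.cpow_def_of_ne_zero h0, hlog, ← Complex.exp_add, ← Complex.exp_add,
      Real.log_sqrt two_pos.le]
    have hlog2 : ((Real.log 2 : ℝ) : ℂ) = Complex.log 2 := by
      rw [Complex.ofReal_log two_pos.le, Complex.ofReal_ofNat]
    congr 1
    push_cast
    rw [hlog2]
    ring
  rw [pcNormalized, pcRatio, e2, mul_assoc _ (2 ^ (-a / 2)), e3]
  ring

/-- The asymptotics of `pcNormalized`, uniform in all parameters. -/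
theorem exists_norm_pcNormalized_sub_le {K : Set ℂ} (hK : IsCompact K)
    (hKi : ∀ a ∈ K, ∀ n : ℤ, a ≠ n) (Y : ℝ) :
    ∃ C : ℝ, 0 ≤ C ∧ ∀ a ∈ K, ∀ w l : ℂ, ‖w‖ ≤ Y → 1 ≤ ‖l‖ → 0 ≤ l.re →
      ‖pcNormalized a w l - (1 + a * w / l)‖ ≤ C / ‖l‖ ^ 2 := by
  obtain ⟨C₁, hC₁0, hC₁⟩ := exists_norm_pcRatio_sub_one_le hK hKi
  obtain ⟨M', hM'⟩ := hK.exists_bound_of_continuousOn (f := fun a : ℂ => a) (by fun_prop)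
  obtain ⟨M, hM0, hM⟩ : ∃ M : ℝ, 0 ≤ M ∧ ∀ a ∈ K, ‖a‖ ≤ M :=
    ⟨|M'|, abs_nonneg _, fun a ha => (hM' a ha).trans (le_abs_self _)⟩
  rcases lt_or_ge Y 0 with hY | hY
  · exact ⟨0, le_rfl, fun a _ w l hw => absurd (hw.trans_lt hY) (norm_nonneg w).not_gt⟩
  -- For `|l| ≥ 9(Y+1)` and `|w| ≤ Y` one has `|w + l| ≥ 8|w|`, hence `Re (w + l) ≥ -|w + l|/8` and
  -- the asymptotics of `pcRatio` apply. On `1 ≤ |l| ≤ R₀` a crude bound suffices, because `1/|l|²`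
  -- is bounded below there.
  set R₀ : ℝ := 9 * (M + 1) * (Y + 1)
  have hR₀ : 1 ≤ R₀ := by simp only [R₀]; nlinarith [mul_nonneg hM0 hY]
  obtain ⟨C₂, hC₂⟩ := exists_norm_parabolicCylinderD_le hK hKi (Real.sqrt 2 * (Y + R₀))
  set B : ℝ := Real.exp ((Y + R₀) ^ 2 / 2) * |C₂| * 2 ^ (M / 2) * (R₀ ^ M * Real.exp (Real.pi * M))
  refine ⟨((9 / 4 * M ^ 2 + M) * Y ^ 2 + 2 * C₁ * Real.exp 1) + (B + (1 + M * Y)) * R₀ ^ 2,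
    by positivity, fun a ha w l hw hl hre => ?_⟩
  have hl0 : 0 < ‖l‖ := by linarith
  have hl0' : l ≠ 0 := norm_pos_iff.1 hl0
  rcases le_total R₀ ‖l‖ with h | h
  · have hwl : ‖w / l‖ * (M + 1) ≤ 1 / 4 := by
      rw [norm_div, div_mul_eq_mul_div, div_le_iff₀ hl0]
      simp only [R₀] at h
      nlinarith [mul_le_mul_of_nonneg_right hw (by linarith : (0 : ℝ) ≤ M + 1)]
    have hwl2 : ‖w / l‖ ≤ 1 / 4 := by nlinarith [norm_nonneg (w / l)]
    have hw2 : ‖w‖ ≤ ‖l‖ / 4 := by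
      rw [norm_div, div_le_iff₀ hl0] at hwl2; linarith
    rw [pcNormalized_eq hl0' hre hwl2]
    set z := (Real.sqrt 2 : ℂ) * (w + l) with hz
    have hs2 : (1 : ℝ) ≤ Real.sqrt 2 := Real.one_le_sqrt.2 one_le_two
    have hzn : ‖z‖ = Real.sqrt 2 * ‖w + l‖ := by
      rw [hz, norm_mul, Complex.norm_real, Real.norm_of_nonneg (by positivity)]
    have hwl3 : ‖l‖ - ‖w‖ ≤ ‖w + l‖ := by
      have := norm_sub_norm_le l (-w)
      rwa [norm_neg, sub_neg_eq_add, add_comm l w] at this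
    have hR9 : 9 * (Y + 1) ≤ ‖l‖ := by
      simp only [R₀] at h; nlinarith
    have hz1 : 1 ≤ ‖z‖ := by rw [hzn]; nlinarith
    have hzre : -‖z‖ / 8 ≤ z.re := by
      rw [hzn, hz, Complex.re_ofReal_mul]
      have h1 := (abs_le.1 (Complex.abs_re_le_norm w)).1
      have : -‖w + l‖ / 8 ≤ (w + l).re := by
        rw [Complex.add_re]; linarith
      nlinarith
    have h1 := hC₁ a ha z hz1 hzre
    have hzl : ‖l‖ ^ 2 / 2 ≤ ‖z‖ ^ 2 := by
      rw [hzn, mul_pow, Real.sq_sqrt two_pos.le]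
      nlinarith
    have h2 := norm_exp_mul_log_one_add_sub_le (hM a ha) hwl
    set p := Complex.exp (a * Complex.log (1 + w / l))
    have h3 : ‖p‖ ≤ Real.exp 1 := by
      rw [Complex.norm_exp]
      gcongr
      refine (Complex.re_le_norm _).trans ?_
      have := Complex.norm_log_one_add_half_le_self (z := w / l) (by linarith)
      rw [norm_mul]
      nlinarith [hM a ha, norm_nonneg (w / l), norm_nonneg a, norm_nonneg (Complex.log (1 + w / l))]
    have h4 : ‖w / l‖ ^ 2 ≤ Y ^ 2 / ‖l‖ ^ 2 := by
      rw [norm_div, div_pow]; gcongr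
    calc ‖pcRatio a z * p - (1 + a * w / l)‖
        = ‖(p - 1 - a * (w / l)) + (pcRatio a z - 1) * p‖ := by congr 1; ring
      _ ≤ ‖p - 1 - a * (w / l)‖ + ‖pcRatio a z - 1‖ * ‖p‖ := by
          refine (norm_add_le _ _).trans ?_; rw [norm_mul]
      _ ≤ (9 / 4 * M ^ 2 + M) * (Y ^ 2 / ‖l‖ ^ 2) + (C₁ / (‖l‖ ^ 2 / 2)) * Real.exp 1 := by
          gcongr
          · exact h2.trans (by gcongr)
          · exact h1.trans (by gcongr)
      _ = ((9 / 4 * M ^ 2 + M) * Y ^ 2 + 2 * C₁ * Real.exp 1) / ‖l‖ ^ 2 := by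
          field_simp
      _ ≤ _ := by
          have : 0 ≤ (B + (1 + M * Y)) * R₀ ^ 2 := by positivity
          exact div_le_div_of_nonneg_right (le_add_of_nonneg_right this) (by positivity)
  · have hE : ‖pcNormalized a w l‖ ≤ B := by
      have b1 : ‖Complex.exp ((w + l) ^ 2 / 2)‖ ≤ Real.exp ((Y + R₀) ^ 2 / 2) := by
        rw [Complex.norm_exp]
        gcongr
        refine (Complex.re_le_norm _).trans ?_
        rw [norm_div, norm_pow, Complex.norm_ofNat]
        gcongr
        exact (norm_add_le _ _).trans (by gcongr)
      have b2 : ‖parabolicCylinderD a ((Real.sqrt 2 : ℂ) * (w + l))‖ ≤ |C₂| := by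
        refine (hC₂ a ha _ ?_).trans (le_abs_self _)
        rw [norm_mul, Complex.norm_real, Real.norm_of_nonneg (by positivity)]
        gcongr
        exact (norm_add_le _ _).trans (by gcongr)
      have hare := abs_le.1 ((Complex.abs_re_le_norm a).trans (hM a ha))
      have haim := ((Complex.abs_im_le_norm a).trans (hM a ha))
      have b3 : ‖(2 : ℂ) ^ (-a / 2)‖ ≤ 2 ^ (M / 2) := by
        rw [← Complex.ofReal_ofNat, Complex.norm_cpow_eq_rpow_re_of_pos two_pos]
        refine Real.rpow_le_rpow_of_exponent_le one_le_two ?_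
        have : (-a / 2).re = -a.re / 2 := by simp
        rw [Complex.ofReal_ofNat, this]; linarith
      have b4 : ‖l ^ (-a)‖ ≤ R₀ ^ M * Real.exp (Real.pi * M) := by
        refine (norm_cpow_le_of_ne_zero hl0' _).trans ?_
        rw [Complex.neg_im, abs_neg, Complex.neg_re]
        gcongr
        · calc ‖l‖ ^ (-a.re) ≤ ‖l‖ ^ M := Real.rpow_le_rpow_of_exponent_le hl (by linarith)
            _ ≤ _ := by gcongr
      rw [pcNormalized, norm_mul, norm_mul, norm_mul]
      simp only [B]
      gcongr
    have h1 : ‖1 + a * w / l‖ ≤ 1 + M * Y := by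
      refine (norm_add_le _ _).trans ?_
      rw [norm_one, norm_div, norm_mul]
      gcongr
      refine (div_le_self (by positivity) hl).trans ?_
      gcongr
      exact hM a ha
    calc _ ≤ B + (1 + M * Y) := (norm_sub_le _ _).trans (add_le_add hE h1)
      _ ≤ (B + (1 + M * Y)) * R₀ ^ 2 / ‖l‖ ^ 2 := by
        rw [le_div_iff₀ (by positivity)]
        gcongr
      _ ≤ _ := by
        have : 0 ≤ (9 / 4 * M ^ 2 + M) * Y ^ 2 + 2 * C₁ * Real.exp 1 := by positivity
        exact div_le_div_of_nonneg_right (le_add_of_nonneg_left this) (by positivity)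

theorem differentiable_parabolicCylinderD {a : ℂ} (ha : ∀ n : ℤ, a ≠ n) :
    Differentiable ℂ (parabolicCylinderD a) := fun z =>
  (hasDerivAt_parabolicCylinderD ha z).differentiableAt

theorem differentiableAt_pcNormalized {a w l : ℂ} (ha : ∀ n : ℤ, a ≠ n) (hl : 0 < l.re) :
    DifferentiableAt ℂ (pcNormalized a w) l := by
  have h1 : DifferentiableAt ℂ (fun l : ℂ => l ^ (-a)) l :=
    differentiableAt_id.cpow_const (Or.inl hl)
  have h2 : DifferentiableAt ℂ
      (fun l : ℂ => parabolicCylinderD a ((Real.sqrt 2 : ℂ) * (w + l))) l :=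
    (differentiable_parabolicCylinderD ha).differentiableAt.comp l (by fun_prop)
  exact (((by fun_prop : DifferentiableAt ℂ (fun l : ℂ => Complex.exp ((w + l) ^ 2 / 2)) l).mul
    h2).mul_const _).mul h1


/-! ### The branch of the logarithm -/

theorem exp_logC {l : ℂ} (hl : l ≠ 0) : Complex.exp (logC l) = l := by
  rw [logC, Complex.exp_add, Complex.exp_log (mul_ne_zero hl (Complex.exp_ne_zero _)), mul_assoc,
    ← Complex.exp_add]
  simp

theorem logC_im_mem (l : ℂ) : (logC l).im ∈ Ioc (-(3 * Real.pi / 4)) (5 * Real.pi / 4) := by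
  have h : (logC l).im =
      (Complex.log (l * Complex.exp (-(Real.pi / 4 * Complex.I)))).im + Real.pi / 4 := by
    have : (Real.pi / 4 * Complex.I : ℂ) = ((Real.pi / 4 : ℝ) : ℂ) * Complex.I := by push_cast; rfl
    rw [logC, Complex.add_im, this]
    simp
  rw [h]
  have h1 := Complex.neg_pi_lt_log_im (l * Complex.exp (-(Real.pi / 4 * Complex.I)))
  have h2 := Complex.log_im_le_pi (l * Complex.exp (-(Real.pi / 4 * Complex.I)))
  constructor <;> linarith

theorem re_eq_exp_mul_cos_logC {l : ℂ} (hl : l ≠ 0) :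
    l.re = Real.exp (logC l).re * Real.cos (logC l).im := by
  conv_lhs => rw [← exp_logC hl, Complex.exp_re]

theorem im_eq_exp_mul_sin_logC {l : ℂ} (hl : l ≠ 0) :
    l.im = Real.exp (logC l).re * Real.sin (logC l).im := by
  conv_lhs => rw [← exp_logC hl, Complex.exp_im]

/-- Translates between the branch of the Riemann–Hilbert problem and the principal powers in
`pcNormalized`: rotation by `τ` adds `τ` to the argument as long as the result stays in `(-π, π]`.
-/
theorem log_exp_mul_eq {l : ℂ} (hl : l ≠ 0) {τ : ℝ} (h1 : -Real.pi < (logC l).im + τ)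
    (h2 : (logC l).im + τ ≤ Real.pi) :
    Complex.log (Complex.exp (τ * Complex.I) * l) = logC l + τ * Complex.I := by
  rw [← Complex.log_exp (x := logC l + τ * Complex.I) (by simpa using h1) (by simpa using h2),
    Complex.exp_add, exp_logC hl, mul_comm]

theorem logC_im_pos_of_im_pos {l : ℂ} (h : 0 < l.im) :
    0 < (logC l).im ∧ (logC l).im < Real.pi := by
  have hl : l ≠ 0 := by rintro rfl; simp at h
  have hm := logC_im_mem l
  rw [im_eq_exp_mul_sin_logC hl] at h
  have hs : 0 < Real.sin (logC l).im := (mul_pos_iff_of_pos_left (Real.exp_pos _)).1 h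
  have hpi := Real.pi_pos
  constructor
  · by_contra! hc
    exact hs.not_ge (Real.sin_nonpos_of_nonpos_of_neg_pi_le hc (by linarith [hm.1]))
  · by_contra! hc
    have := Real.sin_nonneg_of_nonneg_of_le_pi (x := (logC l).im - Real.pi) (by linarith)
      (by linarith [hm.2])
    rw [Real.sin_sub_pi] at this
    linarith

/-- The cut runs through the open third quadrant, so points with negative imaginary part have
arguments below `0` or above `π`, and only a disjunction is available. -/
theorem logC_im_of_im_neg {l : ℂ} (h : l.im < 0) :
    (logC l).im < 0 ∨ Real.pi < (logC l).im := by
  have hl : l ≠ 0 := by rintro rfl; simp at h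
  rw [im_eq_exp_mul_sin_logC hl] at h
  by_contra! hc
  have := Real.sin_nonneg_of_nonneg_of_le_pi hc.1 hc.2
  have := mul_nonneg (Real.exp_pos (logC l).re).le this
  linarith

theorem logC_im_of_re_pos {l : ℂ} (h : 0 < l.re) :
    -(Real.pi / 2) < (logC l).im ∧ (logC l).im < Real.pi / 2 := by
  have hl : l ≠ 0 := by rintro rfl; simp at h
  have hm := logC_im_mem l
  rw [re_eq_exp_mul_cos_logC hl] at h
  have hs : 0 < Real.cos (logC l).im := (mul_pos_iff_of_pos_left (Real.exp_pos _)).1 h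
  have hpi := Real.pi_pos
  constructor
  · by_contra! hc
    have := Real.cos_nonpos_of_pi_div_two_le_of_le (x := -(logC l).im) (by linarith)
      (by linarith [hm.1])
    rw [Real.cos_neg] at this
    linarith
  · by_contra! hc
    have := Real.cos_nonpos_of_pi_div_two_le_of_le hc (by linarith [hm.2])
    linarith

theorem logC_im_of_re_neg {l : ℂ} (h : l.re < 0) :
    (logC l).im < -(Real.pi / 2) ∨ Real.pi / 2 < (logC l).im := by
  have hl : l ≠ 0 := by rintro rfl; simp at h
  rw [re_eq_exp_mul_cos_logC hl] at h
  by_contra! hc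
  have := Real.cos_nonneg_of_neg_pi_div_two_le_of_le hc.1 hc.2
  have := mul_nonneg (Real.exp_pos (logC l).re).le this
  linarith

/-! ### The columns of the solution -/

theorem ne_int_of_ne_I_mul {ν : ℂ} (hν : ∀ n : ℤ, ν ≠ Complex.I * n) (n : ℤ) :
    Complex.I * ν ≠ n := fun h => hν (-n) (by
  push_cast
  linear_combination (-Complex.I) * h + ν * Complex.I_sq)

theorem one_add_rhoSq (ν : ℂ) : 1 + rhoSq ν = Complex.exp (2 * Real.pi * ν) := by
  rw [rhoSq]; ring

theorem rhoSq_ne_zero {ν : ℂ} (hν : ∀ n : ℤ, ν ≠ Complex.I * n) : rhoSq ν ≠ 0 := by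
  rw [rhoSq, sub_ne_zero]
  intro h
  obtain ⟨n, hn⟩ := Complex.exp_eq_one_iff.1 h
  refine hν n ?_
  have : (Real.pi : ℂ) ≠ 0 := Complex.ofReal_ne_zero.2 Real.pi_ne_zero
  have h2 : (2 * Real.pi : ℂ) ≠ 0 := mul_ne_zero two_ne_zero this
  apply mul_left_cancel₀ h2
  linear_combination hn

theorem two_I_cpow (a : ℂ) : (2 * Complex.I) ^ (a + 1) =
    2 ^ (a + 1) * (Complex.I * Complex.exp (Complex.I * Real.pi * a / 2)) := by
  have h1 : Complex.log (2 * Complex.I) = Complex.log 2 + Real.pi / 2 * Complex.I := by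
    have := Complex.log_ofReal_mul (two_pos : (0 : ℝ) < 2) Complex.I_ne_zero
    rw [Complex.log_I, Complex.ofReal_log two_pos.le, Complex.ofReal_ofNat] at this
    exact this
  have h2 : Complex.I = Complex.exp (Real.pi / 2 * Complex.I) := by
    rw [Complex.exp_mul_I, Complex.cos_pi_div_two, Complex.sin_pi_div_two]; ring
  rw [Complex.cpow_def_of_ne_zero (mul_ne_zero two_ne_zero Complex.I_ne_zero), h1,
    Complex.cpow_def_of_ne_zero two_ne_zero]
  have h3 : Complex.I * Complex.exp (Complex.I * Real.pi * a / 2) =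
      Complex.exp (Real.pi / 2 * Complex.I + Complex.I * Real.pi * a / 2) := by
    rw [Complex.exp_add, ← h2]
  rw [h3, ← Complex.exp_add]
  congr 1
  ring

/-- The constant `β` is tailored to the connection formula. In the product with `q Γ(iν)` the
factors `e^{2πν} - 1` and the real exponentials cancel; what remains is visibly nonzero. -/
theorem betaY_mul {ν : ℂ} (hν : ∀ n : ℤ, ν ≠ Complex.I * n) :
    rhoSq ν / (1 + rhoSq ν) * betaY ν * Complex.Gamma (Complex.I * ν) =
      2 * (2 ^ (Complex.I * ν / 2)) ^ 2 * Complex.I * (Real.sqrt Real.pi : ℂ) := by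
  have hp := rhoSq_ne_zero hν
  have hG : Complex.Gamma (Complex.I * ν) ≠ 0 := by
    simpa using Gamma_neg_ne_zero (ne_int_neg (ne_int_of_ne_I_mul hν))
  have e1 : (2 : ℂ) ^ (Complex.I * ν + 1) = 2 * (2 ^ (Complex.I * ν / 2)) ^ 2 := by
    rw [sq, ← Complex.cpow_add _ _ two_ne_zero, add_halves, Complex.cpow_add _ _ two_ne_zero,
      Complex.cpow_one]
    ring
  have e2 : Complex.exp (Complex.I * Real.pi * (Complex.I * ν) / 2) *
      Complex.exp (5 * Real.pi * ν / 2) = Complex.exp (2 * Real.pi * ν) := by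
    rw [← Complex.exp_add]
    congr 1
    linear_combination (Real.pi * ν / 2) * Complex.I_sq
  have e3 := Complex.exp_ne_zero (2 * Real.pi * ν)
  rw [betaY, two_I_cpow, e1, one_add_rhoSq, show Complex.exp (2 * Real.pi * ν) - 1 = rhoSq ν from rfl]
  rw [← e2] at e3 ⊢
  generalize Complex.Gamma (Complex.I * ν) = G at *
  generalize Complex.exp (Complex.I * Real.pi * (Complex.I * ν) / 2) = u at *
  generalize Complex.exp (5 * Real.pi * ν / 2) = v at *
  have hu : u ≠ 0 := left_ne_zero_of_mul e3
  have hv : v ≠ 0 := right_ne_zero_of_mul e3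
  generalize (2 : ℂ) ^ (Complex.I * ν / 2) = t at *
  field_simp

theorem betaY_ne_zero {ν : ℂ} (hν : ∀ n : ℤ, ν ≠ Complex.I * n) : betaY ν ≠ 0 := by
  intro h
  have := betaY_mul hν
  rw [h] at this
  have t0 : (2 : ℂ) ^ (Complex.I * ν / 2) ≠ 0 := by simp [Complex.cpow_eq_zero_iff]
  have : (0 : ℂ) ≠ 2 * (2 ^ (Complex.I * ν / 2)) ^ 2 * Complex.I * (Real.sqrt Real.pi : ℂ) :=
    (mul_ne_zero (mul_ne_zero (mul_ne_zero two_ne_zero (pow_ne_zero 2 t0)) Complex.I_ne_zero)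
      sqrt_pi_ne_zero_complex).symm
  simp_all

/-- The first column of the solution, in the lower (`e = 1`) and upper (`e = -1`) half plane. -/
noncomputable def psiCol₁ (y : ℝ) (ν e l : ℂ) : Fin 2 → ℂ :=
  ![Complex.exp (-(y : ℂ) ^ 2 / 2) * Complex.exp (-(e * Real.pi * ν / 2)) *
      parabolicCylinderD (-(Complex.I * ν)) (e * Complex.I * (Real.sqrt 2 * (y + l))) *
      2 ^ (Complex.I * ν / 2),
    Complex.exp ((y : ℂ) ^ 2 / 2) * (e * (Real.sqrt 2 : ℂ) / betaY ν * ν *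
      Complex.exp (-(e * Real.pi * ν / 2))) *
      parabolicCylinderD (-(Complex.I * ν) - 1) (e * Complex.I * (Real.sqrt 2 * (y + l))) *
      2 ^ (Complex.I * ν / 2)]

/-- The second column of the solution, in the right (`e = 1`) and left (`e = -1`) half plane. -/
noncomputable def psiCol₂ (y : ℝ) (ν e l : ℂ) : Fin 2 → ℂ :=
  ![Complex.exp (-(y : ℂ) ^ 2 / 2) * (-(e * betaY ν / (Real.sqrt 2 : ℂ)) *
      Complex.exp (-((1 - e) / 2 * Real.pi * ν))) *
      parabolicCylinderD (Complex.I * ν - 1) (e * (Real.sqrt 2 * (y + l))) *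
      2 ^ (-(Complex.I * ν / 2)),
    Complex.exp ((y : ℂ) ^ 2 / 2) * Complex.exp (-((1 - e) / 2 * Real.pi * ν)) *
      parabolicCylinderD (Complex.I * ν) (e * (Real.sqrt 2 * (y + l))) * 2 ^ (-(Complex.I * ν / 2))]

theorem exp_mul_log_two (a : ℂ) : Complex.exp (a * (Real.log 2 : ℂ)) = 2 ^ a := by
  rw [Complex.cpow_def_of_ne_zero two_ne_zero, Complex.ofReal_log two_pos.le, Complex.ofReal_ofNat,
    mul_comm]

theorem psiY_eq (y : ℝ) (ν l : ℂ) : psiY y ν l =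
    !![psiCol₁ y ν 1 l 0, psiCol₂ y ν 1 l 0; psiCol₁ y ν 1 l 1, psiCol₂ y ν 1 l 1] := by
  have e1 : Complex.exp (-(Complex.I * ν / 2 * (Real.log 2 : ℂ))) = 2 ^ (-(Complex.I * ν / 2)) := by
    rw [← exp_mul_log_two]; ring_nf
  ext i k
  fin_cases i <;> fin_cases k <;>
    simp only [psiY, expSigma3, psiCol₁, psiCol₂, exp_mul_log_two, e1, Matrix.mul_apply,
      Fin.sum_univ_two, Matrix.of_apply, Matrix.cons_val', Matrix.cons_val_zero,
      Matrix.cons_val_one, Matrix.cons_val_fin_one, Fin.zero_eta, Fin.mk_one, Fin.isValue] <;>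
    (simp <;> ring_nf <;> simp)

/-- These relations are what the constant factors `R₁, …, R₄` encode. They are the connection
formulas of orders `iν - 1` (first row) and `iν` (second row) at `±√2(y+λ)`. In terms of `s =
e^{πν/2}` one has `1 + p = s⁴`, and after elimination of `β` only rational identities remain. -/
theorem psiCol_zero_relations {ν : ℂ} (hν : ∀ n : ℤ, ν ≠ Complex.I * n) (y : ℝ) (l : ℂ) (i : Fin 2) :
    psiCol₁ y ν 1 l i + rhoSq ν / (1 + rhoSq ν) * psiCol₂ y ν 1 l i = psiCol₁ y ν (-1) l i ∧
    (1 + rhoSq ν)⁻¹ * psiCol₂ y ν 1 l i - psiCol₁ y ν 1 l i = psiCol₂ y ν (-1) l i := by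
  have hα := ne_int_of_ne_I_mul hν
  set z : ℂ := Real.sqrt 2 * (y + l) with hz
  set α := Complex.I * ν with hαdef
  have hb := betaY_mul hν
  have hβ := betaY_ne_zero hν
  set s := Complex.exp (Real.pi * ν / 2) with hs
  have s0 : s ≠ 0 := Complex.exp_ne_zero _
  have hp1 : 1 + rhoSq ν = s ^ 4 := by
    rw [one_add_rhoSq, hs, ← Complex.exp_nat_mul]; congr 1; push_cast; ring
  have hp : rhoSq ν = s ^ 4 - 1 := by linear_combination hp1
  have e1 : Complex.exp (-(1 * Real.pi * ν / 2)) = s⁻¹ := by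
    rw [hs, ← Complex.exp_neg]; congr 1; ring
  have e2 : Complex.exp (-(-1 * Real.pi * ν / 2)) = s := by rw [hs]; congr 1; ring
  have e3 : Complex.exp (-((1 - -1) / 2 * Real.pi * ν)) = (s ^ 2)⁻¹ := by
    rw [hs, ← Complex.exp_nat_mul, ← Complex.exp_neg]; congr 1; push_cast; ring
  have e4 : Complex.exp (-((1 - 1) / 2 * Real.pi * ν)) = 1 := by simp
  have hI := Complex.I_sq
  have x1 : Complex.exp (Complex.I * Real.pi * α / 2) = s⁻¹ := by
    rw [hs, ← Complex.exp_neg]; congr 1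
    linear_combination (Real.pi * ν / 2) * hI
  have x2 : Complex.exp (-(Complex.I * Real.pi * α / 2)) = s := by
    rw [Complex.exp_neg, x1, inv_inv]
  have hpi : Complex.exp (Real.pi / 2 * Complex.I) = Complex.I := by
    rw [Complex.exp_mul_I, Complex.cos_pi_div_two, Complex.sin_pi_div_two]; ring
  have x3 : Complex.exp (Complex.I * Real.pi * (α - 1) / 2) = -Complex.I * s⁻¹ := by
    rw [show Complex.I * Real.pi * (α - 1) / 2 =
      -(Real.pi / 2 * Complex.I) + Complex.I * Real.pi * α / 2 by ring, Complex.exp_add,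
      Complex.exp_neg, hpi, x1, Complex.inv_I]
  have x4 : Complex.exp (-(Complex.I * Real.pi * (α - 1) / 2)) = Complex.I * s := by
    rw [show -(Complex.I * Real.pi * (α - 1) / 2) =
      (Real.pi / 2 * Complex.I) + -(Complex.I * Real.pi * α / 2) by ring, Complex.exp_add, hpi, x2]
  have c1 : ∀ z, parabolicCylinderD (α - 1) z = Complex.Gamma α /
      ((Real.sqrt 2 : ℂ) * (Real.sqrt Real.pi : ℂ)) *
      (-Complex.I * s⁻¹ * parabolicCylinderD (-α) (Complex.I * z) +
        Complex.I * s * parabolicCylinderD (-α) (-Complex.I * z)) := fun z => by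
    have := parabolicCylinderD_connection (ne_int_sub_one hα) z
    rwa [x3, x4, sub_add_cancel, show -(α - 1) - 1 = -α by ring] at this
  have c2 : ∀ z, parabolicCylinderD α z = α * Complex.Gamma α /
      ((Real.sqrt 2 : ℂ) * (Real.sqrt Real.pi : ℂ)) *
      (s⁻¹ * parabolicCylinderD (-α - 1) (Complex.I * z) +
        s * parabolicCylinderD (-α - 1) (-Complex.I * z)) := fun z => by
    have := parabolicCylinderD_connection hα z
    rwa [x1, x2, Complex.Gamma_add_one _ (by simpa using hα 0)] at this
  have t0 : (2 : ℂ) ^ (α / 2) ≠ 0 := by simp [Complex.cpow_eq_zero_iff]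
  have r0 : (Real.sqrt 2 : ℂ) ≠ 0 := Complex.ofReal_ne_zero.2 (by positivity)
  have r2 := sqrt_two_sq_complex
  have p0 := sqrt_pi_ne_zero_complex
  have g0 : s ^ 4 - 1 ≠ 0 := by rw [← hp]; exact rhoSq_ne_zero hν
  have hG : Complex.Gamma α ≠ 0 := by simpa using Gamma_neg_ne_zero (ne_int_neg hα)
  rw [hp1, hp, ← hαdef] at hb
  have hβ' : betaY ν = 2 * (2 ^ (α / 2)) ^ 2 * Complex.I * (Real.sqrt Real.pi : ℂ) * s ^ 4 /
      ((s ^ 4 - 1) * Complex.Gamma α) := by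
    rw [eq_div_iff (mul_ne_zero g0 hG), ← hb]
    field_simp
  have n1 : (2 : ℂ) ^ (-(α / 2)) = (2 ^ (α / 2))⁻¹ := Complex.cpow_neg _ _
  have m1 : 1 * Complex.I * z = Complex.I * z := by ring
  have m2 : -1 * Complex.I * z = -Complex.I * z := by ring
  have m3 : 1 * z = z := one_mul z
  have m4 : -1 * z = -z := by ring
  have m5 : Complex.I * -z = -Complex.I * z := by ring
  have m6 : -Complex.I * -z = Complex.I * z := by ring
  have hν' : ν = -Complex.I * α := by rw [hαdef]; linear_combination ν * hI
  have hα0 : α ≠ 0 := by simpa using hα 0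
  fin_cases i
  · simp only [psiCol₁, psiCol₂, ← hz, ← hαdef, Fin.zero_eta, Fin.isValue, Matrix.cons_val_zero,
      e1, e2, e3, e4, n1, m1, m2, m3, m4, c1, hp, m5, m6, hβ']
    generalize parabolicCylinderD (-α) (Complex.I * z) = X
    generalize parabolicCylinderD (-α) (-Complex.I * z) = W
    generalize (2 : ℂ) ^ (α / 2) = t at *
    generalize Complex.exp (-(y : ℂ) ^ 2 / 2) = E
    generalize (Real.sqrt Real.pi : ℂ) = P at *
    generalize (Real.sqrt 2 : ℂ) = r at *
    generalize Complex.Gamma α = G at *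
    clear_value s
    constructor
    · field_simp
      rw [r2]
      ring_nf
      rw [hI]
      ring
    · field_simp
      rw [r2]
      ring_nf
      rw [hI]
      ring
  · simp only [psiCol₁, psiCol₂, ← hz, ← hαdef, Fin.mk_one, Fin.isValue, Matrix.cons_val_one,
      Matrix.cons_val_fin_one, e1, e2, e3, e4, n1, m1, m2, m3, m4, c2, hp, m5, m6, hβ']
    generalize parabolicCylinderD (-α - 1) (Complex.I * z) = X
    generalize parabolicCylinderD (-α - 1) (-Complex.I * z) = W
    generalize (2 : ℂ) ^ (α / 2) = t at *
    generalize Complex.exp ((y : ℂ) ^ 2 / 2) = E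
    generalize (Real.sqrt Real.pi : ℂ) = P at *
    generalize (Real.sqrt 2 : ℂ) = r at *
    generalize Complex.Gamma α = G at *
    clear_value s α
    subst hν'
    have hI0 := Complex.I_ne_zero
    constructor
    · field_simp
      rw [r2]
      ring
    · field_simp
      rw [r2]
      ring


/-! ### The solution in the four quadrants. -/

/-- The angle `θ` measures the difference between the principal logarithm of `eiλ` and `logC λ`, and
`k` compensates the exponential factor which this difference produces in the power. The order in the
lower entry is smaller by one, so its normalization leaves a factor `1/λ`. -/
theorem psiCol₁_mul_eq {ν e l : ℂ} (hν : ∀ n : ℤ, ν ≠ Complex.I * n) (he : e ^ 2 = 1) (hl : l ≠ 0)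
    (y : ℝ) {k θ : ℂ} (hlog : Complex.log (e * Complex.I * l) = logC l + θ * Complex.I)
    (hk : k * Complex.exp (-(e * Real.pi * ν / 2)) =
      Complex.exp (Complex.I * ν * (θ * Complex.I))) :
    k * psiCol₁ y ν e l 0 * Complex.exp (-(l ^ 2 / 2 + y * l)) *
        Complex.exp (Complex.I * ν * logC l) =
      pcNormalized (-(Complex.I * ν)) (e * Complex.I * y) (e * Complex.I * l) ∧
    k * psiCol₁ y ν e l 1 * Complex.exp (-(l ^ 2 / 2 + y * l)) *
        Complex.exp (Complex.I * ν * logC l) =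
      -(Complex.I * ν / betaY ν) * Complex.exp ((y : ℂ) ^ 2) *
        pcNormalized (-(Complex.I * ν) - 1) (e * Complex.I * y) (e * Complex.I * l) / l := by
  have he0 : e ≠ 0 := by rintro rfl; simp at he
  have hel : e * Complex.I * l ≠ 0 := mul_ne_zero (mul_ne_zero he0 Complex.I_ne_zero) hl
  have hI := Complex.I_sq
  have hβ := betaY_ne_zero hν
  have hz : (Real.sqrt 2 : ℂ) * (e * Complex.I * y + e * Complex.I * l) =
      e * Complex.I * (Real.sqrt 2 * (y + l)) := by ring
  have hE : Complex.exp ((e * Complex.I * y + e * Complex.I * l) ^ 2 / 2) =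
      Complex.exp (-(y : ℂ) ^ 2 / 2) * Complex.exp (-(l ^ 2 / 2 + y * l)) := by
    rw [← Complex.exp_add]
    congr 1
    linear_combination (e ^ 2 * (y + l) ^ 2 / 2) * hI - ((y + l) ^ 2 / 2) * he
  have hp : (e * Complex.I * l) ^ (Complex.I * ν) = k * Complex.exp (-(e * Real.pi * ν / 2)) *
      Complex.exp (Complex.I * ν * logC l) := by
    rw [Complex.cpow_def_of_ne_zero hel, hlog, hk, ← Complex.exp_add]
    congr 1
    ring
  constructor
  · rw [pcNormalized, hE, hz, neg_neg, hp]
    simp only [psiCol₁, Matrix.cons_val_zero]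
    ring
  · have h2 : (2 : ℂ) ^ (-(-(Complex.I * ν) - 1) / 2) =
        2 ^ (Complex.I * ν / 2) * (Real.sqrt 2 : ℂ) := by
      rw [sqrt_two_eq_cpow, ← Complex.cpow_add _ _ two_ne_zero]
      congr 1
      ring
    have hp' : (e * Complex.I * l) ^ (-(-(Complex.I * ν) - 1)) =
        k * Complex.exp (-(e * Real.pi * ν / 2)) * Complex.exp (Complex.I * ν * logC l) *
        (e * Complex.I * l) := by
      rw [show -(-(Complex.I * ν) - 1) = Complex.I * ν + 1 by ring, Complex.cpow_add _ _ hel, hp,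
        Complex.cpow_one]
    have hy : Complex.exp ((y : ℂ) ^ 2 / 2) =
        Complex.exp ((y : ℂ) ^ 2) * Complex.exp (-(y : ℂ) ^ 2 / 2) := by
      rw [← Complex.exp_add]; congr 1; ring
    rw [pcNormalized, hE, hz, h2, hp']
    simp only [psiCol₁, Matrix.cons_val_one, Matrix.cons_val_fin_one, hy]
    generalize parabolicCylinderD _ _ = X
    generalize (2 : ℂ) ^ (Complex.I * ν / 2) = t
    generalize Complex.exp (-(y : ℂ) ^ 2 / 2) = E₁
    generalize Complex.exp ((y : ℂ) ^ 2) = E₂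
    generalize Complex.exp (-(e * Real.pi * ν / 2)) = E₃ at *
    generalize Complex.exp (-(l ^ 2 / 2 + y * l)) = E₄
    generalize Complex.exp (Complex.I * ν * logC l) = E₅
    generalize betaY ν = β at *
    field_simp
    rw [hI]
    ring

theorem psiCol₂_mul_eq {ν e l : ℂ} (he : e ^ 2 = 1) (hl : l ≠ 0)
    (y : ℝ) {k θ : ℂ} (hlog : Complex.log (e * l) = logC l + θ * Complex.I)
    (hk : k * Complex.exp (-((1 - e) / 2 * Real.pi * ν)) =
      Complex.exp (-(Complex.I * ν * (θ * Complex.I)))) :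
    k * psiCol₂ y ν e l 0 * Complex.exp (l ^ 2 / 2 + y * l) *
        Complex.exp (-(Complex.I * ν * logC l)) =
      -(betaY ν / 2) * Complex.exp (-(y : ℂ) ^ 2) *
        pcNormalized (Complex.I * ν - 1) (e * y) (e * l) / l ∧
    k * psiCol₂ y ν e l 1 * Complex.exp (l ^ 2 / 2 + y * l) *
        Complex.exp (-(Complex.I * ν * logC l)) =
      pcNormalized (Complex.I * ν) (e * y) (e * l) := by
  have he0 : e ≠ 0 := by rintro rfl; simp at he
  have hel : e * l ≠ 0 := mul_ne_zero he0 hl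
  have hz : (Real.sqrt 2 : ℂ) * (e * y + e * l) = e * (Real.sqrt 2 * (y + l)) := by ring
  have hE : Complex.exp ((e * y + e * l) ^ 2 / 2) =
      Complex.exp ((y : ℂ) ^ 2 / 2) * Complex.exp (l ^ 2 / 2 + y * l) := by
    rw [← Complex.exp_add]
    congr 1
    linear_combination ((y + l) ^ 2 / 2) * he
  have hp : (e * l) ^ (-(Complex.I * ν)) = k * Complex.exp (-((1 - e) / 2 * Real.pi * ν)) *
      Complex.exp (-(Complex.I * ν * logC l)) := by
    rw [Complex.cpow_def_of_ne_zero hel, hlog, hk, ← Complex.exp_add]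
    congr 1
    ring
  constructor
  · have h2 : (2 : ℂ) ^ (-(Complex.I * ν - 1) / 2) =
        2 ^ (-(Complex.I * ν / 2)) * (Real.sqrt 2 : ℂ) := by
      rw [sqrt_two_eq_cpow, ← Complex.cpow_add _ _ two_ne_zero]
      congr 1
      ring
    have hp' : (e * l) ^ (-(Complex.I * ν - 1)) =
        k * Complex.exp (-((1 - e) / 2 * Real.pi * ν)) * Complex.exp (-(Complex.I * ν * logC l)) *
        (e * l) := by
      rw [show -(Complex.I * ν - 1) = -(Complex.I * ν) + 1 by ring, Complex.cpow_add _ _ hel, hp,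
        Complex.cpow_one]
    have hy : Complex.exp (-(y : ℂ) ^ 2 / 2) =
        Complex.exp (-(y : ℂ) ^ 2) * Complex.exp ((y : ℂ) ^ 2 / 2) := by
      rw [← Complex.exp_add]; congr 1; ring
    have r0 : (Real.sqrt 2 : ℂ) ≠ 0 := Complex.ofReal_ne_zero.2 (by positivity)
    have r2 := sqrt_two_sq_complex
    rw [pcNormalized, hE, hz, h2, hp']
    simp only [psiCol₂, Matrix.cons_val_zero, hy]
    generalize parabolicCylinderD _ _ = X
    generalize (2 : ℂ) ^ (-(Complex.I * ν / 2)) = t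
    generalize Complex.exp ((y : ℂ) ^ 2 / 2) = E₁
    generalize Complex.exp (-(y : ℂ) ^ 2) = E₂
    generalize Complex.exp (-((1 - e) / 2 * Real.pi * ν)) = E₃ at *
    generalize Complex.exp (l ^ 2 / 2 + y * l) = E₄
    generalize Complex.exp (-(Complex.I * ν * logC l)) = E₅
    generalize betaY ν = β at *
    generalize (Real.sqrt 2 : ℂ) = r at *
    field_simp
    rw [r2]
    ring
  · rw [pcNormalized, hE, hz, neg_div, hp]
    simp only [psiCol₂, Matrix.cons_val_one, Matrix.cons_val_fin_one]
    ring

/-- The solution outside the unit circle, in terms of normalized parabolic cylinder functions. -/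
noncomputable def outerY (y : ℝ) (ν e₁ e₂ l : ℂ) : Matrix (Fin 2) (Fin 2) ℂ :=
  !![pcNormalized (-(Complex.I * ν)) (e₁ * Complex.I * y) (e₁ * Complex.I * l),
      -(betaY ν / 2) * Complex.exp (-(y : ℂ) ^ 2) *
        pcNormalized (Complex.I * ν - 1) (e₂ * y) (e₂ * l) / l;
     -(Complex.I * ν / betaY ν) * Complex.exp ((y : ℂ) ^ 2) *
        pcNormalized (-(Complex.I * ν) - 1) (e₁ * Complex.I * y) (e₁ * Complex.I * l) / l,
      pcNormalized (Complex.I * ν) (e₂ * y) (e₂ * l)]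

theorem psiY_mul_eq_outerY {ν e₁ e₂ l : ℂ} (hν : ∀ n : ℤ, ν ≠ Complex.I * n) (h₁ : e₁ ^ 2 = 1)
    (h₂ : e₂ ^ 2 = 1) (hl : l ≠ 0) (y : ℝ) {k₁ k₂ θ₁ θ₂ : ℂ} {R : Matrix (Fin 2) (Fin 2) ℂ}
    (hR : psiY y ν l * R = !![k₁ * psiCol₁ y ν e₁ l 0, k₂ * psiCol₂ y ν e₂ l 0;
      k₁ * psiCol₁ y ν e₁ l 1, k₂ * psiCol₂ y ν e₂ l 1])
    (hlog₁ : Complex.log (e₁ * Complex.I * l) = logC l + θ₁ * Complex.I)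
    (hlog₂ : Complex.log (e₂ * l) = logC l + θ₂ * Complex.I)
    (hk₁ : k₁ * Complex.exp (-(e₁ * Real.pi * ν / 2)) =
      Complex.exp (Complex.I * ν * (θ₁ * Complex.I)))
    (hk₂ : k₂ * Complex.exp (-((1 - e₂) / 2 * Real.pi * ν)) =
      Complex.exp (-(Complex.I * ν * (θ₂ * Complex.I)))) :
    psiY y ν l * R * expSigma3 (-(l ^ 2 / 2 + y * l)) * powSigma3 l (Complex.I * ν) =
      outerY y ν e₁ e₂ l := by
  obtain ⟨a1, a2⟩ := psiCol₁_mul_eq hν h₁ hl y hlog₁ hk₁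
  obtain ⟨b1, b2⟩ := psiCol₂_mul_eq h₂ hl y hlog₂ hk₂
  rw [hR, outerY, ← a1, ← a2, ← b1, ← b2, powSigma3, expSigma3, expSigma3, neg_neg]
  ext i k
  fin_cases i <;> fin_cases k <;> simp [Matrix.mul_apply, Fin.sum_univ_two]

/-- Each sector factor exchanges the columns of `ψ` for those with the signs of its quadrant, up to
a factor `1 + p`. Such a factor occurs only on the two sides of the cut. -/
theorem psiY_mul_factors {ν : ℂ} (hν : ∀ n : ℤ, ν ≠ Complex.I * n) (y : ℝ) (l : ℂ) :
    psiY y ν l * !![1, 0; rhoSq ν / (1 + rhoSq ν), 1] =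
      !![psiCol₁ y ν (-1) l 0, psiCol₂ y ν 1 l 0; psiCol₁ y ν (-1) l 1, psiCol₂ y ν 1 l 1] ∧
    psiY y ν l * (!![1, 0; rhoSq ν / (1 + rhoSq ν), 1] * !![1, -1; 0, 1]) =
      !![psiCol₁ y ν (-1) l 0, psiCol₂ y ν (-1) l 0;
        psiCol₁ y ν (-1) l 1, psiCol₂ y ν (-1) l 1] ∧
    psiY y ν l * (!![1, 0; rhoSq ν / (1 + rhoSq ν), 1] * !![1, -1; 0, 1] *
      (!![1, 0; rhoSq ν, 1])⁻¹) =
      !![(1 + rhoSq ν) * psiCol₁ y ν 1 l 0, psiCol₂ y ν (-1) l 0;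
        (1 + rhoSq ν) * psiCol₁ y ν 1 l 1, psiCol₂ y ν (-1) l 1] ∧
    psiY y ν l * !![1, -(1 + rhoSq ν); 0, 1] =
      !![psiCol₁ y ν 1 l 0, (1 + rhoSq ν) * psiCol₂ y ν (-1) l 0;
        psiCol₁ y ν 1 l 1, (1 + rhoSq ν) * psiCol₂ y ν (-1) l 1] := by
  have hrel := psiCol_zero_relations hν y l
  have h1 : 1 + rhoSq ν ≠ 0 := by rw [one_add_rhoSq]; exact Complex.exp_ne_zero _
  have hinv : (!![1, 0; rhoSq ν, 1] : Matrix (Fin 2) (Fin 2) ℂ)⁻¹ = !![1, 0; -rhoSq ν, 1] := by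
    apply Matrix.inv_eq_right_inv
    ext i k
    fin_cases i <;> fin_cases k <;> simp [Matrix.mul_apply, Fin.sum_univ_two]
  obtain ⟨a0, b0⟩ := hrel 0
  obtain ⟨a1, b1⟩ := hrel 1
  rw [hinv, psiY_eq, ← a0, ← a1, ← b0, ← b1]
  refine ⟨?_, ?_, ?_, ?_⟩ <;> ext i k <;>
    fin_cases i <;> fin_cases k <;> simp [Matrix.mul_apply, Fin.sum_univ_two] <;> field_simp <;>
    ring


/-- The signs are determined by the quadrant, and the right-hand side does not involve the cut. Thus
`m^Y` is analytic across the cut outside the circle: the factor `1 + p = e^{2πν}` left by `R₄` and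
by `R₁R₂R₃⁻¹` absorbs the monodromy of `λ^{iν}`. -/
theorem mY_eq_outerY {ν : ℂ} (hν : ∀ n : ℤ, ν ≠ Complex.I * n) (y : ℝ) {l e₁ e₂ : ℂ}
    (h₁ : e₁ = 1 ∨ e₁ = -1) (h₂ : e₂ = 1 ∨ e₂ = -1) (hl : 1 ≤ ‖l‖)
    (hl₁ : 0 < (e₁ * Complex.I * l).re) (hl₂ : 0 < (e₂ * l).re) :
    mY y ν l = outerY y ν e₁ e₂ l := by
  have hl0 : l ≠ 0 := by rintro rfl; simp at hl₂
  obtain ⟨f1, f2, f3, f4⟩ := psiY_mul_factors hν y l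
  have hpi := Real.pi_pos
  obtain ⟨hm1, hm2⟩ := logC_im_mem l
  have hlog : ∀ τ : ℝ, ∀ e : ℂ, Complex.exp (τ * Complex.I) = e → -Real.pi < (logC l).im + τ →
      (logC l).im + τ ≤ Real.pi → Complex.log (e * l) = logC l + τ * Complex.I := by
    rintro τ e rfl ha hb
    exact log_exp_mul_eq hl0 ha hb
  have x0 : Complex.exp (((0 : ℝ) : ℂ) * Complex.I) = 1 := by simp
  have x1 : Complex.exp (((Real.pi / 2 : ℝ) : ℂ) * Complex.I) = 1 * Complex.I := by
    rw [Complex.exp_mul_I, ← Complex.ofReal_cos, ← Complex.ofReal_sin]; simp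
  have x2 : Complex.exp (((-(Real.pi / 2) : ℝ) : ℂ) * Complex.I) = -1 * Complex.I := by
    rw [Complex.exp_mul_I, ← Complex.ofReal_cos, ← Complex.ofReal_sin]; simp
  have x3 : Complex.exp (((-Real.pi : ℝ) : ℂ) * Complex.I) = -1 := by
    rw [Complex.exp_mul_I, ← Complex.ofReal_cos, ← Complex.ofReal_sin]; simp
  have x4 : Complex.exp ((Real.pi : ℂ) * Complex.I) = -1 := Complex.exp_pi_mul_I
  have x5 : Complex.exp (((-(3 * Real.pi / 2) : ℝ) : ℂ) * Complex.I) = 1 * Complex.I := by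
    rw [show (((-(3 * Real.pi / 2) : ℝ) : ℂ) * Complex.I) =
      (((-Real.pi : ℝ) : ℂ) * Complex.I) + (((-(Real.pi / 2) : ℝ) : ℂ) * Complex.I) by
        push_cast; ring, Complex.exp_add, x3, x2]
    ring
  have hI := Complex.I_sq
  rw [mY, if_neg hl.not_gt]
  rcases h₁ with rfl | rfl <;> rcases h₂ with rfl | rfl
  · have him : l.im < 0 := by simpa using hl₁
    have hre : 0 < l.re := by simpa using hl₂
    have a := logC_im_of_im_neg him
    have b := logC_im_of_re_pos hre
    have a' : (logC l).im < 0 := a.resolve_right (by linarith)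
    have hs : sectorFactor ν l = 1 := by
      rw [sectorFactor, if_neg (by linarith), if_pos a']
    rw [hs]
    refine psiY_mul_eq_outerY hν (by norm_num) (by norm_num) hl0 y (k₁ := 1) (k₂ := 1)
      (by rw [mul_one, psiY_eq]; simp)
      (hlog _ _ x1 (by linarith) (by linarith)) (by rw [hlog _ _ x0 (by linarith) (by linarith)])
      ?_ ?_
    · rw [one_mul]; congr 1; push_cast; linear_combination (-Real.pi * ν / 2) * hI
    · rw [one_mul]; congr 1; push_cast; ring
  · have him : l.im < 0 := by simpa using hl₁
    have hre : l.re < 0 := by simpa using hl₂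
    have a := logC_im_of_im_neg him
    have b := logC_im_of_re_neg hre
    -- The third quadrant is divided by the cut: arguments below `-π/2` belong to `R₄`, arguments
    -- above `π` to `R₁R₂R₃⁻¹`.
    rcases a with a | a
    · have b' := b.resolve_right (by linarith)
      have hs : sectorFactor ν l = !![1, -(1 + rhoSq ν); 0, 1] := by
        rw [sectorFactor, if_pos b']
      rw [hs]
      refine psiY_mul_eq_outerY hν (by norm_num) (by norm_num) hl0 y (k₁ := 1)
        (k₂ := 1 + rhoSq ν) (by rw [f4]; simp)
        (hlog _ _ x1 (by linarith) (by linarith)) (hlog _ _ x4 (by linarith) (by linarith))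
        ?_ ?_
      · rw [one_mul]; congr 1; push_cast; linear_combination (-Real.pi * ν / 2) * hI
      · rw [one_add_rhoSq, ← Complex.exp_add]; congr 1; linear_combination (Real.pi * ν) * hI
    · have hs : sectorFactor ν l = !![1, 0; rhoSq ν / (1 + rhoSq ν), 1] * !![1, -1; 0, 1] *
          (!![1, 0; rhoSq ν, 1])⁻¹ := by
        rw [sectorFactor, if_neg (by linarith), if_neg (by linarith), if_neg (by linarith),
          if_neg (by linarith)]
      rw [hs]
      refine psiY_mul_eq_outerY hν (by norm_num) (by norm_num) hl0 y (k₁ := 1 + rhoSq ν)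
        (k₂ := 1) (by rw [f3]; simp)
        (hlog _ _ x5 (by linarith) (by linarith)) (hlog _ _ x3 (by linarith) (by linarith))
        ?_ ?_
      · rw [one_add_rhoSq, ← Complex.exp_add]; congr 1; push_cast
        linear_combination (3 * Real.pi * ν / 2) * hI
      · rw [one_mul]; congr 1; push_cast; linear_combination (-Real.pi * ν) * hI
  · have him : 0 < l.im := by simpa using hl₁
    have hre : 0 < l.re := by simpa using hl₂
    have a := logC_im_pos_of_im_pos him
    have b := logC_im_of_re_pos hre
    have hs : sectorFactor ν l = !![1, 0; rhoSq ν / (1 + rhoSq ν), 1] := by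
      rw [sectorFactor, if_neg (by linarith), if_neg (by linarith), if_pos b.2]
    rw [hs]
    refine psiY_mul_eq_outerY hν (by norm_num) (by norm_num) hl0 y (k₁ := 1) (k₂ := 1)
      (by rw [f1]; simp)
      (hlog _ _ x2 (by linarith) (by linarith)) (by rw [hlog _ _ x0 (by linarith) (by linarith)])
      ?_ ?_
    · rw [one_mul]; congr 1; push_cast; linear_combination (Real.pi * ν / 2) * hI
    · rw [one_mul]; congr 1; push_cast; ring
  · have him : 0 < l.im := by simpa using hl₁
    have hre : l.re < 0 := by simpa using hl₂
    have a := logC_im_pos_of_im_pos him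
    have b := (logC_im_of_re_neg hre).resolve_left (by linarith)
    have hs : sectorFactor ν l = !![1, 0; rhoSq ν / (1 + rhoSq ν), 1] * !![1, -1; 0, 1] := by
      rw [sectorFactor, if_neg (by linarith), if_neg (by linarith), if_neg (by linarith),
        if_pos (by linarith)]
    rw [hs]
    refine psiY_mul_eq_outerY hν (by norm_num) (by norm_num) hl0 y (k₁ := 1) (k₂ := 1)
      (by rw [f2]; simp)
      (hlog _ _ x2 (by linarith) (by linarith)) (hlog _ _ x3 (by linarith) (by linarith))
      ?_ ?_
    · rw [one_mul]; congr 1; push_cast; linear_combination (Real.pi * ν / 2) * hI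
    · rw [one_mul]; congr 1; push_cast; linear_combination (-Real.pi * ν) * hI

/-! ### The contour -/

/-- Replaces the nine parametrized arcs by the unit circle together with the outer parts of the
axes. The values of `arg` in `(-3π/4, 5π/4]` distribute the points of the circle over its five arcs.
-/
theorem mem_contourY_iff (l : ℂ) :
    l ∈ contourY ↔ ‖l‖ = 1 ∨ (1 ≤ ‖l‖ ∧ (l.re = 0 ∨ l.im = 0)) := by
  have hpi := Real.pi_pos
  constructor
  · rw [contourY, mem_iUnion]
    rintro ⟨j, s, hs, rfl⟩
    fin_cases j <;> simp [arcY] at hs ⊢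
    · right; rwa [abs_of_nonneg (by linarith)]
    · right; rwa [abs_of_nonneg (by linarith)]
    · right; rw [abs_of_nonpos (by linarith)]; linarith
    · right; rw [abs_of_nonpos (by linarith)]; linarith
  · have key : ∀ j : Fin 9, l ∈ (arcY j).carrier → l ∈ contourY := fun j h =>
      mem_iUnion.2 ⟨j, h⟩
    rintro (h | ⟨h, h0 | h0⟩)
    · have hl : l ≠ 0 := by rintro rfl; simp at h
      have hm := logC_im_mem l
      have hre : (logC l).re = 0 := by
        have := congrArg norm (exp_logC hl)
        rw [Complex.norm_exp, h, Real.exp_eq_one_iff] at this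
        exact this
      have hs : Complex.exp ((logC l).im * Complex.I) = l := by
        conv_rhs => rw [← exp_logC hl]
        congr 1
        apply Complex.ext <;> simp [hre]
      rcases le_total (logC l).im (-(Real.pi / 2)) with h1 | h1
      · exact key 8 ⟨_, ⟨hm.1.le, h1⟩, hs⟩
      rcases le_total (logC l).im 0 with h2 | h2
      · exact key 4 ⟨_, ⟨h1, h2⟩, hs⟩
      rcases le_total (logC l).im (Real.pi / 2) with h3 | h3
      · exact key 5 ⟨_, ⟨h2, h3⟩, hs⟩
      rcases le_total (logC l).im Real.pi with h4 | h4
      · exact key 6 ⟨_, ⟨h3, h4⟩, hs⟩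
      · exact key 7 ⟨_, ⟨h4, hm.2⟩, hs⟩
    · have hs : (l.im : ℂ) * Complex.I = l := by apply Complex.ext <;> simp [h0]
      have hn : ‖l‖ = |l.im| := by conv_lhs => rw [← hs]; simp
      rw [hn, le_abs] at h
      rcases h with h | h
      · exact key 1 ⟨l.im, h, hs⟩
      · exact key 3 ⟨l.im, show l.im ≤ -1 by linarith, hs⟩
    · have hs : (l.re : ℂ) = l := by apply Complex.ext <;> simp [h0]
      have hn : ‖l‖ = |l.re| := by conv_lhs => rw [← hs]; simp
      rw [hn, le_abs] at h
      rcases h with h | h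
      · exact key 0 ⟨l.re, h, hs⟩
      · exact key 2 ⟨l.re, show l.re ≤ -1 by linarith, hs⟩

theorem notMem_contourY_iff (l : ℂ) :
    l ∉ contourY ↔ ‖l‖ < 1 ∨ (1 < ‖l‖ ∧ l.re ≠ 0 ∧ l.im ≠ 0) := by
  rw [mem_contourY_iff]
  rcases lt_trichotomy ‖l‖ 1 with h | h | h
  · simp [h, h.ne, h.not_ge]
  · simp [h]
  · simp [h, h.ne', h.le, h.not_gt]

/-- Off the axes, signs can be chosen as in `mY_eq_outerY`. -/
theorem exists_signs {l : ℂ} (hre : l.re ≠ 0) (him : l.im ≠ 0) :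
    ∃ e₁ e₂ : ℂ, (e₁ = 1 ∨ e₁ = -1) ∧ (e₂ = 1 ∨ e₂ = -1) ∧
      0 < (e₁ * Complex.I * l).re ∧ 0 < (e₂ * l).re := by
  rcases hre.lt_or_gt with h | h <;> rcases him.lt_or_gt with h' | h'
  · exact ⟨1, -1, by simp, by simp, by simpa, by simpa⟩
  · exact ⟨-1, -1, by simp, by simp, by simpa, by simpa⟩
  · exact ⟨1, 1, by simp, by simp, by simpa, by simpa⟩
  · exact ⟨-1, 1, by simp, by simp, by simpa, by simpa⟩


/-! ### Estimates of the solution, uniform in the parameters. -/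

theorem continuousOn_betaY {K : Set ℂ} (hK : ∀ ν ∈ K, ∀ n : ℤ, ν ≠ Complex.I * n) :
    ContinuousOn betaY K := by
  intro ν hν
  apply ContinuousAt.continuousWithinAt
  have h := hK ν hν
  have hα := ne_int_of_ne_I_mul h
  have hG : ContinuousAt (fun ν : ℂ => Complex.Gamma (Complex.I * ν)) ν :=
    (Complex.differentiableAt_Gamma _ fun m hm => hα (-m) (by push_cast; exact hm)).continuousAt.comp
      (f := fun ν : ℂ => Complex.I * ν) (by fun_prop)
  have h2 : ContinuousAt (fun ν : ℂ => (2 * Complex.I) ^ (Complex.I * ν + 1)) ν :=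
    ContinuousAt.const_cpow (by fun_prop) (Or.inl (mul_ne_zero two_ne_zero Complex.I_ne_zero))
  refine ContinuousAt.div ((h2.mul continuousAt_const).mul (by fun_prop))
    (ContinuousAt.mul (by fun_prop) hG) ?_
  exact mul_ne_zero (rhoSq_ne_zero h) (by simpa using Gamma_neg_ne_zero (ne_int_neg hα))

theorem exists_norm_pcNormalized_sub_one_le {K : Set ℂ} (hK : IsCompact K)
    (hKi : ∀ a ∈ K, ∀ n : ℤ, a ≠ n) (Y : ℝ) : ∃ C : ℝ, 0 ≤ C ∧ ∀ a ∈ K, ∀ w l : ℂ,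
      ‖w‖ ≤ Y → 1 ≤ ‖l‖ → 0 ≤ l.re → ‖pcNormalized a w l - 1‖ ≤ C / ‖l‖ := by
  obtain ⟨C, hC0, hC⟩ := exists_norm_pcNormalized_sub_le hK hKi Y
  obtain ⟨A, hA⟩ := hK.isBounded.exists_norm_le
  refine ⟨C + |A| * |Y|, by positivity, fun a ha w l hw hl hre => ?_⟩
  have h0 : 0 < ‖l‖ := by linarith
  have h1 := hC a ha w l hw hl hre
  have h2 : ‖a * w / l‖ ≤ |A| * |Y| / ‖l‖ := by
    rw [norm_div, norm_mul]
    gcongr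
    · exact (hA a ha).trans (le_abs_self _)
    · exact hw.trans (le_abs_self _)
  have h3 : C / ‖l‖ ^ 2 ≤ C / ‖l‖ := by
    apply div_le_div_of_nonneg_left hC0 h0
    nlinarith
  calc ‖pcNormalized a w l - 1‖ = ‖(pcNormalized a w l - (1 + a * w / l)) + a * w / l‖ := by
        congr 1; ring
    _ ≤ C / ‖l‖ + |A| * |Y| / ‖l‖ := (norm_add_le _ _).trans (add_le_add (h1.trans h3) h2)
    _ = _ := by ring

theorem exists_norm_m1Y_le {K₁ : Set ℝ} {K₂ : Set ℂ} (h₁ : IsCompact K₁) (h₂ : IsCompact K₂)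
    (hK : ∀ ν ∈ K₂, ∀ n : ℤ, ν ≠ Complex.I * n) :
    ∃ C : ℝ, 0 ≤ C ∧ ∀ y ∈ K₁, ∀ ν ∈ K₂, ∀ i k, ‖m1Y y ν i k‖ ≤ C := by
  have hβ : ContinuousOn (fun q : ℝ × ℂ => betaY q.2) (K₁ ×ˢ K₂) :=
    (continuousOn_betaY hK).comp continuousOn_snd fun q hq => hq.2
  have hβ0 : ∀ q ∈ K₁ ×ˢ K₂, betaY q.2 ≠ 0 := fun q hq => betaY_ne_zero (hK _ hq.2)
  have key : ∀ i k, ∃ C : ℝ, ∀ q ∈ K₁ ×ˢ K₂, ‖m1Y q.1 q.2 i k‖ ≤ C := fun i k => by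
    apply (h₁.prod h₂).exists_bound_of_continuousOn
    fin_cases i <;> fin_cases k <;> simp only [m1Y, Fin.zero_eta, Fin.mk_one, Fin.isValue,
      Matrix.of_apply, Matrix.cons_val', Matrix.cons_val_zero, Matrix.cons_val_one,
      Matrix.cons_val_fin_one]
    · fun_prop
    · exact ((hβ.div_const 2).neg).mul (by fun_prop)
    · exact ((ContinuousOn.div (by fun_prop) hβ hβ0).neg).mul (by fun_prop)
    · fun_prop
  choose C hC using key
  refine ⟨∑ i, ∑ k, |C i k|, by positivity, fun y hy ν hν i k => ?_⟩
  calc _ ≤ |C i k| := (hC i k (y, ν) ⟨hy, hν⟩).trans (le_abs_self _)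
    _ ≤ ∑ k, |C i k| := Finset.single_le_sum (f := fun k => |C i k|)
        (fun k _ => abs_nonneg _) (Finset.mem_univ k)
    _ ≤ _ := Finset.single_le_sum (f := fun i => ∑ k, |C i k|)
        (fun i _ => by positivity) (Finset.mem_univ i)

/-- The diagonal entries need the two-term expansion of `pcNormalized`; its linear term is `∓iνy/λ`,
since the signs of the quadrant cancel in `w/l`. The off-diagonal entries already carry `1/λ`, so
there the leading term is enough. -/
theorem exists_norm_mY_sub_le {K₁ : Set ℝ} {K₂ : Set ℂ} (h₁ : IsCompact K₁) (h₂ : IsCompact K₂)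
    (hK : ∀ ν ∈ K₂, ∀ n : ℤ, ν ≠ Complex.I * n) :
    ∃ C : ℝ, 0 ≤ C ∧ ∀ y ∈ K₁, ∀ ν ∈ K₂, ∀ l ∈ contourYᶜ, 1 ≤ ‖l‖ → ∀ i k : Fin 2,
      ‖mY y ν l i k - ((1 : Matrix (Fin 2) (Fin 2) ℂ) i k + m1Y y ν i k / l)‖ ≤ C / ‖l‖ ^ 2 := by
  obtain ⟨Y, hY⟩ := h₁.isBounded.exists_norm_le
  obtain ⟨M, hM0, hM⟩ := exists_norm_m1Y_le h₁ h₂ hK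
  have hα : ∀ ν ∈ K₂, ∀ n : ℤ, Complex.I * ν ≠ n := fun ν hν => ne_int_of_ne_I_mul (hK ν hν)
  obtain ⟨C₁, h10, hC₁⟩ := exists_norm_pcNormalized_sub_le
    (h₂.image (f := fun ν => Complex.I * ν) (by fun_prop))
    (by rintro _ ⟨ν, hν, rfl⟩; exact hα ν hν) Y
  obtain ⟨C₂, h20, hC₂⟩ := exists_norm_pcNormalized_sub_le
    (h₂.image (f := fun ν => -(Complex.I * ν)) (by fun_prop))
    (by rintro _ ⟨ν, hν, rfl⟩; exact ne_int_neg (hα ν hν)) Y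
  obtain ⟨C₃, h30, hC₃⟩ := exists_norm_pcNormalized_sub_one_le
    (h₂.image (f := fun ν => Complex.I * ν - 1) (by fun_prop))
    (by rintro _ ⟨ν, hν, rfl⟩; exact ne_int_sub_one (hα ν hν)) Y
  obtain ⟨C₄, h40, hC₄⟩ := exists_norm_pcNormalized_sub_one_le
    (h₂.image (f := fun ν => -(Complex.I * ν) - 1) (by fun_prop))
    (by rintro _ ⟨ν, hν, rfl⟩; exact ne_int_sub_one (ne_int_neg (hα ν hν))) Y
  refine ⟨C₁ + C₂ + M * C₃ + M * C₄, by positivity, fun y hy ν hν l hl h1 => ?_⟩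
  have hre : l.re ≠ 0 ∧ l.im ≠ 0 := by
    rcases (notMem_contourY_iff l).1 hl with h | h
    · linarith
    · exact h.2
  obtain ⟨e₁, e₂, he₁, he₂, p1, p2⟩ := exists_signs hre.1 hre.2
  have hl0 : 0 < ‖l‖ := by linarith
  have hln : l ≠ 0 := norm_pos_iff.1 hl0
  have n1 : ‖e₁‖ = 1 := by rcases he₁ with rfl | rfl <;> simp
  have n2 : ‖e₂‖ = 1 := by rcases he₂ with rfl | rfl <;> simp
  have q1 : e₁ ≠ 0 := norm_pos_iff.1 (by rw [n1]; norm_num)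
  have q2 : e₂ ≠ 0 := norm_pos_iff.1 (by rw [n2]; norm_num)
  have hyn : ‖(y : ℂ)‖ ≤ Y := by rw [Complex.norm_real]; exact hY y hy
  have w1 : ‖e₁ * Complex.I * y‖ ≤ Y := by simpa [n1] using hyn
  have w2 : ‖e₂ * (y : ℂ)‖ ≤ Y := by simpa [n2] using hyn
  have l1 : ‖e₁ * Complex.I * l‖ = ‖l‖ := by simp [n1]
  have l2 : ‖e₂ * l‖ = ‖l‖ := by simp [n2]
  have a1 := hC₁ _ ⟨ν, hν, rfl⟩ (e₂ * y) (e₂ * l) w2 (by rw [l2]; exact h1) p2.le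
  have a2 := hC₂ _ ⟨ν, hν, rfl⟩ (e₁ * Complex.I * y) (e₁ * Complex.I * l) w1
    (by rw [l1]; exact h1) p1.le
  have a3 := hC₃ _ ⟨ν, hν, rfl⟩ (e₂ * y) (e₂ * l) w2 (by rw [l2]; exact h1) p2.le
  have a4 := hC₄ _ ⟨ν, hν, rfl⟩ (e₁ * Complex.I * y) (e₁ * Complex.I * l) w1
    (by rw [l1]; exact h1) p1.le
  rw [l2] at a1 a3
  rw [l1] at a2 a4
  have m3 := hM y hy ν hν 0 1
  have m4 := hM y hy ν hν 1 0
  rw [mY_eq_outerY (hK ν hν) y he₁ he₂ h1 p1 p2]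
  have mono : ∀ c, c ≤ C₁ + C₂ + M * C₃ + M * C₄ →
      c / ‖l‖ ^ 2 ≤ (C₁ + C₂ + M * C₃ + M * C₄) / ‖l‖ ^ 2 := fun c hc => by gcongr
  have p3 : 0 ≤ M * C₃ := by positivity
  have p4 : 0 ≤ M * C₄ := by positivity
  have fin : ∀ m N c : ℂ, ∀ C' : ℝ, ‖m‖ ≤ M → ‖N - 1‖ ≤ C' / ‖l‖ →
      ‖m * N / l - (0 + m / l)‖ ≤ M * C' / ‖l‖ ^ 2 := fun m N c C' hm hN => by
    rw [show m * N / l - (0 + m / l) = m * (N - 1) / l by ring, norm_div, norm_mul, sq, ← div_div,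
      mul_div_assoc M]
    gcongr
  intro i k
  fin_cases i <;> fin_cases k
  · refine le_trans (le_of_eq ?_) (a2.trans (mono _ (by linarith)))
    simp only [outerY, m1Y]
    congr 1
    simp
    field_simp
  · refine le_trans ?_ ((fin _ _ 0 _ m3 a3).trans (mono _ (by linarith)))
    simp [outerY, m1Y]
  · refine le_trans ?_ ((fin _ _ 0 _ m4 a4).trans (mono _ (by linarith)))
    simp [outerY, m1Y]
  · refine le_trans (le_of_eq ?_) (a1.trans (mono _ (by linarith)))
    simp only [outerY, m1Y]
    congr 1
    simp
    field_simp

theorem mY_of_norm_lt_one {l : ℂ} (hl : ‖l‖ < 1) (y : ℝ) (ν : ℂ) (i : Fin 2) :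
    mY y ν l i 0 = psiCol₁ y ν 1 l i * Complex.exp (-(l ^ 2 / 2 + y * l)) ∧
    mY y ν l i 1 = psiCol₂ y ν 1 l i * Complex.exp (l ^ 2 / 2 + y * l) := by
  rw [mY, if_pos hl, psiY_eq, expSigma3, neg_neg]
  fin_cases i <;> simp [Matrix.mul_apply, Fin.sum_univ_two]

theorem exists_norm_mY_le_of_norm_lt_one {K₁ : Set ℝ} {K₂ : Set ℂ} (h₁ : IsCompact K₁)
    (h₂ : IsCompact K₂) (hK : ∀ ν ∈ K₂, ∀ n : ℤ, ν ≠ Complex.I * n) (i k : Fin 2) :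
    ∃ C : ℝ, ∀ y ∈ K₁, ∀ ν ∈ K₂, ∀ l : ℂ, ‖l‖ < 1 → ‖mY y ν l i k‖ ≤ C := by
  obtain ⟨Y, hY⟩ := h₁.isBounded.exists_norm_le
  have hα : ∀ ν ∈ K₂, ∀ n : ℤ, Complex.I * ν ≠ n := fun ν hν => ne_int_of_ne_I_mul (hK ν hν)
  set S : Set (ℝ × ℂ × ℂ) := K₁ ×ˢ K₂ ×ˢ Metric.closedBall 0 1
  have hS : IsCompact S := h₁.prod (h₂.prod (isCompact_closedBall _ _))
  have hβ : ContinuousOn (fun q : ℝ × ℂ × ℂ => betaY q.2.1) S :=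
    (continuousOn_betaY hK).comp (by fun_prop) fun q hq => hq.2.1
  have hβ0 : ∀ q ∈ S, betaY q.2.1 ≠ 0 := fun q hq => betaY_ne_zero (hK _ hq.2.1)
  -- Each entry is an explicit factor, continuous on a compact set, times one parabolic cylinder
  -- function. The latter is bounded by the uniform estimate, so no joint continuity in order and
  -- argument is required.
  have key : ∀ (a : ℂ → ℂ) (c : ℂ) (G : ℝ × ℂ × ℂ → ℂ), Continuous a →
      (∀ ν ∈ K₂, ∀ n : ℤ, a ν ≠ n) → ‖c‖ = 1 → ContinuousOn G S →
      (∀ y ∈ K₁, ∀ ν ∈ K₂, ∀ l : ℂ, ‖l‖ < 1 → mY y ν l i k =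
        G (y, ν, l) * parabolicCylinderD (a ν) (c * (Real.sqrt 2 * (y + l)))) →
      ∃ C : ℝ, ∀ y ∈ K₁, ∀ ν ∈ K₂, ∀ l : ℂ, ‖l‖ < 1 → ‖mY y ν l i k‖ ≤ C := by
    intro a c G ha hai hc hG hm
    obtain ⟨A, hA⟩ := exists_norm_parabolicCylinderD_le (h₂.image ha)
      (by rintro _ ⟨ν, hν, rfl⟩; exact hai ν hν) (2 * (|Y| + 1))
    obtain ⟨B, hB⟩ := hS.exists_bound_of_continuousOn hG
    refine ⟨|B| * A, fun y hy ν hν l hl => ?_⟩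
    rw [hm y hy ν hν l hl, norm_mul]
    refine mul_le_mul ((hB (y, ν, l) ⟨hy, hν, by simpa using hl.le⟩).trans (le_abs_self _))
      (hA _ ⟨ν, hν, rfl⟩ _ ?_) (norm_nonneg _) (abs_nonneg _)
    rw [norm_mul, norm_mul, hc, one_mul, Complex.norm_real, Real.norm_of_nonneg (by positivity)]
    have hyn : ‖(y : ℂ)‖ ≤ |Y| := by rw [Complex.norm_real]; exact (hY y hy).trans (le_abs_self _)
    have : Real.sqrt 2 ≤ 2 := Real.sqrt_le_iff.2 (by norm_num)
    have := norm_add_le (y : ℂ) l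
    exact mul_le_mul ‹_› (by linarith) (norm_nonneg _) (by norm_num)
  have c2 : ∀ g : ℝ × ℂ × ℂ → ℂ, Continuous g → ContinuousOn (fun q => (2 : ℂ) ^ g q) S :=
    fun g hg => (hg.const_cpow (Or.inl two_ne_zero)).continuousOn
  fin_cases k
  · fin_cases i
    · refine key (fun ν => -(Complex.I * ν)) (1 * Complex.I)
        (fun q => Complex.exp (-(q.1 : ℂ) ^ 2 / 2) * Complex.exp (-(1 * Real.pi * q.2.1 / 2)) *
          2 ^ (Complex.I * q.2.1 / 2) * Complex.exp (-(q.2.2 ^ 2 / 2 + q.1 * q.2.2)))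
        (by fun_prop) (fun ν hν => ne_int_neg (hα ν hν)) (by simp)
        (((by fun_prop : ContinuousOn _ S).mul (c2 _ (by fun_prop))).mul (by fun_prop))
        fun y hy ν hν l hl => ?_
      refine (mY_of_norm_lt_one hl y ν 0).1.trans ?_
      simp only [psiCol₁, Matrix.cons_val_zero]
      ring
    · refine key (fun ν => -(Complex.I * ν) - 1) (1 * Complex.I)
        (fun q => Complex.exp ((q.1 : ℂ) ^ 2 / 2) * (1 * (Real.sqrt 2 : ℂ) / betaY q.2.1 * q.2.1 *
          Complex.exp (-(1 * Real.pi * q.2.1 / 2))) *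
          2 ^ (Complex.I * q.2.1 / 2) * Complex.exp (-(q.2.2 ^ 2 / 2 + q.1 * q.2.2)))
        (by fun_prop) (fun ν hν => ne_int_sub_one (ne_int_neg (hα ν hν))) (by simp)
        ((((by fun_prop : ContinuousOn _ S).mul (((ContinuousOn.div (by fun_prop) hβ hβ0).mul
          (by fun_prop)).mul (by fun_prop))).mul (c2 _ (by fun_prop))).mul (by fun_prop))
        fun y hy ν hν l hl => ?_
      refine (mY_of_norm_lt_one hl y ν 1).1.trans ?_
      simp only [psiCol₁, Matrix.cons_val_one, Matrix.cons_val_fin_one]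
      ring
  · fin_cases i
    · refine key (fun ν => Complex.I * ν - 1) 1
        (fun q => Complex.exp (-(q.1 : ℂ) ^ 2 / 2) * (-(1 * betaY q.2.1 / (Real.sqrt 2 : ℂ)) *
          Complex.exp (-((1 - 1) / 2 * Real.pi * q.2.1))) *
          2 ^ (-(Complex.I * q.2.1 / 2)) * Complex.exp (q.2.2 ^ 2 / 2 + q.1 * q.2.2))
        (by fun_prop) (fun ν hν => ne_int_sub_one (hα ν hν)) (by simp)
        ((((by fun_prop : ContinuousOn _ S).mul ((((continuousOn_const.mul hβ).div_const _).neg).mul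
          (by fun_prop))).mul (c2 _ (by fun_prop))).mul (by fun_prop))
        fun y hy ν hν l hl => ?_
      refine (mY_of_norm_lt_one hl y ν 0).2.trans ?_
      simp only [psiCol₂, Matrix.cons_val_zero]
      ring
    · refine key (fun ν => Complex.I * ν) 1
        (fun q => Complex.exp ((q.1 : ℂ) ^ 2 / 2) * 
          Complex.exp (-((1 - 1) / 2 * Real.pi * q.2.1)) *
          2 ^ (-(Complex.I * q.2.1 / 2)) * Complex.exp (q.2.2 ^ 2 / 2 + q.1 * q.2.2))
        (by fun_prop) (fun ν hν => hα ν hν) (by simp)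
        (((by fun_prop : ContinuousOn _ S).mul (c2 _ (by fun_prop))).mul (by fun_prop))
        fun y hy ν hν l hl => ?_
      refine (mY_of_norm_lt_one hl y ν 1).2.trans ?_
      simp only [psiCol₂, Matrix.cons_val_one, Matrix.cons_val_fin_one]
      ring

theorem exists_norm_mY_le {K₁ : Set ℝ} {K₂ : Set ℂ} (h₁ : IsCompact K₁) (h₂ : IsCompact K₂)
    (hK : ∀ ν ∈ K₂, ∀ n : ℤ, ν ≠ Complex.I * n) :
    ∃ C : ℝ, ∀ y ∈ K₁, ∀ ν ∈ K₂, ∀ l ∈ contourYᶜ, ∀ i k : Fin 2, ‖mY y ν l i k‖ ≤ C := by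
  obtain ⟨C, hC0, hC⟩ := exists_norm_mY_sub_le h₁ h₂ hK
  obtain ⟨M, hM0, hM⟩ := exists_norm_m1Y_le h₁ h₂ hK
  choose D hD using fun i k => exists_norm_mY_le_of_norm_lt_one h₁ h₂ hK i k
  refine ⟨∑ i, ∑ k, |D i k| + (C + 1 + M), fun y hy ν hν l hl i k => ?_⟩
  rcases lt_or_ge ‖l‖ 1 with h | h
  · have a : ‖mY y ν l i k‖ ≤ ∑ i, ∑ k, |D i k| := by
      calc _ ≤ |D i k| := (hD i k y hy ν hν l h).trans (le_abs_self _)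
        _ ≤ ∑ k, |D i k| := Finset.single_le_sum (f := fun k => |D i k|)
            (fun k _ => abs_nonneg _) (Finset.mem_univ k)
        _ ≤ _ := Finset.single_le_sum (f := fun i => ∑ k, |D i k|)
            (fun i _ => by positivity) (Finset.mem_univ i)
    linarith
  · have a := hC y hy ν hν l hl h i k
    have h0 : 0 < ‖l‖ := by linarith
    have b : C / ‖l‖ ^ 2 ≤ C := div_le_self hC0 (by nlinarith)
    have c : ‖(1 : Matrix (Fin 2) (Fin 2) ℂ) i k‖ ≤ 1 := by
      rw [Matrix.one_apply]; split_ifs <;> simp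
    have d : ‖m1Y y ν i k / l‖ ≤ M := by
      rw [norm_div]
      exact (div_le_self (norm_nonneg _) h).trans (hM y hy ν hν i k)
    have e : 0 ≤ ∑ i, ∑ k, |D i k| := by positivity
    have := norm_le_insert' (mY y ν l i k) ((1 : Matrix (Fin 2) (Fin 2) ℂ) i k + m1Y y ν i k / l)
    have := norm_add_le ((1 : Matrix (Fin 2) (Fin 2) ℂ) i k) (m1Y y ν i k / l)
    linarith


/-! ### Analyticity and determinant of the solution. -/

theorem differentiable_psiCol {ν : ℂ} (hν : ∀ n : ℤ, ν ≠ Complex.I * n) (y : ℝ) (e : ℂ)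
    (i : Fin 2) :
    Differentiable ℂ (fun l => psiCol₁ y ν e l i) ∧
      Differentiable ℂ (fun l => psiCol₂ y ν e l i) := by
  have hα := ne_int_of_ne_I_mul hν
  have h1 := differentiable_parabolicCylinderD hα
  have h2 := differentiable_parabolicCylinderD (ne_int_neg hα)
  have h3 := differentiable_parabolicCylinderD (ne_int_sub_one hα)
  have h4 := differentiable_parabolicCylinderD (ne_int_sub_one (ne_int_neg hα))
  fin_cases i <;> simp only [psiCol₁, psiCol₂, Fin.zero_eta, Fin.mk_one, Fin.isValue,
      Matrix.cons_val_zero, Matrix.cons_val_one, Matrix.cons_val_fin_one] <;>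
    constructor <;> fun_prop

theorem continuous_psiY {ν : ℂ} (hν : ∀ n : ℤ, ν ≠ Complex.I * n) (y : ℝ) :
    Continuous (psiY y ν) := by
  have h := fun i => differentiable_psiCol hν y 1 i
  refine continuous_matrix fun i k => ?_
  simp only [psiY_eq]
  fin_cases i <;> fin_cases k
  · exact (h 0).1.continuous
  · exact (h 0).2.continuous
  · exact (h 1).1.continuous
  · exact (h 1).2.continuous

theorem differentiableAt_outerY {ν : ℂ} (hν : ∀ n : ℤ, ν ≠ Complex.I * n) (y : ℝ) {l e₁ e₂ : ℂ}
    (hl₁ : 0 < (e₁ * Complex.I * l).re) (hl₂ : 0 < (e₂ * l).re) (i k : Fin 2) :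
    DifferentiableAt ℂ (fun l => outerY y ν e₁ e₂ l i k) l := by
  have hl : l ≠ 0 := by rintro rfl; simp at hl₂
  have hα := ne_int_of_ne_I_mul hν
  have key : ∀ a w e : ℂ, (∀ n : ℤ, a ≠ n) → 0 < (e * l).re →
      DifferentiableAt ℂ (fun l => pcNormalized a w (e * l)) l := fun a w e ha he =>
    (differentiableAt_pcNormalized ha he).comp l (f := fun l => e * l) (by fun_prop)
  have h1 := fun w => key _ w e₂ hα hl₂
  have h2 := fun w => key _ w (e₁ * Complex.I) (ne_int_neg hα) hl₁
  have h3 := fun w => key _ w e₂ (ne_int_sub_one hα) hl₂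
  have h4 := fun w => key _ w (e₁ * Complex.I) (ne_int_sub_one (ne_int_neg hα)) hl₁
  fin_cases i <;> fin_cases k <;> simp only [outerY, Fin.zero_eta, Fin.mk_one, Fin.isValue,
    Matrix.of_apply, Matrix.cons_val', Matrix.cons_val_zero, Matrix.cons_val_one,
    Matrix.cons_val_fin_one]
  · exact h2 _
  · exact ((h3 _).const_mul _).div differentiableAt_id hl
  · exact ((h4 _).const_mul _).div differentiableAt_id hl
  · exact h1 _

theorem differentiableAt_mY {ν : ℂ} (hν : ∀ n : ℤ, ν ≠ Complex.I * n) (y : ℝ) {l : ℂ}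
    (hl : l ∉ contourY) (i k : Fin 2) : DifferentiableAt ℂ (fun l => mY y ν l i k) l := by
  rcases (notMem_contourY_iff l).1 hl with h | ⟨h, hre, him⟩
  · have hev : ∀ᶠ z in 𝓝 l, ‖z‖ < 1 := continuous_norm.continuousAt.eventually_lt_const h
    obtain ⟨h1, h2⟩ := differentiable_psiCol hν y 1 i
    fin_cases k
    · refine DifferentiableAt.congr_of_eventuallyEq (f := fun l =>
        psiCol₁ y ν 1 l i * Complex.exp (-(l ^ 2 / 2 + y * l))) (by fun_prop) ?_
      filter_upwards [hev] with z hz using (mY_of_norm_lt_one hz y ν i).1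
    · refine DifferentiableAt.congr_of_eventuallyEq (f := fun l =>
        psiCol₂ y ν 1 l i * Complex.exp (l ^ 2 / 2 + y * l)) (by fun_prop) ?_
      filter_upwards [hev] with z hz using (mY_of_norm_lt_one hz y ν i).2
  · obtain ⟨e₁, e₂, he₁, he₂, p1, p2⟩ := exists_signs hre him
    refine DifferentiableAt.congr_of_eventuallyEq (differentiableAt_outerY hν y p1 p2 i k) ?_
    have c0 : ∀ᶠ z in 𝓝 l, 1 < ‖z‖ := continuous_norm.continuousAt.eventually_const_lt h
    have c1 : ∀ᶠ z in 𝓝 l, 0 < (e₁ * Complex.I * z).re :=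
      Filter.Tendsto.eventually_const_lt p1 (Continuous.tendsto (by fun_prop) l)
    have c2 : ∀ᶠ z in 𝓝 l, 0 < (e₂ * z).re :=
      Filter.Tendsto.eventually_const_lt p2 (Continuous.tendsto (by fun_prop) l)
    filter_upwards [c0, c1, c2] with z z0 z1 z2
    rw [mY_eq_outerY hν y he₁ he₂ z0.le z1 z2]

theorem det_expSigma3 (a : ℂ) : (expSigma3 a).det = 1 := by
  rw [expSigma3, Matrix.det_fin_two_of, ← Complex.exp_add]
  simp

/-- This is the Wronskian relation of order `iν` at `√2(y+λ)`; the prefactor `e^{-πν/2}` of the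
first column is the inverse of its right-hand side. It makes the solution invertible in the
uniqueness proof. -/
theorem det_psiY {ν : ℂ} (hν : ∀ n : ℤ, ν ≠ Complex.I * n) (y : ℝ) (l : ℂ) :
    (psiY y ν l).det = 1 := by
  have hw := parabolicCylinderD_wronskian (ne_int_of_ne_I_mul hν) ((Real.sqrt 2 : ℂ) * (y + l))
  have hβ := betaY_ne_zero hν
  have r0 : (Real.sqrt 2 : ℂ) ≠ 0 := Complex.ofReal_ne_zero.2 (by positivity)
  have hI := Complex.I_sq
  have he : Complex.exp (-(Real.pi * ν / 2)) *
      Complex.exp (-(Complex.I * Real.pi * (Complex.I * ν) / 2)) = 1 := by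
    rw [← Complex.exp_add, ← Complex.exp_zero]
    congr 1
    linear_combination (-Real.pi * ν / 2) * hI
  rw [← hw] at he
  have m1 : -Complex.I * ν = -(Complex.I * ν) := by ring
  rw [psiY]
  rw [Matrix.det_mul, Matrix.det_mul, det_expSigma3, det_expSigma3, Matrix.det_fin_two_of, one_mul,
    mul_one, m1, mul_assoc Complex.I]
  refine Eq.trans ?_ he
  generalize (Real.sqrt 2 : ℂ) * (y + l) = z at *
  generalize parabolicCylinderD (-(Complex.I * ν)) (Complex.I * z) = A
  generalize parabolicCylinderD (Complex.I * ν) z = B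
  generalize parabolicCylinderD (-(Complex.I * ν) - 1) (Complex.I * z) = C
  generalize parabolicCylinderD (Complex.I * ν - 1) z = D
  generalize betaY ν = β at *
  generalize (Real.sqrt 2 : ℂ) = r at *
  generalize Complex.exp (-(Real.pi * ν / 2)) = s at *
  field_simp
  linear_combination (s * ν * C * D) * hI

theorem det_sectorFactor (ν l : ℂ) : (sectorFactor ν l).det = 1 := by
  rw [sectorFactor]
  split_ifs <;> (try rw [Matrix.det_mul, Matrix.det_mul, Matrix.det_nonsing_inv]) <;> simp

theorem det_mY {ν : ℂ} (hν : ∀ n : ℤ, ν ≠ Complex.I * n) (y : ℝ) (l : ℂ) :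
    (mY y ν l).det = 1 := by
  rw [mY]
  split_ifs <;> simp only [Matrix.det_mul, det_psiY hν, det_expSigma3, det_sectorFactor, powSigma3,
    mul_one]

theorem exists_norm_mY_sub_one_le {ν : ℂ} (hν : ∀ n : ℤ, ν ≠ Complex.I * n) (y : ℝ) :
    ∃ C : ℝ, 0 ≤ C ∧ ∀ l ∉ contourY, ∀ i k : Fin 2,
      ‖mY y ν l i k - (1 : Matrix (Fin 2) (Fin 2) ℂ) i k‖ ≤ C ∧ (1 ≤ ‖l‖ →
      ‖mY y ν l i k - (1 : Matrix (Fin 2) (Fin 2) ℂ) i k‖ ≤ C / ‖l‖) := by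
  have hK : ∀ ν' ∈ ({ν} : Set ℂ), ∀ n : ℤ, ν' ≠ Complex.I * n := by rintro _ rfl; exact hν
  obtain ⟨A, hA0, hA⟩ := exists_norm_mY_sub_le (isCompact_singleton (x := y)) isCompact_singleton hK
  obtain ⟨M, hM0, hM⟩ := exists_norm_m1Y_le (isCompact_singleton (x := y)) isCompact_singleton hK
  obtain ⟨B, hB⟩ := exists_norm_mY_le (isCompact_singleton (x := y)) isCompact_singleton hK
  refine ⟨A + M + (|B| + 1), by positivity, fun l hl i k => ?_⟩
  have c : ‖(1 : Matrix (Fin 2) (Fin 2) ℂ) i k‖ ≤ 1 := by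
    rw [Matrix.one_apply]; split_ifs <;> simp
  have hb : ‖mY y ν l i k - (1 : Matrix (Fin 2) (Fin 2) ℂ) i k‖ ≤ |B| + 1 :=
    (norm_sub_le _ _).trans
      (add_le_add ((hB y rfl ν rfl l hl i k).trans (le_abs_self _)) c)
  refine ⟨hb.trans (by linarith), fun h => ?_⟩
  have a := hA y rfl ν rfl l hl h i k
  have h0 : 0 < ‖l‖ := by linarith
  have a' : A / ‖l‖ ^ 2 ≤ A / ‖l‖ := div_le_div_of_nonneg_left hA0 h0 (by nlinarith)
  have d : ‖m1Y y ν i k / l‖ ≤ M / ‖l‖ := by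
    rw [norm_div]
    gcongr
    exact hM y rfl ν rfl i k
  have e : 0 ≤ (|B| + 1) / ‖l‖ := by positivity
  calc _ = ‖(mY y ν l i k - ((1 : Matrix (Fin 2) (Fin 2) ℂ) i k + m1Y y ν i k / l)) +
        m1Y y ν i k / l‖ := by congr 1; ring
    _ ≤ A / ‖l‖ + M / ‖l‖ := (norm_add_le _ _).trans (add_le_add (a.trans a') d)
    _ ≤ _ := by rw [add_div, add_div]; linarith


/-! ### The jumps -/

theorem logC_exp {w : ℂ} (h1 : -(3 * Real.pi / 4) < w.im) (h2 : w.im ≤ 5 * Real.pi / 4) :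
    logC (Complex.exp w) = w := by
  have him : (w + -(Real.pi / 4 * Complex.I)).im = w.im - Real.pi / 4 := by
    have : (Real.pi / 4 * Complex.I : ℂ) = ((Real.pi / 4 : ℝ) : ℂ) * Complex.I := by push_cast; rfl
    rw [Complex.add_im, Complex.neg_im, this]
    simp [sub_eq_add_neg]
  rw [logC, ← Complex.exp_add, Complex.log_exp (by rw [him]; linarith) (by rw [him]; linarith)]
  ring

theorem continuousAt_logC {p : ℂ} (hp : p ≠ 0) (h : (logC p).im < 5 * Real.pi / 4) :
    ContinuousAt logC p := by
  have hm : p * Complex.exp (-(Real.pi / 4 * Complex.I)) ∈ Complex.slitPlane := by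
    rw [Complex.mem_slitPlane_iff_arg]
    refine ⟨fun ha => ?_, mul_ne_zero hp (Complex.exp_ne_zero _)⟩
    rw [← Complex.log_im] at ha
    have : (Real.pi / 4 * Complex.I : ℂ) = ((Real.pi / 4 : ℝ) : ℂ) * Complex.I := by push_cast; rfl
    rw [logC, Complex.add_im, ha, this] at h
    simp at h
    linarith
  exact ((continuousAt_clog hm).comp (f := fun p => p * Complex.exp (-(Real.pi / 4 * Complex.I)))
    (by fun_prop)).add continuousAt_const

/-- The function need agree with a continuous one only inside each sector, on a neighbourhood which
may depend on the opening `κ`. At curved arcs this dependence is unavoidable. -/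
theorem hasLeftBoundaryValue_of_eq {m M : ℂ → Matrix (Fin 2) (Fin 2) ℂ} {p τ : ℂ}
    (hM : ContinuousAt M p) (h : ∀ κ > 0, ∀ᶠ z in 𝓝 p,
      κ * ‖z - p‖ < ((z - p) * (starRingEnd ℂ) τ).im → m z = M z) :
    HasLeftBoundaryValue m p τ (M p) := by
  intro κ hκ
  refine (hM.tendsto.mono_left nhdsWithin_le_nhds).congr' ?_
  filter_upwards [nhdsWithin_le_nhds (h κ hκ.1), self_mem_nhdsWithin] with z h1 h2
  exact (h1 h2).symm

/-- The continuation of the solution outside the unit circle with constant right factor `R`. -/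
noncomputable def sideY (y : ℝ) (ν : ℂ) (R : Matrix (Fin 2) (Fin 2) ℂ) (l : ℂ) :
    Matrix (Fin 2) (Fin 2) ℂ :=
  psiY y ν l * R * expSigma3 (-(l ^ 2 / 2 + y * l)) * powSigma3 l (Complex.I * ν)

theorem ContinuousAt.expSigma3 {f : ℂ → ℂ} {p : ℂ} (hf : ContinuousAt f p) :
    ContinuousAt (fun l => expSigma3 (f l)) p := by
  refine continuousAt_pi.2 fun i => continuousAt_pi.2 fun k => ?_
  fin_cases i <;> fin_cases k <;> simp only [_root_.expSigma3, Fin.zero_eta, Fin.mk_one, Fin.isValue,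
    Matrix.of_apply, Matrix.cons_val', Matrix.cons_val_zero, Matrix.cons_val_one,
    Matrix.cons_val_fin_one] <;> fun_prop

theorem continuousAt_sideY {ν : ℂ} (hν : ∀ n : ℤ, ν ≠ Complex.I * n) (y : ℝ)
    (R : Matrix (Fin 2) (Fin 2) ℂ) {p : ℂ} (hp : p ≠ 0) (h : (logC p).im < 5 * Real.pi / 4) :
    ContinuousAt (sideY y ν R) p :=
  (((continuous_psiY hν y).continuousAt.mul continuousAt_const).mul
    (ContinuousAt.expSigma3 (by fun_prop))).mul
    (ContinuousAt.expSigma3 (continuousAt_const.mul (continuousAt_logC hp h)))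

/-- The common left factor `ψ` can be dropped. What remains is rational in `d = e^{-(λ²/2+yλ)}` and
`u = λ^{iν}`, in terms of which the exponentials and powers in the ray jumps are `d^{±2}` and
`u^{±2}`. -/
theorem sideY_eq_mul {y : ℝ} {ν l : ℂ} {R R' v : Matrix (Fin 2) (Fin 2) ℂ}
    (h : ∀ d u : ℂ, d ≠ 0 → u ≠ 0 → Complex.exp (-l ^ 2 - 2 * y * l) = d ^ 2 →
      Complex.exp (l ^ 2 + 2 * y * l) = (d ^ 2)⁻¹ → powC l (2 * Complex.I * ν) = u ^ 2 →
      powC l (-2 * Complex.I * ν) = (u ^ 2)⁻¹ →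
      R * !![d, 0; 0, d⁻¹] * !![u, 0; 0, u⁻¹] = R' * !![d, 0; 0, d⁻¹] * !![u, 0; 0, u⁻¹] * v) :
    sideY y ν R l = sideY y ν R' l * v := by
  have key := h (Complex.exp (-(l ^ 2 / 2 + y * l))) (Complex.exp (Complex.I * ν * logC l))
    (Complex.exp_ne_zero _) (Complex.exp_ne_zero _)
    (by rw [← Complex.exp_nat_mul]; congr 1; push_cast; ring)
    (by rw [← Complex.exp_nat_mul, ← Complex.exp_neg]; congr 1; push_cast; ring)
    (by rw [powC, ← Complex.exp_nat_mul]; congr 1; push_cast; ring)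
    (by rw [powC, ← Complex.exp_nat_mul, ← Complex.exp_neg]; congr 1; push_cast; ring)
  simp only [sideY, powSigma3, expSigma3, Complex.exp_neg] at key ⊢
  rw [Matrix.mul_assoc, Matrix.mul_assoc, Matrix.mul_assoc, Matrix.mul_assoc, Matrix.mul_assoc,
    ← Matrix.mul_assoc R, key]
  simp only [Matrix.mul_assoc]

/-- On the circle the factor `λ^{-iνσ₃}` of the jump removes `λ^{iνσ₃}` from the outer side, so only
`d` is left. -/
theorem psiY_mul_eq_sideY_mul {y : ℝ} {ν l : ℂ} {R' w : Matrix (Fin 2) (Fin 2) ℂ}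
    (h : ∀ d : ℂ, d ≠ 0 → Complex.exp (-l ^ 2 - 2 * y * l) = d ^ 2 →
      Complex.exp (l ^ 2 + 2 * y * l) = (d ^ 2)⁻¹ →
      !![d, 0; 0, d⁻¹] = R' * !![d, 0; 0, d⁻¹] * w) :
    psiY y ν l * expSigma3 (-(l ^ 2 / 2 + y * l)) =
      sideY y ν R' l * (powSigma3 l (-Complex.I * ν) * w) := by
  have key := h (Complex.exp (-(l ^ 2 / 2 + y * l))) (Complex.exp_ne_zero _)
    (by rw [← Complex.exp_nat_mul]; congr 1; push_cast; ring)
    (by rw [← Complex.exp_nat_mul, ← Complex.exp_neg]; congr 1; push_cast; ring)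
  have hP : powSigma3 l (Complex.I * ν) * powSigma3 l (-Complex.I * ν) = 1 := by
    simp only [powSigma3, expSigma3]
    ext i k
    fin_cases i <;> fin_cases k <;> simp [Matrix.mul_apply, Fin.sum_univ_two, ← Complex.exp_add]
  rw [sideY, Matrix.mul_assoc _ (powSigma3 _ _), ← Matrix.mul_assoc (powSigma3 _ _), hP,
    Matrix.one_mul, Matrix.mul_assoc, Matrix.mul_assoc]
  simp only [expSigma3, Complex.exp_neg] at key ⊢
  rw [← Matrix.mul_assoc R', ← key]

/-- The four jumps across the rays. -/
theorem jump_ray {ν : ℂ} (hν : ∀ n : ℤ, ν ≠ Complex.I * n) (y : ℝ) {j : Fin 9} {p τ : ℂ}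
    (hp : 1 < ‖p‖) (hlog : (logC p).im < 5 * Real.pi / 4)
    {Rp Rm : Matrix (Fin 2) (Fin 2) ℂ}
    (hl : ∀ᶠ z in 𝓝 p, 0 < ((z - p) * (starRingEnd ℂ) τ).im → sectorFactor ν z = Rp)
    (hr : ∀ᶠ z in 𝓝 p, ((z - p) * (starRingEnd ℂ) τ).im < 0 → sectorFactor ν z = Rm)
    (h : sideY y ν Rp p = sideY y ν Rm p * jumpY y ν j p) :
    ∃ mplus mminus : Matrix (Fin 2) (Fin 2) ℂ,
      HasLeftBoundaryValue (mY y ν) p τ mplus ∧ HasLeftBoundaryValue (mY y ν) p (-τ) mminus ∧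
      mplus = mminus * jumpY y ν j p := by
  have hp0 : p ≠ 0 := norm_pos_iff.1 (by linarith)
  have hn : ∀ᶠ z in 𝓝 p, 1 < ‖z‖ := continuous_norm.continuousAt.eventually_const_lt hp
  refine ⟨_, _, hasLeftBoundaryValue_of_eq (continuousAt_sideY hν y Rp hp0 hlog) fun κ hκ => ?_,
    hasLeftBoundaryValue_of_eq (continuousAt_sideY hν y Rm hp0 hlog) fun κ hκ => ?_, h⟩
  · filter_upwards [hn, hl] with z h1 h2 h3
    rw [mY, if_neg h1.not_gt, h2 (lt_of_le_of_lt (by positivity) h3), sideY]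
  · filter_upwards [hn, hr] with z h1 h2 h3
    have h4 : 0 < ((z - p) * (starRingEnd ℂ) (-τ)).im := lt_of_le_of_lt (by positivity) h3
    rw [map_neg, mul_neg, Complex.neg_im] at h4
    rw [mY, if_neg h1.not_gt, h2 (by linarith), sideY]

/-- The jumps across the arcs of the unit circle. -/
theorem jump_circle {ν : ℂ} (hν : ∀ n : ℤ, ν ≠ Complex.I * n) (y : ℝ) {j : Fin 9} {p : ℂ}
    (hp : ‖p‖ = 1) (hlog : (logC p).im < 5 * Real.pi / 4)
    {R : Matrix (Fin 2) (Fin 2) ℂ} (hr : ∀ᶠ z in 𝓝 p, sectorFactor ν z = R)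
    (h : psiY y ν p * expSigma3 (-(p ^ 2 / 2 + y * p)) = sideY y ν R p * jumpY y ν j p) :
    ∃ mplus mminus : Matrix (Fin 2) (Fin 2) ℂ,
      HasLeftBoundaryValue (mY y ν) p (p * Complex.I) mplus ∧
      HasLeftBoundaryValue (mY y ν) p (-(p * Complex.I)) mminus ∧
      mplus = mminus * jumpY y ν j p := by
  have hp0 : p ≠ 0 := norm_pos_iff.1 (by rw [hp]; norm_num)
  have hpp : p.re ^ 2 + p.im ^ 2 = 1 := by
    have := Complex.sq_norm p
    rw [hp, Complex.normSq_apply] at this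
    nlinarith
  -- Expansion of `|p + (z - p)|²`. In the left sector the imaginary part exceeds `κ|z - p|`, so
  -- `|z| < 1` as soon as `|z - p| < 2κ`. In the right sector `|z| ≥ 1` holds without restriction.
  have key : ∀ z : ℂ, ‖z‖ ^ 2 = 1 - 2 * ((z - p) * (starRingEnd ℂ) (p * Complex.I)).im +
      ‖z - p‖ ^ 2 := fun z => by
    rw [Complex.sq_norm, Complex.sq_norm, Complex.normSq_apply, Complex.normSq_apply]
    simp
    nlinarith
  refine ⟨_, _, hasLeftBoundaryValue_of_eq (M := fun l => psiY y ν l *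
      expSigma3 (-(l ^ 2 / 2 + y * l))) ?_ fun κ hκ => ?_,
    hasLeftBoundaryValue_of_eq (continuousAt_sideY hν y R hp0 hlog) fun κ hκ => ?_, h⟩
  · exact (continuous_psiY hν y).continuousAt.mul (ContinuousAt.expSigma3 (by fun_prop))
  · have hd : ∀ᶠ z in 𝓝 p, ‖z - p‖ < 2 * κ :=
      Filter.Tendsto.eventually_lt_const (v := ‖p - p‖) (by simpa using hκ)
        (Continuous.tendsto (by fun_prop) p)
    filter_upwards [hd] with z h1 h2
    have := key z
    have h3 : ‖z‖ < 1 := by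
      rw [← sq_lt_one_iff₀ (norm_nonneg _)]
      nlinarith [norm_nonneg (z - p)]
    rw [mY, if_pos h3]
  · filter_upwards [hr] with z h1 h2
    rw [map_neg, mul_neg, Complex.neg_im] at h2
    have := key z
    have h3 : 1 ≤ ‖z‖ := by
      rw [← one_le_sq_iff₀ (norm_nonneg _)]
      nlinarith [norm_nonneg (z - p)]
    rw [mY, if_neg h3.not_gt, h1, sideY]


theorem inv_lowerUnipotent (p : ℂ) :
    (!![1, 0; p, 1] : Matrix (Fin 2) (Fin 2) ℂ)⁻¹ = !![1, 0; -p, 1] := by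
  apply Matrix.inv_eq_right_inv
  ext i k
  fin_cases i <;> fin_cases k <;> simp [Matrix.mul_apply, Fin.sum_univ_two]

theorem sideY_jump_ray (y : ℝ) (ν l : ℂ) :
    sideY y ν (!![1, 0; rhoSq ν / (1 + rhoSq ν), 1]) l = sideY y ν 1 l * jumpY y ν 0 l ∧
    sideY y ν (!![1, 0; rhoSq ν / (1 + rhoSq ν), 1] * !![1, -1; 0, 1]) l =
      sideY y ν (!![1, 0; rhoSq ν / (1 + rhoSq ν), 1]) l * jumpY y ν 1 l ∧
    sideY y ν (!![1, 0; rhoSq ν / (1 + rhoSq ν), 1] * !![1, -1; 0, 1]) l =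
      sideY y ν (!![1, 0; rhoSq ν / (1 + rhoSq ν), 1] * !![1, -1; 0, 1] *
        (!![1, 0; rhoSq ν, 1])⁻¹) l * jumpY y ν 2 l ∧
    sideY y ν (!![1, -(1 + rhoSq ν); 0, 1]) l = sideY y ν 1 l * jumpY y ν 3 l := by
  have h1 : 1 + rhoSq ν ≠ 0 := by rw [one_add_rhoSq]; exact Complex.exp_ne_zero _
  rw [inv_lowerUnipotent]
  refine ⟨sideY_eq_mul ?_, sideY_eq_mul ?_, sideY_eq_mul ?_, sideY_eq_mul ?_⟩ <;>
    intro d u hd hu e1 e2 e3 e4 <;>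
    simp only [jumpY, e1, e2, e3, e4] <;>
    ext i k <;> fin_cases i <;> fin_cases k <;>
    simp [Matrix.mul_apply, Fin.sum_univ_two] <;> field_simp <;> ring

theorem psiY_jump_circle (y : ℝ) (ν l : ℂ) :
    psiY y ν l * expSigma3 (-(l ^ 2 / 2 + y * l)) = sideY y ν 1 l * jumpY y ν 4 l ∧
    psiY y ν l * expSigma3 (-(l ^ 2 / 2 + y * l)) =
      sideY y ν (!![1, 0; rhoSq ν / (1 + rhoSq ν), 1]) l * jumpY y ν 5 l ∧
    psiY y ν l * expSigma3 (-(l ^ 2 / 2 + y * l)) =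
      sideY y ν (!![1, 0; rhoSq ν / (1 + rhoSq ν), 1] * !![1, -1; 0, 1]) l * jumpY y ν 6 l ∧
    psiY y ν l * expSigma3 (-(l ^ 2 / 2 + y * l)) =
      sideY y ν (!![1, 0; rhoSq ν / (1 + rhoSq ν), 1] * !![1, -1; 0, 1] *
        (!![1, 0; rhoSq ν, 1])⁻¹) l * jumpY y ν 7 l ∧
    psiY y ν l * expSigma3 (-(l ^ 2 / 2 + y * l)) =
      sideY y ν (!![1, -(1 + rhoSq ν); 0, 1]) l * jumpY y ν 8 l := by
  have h1 : 1 + rhoSq ν ≠ 0 := by rw [one_add_rhoSq]; exact Complex.exp_ne_zero _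
  rw [inv_lowerUnipotent]
  have h4 : jumpY y ν 4 l = powSigma3 l (-Complex.I * ν) * 1 := by rw [Matrix.mul_one]; rfl
  rw [h4]
  refine ⟨psiY_mul_eq_sideY_mul ?_, psiY_mul_eq_sideY_mul ?_, psiY_mul_eq_sideY_mul ?_,
    psiY_mul_eq_sideY_mul ?_, psiY_mul_eq_sideY_mul ?_⟩ <;>
    intro d hd e1 e2 <;> (try rw [e1]) <;> (try rw [e2]) <;>
    ext i k <;> fin_cases i <;> fin_cases k <;>
    simp [Matrix.mul_apply, Fin.sum_univ_two] <;>
    first | (field_simp <;> ring1) | (field_simp; simp)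


theorem logC_im_mul_exp {r θ : ℝ} (hr : 0 < r) (h1 : -(3 * Real.pi / 4) < θ)
    (h2 : θ ≤ 5 * Real.pi / 4) : (logC (r * Complex.exp (θ * Complex.I))).im = θ := by
  have : (r : ℂ) * Complex.exp (θ * Complex.I) =
      Complex.exp ((Real.log r : ℂ) + θ * Complex.I) := by
    rw [Complex.exp_add, ← Complex.ofReal_exp, Real.exp_log hr]
  rw [this, logC_exp (by simpa using h1) (by simpa using h2)]
  simp

theorem eventually_logC_im_mem {p : ℂ} (hp : p ≠ 0) (h : (logC p).im < 5 * Real.pi / 4) {a b : ℝ}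
    (ha : a < (logC p).im) (hb : (logC p).im < b) : ∀ᶠ z in 𝓝 p, (logC z).im ∈ Ioo a b :=
  (Complex.continuous_im.continuousAt.comp (continuousAt_logC hp h)).eventually
    (isOpen_Ioo.mem_nhds ⟨ha, hb⟩)

/-- The endpoints of an arc form a null set and are discarded. At interior points of a ray the
sector factor is constant on each side, and at interior points of a circular arc it is constant in a
full neighbourhood. The discontinuity of `logC` on the circle lies at an endpoint. -/
theorem jump_mY {ν : ℂ} (hν : ∀ n : ℤ, ν ≠ Complex.I * n) (y : ℝ) (j : Fin 9) :
    ∀ᵐ s ∂(volume.restrict (arcY j).dom), ∃ mplus mminus : Matrix (Fin 2) (Fin 2) ℂ,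
      HasLeftBoundaryValue (mY y ν) ((arcY j).param s) (deriv (arcY j).param s) mplus ∧
      HasLeftBoundaryValue (mY y ν) ((arcY j).param s) (-deriv (arcY j).param s) mminus ∧
      mplus = mminus * jumpY y ν j ((arcY j).param s) := by
  have hpi := Real.pi_pos
  have d1 : ∀ s : ℝ, deriv (fun s : ℝ => (s : ℂ)) s = 1 := fun s =>
    (Complex.ofRealCLM.hasDerivAt (x := s)).deriv
  have d2 : ∀ s : ℝ, deriv (fun s : ℝ => (s : ℂ) * Complex.I) s = Complex.I := fun s => by
    simpa using ((Complex.ofRealCLM.hasDerivAt (x := s)).mul_const Complex.I).deriv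
  have d3 : ∀ s : ℝ, deriv (fun s : ℝ => Complex.exp (s * Complex.I)) s =
      Complex.exp (s * Complex.I) * Complex.I := fun s => by
    simpa using ((Complex.ofRealCLM.hasDerivAt (x := s)).mul_const Complex.I).cexp.deriv
  have x0 : ∀ s : ℝ, (s : ℂ) = (s : ℝ) * Complex.exp ((0 : ℝ) * Complex.I) := by simp
  have x1 : ∀ s : ℝ, (s : ℂ) * Complex.I = (s : ℝ) * Complex.exp ((Real.pi / 2 : ℝ) * Complex.I) := by
    intro s
    rw [Complex.exp_mul_I, ← Complex.ofReal_cos, ← Complex.ofReal_sin]; simp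
  have x2 : ∀ s : ℝ, (s : ℂ) = (-s : ℝ) * Complex.exp (Real.pi * Complex.I) := by simp
  have x3 : ∀ s : ℝ, (s : ℂ) * Complex.I =
      (-s : ℝ) * Complex.exp ((-(Real.pi / 2) : ℝ) * Complex.I) := by
    intro s
    rw [Complex.exp_mul_I, ← Complex.ofReal_cos, ← Complex.ofReal_sin]; simp
  have hI : ∀ z : ℂ, (z * (starRingEnd ℂ) Complex.I).im = -z.re := fun z => by simp
  have hone : ∀ z : ℂ, (z * (starRingEnd ℂ) 1).im = z.im := fun z => by simp
  have hcirc : ∀ (j : Fin 9) (a b : ℝ) (R : Matrix (Fin 2) (Fin 2) ℂ),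
      -(3 * Real.pi / 4) ≤ a → b ≤ 5 * Real.pi / 4 →
      (∀ z : ℂ, (logC z).im ∈ Ioo a b → sectorFactor ν z = R) →
      (∀ p, psiY y ν p * expSigma3 (-(p ^ 2 / 2 + y * p)) = sideY y ν R p * jumpY y ν j p) →
      ∀ᵐ s : ℝ ∂(volume.restrict (Icc a b)), ∃ mplus mminus : Matrix (Fin 2) (Fin 2) ℂ,
        HasLeftBoundaryValue (mY y ν) (Complex.exp (s * Complex.I))
          (deriv (fun s : ℝ => Complex.exp (s * Complex.I)) s) mplus ∧
        HasLeftBoundaryValue (mY y ν) (Complex.exp (s * Complex.I))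
          (-deriv (fun s : ℝ => Complex.exp (s * Complex.I)) s) mminus ∧
        mplus = mminus * jumpY y ν j (Complex.exp (s * Complex.I)) := by
    intro j a b R ha hb hR hj
    rw [← restrict_Ioo_eq_restrict_Icc]
    refine ae_restrict_of_forall_mem measurableSet_Ioo fun s hs => ?_
    have him : (logC (Complex.exp (s * Complex.I))).im = s := by
      simpa using logC_im_mul_exp one_pos (lt_of_le_of_lt ha hs.1) (hs.2.le.trans hb)
    have hlt : (logC (Complex.exp (s * Complex.I))).im < 5 * Real.pi / 4 := by
      rw [him]; linarith [hs.2]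
    rw [d3]
    refine jump_circle hν y (Complex.norm_exp_ofReal_mul_I s) hlt ?_ (hj _)
    exact (eventually_logC_im_mem (Complex.exp_ne_zero _) hlt (by rw [him]; exact hs.1)
      (by rw [him]; exact hs.2)).mono hR
  fin_cases j
  · change ∀ᵐ s ∂(volume.restrict (Ici (1 : ℝ))), _
    rw [← restrict_Ioi_eq_restrict_Ici]
    refine ae_restrict_of_forall_mem measurableSet_Ioi fun s hs => ?_
    have hs0 : 0 < s := one_pos.trans hs
    have him : (logC (s : ℂ)).im = 0 := by
      rw [x0]; exact logC_im_mul_exp hs0 (by linarith) (by linarith)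
    have hlt : (logC (s : ℂ)).im < 5 * Real.pi / 4 := by rw [him]; linarith
    have hev := eventually_logC_im_mem (Complex.ofReal_ne_zero.2 hs0.ne') hlt
      (a := -(Real.pi / 2)) (b := Real.pi / 2) (by rw [him]; linarith) (by rw [him]; linarith)
    change ∃ mplus mminus : Matrix (Fin 2) (Fin 2) ℂ,
      HasLeftBoundaryValue (mY y ν) (s : ℂ) (deriv (fun s : ℝ => (s : ℂ)) s) mplus ∧
      HasLeftBoundaryValue (mY y ν) (s : ℂ) (-deriv (fun s : ℝ => (s : ℂ)) s) mminus ∧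
      mplus = mminus * jumpY y ν 0 (s : ℂ)
    rw [d1]
    refine jump_ray hν y (by rw [Complex.norm_real, Real.norm_of_nonneg hs0.le]; exact hs) hlt ?_ ?_
      (sideY_jump_ray y ν _).1
    · filter_upwards [hev] with z h1 h2
      rw [hone, Complex.sub_im, Complex.ofReal_im, sub_zero] at h2
      have := logC_im_pos_of_im_pos h2
      rw [sectorFactor, if_neg (by linarith [h1.1]), if_neg (by linarith), if_pos h1.2]
    · filter_upwards [hev] with z h1 h2
      rw [hone, Complex.sub_im, Complex.ofReal_im, sub_zero] at h2
      have := (logC_im_of_im_neg h2).resolve_right (by linarith [h1.2])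
      rw [sectorFactor, if_neg (by linarith [h1.1]), if_pos (by linarith)]
  · change ∀ᵐ s ∂(volume.restrict (Ici (1 : ℝ))), _
    rw [← restrict_Ioi_eq_restrict_Ici]
    refine ae_restrict_of_forall_mem measurableSet_Ioi fun s hs => ?_
    have hs0 : 0 < s := one_pos.trans hs
    have him : (logC (s * Complex.I)).im = Real.pi / 2 := by
      rw [x1]; exact logC_im_mul_exp hs0 (by linarith) (by linarith)
    have hlt : (logC (s * Complex.I)).im < 5 * Real.pi / 4 := by rw [him]; linarith
    have hev := eventually_logC_im_mem
      (mul_ne_zero (Complex.ofReal_ne_zero.2 hs0.ne') Complex.I_ne_zero) hlt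
      (a := 0) (b := Real.pi) (by rw [him]; linarith) (by rw [him]; linarith)
    change ∃ mplus mminus : Matrix (Fin 2) (Fin 2) ℂ,
      HasLeftBoundaryValue (mY y ν) (s * Complex.I) (deriv (fun s : ℝ => s * Complex.I) s) mplus ∧
      HasLeftBoundaryValue (mY y ν) (s * Complex.I) (-deriv (fun s : ℝ => s * Complex.I) s) mminus ∧
      mplus = mminus * jumpY y ν 1 (s * Complex.I)
    rw [d2]
    refine jump_ray hν y (by simpa [abs_of_pos hs0] using hs) hlt ?_ ?_
      (sideY_jump_ray y ν _).2.1
    · filter_upwards [hev] with z h1 h2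
      rw [hI, Complex.sub_re, Complex.re_ofReal_mul, Complex.I_re, mul_zero, sub_zero] at h2
      have := (logC_im_of_re_neg (l := z) (by linarith)).resolve_left (by linarith [h1.1])
      rw [sectorFactor, if_neg (by linarith), if_neg (by linarith), if_neg (by linarith),
        if_pos h1.2]
    · filter_upwards [hev] with z h1 h2
      rw [hI, Complex.sub_re, Complex.re_ofReal_mul, Complex.I_re, mul_zero, sub_zero] at h2
      have := logC_im_of_re_pos (l := z) (by linarith)
      rw [sectorFactor, if_neg (by linarith), if_neg (by linarith [h1.1]), if_pos (by linarith)]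
  · change ∀ᵐ s ∂(volume.restrict (Iic (-1 : ℝ))), _
    rw [← restrict_Iio_eq_restrict_Iic]
    refine ae_restrict_of_forall_mem measurableSet_Iio fun s hs => ?_
    have hs0 : 0 < -s := by have : s < -1 := hs; linarith
    have him : (logC (s : ℂ)).im = Real.pi := by
      rw [x2]; exact logC_im_mul_exp hs0 (by linarith) (by linarith)
    have hlt : (logC (s : ℂ)).im < 5 * Real.pi / 4 := by rw [him]; linarith
    have hev := eventually_logC_im_mem (Complex.ofReal_ne_zero.2 (by linarith : s ≠ 0)) hlt
      (a := Real.pi / 2) (b := 5 * Real.pi / 4) (by rw [him]; linarith) (by rw [him]; linarith)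
    change ∃ mplus mminus : Matrix (Fin 2) (Fin 2) ℂ,
      HasLeftBoundaryValue (mY y ν) (s : ℂ) (deriv (fun s : ℝ => (s : ℂ)) s) mplus ∧
      HasLeftBoundaryValue (mY y ν) (s : ℂ) (-deriv (fun s : ℝ => (s : ℂ)) s) mminus ∧
      mplus = mminus * jumpY y ν 2 (s : ℂ)
    rw [d1]
    refine jump_ray hν y (by
      rw [Complex.norm_real, Real.norm_of_nonpos (by linarith)]
      have : s < -1 := hs
      linarith) hlt ?_ ?_ (sideY_jump_ray y ν _).2.2.1
    · filter_upwards [hev] with z h1 h2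
      rw [hone, Complex.sub_im, Complex.ofReal_im, sub_zero] at h2
      have := logC_im_pos_of_im_pos h2
      rw [sectorFactor, if_neg (by linarith), if_neg (by linarith), if_neg (by linarith [h1.1]),
        if_pos this.2]
    · filter_upwards [hev] with z h1 h2
      rw [hone, Complex.sub_im, Complex.ofReal_im, sub_zero] at h2
      have := (logC_im_of_im_neg h2).resolve_left (by linarith [h1.1])
      rw [sectorFactor, if_neg (by linarith), if_neg (by linarith), if_neg (by linarith),
        if_neg (by linarith)]
  · change ∀ᵐ s ∂(volume.restrict (Iic (-1 : ℝ))), _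
    rw [← restrict_Iio_eq_restrict_Iic]
    refine ae_restrict_of_forall_mem measurableSet_Iio fun s hs => ?_
    have hs0 : 0 < -s := by have : s < -1 := hs; linarith
    have him : (logC (s * Complex.I)).im = -(Real.pi / 2) := by
      rw [x3]; exact logC_im_mul_exp hs0 (by linarith) (by linarith)
    have hlt : (logC (s * Complex.I)).im < 5 * Real.pi / 4 := by rw [him]; linarith
    have hev := eventually_logC_im_mem
      (mul_ne_zero (Complex.ofReal_ne_zero.2 (by linarith : s ≠ 0)) Complex.I_ne_zero) hlt
      (a := -(3 * Real.pi / 4)) (b := 0) (by rw [him]; linarith) (by rw [him]; linarith)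
    change ∃ mplus mminus : Matrix (Fin 2) (Fin 2) ℂ,
      HasLeftBoundaryValue (mY y ν) (s * Complex.I) (deriv (fun s : ℝ => s * Complex.I) s) mplus ∧
      HasLeftBoundaryValue (mY y ν) (s * Complex.I) (-deriv (fun s : ℝ => s * Complex.I) s) mminus ∧
      mplus = mminus * jumpY y ν 3 (s * Complex.I)
    rw [d2]
    refine jump_ray hν y (by
      rw [norm_mul, Complex.norm_I, mul_one, Complex.norm_real, Real.norm_of_nonpos (by linarith)]
      have : s < -1 := hs
      linarith) hlt ?_ ?_ (sideY_jump_ray y ν _).2.2.2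
    · filter_upwards [hev] with z h1 h2
      rw [hI, Complex.sub_re, Complex.re_ofReal_mul, Complex.I_re, mul_zero, sub_zero] at h2
      have := (logC_im_of_re_neg (l := z) (by linarith)).resolve_right (by linarith [h1.2])
      rw [sectorFactor, if_pos this]
    · filter_upwards [hev] with z h1 h2
      rw [hI, Complex.sub_re, Complex.re_ofReal_mul, Complex.I_re, mul_zero, sub_zero] at h2
      have := logC_im_of_re_pos (l := z) (by linarith)
      rw [sectorFactor, if_neg (by linarith), if_pos h1.2]
  · refine hcirc 4 _ _ 1 (by linarith) (by linarith) (fun z hz => ?_)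
      fun p => (psiY_jump_circle y ν p).1
    rw [sectorFactor, if_neg (by linarith [hz.1]), if_pos hz.2]
  · refine hcirc 5 _ _ _ (by linarith) (by linarith) (fun z hz => ?_)
      fun p => (psiY_jump_circle y ν p).2.1
    rw [sectorFactor, if_neg (by linarith [hz.1]), if_neg (by linarith [hz.1]), if_pos hz.2]
  · refine hcirc 6 _ _ _ (by linarith) (by linarith) (fun z hz => ?_)
      fun p => (psiY_jump_circle y ν p).2.2.1
    rw [sectorFactor, if_neg (by linarith [hz.1]), if_neg (by linarith [hz.1]),
      if_neg (by linarith [hz.1]), if_pos hz.2]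
  · refine hcirc 7 _ _ _ (by linarith) (by linarith) (fun z hz => ?_)
      fun p => (psiY_jump_circle y ν p).2.2.2.1
    rw [sectorFactor, if_neg (by linarith [hz.1]), if_neg (by linarith [hz.1]),
      if_neg (by linarith [hz.1]), if_neg (by linarith [hz.1])]
  · refine hcirc 8 _ _ _ (by linarith) (by linarith) (fun z hz => ?_)
      fun p => (psiY_jump_circle y ν p).2.2.2.2
    rw [sectorFactor, if_pos hz.2]


/-! ### Integration along Lipschitz curves -/

/-- Holomorphic functions are locally Lipschitz, and on a compact interval local Lipschitz bounds
give a global one. -/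
theorem LipschitzOnWith.exists_comp_differentiableOn {γ : ℝ → ℂ} {K : NNReal} {a b : ℝ}
    (hγ : LipschitzOnWith K γ (Icc a b)) {V : Set ℂ} (hV : IsOpen V) {F : ℂ → ℂ}
    (hF : DifferentiableOn ℂ F V) (hm : ∀ t ∈ Icc a b, γ t ∈ V) :
    ∃ K', LipschitzOnWith K' (fun t => F (γ t)) (Icc a b) := by
  apply LocallyLipschitzOn.exists_lipschitzOnWith_of_compact isCompact_Icc
  intro t ht
  have hc : ContDiffAt ℂ 1 F (γ t) := (hF.contDiffOn hV).contDiffAt (hV.mem_nhds (hm t ht))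
  obtain ⟨K', s, hs, hL⟩ := hc.exists_lipschitzOnWith
  refine ⟨K' * K, γ ⁻¹' s ∩ Icc a b,
    inter_mem (hγ.continuousOn t ht hs) self_mem_nhdsWithin, ?_⟩
  exact hL.comp (hγ.mono inter_subset_right) fun x hx => hx.1

theorem LipschitzOnWith.ae_hasDerivAt_real {γ : ℝ → ℂ} {K : NNReal} {a b : ℝ}
    (hγ : LipschitzOnWith K γ (Icc a b)) :
    ∀ᵐ t : ℝ, t ∈ Ioo a b → HasDerivAt γ (deriv γ t) t := by
  filter_upwards [hγ.ae_differentiableWithinAt_of_mem_real] with t h1 h2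
  exact ((h1 (Ioo_subset_Icc_self h2)).differentiableAt (Icc_mem_nhds h2.1 h2.2)).hasDerivAt

theorem LipschitzOnWith.norm_deriv_le_of_mem_Ioo {γ : ℝ → ℂ} {K : NNReal} {a b : ℝ}
    (hγ : LipschitzOnWith K γ (Icc a b)) {t : ℝ} (ht : t ∈ Ioo a b) : ‖deriv γ t‖ ≤ K :=
  norm_deriv_le_of_lipschitzOn (Icc_mem_nhds ht.1 ht.2) hγ

theorem LipschitzOnWith.intervalIntegrable_deriv_mul {γ : ℝ → ℂ} {K : NNReal} {a b : ℝ}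
    (hab : a ≤ b) (hγ : LipschitzOnWith K γ (Icc a b)) {g : ℝ → ℂ} (hg : ContinuousOn g (Icc a b)) :
    IntervalIntegrable (fun t => deriv γ t * g t) volume a b := by
  rw [intervalIntegrable_iff_integrableOn_Ioo_of_le hab]
  obtain ⟨C, hC⟩ := isCompact_Icc.exists_bound_of_continuousOn hg
  have hm : AEStronglyMeasurable (fun t => deriv γ t * g t) (volume.restrict (Ioo a b)) :=
    ((measurable_deriv γ).aestronglyMeasurable).mul
      ((hg.mono Ioo_subset_Icc_self).aestronglyMeasurable measurableSet_Ioo)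
  refine IntegrableOn.of_bound (by simp) hm (K * C) ?_
  refine ae_restrict_of_forall_mem measurableSet_Ioo fun t ht => ?_
  rw [norm_mul]
  exact mul_le_mul (hγ.norm_deriv_le_of_mem_Ioo ht) (hC t (Ioo_subset_Icc_self ht))
    (norm_nonneg _) K.2

/-- Lipschitz functions are absolutely continuous; the fundamental theorem is applied to the real
and imaginary parts. The right endpoint is removed as a null set, since differentiability is known
only inside. -/
theorem LipschitzOnWith.integral_deriv_eq_sub {γ : ℝ → ℂ} {K : NNReal} {a b : ℝ}
    (hab : a ≤ b) (hγ : LipschitzOnWith K γ (Icc a b)) :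
    ∫ t in a..b, deriv γ t = γ b - γ a := by
  have hint : IntervalIntegrable (deriv γ) volume a b := by
    simpa using hγ.intervalIntegrable_deriv_mul hab (continuousOn_const (c := (1 : ℂ)))
  have key : ∀ L : ℂ →L[ℝ] ℝ, L (∫ t in a..b, deriv γ t) = L (γ b) - L (γ a) := fun L => by
    rw [← L.intervalIntegral_comp_comm hint]
    have hL : LipschitzOnWith (‖L‖₊ * K) (fun t => L (γ t)) (uIcc a b) := by
      rw [uIcc_of_le hab]
      exact L.lipschitz.comp_lipschitzOnWith hγ
    rw [← hL.absolutelyContinuousOnInterval.integral_deriv_eq_sub]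
    apply intervalIntegral.integral_congr_ae
    have hb : ∀ᵐ t : ℝ, t ≠ b := by simp [ae_iff, measure_singleton]
    filter_upwards [hγ.ae_hasDerivAt_real, hb] with t ht htb htm
    rw [uIoc_of_le hab] at htm
    exact ((L.hasFDerivAt.comp_hasDerivAt t (ht ⟨htm.1, lt_of_le_of_ne htm.2 htb⟩)).deriv).symm
  apply Complex.ext
  · simpa using key Complex.reCLM
  · simpa using key Complex.imCLM

theorem LipschitzOnWith.integral_deriv_mul_eq_sub {γ : ℝ → ℂ} {K : NNReal} {a b : ℝ}
    (hab : a ≤ b) (hγ : LipschitzOnWith K γ (Icc a b)) {V : Set ℂ} (hV : IsOpen V) {F f : ℂ → ℂ}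
    (hF : ∀ z ∈ V, HasDerivAt F (f z) z) (hm : ∀ t ∈ Icc a b, γ t ∈ V) :
    ∫ t in a..b, deriv γ t * f (γ t) = F (γ b) - F (γ a) := by
  obtain ⟨K', hK'⟩ := hγ.exists_comp_differentiableOn hV
    (fun z hz => (hF z hz).differentiableAt.differentiableWithinAt) hm
  rw [← hK'.integral_deriv_eq_sub hab]
  apply intervalIntegral.integral_congr_ae
  have hb : ∀ᵐ t : ℝ, t ≠ b := by simp [ae_iff, measure_singleton]
  filter_upwards [hγ.ae_hasDerivAt_real, hb] with t ht htb htm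
  rw [uIoc_of_le hab] at htm
  have htm' : t ∈ Ioo a b := ⟨htm.1, lt_of_le_of_ne htm.2 htb⟩
  have := ((hF _ (hm t (Ioo_subset_Icc_self htm'))).scomp t (ht htm')).deriv
  rw [smul_eq_mul] at this
  exact this.symm

theorem LipschitzOnWith.integral_deriv_mul_eq_zero_of_convex {γ : ℝ → ℂ} {K : NNReal}
    (hγ : LipschitzOnWith K γ (Icc 0 1)) (hclosed : γ 0 = γ 1) {V : Set ℂ} (hV : IsOpen V)
    (hconv : Convex ℝ V) {f : ℂ → ℂ} (hf : DifferentiableOn ℂ f V)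
    (hm : ∀ t ∈ Icc (0 : ℝ) 1, γ t ∈ V) :
    ∫ t in (0 : ℝ)..1, deriv γ t * f (γ t) = 0 := by
  obtain ⟨F, hF⟩ := hconv.exists_forall_hasDerivWithinAt hf
  rw [hγ.integral_deriv_mul_eq_sub zero_le_one hV
    (fun z hz => (hF z hz).hasDerivAt (hV.mem_nhds hz)) hm, hclosed, sub_self]

/-- Winding numbers are invariant under injective analytic maps of convex sets. -/
theorem winding_comp {γ : ℝ → ℂ} {K : NNReal} (hγ : LipschitzOnWith K γ (Icc 0 1))
    (hclosed : γ 0 = γ 1) {V : Set ℂ} (hV : IsOpen V) (hconv : Convex ℝ V) {Φ : ℂ → ℂ}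
    (hΦ : DifferentiableOn ℂ Φ V) (hinj : InjOn Φ V) (hΦ' : ∀ z ∈ V, deriv Φ z ≠ 0)
    (hm : ∀ t ∈ Icc (0 : ℝ) 1, γ t ∈ V) {w : ℂ} (hw : w ∈ V) (hwγ : ∀ t ∈ Icc (0 : ℝ) 1, γ t ≠ w) :
    ∫ t in (0 : ℝ)..1, deriv (fun t => Φ (γ t)) t / (Φ (γ t) - Φ w) =
      ∫ t in (0 : ℝ)..1, deriv γ t / (γ t - w) := by
  -- `Φ(z) - Φ(w) = (z - w) g(z)`, where `g` has no zeros: off `w` by injectivity, at `w` since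
  -- `Φ'(w) ≠ 0`. The two integrands differ by `γ' g'/g`, whose integral vanishes because `g'/g` has
  -- a primitive on the convex set `V`.
  set g : ℂ → ℂ := dslope Φ w with hg
  have hgd : DifferentiableOn ℂ g V := (Complex.differentiableOn_dslope (hV.mem_nhds hw)).2 hΦ
  have hg0 : ∀ z ∈ V, g z ≠ 0 := fun z hz => by
    rcases eq_or_ne z w with rfl | hne
    · rw [hg, dslope_same]; exact hΦ' z hz
    · rw [hg, dslope_of_ne _ hne, slope_def_field]
      exact div_ne_zero (sub_ne_zero.2 fun h => hne (hinj hz hw h)) (sub_ne_zero.2 hne)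
  have hΦg : ∀ z, Φ z - Φ w = (z - w) * g z := fun z => by
    have := sub_smul_dslope Φ w z
    rw [smul_eq_mul] at this
    exact this.symm
  have hfd : DifferentiableOn ℂ (fun z => deriv g z / g z) V :=
    (hgd.deriv hV).div hgd hg0
  have hz := hγ.integral_deriv_mul_eq_zero_of_convex hclosed hV hconv hfd hm
  have hcont : ContinuousOn (fun t => (γ t - w)⁻¹) (Icc 0 1) :=
    (hγ.continuousOn.sub continuousOn_const).inv₀ fun t ht => sub_ne_zero.2 (hwγ t ht)
  have i1 := hγ.intervalIntegrable_deriv_mul zero_le_one hcont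
  have i2 : IntervalIntegrable (fun t => deriv γ t * (deriv g (γ t) / g (γ t))) volume 0 1 :=
    hγ.intervalIntegrable_deriv_mul zero_le_one (hfd.continuousOn.comp hγ.continuousOn hm)
  have h3 : ∫ t in (0 : ℝ)..1, deriv γ t / (γ t - w) =
      ∫ t in (0 : ℝ)..1, (deriv γ t * (γ t - w)⁻¹ + deriv γ t * (deriv g (γ t) / g (γ t))) := by
    rw [intervalIntegral.integral_add i1 i2]
    simp only [div_eq_mul_inv] at hz ⊢
    rw [hz, add_zero]
  rw [h3]
  apply intervalIntegral.integral_congr_ae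
  have hb : ∀ᵐ t : ℝ, t ≠ 1 := by simp [ae_iff, measure_singleton]
  filter_upwards [hγ.ae_hasDerivAt_real, hb] with t ht htb htm
  rw [uIoc_of_le zero_le_one] at htm
  have htm' : t ∈ Ioo (0 : ℝ) 1 := ⟨htm.1, lt_of_le_of_ne htm.2 htb⟩
  have htm'' := Ioo_subset_Icc_self htm'
  have hVt := hV.mem_nhds (hm t htm'')
  have hgt := (hgd.differentiableAt hVt).hasDerivAt
  have hΦt : HasDerivAt Φ (g (γ t) + (γ t - w) * deriv g (γ t)) (γ t) := by
    have h1 := (((hasDerivAt_id (γ t)).sub_const w).mul hgt).add_const (Φ w)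
    have h2 : (fun z => (z - w) * g z + Φ w) = Φ := by
      funext z; rw [← hΦg]; ring
    simp only [id, one_mul] at h1
    exact h2 ▸ h1
  have hd := (hΦt.scomp t (ht htm')).deriv
  rw [smul_eq_mul] at hd
  have hd' : deriv (fun t => Φ (γ t)) t = deriv γ t * (g (γ t) + (γ t - w) * deriv g (γ t)) := hd
  rw [hd', hΦg]
  have n1 := sub_ne_zero.2 (hwγ t htm'')
  have n2 := hg0 _ (hm t htm'')
  field_simp


/-! ### Winding numbers by half planes. -/

theorem log_I_mul {B : ℂ} (hB : 0 < B.re) :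
    Complex.log (Complex.I * B) = Complex.log B + Real.pi / 2 * Complex.I := by
  have hB0 : B ≠ 0 := by rintro rfl; simp at hB
  have ha := abs_lt.1 (Complex.abs_arg_lt_pi_div_two_iff.2 (Or.inl hB))
  have hpi := Real.pi_pos
  have him : (Complex.log B + Real.pi / 2 * Complex.I).im = B.arg + Real.pi / 2 := by
    have : (Real.pi / 2 * Complex.I : ℂ) = ((Real.pi / 2 : ℝ) : ℂ) * Complex.I := by push_cast; rfl
    rw [Complex.add_im, Complex.log_im, this]
    simp
  rw [← Complex.log_exp (x := Complex.log B + Real.pi / 2 * Complex.I) (by rw [him]; linarith)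
    (by rw [him]; linarith), Complex.exp_add, Complex.exp_log hB0, Complex.exp_mul_I,
    Complex.cos_pi_div_two, Complex.sin_pi_div_two]
  congr 1
  ring

/-- A closed curve which passes successively below, right, above and left of a point has winding
number one about it. -/
theorem winding_of_four_half_planes {γ : ℝ → ℂ} {K : NNReal} (hγ : LipschitzOnWith K γ (Icc 0 1))
    (hclosed : γ 0 = γ 1) {w : ℂ} (h1 : ∀ t ∈ Icc (0 : ℝ) (1 / 4), (γ t).im < w.im)
    (h2 : ∀ t ∈ Icc (1 / 4 : ℝ) (1 / 2), w.re < (γ t).re)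
    (h3 : ∀ t ∈ Icc (1 / 2 : ℝ) (3 / 4), w.im < (γ t).im)
    (h4 : ∀ t ∈ Icc (3 / 4 : ℝ) 1, (γ t).re < w.re) :
    ∫ t in (0 : ℝ)..1, deriv γ t / (γ t - w) = 2 * Real.pi * Complex.I := by
  have hne : ∀ t ∈ Icc (0 : ℝ) 1, γ t ≠ w := by
    rintro t ht rfl
    rcases le_total t (1 / 4) with a | a
    · exact (h1 t ⟨ht.1, a⟩).false
    rcases le_total t (1 / 2) with b | b
    · exact (h2 t ⟨a, b⟩).false
    rcases le_total t (3 / 4) with c | c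
    · exact (h3 t ⟨b, c⟩).false
    · exact (h4 t ⟨c, ht.2⟩).false
  have hcont : ContinuousOn (fun t => (γ t - w)⁻¹) (Icc 0 1) :=
    (hγ.continuousOn.sub continuousOn_const).inv₀ fun t ht => sub_ne_zero.2 (hne t ht)
  -- On each quarter a multiplier `c` rotates `γ - w` into the right half plane, where the principal
  -- logarithm is a primitive. Consecutive multipliers `i, 1, -i, -1` differ by the factor `-i`, so
  -- each of the four junctions contributes `πi/2`.
  have seg : ∀ (c : ℂ) (a b : ℝ), 0 ≤ a → a ≤ b → b ≤ 1 →
      (∀ t ∈ Icc a b, 0 < (c * (γ t - w)).re) →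
      IntervalIntegrable (fun t => deriv γ t / (γ t - w)) volume a b ∧
      ∫ t in a..b, deriv γ t / (γ t - w) =
        Complex.log (c * (γ b - w)) - Complex.log (c * (γ a - w)) := by
    intro c a b ha hab hb hre
    have hsub : Icc a b ⊆ Icc 0 1 := Icc_subset_Icc ha hb
    simp only [div_eq_mul_inv]
    refine ⟨(hγ.mono hsub).intervalIntegrable_deriv_mul hab (hcont.mono hsub), ?_⟩
    refine (hγ.mono hsub).integral_deriv_mul_eq_sub hab (V := {z | 0 < (c * (z - w)).re})
      (F := fun z => Complex.log (c * (z - w))) (f := fun z => (z - w)⁻¹)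
      (isOpen_lt continuous_const (by fun_prop)) ?_ hre
    intro z hz
    have hz' : 0 < (c * (z - w)).re := hz
    have hcz : c * (z - w) ≠ 0 := by intro h; rw [h] at hz'; simp at hz'
    have hc : c ≠ 0 := left_ne_zero_of_mul hcz
    have hzw : z - w ≠ 0 := right_ne_zero_of_mul hcz
    have hd := (((hasDerivAt_id z).sub_const w).const_mul c).clog (Or.inl hz')
    simp only [id, mul_one] at hd
    convert hd using 1
    field_simp
  obtain ⟨i1, e1⟩ := seg Complex.I 0 (1 / 4) le_rfl (by norm_num) (by norm_num) fun t ht => by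
    have := h1 t ht; simp; linarith
  obtain ⟨i2, e2⟩ := seg 1 (1 / 4) (1 / 2) (by norm_num) (by norm_num) (by norm_num) fun t ht => by
    have := h2 t ht; simp; linarith
  obtain ⟨i3, e3⟩ := seg (-Complex.I) (1 / 2) (3 / 4) (by norm_num) (by norm_num) (by norm_num)
    fun t ht => by have := h3 t ht; simp; linarith
  obtain ⟨i4, e4⟩ := seg (-1) (3 / 4) 1 (by norm_num) (by norm_num) le_rfl fun t ht => by
    have := h4 t ht; simp; linarith
  rw [← intervalIntegral.integral_add_adjacent_intervals ((i1.trans i2).trans i3) i4,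
    ← intervalIntegral.integral_add_adjacent_intervals (i1.trans i2) i3,
    ← intervalIntegral.integral_add_adjacent_intervals i1 i2, e1, e2, e3, e4, hclosed]
  have cB := log_I_mul (B := 1 * (γ (1 / 4) - w)) (by
    have := h2 (1 / 4) (by norm_num); simp; norm_num at this; linarith)
  have cC := log_I_mul (B := -Complex.I * (γ (1 / 2) - w)) (by
    have := h3 (1 / 2) (by norm_num); simp; norm_num at this; linarith)
  have cD := log_I_mul (B := -1 * (γ (3 / 4) - w)) (by
    have := h4 (3 / 4) (by norm_num); simp; norm_num at this; linarith)
  have cA := log_I_mul (B := Complex.I * (γ 1 - w)) (by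
    have := h1 0 (by norm_num); rw [hclosed] at this; simp; linarith)
  have hI := Complex.I_sq
  rw [show Complex.I * (1 * (γ (1 / 4) - w)) = Complex.I * (γ (1 / 4) - w) by ring] at cB
  rw [show Complex.I * (-Complex.I * (γ (1 / 2) - w)) = 1 * (γ (1 / 2) - w) by
    linear_combination (-(γ (1 / 2) - w)) * hI] at cC
  rw [show Complex.I * (-1 * (γ (3 / 4) - w)) = -Complex.I * (γ (3 / 4) - w) by ring] at cD
  rw [show Complex.I * (Complex.I * (γ 1 - w)) = -1 * (γ 1 - w) by
    linear_combination (γ 1 - w) * hI] at cA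
  linear_combination cA + cB + cC + cD

/-! ### The boundary of the unit square -/

/-- The first coordinate of a parametrization of the boundary of the unit square. -/
noncomputable def squareX (t : ℝ) : ℝ := max 0 (min 1 (4 * t)) - max 0 (min 1 (4 * t - 2))

/-- The second coordinate of a parametrization of the boundary of the unit square. -/
noncomputable def squareY (t : ℝ) : ℝ := max 0 (min 1 (4 * t - 1)) - max 0 (min 1 (4 * t - 3))

theorem lipschitzWith_clamp (b : ℝ) : LipschitzWith 4 fun t : ℝ => max 0 (min 1 (4 * t - b)) := by
  have h : LipschitzWith 4 fun t : ℝ => 4 * t - b := by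
    refine LipschitzWith.of_dist_le_mul fun s t => ?_
    rw [Real.dist_eq, Real.dist_eq, show 4 * s - b - (4 * t - b) = 4 * (s - t) by ring, abs_mul]
    norm_num
  exact (h.const_min 1).const_max 0

theorem lipschitzWith_squareX : LipschitzWith 8 squareX := by
  have := (lipschitzWith_clamp 0).sub (lipschitzWith_clamp 2)
  norm_num at this
  exact this

theorem lipschitzWith_squareY : LipschitzWith 8 squareY := by
  have := (lipschitzWith_clamp 1).sub (lipschitzWith_clamp 3)
  norm_num at this
  exact this

theorem squareXY_mem (t : ℝ) : squareX t ∈ Icc (0 : ℝ) 1 ∧ squareY t ∈ Icc (0 : ℝ) 1 := by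
  simp only [squareX, squareY, mem_Icc]
  grind

/-- Bottom, right, top and left side on the successive quarters, in accordance with
`winding_of_four_half_planes`. -/
theorem squareXY_phases {t : ℝ} (h0 : 0 ≤ t) (h1 : t ≤ 1) :
    (t ≤ 1 / 4 → squareX t = 4 * t ∧ squareY t = 0) ∧
    (1 / 4 ≤ t → t ≤ 1 / 2 → squareX t = 1 ∧ squareY t = 4 * t - 1) ∧
    (1 / 2 ≤ t → t ≤ 3 / 4 → squareX t = 3 - 4 * t ∧ squareY t = 1) ∧
    (3 / 4 ≤ t → squareX t = 0 ∧ squareY t = 4 - 4 * t) := by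
  have c0 : ∀ u : ℝ, u ≤ 0 → max 0 (min 1 u) = 0 := fun u hu => by
    rw [min_eq_right (by linarith), max_eq_left hu]
  have c1 : ∀ u : ℝ, 1 ≤ u → max 0 (min 1 u) = 1 := fun u hu => by
    rw [min_eq_left hu, max_eq_right zero_le_one]
  have c2 : ∀ u : ℝ, 0 ≤ u → u ≤ 1 → max 0 (min 1 u) = u := fun u hu hu' => by
    rw [min_eq_right hu', max_eq_right hu]
  simp only [squareX, squareY]
  refine ⟨fun h => ?_, fun h h' => ?_, fun h h' => ?_, fun h => ?_⟩
  · rw [c2 (4 * t) (by linarith) (by linarith), c0 (4 * t - 2) (by linarith),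
      c0 (4 * t - 1) (by linarith), c0 (4 * t - 3) (by linarith)]
    simp
  · rw [c1 (4 * t) (by linarith), c0 (4 * t - 2) (by linarith),
      c2 (4 * t - 1) (by linarith) (by linarith), c0 (4 * t - 3) (by linarith)]
    simp
  · rw [c1 (4 * t) (by linarith), c2 (4 * t - 2) (by linarith) (by linarith),
      c1 (4 * t - 1) (by linarith), c0 (4 * t - 3) (by linarith)]
    constructor <;> ring
  · rw [c1 (4 * t) (by linarith), c1 (4 * t - 2) (by linarith),
      c1 (4 * t - 1) (by linarith), c2 (4 * t - 3) (by linarith) (by linarith)]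
    constructor <;> ring

theorem squareXY_injOn {s t : ℝ} (hs : s ∈ Ico (0 : ℝ) 1) (ht : t ∈ Ico (0 : ℝ) 1)
    (hX : squareX s = squareX t) (hY : squareY s = squareY t) : s = t := by
  obtain ⟨s1, s2, s3, s4⟩ := squareXY_phases hs.1 hs.2.le
  obtain ⟨t1, t2, t3, t4⟩ := squareXY_phases ht.1 ht.2.le
  obtain ⟨hs0, hs1⟩ := hs
  obtain ⟨ht0, ht1⟩ := ht
  rw [hX, hY] at s1 s2 s3 s4
  generalize squareX t = x at *
  generalize squareY t = y at *
  grind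

theorem squareXY_zero_one : squareX 0 = squareX 1 ∧ squareY 0 = squareY 1 := by
  norm_num [squareX, squareY]


/-! ### The components of the complement of the contour -/

/-- A connected subset of `U` that meets `D` cannot leave it, as the open sets `D` and `Fᶜ` are
disjoint and cover `U`. -/
theorem connectedComponentIn_eq_of_clopen {X : Type*} [TopologicalSpace X] {U D F : Set X}
    (hD : IsPreconnected D) (hDo : IsOpen D) (hF : IsClosed F) (h : D = U ∩ F) {z : X}
    (hz : z ∈ D) : connectedComponentIn U z = D := by
  have hDU : D ⊆ U := h ▸ inter_subset_left
  refine Subset.antisymm ?_ (hD.subset_connectedComponentIn hz hDU)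
  refine IsPreconnected.subset_left_of_subset_union hDo hF.isOpen_compl ?_ ?_
    ⟨z, mem_connectedComponentIn (hDU hz), hz⟩ isPreconnected_connectedComponentIn
  · rw [disjoint_compl_right_iff_subset, h]
    exact inter_subset_right
  · intro x hx
    have hxU := connectedComponentIn_subset U z hx
    by_cases hxF : x ∈ F
    · exact Or.inl (h ▸ ⟨hxU, hxF⟩)
    · exact Or.inr hxF

/-- The half strip which the exponential function maps to the part of the first quadrant outside
the unit circle. -/
def halfStrip : Set ℂ := {w | 0 < w.re ∧ 0 < w.im ∧ w.im < Real.pi / 2}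

theorem isOpen_halfStrip : IsOpen halfStrip :=
  (isOpen_lt continuous_const Complex.continuous_re).inter
    ((isOpen_lt continuous_const Complex.continuous_im).inter
      (isOpen_lt Complex.continuous_im continuous_const))

theorem convex_halfStrip : Convex ℝ halfStrip :=
  (convex_halfSpace_re_gt 0).inter ((convex_halfSpace_im_gt 0).inter
    (convex_halfSpace_im_lt (Real.pi / 2)))

/-- The part of a quadrant outside the unit circle. -/
def outerQuadrant (c : ℂ) : Set ℂ := {z | 1 < ‖z‖ ∧ 0 < (z / c).re ∧ 0 < (z / c).im}

/-- `c` is one of the four points `1`, `i`, `-1`, `-i`. -/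
def IsFourthRoot (c : ℂ) : Prop := c = 1 ∨ c = Complex.I ∨ c = -1 ∨ c = -Complex.I

theorem IsFourthRoot.norm_eq {c : ℂ} (hc : IsFourthRoot c) : ‖c‖ = 1 := by
  rcases hc with rfl | rfl | rfl | rfl <;> simp

theorem IsFourthRoot.ne_zero {c : ℂ} (hc : IsFourthRoot c) : c ≠ 0 :=
  norm_pos_iff.1 (by rw [hc.norm_eq]; exact one_pos)

/-- A quadrant outside the circle is not convex, but its preimage under the exponential is.
Connectedness, primitives and winding numbers are therefore treated in the half strip. -/
theorem image_halfStrip {c : ℂ} (hc : ‖c‖ = 1) :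
    (fun w => c * Complex.exp w) '' halfStrip = outerQuadrant c := by
  have hc0 : c ≠ 0 := norm_pos_iff.1 (by rw [hc]; exact one_pos)
  have hpi := Real.pi_pos
  ext z
  constructor
  · rintro ⟨w, ⟨h1, h2, h3⟩, rfl⟩
    have hdiv : c * Complex.exp w / c = Complex.exp w := by field_simp
    refine ⟨?_, ?_, ?_⟩
    · rw [norm_mul, hc, one_mul, Complex.norm_exp]
      exact Real.one_lt_exp_iff.2 h1
    · simp only [hdiv]
      rw [Complex.exp_re]
      exact mul_pos (Real.exp_pos _) (Real.cos_pos_of_mem_Ioo ⟨by linarith, h3⟩)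
    · simp only [hdiv]
      rw [Complex.exp_im]
      exact mul_pos (Real.exp_pos _) (Real.sin_pos_of_pos_of_lt_pi h2 (by linarith))
  · rintro ⟨h1, h2, h3⟩
    have hz : z / c ≠ 0 := by intro h; rw [h] at h2; simp at h2
    refine ⟨Complex.log (z / c), ⟨?_, ?_, ?_⟩, ?_⟩
    · rw [Complex.log_re, norm_div, hc, div_one]
      exact Real.log_pos h1
    · rw [Complex.log_im]
      have := (Complex.arg_nonneg_iff (z := z / c)).2 h3.le
      refine lt_of_le_of_ne this fun h => ?_
      rw [eq_comm, Complex.arg_eq_zero_iff] at h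
      exact h3.ne' h.2
    · rw [Complex.log_im]
      exact (abs_lt.1 (Complex.abs_arg_lt_pi_div_two_iff.2 (Or.inl h2))).2
    · simp only
      rw [Complex.exp_log hz]
      field_simp

theorem IsFourthRoot.outerQuadrant_eq {c : ℂ} (hc : IsFourthRoot c) :
    outerQuadrant c = contourYᶜ ∩ {z | 1 ≤ ‖z‖ ∧ 0 ≤ (z / c).re ∧ 0 ≤ (z / c).im} := by
  ext z
  simp only [outerQuadrant, mem_inter_iff, mem_compl_iff, mem_ofPred_eq]
  constructor
  · rintro ⟨h1, h2, h3⟩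
    refine ⟨?_, h1.le, h2.le, h3.le⟩
    rw [notMem_contourY_iff]
    refine Or.inr ⟨h1, ?_⟩
    rcases hc with rfl | rfl | rfl | rfl <;> simp [Complex.div_I, div_neg] at h2 h3 <;>
      constructor <;> linarith
  · rintro ⟨h1, h2, h3, h4⟩
    rw [notMem_contourY_iff] at h1
    obtain ⟨a, b, d⟩ := h1.resolve_left h2.not_gt
    refine ⟨a, lt_of_le_of_ne h3 ?_, lt_of_le_of_ne h4 ?_⟩ <;>
    rcases hc with rfl | rfl | rfl | rfl <;> simp [Complex.div_I, div_neg] <;>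
      first | exact b.symm | exact d.symm | exact b | exact d

theorem continuous_div_re_im (c : ℂ) :
    Continuous (fun z : ℂ => (z / c).re) ∧ Continuous fun z : ℂ => (z / c).im :=
  ⟨by fun_prop, by fun_prop⟩

theorem isOpen_outerQuadrant (c : ℂ) : IsOpen (outerQuadrant c) :=
  (isOpen_lt continuous_const continuous_norm).inter
    ((isOpen_lt continuous_const (continuous_div_re_im c).1).inter
      (isOpen_lt continuous_const (continuous_div_re_im c).2))

theorem IsFourthRoot.connectedComponentIn_eq {c : ℂ} (hc : IsFourthRoot c) {z : ℂ}
    (hz : z ∈ outerQuadrant c) : connectedComponentIn contourYᶜ z = outerQuadrant c := by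
  refine connectedComponentIn_eq_of_clopen ?_ (isOpen_outerQuadrant c) ?_ hc.outerQuadrant_eq hz
  · rw [← image_halfStrip hc.norm_eq]
    exact convex_halfStrip.isPreconnected.image _ (by fun_prop)
  · exact (isClosed_le continuous_const continuous_norm).inter
      ((isClosed_le continuous_const (continuous_div_re_im c).1).inter
        (isClosed_le continuous_const (continuous_div_re_im c).2))

theorem ball_subset_compl_contourY : Metric.ball (0 : ℂ) 1 ⊆ contourYᶜ := fun z hz =>
  (notMem_contourY_iff z).2 (Or.inl (by simpa using hz))

theorem connectedComponentIn_eq_ball {z : ℂ} (hz : z ∈ Metric.ball (0 : ℂ) 1) :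
    connectedComponentIn contourYᶜ z = Metric.ball 0 1 := by
  refine connectedComponentIn_eq_of_clopen (convex_ball _ _).isPreconnected Metric.isOpen_ball
    (Metric.isClosed_closedBall (x := (0 : ℂ)) (ε := 1)) ?_ hz
  ext w
  constructor
  · exact fun h => ⟨ball_subset_compl_contourY h, Metric.ball_subset_closedBall h⟩
  · rintro ⟨h1, h2⟩
    have h2 : ‖w‖ ≤ 1 := by simpa using h2
    rcases (notMem_contourY_iff w).1 h1 with h | h
    · simpa using h
    · linarith

theorem mem_ball_or_outerQuadrant {z : ℂ} (hz : z ∉ contourY) :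
    z ∈ Metric.ball (0 : ℂ) 1 ∨ ∃ c, IsFourthRoot c ∧ z ∈ outerQuadrant c := by
  rcases (notMem_contourY_iff z).1 hz with h | ⟨h, h1, h2⟩
  · exact Or.inl (by simpa using h)
  · right
    rcases h1.lt_or_gt with h1 | h1 <;> rcases h2.lt_or_gt with h2 | h2
    · exact ⟨-1, by simp [IsFourthRoot], h, by simpa [div_neg], by simpa [div_neg]⟩
    · exact ⟨Complex.I, by simp [IsFourthRoot], h, by simpa [Complex.div_I], by simpa [Complex.div_I]⟩
    · exact ⟨-Complex.I, by simp [IsFourthRoot], h, by simpa [div_neg, Complex.div_I],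
        by simpa [div_neg, Complex.div_I]⟩
    · exact ⟨1, by simp [IsFourthRoot], h, by simpa, by simpa⟩

theorem isOpen_compl_contourY : IsOpen contourYᶜ := by
  have : contourYᶜ = {z : ℂ | ‖z‖ < 1} ∪ {z : ℂ | 1 < ‖z‖ ∧ z.re ≠ 0 ∧ z.im ≠ 0} := by
    ext z; exact notMem_contourY_iff z
  rw [this]
  refine (isOpen_lt continuous_norm continuous_const).union
    ((isOpen_lt continuous_const continuous_norm).inter
      ((isOpen_ne_fun Complex.continuous_re continuous_const).inter
        (isOpen_ne_fun Complex.continuous_im continuous_const)))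

/-! ### The exhausting curves -/

theorem injOn_mul_exp_halfStrip {c : ℂ} (hc : c ≠ 0) :
    InjOn (fun w => c * Complex.exp w) halfStrip := by
  rintro w ⟨_, h2, h3⟩ w' ⟨_, h2', h3'⟩ h
  have hpi := Real.pi_pos
  exact Complex.exp_inj_of_neg_pi_lt_of_le_pi (by linarith) (by linarith) (by linarith)
    (by linarith) (mul_left_cancel₀ hc h)

/-- The boundary of a rectangle in the half strip, with a parametrization which is uniform in
`exp (-w)` on the horizontal sides. -/
noncomputable def stripCurve (δ t : ℝ) : ℂ :=
  -Complex.log ((1 - δ + (2 * δ - 1) * squareX t : ℝ) : ℂ) +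
    ((δ + (Real.pi / 2 - 2 * δ) * squareY t : ℝ) : ℂ) * Complex.I

theorem stripCurve_bounds {δ : ℝ} (h0 : 0 < δ) (h1 : δ ≤ 1 / 3) (t : ℝ) :
    1 - δ + (2 * δ - 1) * squareX t ∈ Icc δ (1 - δ) ∧
    δ + (Real.pi / 2 - 2 * δ) * squareY t ∈ Icc δ (Real.pi / 2 - δ) := by
  obtain ⟨⟨a, b⟩, c, d⟩ := squareXY_mem t
  have hpi := Real.pi_gt_three
  refine ⟨⟨?_, ?_⟩, ?_, ?_⟩ <;> nlinarith

theorem stripCurve_re (δ t : ℝ) :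
    (stripCurve δ t).re = -Real.log (1 - δ + (2 * δ - 1) * squareX t) := by
  simp [stripCurve, Complex.log_re, -Complex.ofReal_add, -Complex.ofReal_sub, -Complex.ofReal_mul]

theorem stripCurve_im {δ : ℝ} (h0 : 0 < δ) (h1 : δ ≤ 1 / 3) (t : ℝ) :
    (stripCurve δ t).im = δ + (Real.pi / 2 - 2 * δ) * squareY t := by
  have := (stripCurve_bounds h0 h1 t).1.1
  rw [stripCurve, ← Complex.ofReal_log (by linarith)]
  simp [-Complex.ofReal_add, -Complex.ofReal_sub, -Complex.ofReal_mul]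

theorem stripCurve_mem {δ : ℝ} (h0 : 0 < δ) (h1 : δ ≤ 1 / 3) (t : ℝ) :
    stripCurve δ t ∈ halfStrip := by
  obtain ⟨⟨a, b⟩, c, d⟩ := stripCurve_bounds h0 h1 t
  refine ⟨?_, ?_, ?_⟩
  · rw [stripCurve_re]
    have := Real.log_neg (by linarith) (by linarith : 1 - δ + (2 * δ - 1) * squareX t < 1)
    linarith
  · rw [stripCurve_im h0 h1]; linarith
  · rw [stripCurve_im h0 h1]; linarith

theorem exists_lipschitzOnWith_stripCurve {δ : ℝ} (h0 : 0 < δ) (h1 : δ ≤ 1 / 3) :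
    ∃ K, LipschitzOnWith K (stripCurve δ) (Icc 0 1) := by
  have aff : ∀ (f : ℝ → ℝ) (a b : ℝ), LipschitzWith 8 f →
      ∃ K, LipschitzWith K fun t => ((a + b * f t : ℝ) : ℂ) := fun f a b hf => by
    refine ⟨8 * ‖b‖₊, LipschitzWith.of_dist_le_mul fun s t => ?_⟩
    have := hf.dist_le_mul s t
    rw [Complex.dist_eq, ← Complex.ofReal_sub, Complex.norm_real,
      show a + b * f s - (a + b * f t) = b * (f s - f t) by ring, norm_mul]
    rw [Real.dist_eq (f s), ← Real.norm_eq_abs] at this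
    calc ‖b‖ * ‖f s - f t‖ ≤ ‖b‖ * ((8 : NNReal) * dist s t) := by gcongr
      _ = _ := by push_cast; ring
  obtain ⟨K₁, hK₁⟩ := aff _ (1 - δ) (2 * δ - 1) lipschitzWith_squareX
  obtain ⟨K₂, hK₂⟩ := aff _ δ (Real.pi / 2 - 2 * δ) lipschitzWith_squareY
  obtain ⟨K₃, hK₃⟩ := (hK₁.lipschitzOnWith (s := Icc (0 : ℝ) 1)).exists_comp_differentiableOn
    Complex.isOpen_slitPlane (F := fun z => -Complex.log z)
    (fun z hz => ((Complex.differentiableAt_log hz).neg).differentiableWithinAt) fun t _ =>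
      Complex.ofReal_mem_slitPlane.2 (lt_of_lt_of_le h0 (stripCurve_bounds h0 h1 t).1.1)
  obtain ⟨K₄, hK₄⟩ := (hK₂.lipschitzOnWith (s := Icc (0 : ℝ) 1)).exists_comp_differentiableOn
    isOpen_univ (F := fun z => z * Complex.I) (by fun_prop) fun t _ => mem_univ _
  exact ⟨_, hK₃.add hK₄⟩

theorem stripCurve_zero_one (δ : ℝ) : stripCurve δ 0 = stripCurve δ 1 := by
  rw [stripCurve, stripCurve, squareXY_zero_one.1, squareXY_zero_one.2]

theorem stripCurve_injOn {δ : ℝ} (h0 : 0 < δ) (h1 : δ ≤ 1 / 3) :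
    InjOn (stripCurve δ) (Ico 0 1) := by
  intro s hs t ht h
  have hpi := Real.pi_gt_three
  have hre := congrArg Complex.re h
  have him := congrArg Complex.im h
  rw [stripCurve_im h0 h1, stripCurve_im h0 h1] at him
  rw [stripCurve_re, stripCurve_re, neg_inj] at hre
  have hlog := Real.log_injOn_pos (lt_of_lt_of_le h0 (stripCurve_bounds h0 h1 s).1.1)
    (lt_of_lt_of_le h0 (stripCurve_bounds h0 h1 t).1.1) hre
  refine squareXY_injOn hs ht ?_ ?_
  · have : (2 * δ - 1) ≠ 0 := by linarith
    exact mul_left_cancel₀ this (by linarith)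
  · have : (Real.pi / 2 - 2 * δ) ≠ 0 := by linarith
    exact mul_left_cancel₀ this (by linarith)

/-- The open rectangle bounded by `stripCurve δ`. -/
def stripRect (δ : ℝ) : Set ℂ :=
  {w | -Real.log (1 - δ) < w.re ∧ w.re < -Real.log δ ∧ δ < w.im ∧ w.im < Real.pi / 2 - δ}

theorem stripCurve_phases {δ : ℝ} (h0 : 0 < δ) (h1 : δ ≤ 1 / 3) {w : ℂ} (hw : w ∈ stripRect δ) :
    (∀ t ∈ Icc (0 : ℝ) (1 / 4), (stripCurve δ t).im < w.im) ∧
    (∀ t ∈ Icc (1 / 4 : ℝ) (1 / 2), w.re < (stripCurve δ t).re) ∧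
    (∀ t ∈ Icc (1 / 2 : ℝ) (3 / 4), w.im < (stripCurve δ t).im) ∧
    (∀ t ∈ Icc (3 / 4 : ℝ) 1, (stripCurve δ t).re < w.re) := by
  obtain ⟨a, b, c, d⟩ := hw
  simp only [stripCurve_im h0 h1, stripCurve_re]
  refine ⟨fun t ht => ?_, fun t ht => ?_, fun t ht => ?_, fun t ht => ?_⟩
  · rw [((squareXY_phases ht.1 (by linarith [ht.2])).1 ht.2).2]; linarith
  · rw [((squareXY_phases (by linarith [ht.1]) (by linarith [ht.2])).2.1 ht.1 ht.2).1]
    ring_nf; linarith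
  · rw [((squareXY_phases (by linarith [ht.1]) (by linarith [ht.2])).2.2.1 ht.1 ht.2).2]; linarith
  · rw [((squareXY_phases (by linarith [ht.1]) ht.2).2.2.2 ht.1).1]; simpa using a


/-- The curves are images of rectangle boundaries under `w ↦ ce^w`. With `s = e^{-Re w}` one has
`|λ| = 1/s`, the speed is at most `s⁻¹(8/s + 16)` and `|f|² ≤ B²s²`. So the integrand is at most
`B²(8 + 16s) ≤ 24B²`, although the lengths of the curves are unbounded. -/
theorem exists_curves_outerQuadrant {c : ℂ} (hc : IsFourthRoot c) {f : ℂ → ℂ} {B : ℝ}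
    (hB : ∀ l ∈ outerQuadrant c, ‖f l‖ ≤ B / ‖l‖) : ∃ γ : ℕ → ℝ → ℂ,
    (∀ n, IsRectifiableJordanCurve (γ n)) ∧
    (∀ n, γ n '' Icc 0 1 ⊆ outerQuadrant c) ∧
    (∀ K ⊆ outerQuadrant c, IsCompact K → ∃ N, ∀ n ≥ N, Surrounds (γ n) K) ∧
    ∃ C : ℝ, ∀ n, ∫ t in (0 : ℝ)..1, ‖f (γ n t)‖ ^ 2 * ‖deriv (γ n) t‖ ≤ C := by
  have hc0 := hc.ne_zero
  have hpi := Real.pi_gt_three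
  set δ : ℕ → ℝ := fun n => 1 / ((n : ℝ) + 3) with hδ
  have h0 : ∀ n, 0 < δ n := fun n => by positivity
  have h1 : ∀ n, δ n ≤ 1 / 3 := fun n => by
    apply one_div_le_one_div_of_le (by norm_num)
    have : (0 : ℝ) ≤ n := n.cast_nonneg
    linarith
  have himg := image_halfStrip hc.norm_eq
  have hmem : ∀ n t, c * Complex.exp (stripCurve (δ n) t) ∈ outerQuadrant c := fun n t => by
    rw [← himg]
    exact ⟨_, stripCurve_mem (h0 n) (h1 n) t, rfl⟩
  refine ⟨fun n t => c * Complex.exp (stripCurve (δ n) t), fun n => ?_, fun n => ?_, ?_,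
    B ^ 2 * 24, fun n => ?_⟩
  · obtain ⟨K, hK⟩ := exists_lipschitzOnWith_stripCurve (h0 n) (h1 n)
    refine ⟨hK.exists_comp_differentiableOn isOpen_univ (F := fun w => c * Complex.exp w)
      (by fun_prop) fun t _ => mem_univ _, ?_, ?_⟩
    · simp only [stripCurve_zero_one]
    · intro s hs t ht h
      exact stripCurve_injOn (h0 n) (h1 n) hs ht (injOn_mul_exp_halfStrip hc0
        (stripCurve_mem (h0 n) (h1 n) s) (stripCurve_mem (h0 n) (h1 n) t) h)
  · rintro _ ⟨t, _, rfl⟩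
    exact hmem n t
  · intro K hK hKc
    have hK' : IsCompact ((fun z => Complex.log (z / c)) '' K) := by
      refine hKc.image_of_continuousOn fun z hz => ?_
      have : z / c ∈ Complex.slitPlane := Or.inl (hK hz).2.1
      exact ((continuousAt_clog this).comp (f := fun z => z / c) (by fun_prop)).continuousWithinAt
    have hanti : ∀ m n, m ≤ n → δ n ≤ δ m := fun m n hmn => by
      apply one_div_le_one_div_of_le (by positivity)
      have : (m : ℝ) ≤ n := by exact_mod_cast hmn
      linarith
    have hmono : ∀ m n, m ≤ n → stripRect (δ m) ⊆ stripRect (δ n) := fun m n hmn w hw => by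
      obtain ⟨a1, a2, a3, a4⟩ := hw
      have := hanti m n hmn
      have l1 := Real.log_le_log (h0 n) this
      have l2 := Real.log_le_log (by linarith [h1 m]) (by linarith : 1 - δ m ≤ 1 - δ n)
      exact ⟨by linarith, by linarith, by linarith, by linarith⟩
    have hopen : ∀ n, IsOpen (stripRect (δ n)) := fun n =>
      (isOpen_lt continuous_const Complex.continuous_re).inter
        ((isOpen_lt Complex.continuous_re continuous_const).inter
          ((isOpen_lt continuous_const Complex.continuous_im).inter
            (isOpen_lt Complex.continuous_im continuous_const)))
    have hδ0 : Tendsto δ atTop (𝓝 0) := by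
      have : Tendsto (fun n : ℕ => (n : ℝ) + 3) atTop atTop :=
        tendsto_atTop_add_const_right _ _ tendsto_natCast_atTop_atTop
      simpa [hδ, Pi.inv_def] using this.inv_tendsto_atTop
    have hpre : ∀ z ∈ K, Complex.log (z / c) ∈ halfStrip ∧
        c * Complex.exp (Complex.log (z / c)) = z := fun z hz => by
      obtain ⟨w, hw, rfl⟩ := himg.symm ▸ hK hz
      have hw' := hw
      obtain ⟨a1, a2, a3⟩ := hw'
      have : c * Complex.exp w / c = Complex.exp w := by field_simp
      simp only [this]
      rw [Complex.log_exp (by linarith) (by linarith)]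
      exact ⟨hw, rfl⟩
    have hcover : (fun z => Complex.log (z / c)) '' K ⊆ ⋃ n, stripRect (δ n) := by
      rintro _ ⟨z, hz, rfl⟩
      obtain ⟨⟨a1, a2, a3⟩, _⟩ := hpre z hz
      simp only
      generalize Complex.log (z / c) = w at a1 a2 a3
      have t1 : ∀ᶠ n in atTop, -Real.log (1 - δ n) < w.re := by
        have : Tendsto (fun n => -Real.log (1 - δ n)) atTop (𝓝 (-Real.log (1 - 0))) :=
          ((hδ0.const_sub 1).log (by norm_num)).neg
        rw [sub_zero, Real.log_one, neg_zero] at this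
        exact this.eventually_lt_const a1
      have t2 : ∀ᶠ n in atTop, w.re < -Real.log (δ n) := by
        have : ∀ᶠ n in atTop, δ n < Real.exp (-w.re) := hδ0.eventually_lt_const (Real.exp_pos _)
        filter_upwards [this] with n hn
        have := (Real.log_lt_iff_lt_exp (h0 n)).2 hn
        linarith
      have t3 : ∀ᶠ n in atTop, δ n < w.im := hδ0.eventually_lt_const a2
      have t4 : ∀ᶠ n in atTop, δ n < Real.pi / 2 - w.im := hδ0.eventually_lt_const (by linarith)
      obtain ⟨n, b1, b2, b3, b4⟩ := (t1.and (t2.and (t3.and t4))).exists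
      exact mem_iUnion.2 ⟨n, b1, b2, b3, by linarith⟩
    -- The open rectangles increase and exhaust the half strip, so the compact preimage of `K` lies
    -- in one of them.
    obtain ⟨N, hN⟩ := hK'.elim_directed_cover _ hopen hcover
      (directed_of_isDirected_le fun m n hmn => hmono m n hmn)
    refine ⟨N, fun n hn z hz => ?_⟩
    obtain ⟨hw, hwz⟩ := hpre z hz
    have hwr : Complex.log (z / c) ∈ stripRect (δ n) := hmono N n hn (hN ⟨z, hz, rfl⟩)
    generalize Complex.log (z / c) = w at hw hwz hwr
    obtain ⟨p1, p2, p3, p4⟩ := stripCurve_phases (h0 n) (h1 n) hwr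
    obtain ⟨L, hL⟩ := exists_lipschitzOnWith_stripCurve (h0 n) (h1 n)
    have hne : ∀ t ∈ Icc (0 : ℝ) 1, stripCurve (δ n) t ≠ w := by
      rintro t ht rfl
      rcases le_total t (1 / 4) with a | a
      · exact (p1 t ⟨ht.1, a⟩).false
      rcases le_total t (1 / 2) with b | b
      · exact (p2 t ⟨a, b⟩).false
      rcases le_total t (3 / 4) with d | d
      · exact (p3 t ⟨b, d⟩).false
      · exact (p4 t ⟨d, ht.2⟩).false
    constructor
    · rintro ⟨t, ht, h⟩
      refine hne t ht (injOn_mul_exp_halfStrip hc0 (stripCurve_mem (h0 n) (h1 n) t) hw ?_)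
      simp only
      rw [hwz]; exact h
    -- The winding number is computed for the rectangle and transported by the injective map `w ↦
    -- ce^w`.
    · have := winding_comp (Φ := fun w => c * Complex.exp w) hL (stripCurve_zero_one _)
        isOpen_halfStrip convex_halfStrip (by fun_prop) (injOn_mul_exp_halfStrip hc0)
        (fun z _ => by simp [hc0])
        (fun t _ => stripCurve_mem (h0 n) (h1 n) t) hw hne
      rw [hwz] at this
      rw [this, winding_of_four_half_planes hL (stripCurve_zero_one _) p1 p2 p3 p4]
      have : (2 * Real.pi * Complex.I : ℂ) ≠ 0 := Complex.two_pi_I_ne_zero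
      field_simp
  · refine (le_abs_self _).trans ?_
    rw [← Real.norm_eq_abs]
    have := intervalIntegral.norm_integral_le_of_norm_le_const_ae (a := 0) (b := 1) (C := B ^ 2 * 24)
      (f := fun t => ‖f (c * Complex.exp (stripCurve (δ n) t))‖ ^ 2 *
        ‖deriv (fun t => c * Complex.exp (stripCurve (δ n) t)) t‖) ?_
    · simpa using this
    filter_upwards [lipschitzWith_squareX.ae_differentiableAt_real,
      lipschitzWith_squareY.ae_differentiableAt_real] with t hX hY _
    have dX := norm_deriv_le_of_lipschitz (x₀ := t) lipschitzWith_squareX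
    have dY := norm_deriv_le_of_lipschitz (x₀ := t) lipschitzWith_squareY
    obtain ⟨b1, b2⟩ := stripCurve_bounds (h0 n) (h1 n) t
    set s : ℝ := 1 - δ n + (2 * δ n - 1) * squareX t with hs
    have hs0 : 0 < s := lt_of_lt_of_le (h0 n) b1.1
    have hs1 : s ≤ 1 := by linarith [b1.2, h0 n]
    have e1 : HasDerivAt (fun t => ((1 - δ n + (2 * δ n - 1) * squareX t : ℝ) : ℂ))
        (((2 * δ n - 1) * deriv squareX t : ℝ) : ℂ) t :=
      ((hX.hasDerivAt.const_mul _).const_add _).ofReal_comp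
    have e2 : HasDerivAt (fun t => ((δ n + (Real.pi / 2 - 2 * δ n) * squareY t : ℝ) : ℂ))
        (((Real.pi / 2 - 2 * δ n) * deriv squareY t : ℝ) : ℂ) t :=
      ((hY.hasDerivAt.const_mul _).const_add _).ofReal_comp
    have e3 := (((e1.clog_real (Complex.ofReal_mem_slitPlane.2 hs0)).neg.add
      (e2.mul_const Complex.I)).cexp.const_mul c).deriv
    have hnorm : ‖c * Complex.exp (stripCurve (δ n) t)‖ = 1 / s := by
      rw [norm_mul, hc.norm_eq, one_mul, Complex.norm_exp, stripCurve_re, ← hs, Real.exp_neg,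
        Real.exp_log hs0, one_div]
    have e4 : ‖deriv (fun t => c * Complex.exp (stripCurve (δ n) t)) t‖ ≤ 1 / s * (8 / s + 16) := by
      have : deriv (fun t => c * Complex.exp (stripCurve (δ n) t)) t = c * (Complex.exp
        (stripCurve (δ n) t) * (-((((2 * δ n - 1) * deriv squareX t : ℝ) : ℂ) / (s : ℂ)) +
          (((Real.pi / 2 - 2 * δ n) * deriv squareY t : ℝ) : ℂ) * Complex.I)) := e3
      rw [this, ← mul_assoc, norm_mul, hnorm]
      gcongr
      refine (norm_add_le _ _).trans (add_le_add ?_ ?_)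
      · rw [norm_neg, norm_div, Complex.norm_real, Complex.norm_real, norm_mul,
          Real.norm_of_nonneg hs0.le]
        gcongr
        have : ‖2 * δ n - 1‖ ≤ 1 := by
          rw [Real.norm_eq_abs, abs_le]; constructor <;> linarith [h0 n, h1 n]
        calc _ ≤ 1 * (8 : ℝ) := mul_le_mul this dX (norm_nonneg _) zero_le_one
          _ = 8 := one_mul _
      · rw [norm_mul, Complex.norm_I, mul_one, Complex.norm_real, norm_mul]
        have hp4 := Real.pi_le_four
        have : ‖Real.pi / 2 - 2 * δ n‖ ≤ 2 := by
          rw [Real.norm_eq_abs, abs_le]; constructor <;> linarith [h0 n, h1 n]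
        calc _ ≤ 2 * (8 : ℝ) := mul_le_mul this dY (norm_nonneg _) zero_le_two
          _ = 16 := by norm_num
    have e5 : ‖f (c * Complex.exp (stripCurve (δ n) t))‖ ≤ B * s := by
      have := hB _ (hmem n t)
      rwa [hnorm, div_div_eq_mul_div, div_one] at this
    rw [norm_mul, norm_pow, norm_norm, norm_norm]
    calc _ ≤ (B * s) ^ 2 * (1 / s * (8 / s + 16)) := by gcongr
      _ = B ^ 2 * (8 + 16 * s) := by field_simp
      _ ≤ B ^ 2 * 24 := by
        have : 0 ≤ B ^ 2 := sq_nonneg B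
        nlinarith

theorem exists_curves_ball {f : ℂ → ℂ} {B : ℝ}
    (hB : ∀ l ∈ Metric.ball (0 : ℂ) 1, ‖f l‖ ≤ B) : ∃ γ : ℕ → ℝ → ℂ,
    (∀ n, IsRectifiableJordanCurve (γ n)) ∧
    (∀ n, γ n '' Icc 0 1 ⊆ Metric.ball (0 : ℂ) 1) ∧
    (∀ K ⊆ Metric.ball (0 : ℂ) 1, IsCompact K → ∃ N, ∀ n ≥ N, Surrounds (γ n) K) ∧
    ∃ C : ℝ, ∀ n, ∫ t in (0 : ℝ)..1, ‖f (γ n t)‖ ^ 2 * ‖deriv (γ n) t‖ ≤ C := by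
  have hpi := Real.pi_pos
  set r : ℕ → ℝ := fun n => 1 - 1 / ((n : ℝ) + 2) with hr
  have h0 : ∀ n, 0 < r n := fun n => by
    have : 1 / ((n : ℝ) + 2) < 1 := by
      rw [div_lt_one (by positivity)]
      have : (0 : ℝ) ≤ n := n.cast_nonneg
      linarith
    simp only [hr]; linarith
  have h1 : ∀ n, r n < 1 := fun n => by
    have : 0 < 1 / ((n : ℝ) + 2) := by positivity
    simp only [hr]; linarith
  have hd : ∀ n (t : ℝ), HasDerivAt (fun t : ℝ => circleMap 0 (r n) (2 * Real.pi * t))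
      (2 * Real.pi * (circleMap 0 (r n) (2 * Real.pi * t) * Complex.I)) t := fun n t => by
    have h2 : HasDerivAt (fun t : ℝ => 2 * Real.pi * t) (2 * Real.pi) t := by
      simpa using (hasDerivAt_id t).const_mul (2 * Real.pi)
    have := (hasDerivAt_circleMap 0 (r n) (2 * Real.pi * t)).scomp t h2
    rw [Complex.real_smul] at this
    push_cast at this
    exact this
  have hmem : ∀ n t, circleMap 0 (r n) (2 * Real.pi * t) ∈ Metric.ball (0 : ℂ) 1 := fun n t => by
    simp [abs_of_pos (h0 n), h1 n]
  refine ⟨fun n t => circleMap 0 (r n) (2 * Real.pi * t), fun n => ⟨?_, ?_, ?_⟩, fun n => ?_, ?_,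
    B ^ 2 * (2 * Real.pi), fun n => ?_⟩
  · have hl : LipschitzWith (2 * ‖Real.pi‖₊) (fun t : ℝ => 2 * Real.pi * t) :=
      LipschitzWith.of_dist_le_mul fun s t => by
        rw [Real.dist_eq, Real.dist_eq, ← mul_sub, abs_mul, abs_mul]
        simp
    exact ⟨_, ((lipschitzWith_circleMap 0 (r n)).comp hl).lipschitzOnWith⟩
  · simp [circleMap_zero]
  · intro s hs t ht h
    have h3 := injOn_circleMap_of_abs_sub_le' (c := 0) (h0 n).ne' (a := 0) (b := 2 * Real.pi)
      (by simp)
    have := h3 (x₁ := 2 * Real.pi * s) (x₂ := 2 * Real.pi * t) ⟨by nlinarith [hs.1], by nlinarith [hs.2]⟩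
      ⟨by nlinarith [ht.1], by nlinarith [ht.2]⟩ h
    exact mul_left_cancel₀ (by positivity) this
  · rintro _ ⟨t, _, rfl⟩
    exact hmem n t
  · intro K hK hKc
    obtain ⟨M, hM1, hM⟩ : ∃ M < 1, ∀ z ∈ K, ‖z‖ ≤ M := by
      rcases K.eq_empty_or_nonempty with rfl | hne
      · exact ⟨0, by norm_num, by simp⟩
      · obtain ⟨z, hz, hmax⟩ := hKc.exists_isMaxOn hne continuous_norm.continuousOn
        exact ⟨‖z‖, by simpa using hK hz, fun w hw => hmax hw⟩
    have hr1 : Tendsto r atTop (𝓝 1) := by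
      have : Tendsto (fun n : ℕ => (n : ℝ) + 2) atTop atTop :=
        tendsto_atTop_add_const_right _ _ tendsto_natCast_atTop_atTop
      simpa [hr, Pi.inv_def] using this.inv_tendsto_atTop.const_sub 1
    obtain ⟨N, hN⟩ := eventually_atTop.1 (hr1.eventually_const_lt hM1)
    refine ⟨N, fun n hn z hz => ⟨?_, ?_⟩⟩
    · rintro ⟨t, _, rfl⟩
      have := (hM _ hz).trans_lt (hN n hn)
      simp [abs_of_pos (h0 n)] at this
    · have hzb : z ∈ Metric.ball (0 : ℂ) (r n) := by
        simpa using (hM _ hz).trans_lt (hN n hn)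
      have h4 := circleIntegral.integral_sub_inv_of_mem_ball hzb
      rw [circleIntegral] at h4
      have h5 := intervalIntegral.smul_integral_comp_mul_left (a := 0) (b := 1)
        (fun θ => deriv (circleMap 0 (r n)) θ • (circleMap 0 (r n) θ - z)⁻¹) (2 * Real.pi)
      rw [mul_zero, mul_one, h4, ← intervalIntegral.integral_smul] at h5
      have h6 : ∫ t in (0 : ℝ)..1, deriv (fun t : ℝ => circleMap 0 (r n) (2 * Real.pi * t)) t /
          (circleMap 0 (r n) (2 * Real.pi * t) - z) = 2 * Real.pi * Complex.I := by
        rw [← h5]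
        refine intervalIntegral.integral_congr fun t _ => ?_
        rw [(hd n t).deriv, deriv_circleMap, Complex.real_smul, smul_eq_mul]
        push_cast
        ring
      simp only
      rw [h6]
      have : (2 * Real.pi * Complex.I : ℂ) ≠ 0 := Complex.two_pi_I_ne_zero
      field_simp
  · refine (le_abs_self _).trans ?_
    rw [← Real.norm_eq_abs]
    have := intervalIntegral.norm_integral_le_of_norm_le_const (a := 0) (b := 1)
      (C := B ^ 2 * (2 * Real.pi))
      (f := fun t => ‖f (circleMap 0 (r n) (2 * Real.pi * t))‖ ^ 2 *
        ‖deriv (fun t : ℝ => circleMap 0 (r n) (2 * Real.pi * t)) t‖) fun t _ => ?_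
    · simpa using this
    have e : ‖(2 * Real.pi : ℂ) * (circleMap 0 (r n) (2 * Real.pi * t) * Complex.I)‖ =
        2 * Real.pi * r n := by
      simp [abs_of_pos (h0 n), abs_of_pos hpi]
    rw [(hd n t).deriv, norm_mul, norm_pow, norm_norm, norm_norm, e]
    have h2 := hB _ (hmem n t)
    have h3 := h1 n
    have h4 := h0 n
    have h5 : ‖f (circleMap 0 (r n) (2 * Real.pi * t))‖ ^ 2 ≤ B ^ 2 := by gcongr
    exact mul_le_mul h5 (by nlinarith) (by positivity) (sq_nonneg B)

/-- A bounded analytic function off `Y` which decays like `1 / λ` is in the Smirnoff class. -/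
theorem isSmirnoffE2_of_decay {f : ℂ → ℂ} {B : ℝ} (hf : DifferentiableOn ℂ f contourYᶜ)
    (hB : ∀ l ∉ contourY, ‖f l‖ ≤ B ∧ (1 ≤ ‖l‖ → ‖f l‖ ≤ B / ‖l‖)) :
    IsSmirnoffE2 contourYᶜ f := by
  refine ⟨hf, fun z hz => ?_⟩
  rcases mem_ball_or_outerQuadrant hz with h | ⟨c, hc, h⟩
  · rw [connectedComponentIn_eq_ball h]
    exact exists_curves_ball fun l hl => (hB l (ball_subset_compl_contourY hl)).1
  · rw [hc.connectedComponentIn_eq h]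
    refine exists_curves_outerQuadrant hc fun l hl => (hB l ?_).2 hl.1.le
    rw [hc.outerQuadrant_eq] at hl
    exact hl.1

theorem isRHSolution_mY {ν : ℂ} (hν : ∀ n : ℤ, ν ≠ Complex.I * n) (y : ℝ) :
    IsRHSolution arcY (jumpY y ν) (mY y ν) where
  smirnoff i k := by
    obtain ⟨C, hC0, hC⟩ := exists_norm_mY_sub_one_le hν y
    exact isSmirnoffE2_of_decay (B := C)
      (fun z hz => ((differentiableAt_mY hν y hz i k).sub_const _).differentiableWithinAt)
      fun l hl => hC l hl i k
  jump j := jump_mY hν y j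


/-! ### Cauchy's formula in domains with primitives -/

/-- Every analytic function in `D` has a primitive. -/
def HasPrimitives (D : Set ℂ) : Prop :=
  ∀ g : ℂ → ℂ, DifferentiableOn ℂ g D → Complex.IsExactOn g D

theorem hasPrimitives_ball : HasPrimitives (Metric.ball 0 1) := fun _ hg => hg.isExactOn_ball

/-- Pull back to the convex half strip: a primitive of `g(ce^w) ce^w`, composed with `log(z/c)`, is
a primitive of `g`. -/
theorem hasPrimitives_outerQuadrant {c : ℂ} (hc : IsFourthRoot c) :
    HasPrimitives (outerQuadrant c) := by
  intro g hg
  have himg := image_halfStrip hc.norm_eq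
  have hpi := Real.pi_pos
  have hG : DifferentiableOn ℂ (fun w => g (c * Complex.exp w) * (c * Complex.exp w)) halfStrip := by
    refine DifferentiableOn.mul (hg.comp (f := fun w => c * Complex.exp w) (by fun_prop) ?_)
      (by fun_prop)
    intro w hw
    rw [← himg]
    exact ⟨w, hw, rfl⟩
  obtain ⟨F, hF⟩ := convex_halfStrip.exists_forall_hasDerivWithinAt hG
  refine ⟨fun z => F (Complex.log (z / c)), fun z hz => ?_⟩
  have hz1 : z / c ∈ Complex.slitPlane := Or.inl hz.2.1
  have hz0 : z ≠ 0 := by rintro rfl; simp [outerQuadrant] at hz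
  obtain ⟨w, hw, rfl⟩ := himg.symm ▸ hz
  have e1 : c * Complex.exp w / c = Complex.exp w := by field_simp [hc.ne_zero]
  have e2 : Complex.log (c * Complex.exp w / c) = w := by
    rw [e1, Complex.log_exp (by linarith [hw.2.1]) (by linarith [hw.2.2])]
  have h1 := ((hF w hw).hasDerivAt (isOpen_halfStrip.mem_nhds hw))
  have h2 := ((hasDerivAt_id (c * Complex.exp w)).div_const c).clog hz1
  have h3 := HasDerivAt.comp (c * Complex.exp w) (h₂ := F) (by simp only [id]; rw [e2]; exact h1) h2
  refine HasDerivAt.congr_deriv (f' := g (c * Complex.exp w) * (c * Complex.exp w) *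
    (1 / c / (c * Complex.exp w / c))) h3 ?_
  simp only
  have := hc.ne_zero
  have := Complex.exp_ne_zero w
  field_simp

theorem IsRectifiableJordanCurve.integral_eq_zero {γ : ℝ → ℂ} (hγ : IsRectifiableJordanCurve γ)
    {D : Set ℂ} (hD : IsOpen D) (hp : HasPrimitives D) (hm : ∀ t ∈ Icc (0 : ℝ) 1, γ t ∈ D)
    {g : ℂ → ℂ} (hg : DifferentiableOn ℂ g D) : ∫ t in (0 : ℝ)..1, deriv γ t * g (γ t) = 0 := by
  obtain ⟨K, hK⟩ := hγ.lipschitz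
  obtain ⟨F, hF⟩ := hp g hg
  rw [hK.integral_deriv_mul_eq_sub zero_le_one hD hF hm, hγ.closed, sub_self]

/-- The difference quotient of `g` at `a` is analytic and integrates to zero; the remaining term is
`g(a)` times the winding integral. -/
theorem IsRectifiableJordanCurve.integral_div_sub {γ : ℝ → ℂ} (hγ : IsRectifiableJordanCurve γ)
    {D : Set ℂ} (hD : IsOpen D) (hp : HasPrimitives D) (hm : ∀ t ∈ Icc (0 : ℝ) 1, γ t ∈ D)
    {g : ℂ → ℂ} (hg : DifferentiableOn ℂ g D) {K : Set ℂ} (hK : Surrounds γ K) {a : ℂ}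
    (haK : a ∈ K) (ha : a ∈ D) :
    ∫ t in (0 : ℝ)..1, deriv γ t * (g (γ t) / (γ t - a)) = 2 * Real.pi * Complex.I * g a := by
  obtain ⟨L, hL⟩ := hγ.lipschitz
  obtain ⟨hn, hw⟩ := hK a haK
  have hne : ∀ t ∈ Icc (0 : ℝ) 1, γ t ≠ a := fun t ht h => hn ⟨t, ht, h⟩
  have hd : DifferentiableOn ℂ (dslope g a) D :=
    (Complex.differentiableOn_dslope (hD.mem_nhds ha)).2 hg
  have h0 := hγ.integral_eq_zero hD hp hm hd
  have hw' : ∫ t in (0 : ℝ)..1, deriv γ t / (γ t - a) = 2 * Real.pi * Complex.I := by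
    have := Complex.two_pi_I_ne_zero
    field_simp at hw
    linear_combination hw
  have i1 : IntervalIntegrable (fun t => deriv γ t * dslope g a (γ t)) volume 0 1 :=
    hL.intervalIntegrable_deriv_mul zero_le_one (hd.continuousOn.comp hL.continuousOn hm)
  have i2 : IntervalIntegrable (fun t => deriv γ t * (γ t - a)⁻¹) volume 0 1 :=
    hL.intervalIntegrable_deriv_mul zero_le_one
      ((hL.continuousOn.sub continuousOn_const).inv₀ fun t ht => sub_ne_zero.2 (hne t ht))
  have h1 : ∫ t in (0 : ℝ)..1, deriv γ t * (g (γ t) / (γ t - a)) =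
      ∫ t in (0 : ℝ)..1, (deriv γ t * dslope g a (γ t) + g a * (deriv γ t * (γ t - a)⁻¹)) := by
    refine intervalIntegral.integral_congr fun t ht => ?_
    rw [uIcc_of_le zero_le_one] at ht
    have := sub_ne_zero.2 (hne t ht)
    rw [dslope_of_ne _ (hne t ht), slope_def_field]
    field_simp
    ring
  rw [h1, intervalIntegral.integral_add i1 (i2.const_mul _), h0, zero_add,
    intervalIntegral.integral_const_mul]
  simp only [← div_eq_mul_inv]
  rw [hw']
  ring

/-! ### Interior bounds for Smirnoff functions. -/

/-- The data of a function in the Smirnoff class on one component. -/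
structure SmirnoffData (D : Set ℂ) (f : ℂ → ℂ) (γ : ℕ → ℝ → ℂ) (C : ℝ) : Prop where
  isOpen : IsOpen D
  prim : HasPrimitives D
  diff : DifferentiableOn ℂ f D
  jordan : ∀ n, IsRectifiableJordanCurve (γ n)
  mem : ∀ n, γ n '' Icc 0 1 ⊆ D
  surr : ∀ K ⊆ D, IsCompact K → ∃ N, ∀ n ≥ N, Surrounds (γ n) K
  bound : ∀ n, ∫ t in (0 : ℝ)..1, ‖f (γ n t)‖ ^ 2 * ‖deriv (γ n) t‖ ≤ C

theorem SmirnoffData.mem' {D : Set ℂ} {f : ℂ → ℂ} {γ : ℕ → ℝ → ℂ} {C : ℝ}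
    (h : SmirnoffData D f γ C) (n : ℕ) : ∀ t ∈ Icc (0 : ℝ) 1, γ n t ∈ D :=
  fun t ht => h.mem n ⟨t, ht, rfl⟩

theorem SmirnoffData.intervalIntegrable {D : Set ℂ} {f : ℂ → ℂ} {γ : ℕ → ℝ → ℂ} {C : ℝ}
    (h : SmirnoffData D f γ C) (n : ℕ) :
    IntervalIntegrable (fun t => ‖f (γ n t)‖ ^ 2 * ‖deriv (γ n) t‖) volume 0 1 := by
  obtain ⟨L, hL⟩ := (h.jordan n).lipschitz
  have hc : ContinuousOn (fun t => f (γ n t) ^ 2) (Icc 0 1) :=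
    (h.diff.continuousOn.comp hL.continuousOn (h.mem' n)).pow 2
  refine (hL.intervalIntegrable_deriv_mul zero_le_one hc).norm.congr (fun t _ => ?_)
  rw [norm_mul, norm_pow, mul_comm]

theorem SmirnoffData.nonneg {D : Set ℂ} {f : ℂ → ℂ} {γ : ℕ → ℝ → ℂ} {C : ℝ}
    (h : SmirnoffData D f γ C) : 0 ≤ C :=
  (intervalIntegral.integral_nonneg zero_le_one fun t _ => by positivity).trans (h.bound 0)

/-- Cauchy's formula is applied to `f²`, so that the `L²` bound on the curve is the one needed. A
curve surrounding the closed disc has distance at least `d` from its centre. -/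
theorem SmirnoffData.norm_sq_le {D : Set ℂ} {f : ℂ → ℂ} {γ : ℕ → ℝ → ℂ} {C : ℝ}
    (h : SmirnoffData D f γ C) {a : ℂ} {d : ℝ} (hd : 0 < d) (had : Metric.closedBall a d ⊆ D) :
    ‖f a‖ ^ 2 ≤ C / d := by
  have haD := had (Metric.mem_closedBall_self hd.le)
  obtain ⟨N, hN⟩ := h.surr _ had (isCompact_closedBall a d)
  have hs := hN N le_rfl
  have hne : ∀ t ∈ Icc (0 : ℝ) 1, d ≤ ‖γ N t - a‖ := fun t ht => by
    by_contra! hlt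
    exact (hs (γ N t) (by rw [mem_closedBall_iff_norm]; exact hlt.le)).1 ⟨t, ht, rfl⟩
  have key := (h.jordan N).integral_div_sub h.isOpen h.prim (h.mem' N) (h.diff.pow 2) hs
    (Metric.mem_closedBall_self hd.le) haD
  have h1 : ‖∫ t in (0 : ℝ)..1, deriv (γ N) t * ((f ^ 2) (γ N t) / (γ N t - a))‖ ≤
      ∫ t in (0 : ℝ)..1, (‖f (γ N t)‖ ^ 2 * ‖deriv (γ N) t‖) * d⁻¹ := by
    refine intervalIntegral.norm_integral_le_of_norm_le zero_le_one ?_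
      ((h.intervalIntegrable N).mul_const _)
    refine Eventually.of_forall fun t ht => ?_
    have h2 := hne t ⟨ht.1.le, ht.2⟩
    rw [norm_mul, norm_div, Pi.pow_apply, norm_pow, div_eq_mul_inv, ← mul_assoc,
      mul_comm ‖deriv (γ N) t‖]
    gcongr
  have h3 : ‖f a‖ ^ 2 ≤ ‖(2 * Real.pi * Complex.I * (f ^ 2) a : ℂ)‖ := by
    rw [norm_mul, Pi.pow_apply, norm_pow]
    have : 1 ≤ ‖(2 * Real.pi * Complex.I : ℂ)‖ := by
      simp [abs_of_pos Real.pi_pos]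
      linarith [Real.pi_gt_three]
    nlinarith [sq_nonneg ‖f a‖]
  rw [key] at h1
  rw [intervalIntegral.integral_mul_const] at h1
  calc _ ≤ _ := h3.trans h1
    _ ≤ C * d⁻¹ := by gcongr; exact h.bound N
    _ = C / d := by rw [div_eq_mul_inv]

/-- The primitive is `2 arctan(2(x-u)/ε)`, so the bound is independent of `ε`, `u` and the interval.
The term `ε²/4` corresponds to the vertical distance `ε/2` in `exists_kernel_le`. -/
theorem integral_poisson_le (ε u a b : ℝ) (hε : 0 < ε) :
    ∫ x in a..b, ε / ((x - u) ^ 2 + ε ^ 2 / 4) ≤ 2 * Real.pi := by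
  have hd : ∀ x ∈ uIcc a b, HasDerivAt (fun x => 2 * Real.arctan (2 / ε * (x - u)))
      (ε / ((x - u) ^ 2 + ε ^ 2 / 4)) x := fun x _ => by
    have h1 : HasDerivAt (fun x => 2 / ε * (x - u)) (2 / ε) x := by
      simpa using ((hasDerivAt_id x).sub_const u).const_mul (2 / ε)
    have h2 : 1 + (2 / ε * (x - u)) ^ 2 = ((x - u) ^ 2 + ε ^ 2 / 4) * (4 / ε ^ 2) := by
      field_simp
      ring
    have h3 : (x - u) ^ 2 + ε ^ 2 / 4 ≠ 0 := by positivity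
    refine (h1.arctan.const_mul 2).congr_deriv ?_
    rw [h2]
    generalize (x - u) ^ 2 + ε ^ 2 / 4 = q at *
    field_simp
    norm_num
  have hc : Continuous fun x => ε / ((x - u) ^ 2 + ε ^ 2 / 4) :=
    Continuous.div continuous_const (by fun_prop) fun x => by positivity
  rw [intervalIntegral.integral_eq_sub_of_hasDerivAt hd (hc.intervalIntegrable _ _)]
  have h1 := Real.arctan_lt_pi_div_two (2 / ε * (b - u))
  have h2 := Real.neg_pi_div_two_lt_arctan (2 / ε * (a - u))
  linarith


/-! ### Exponential charts -/

/-- An exponential chart, which maps `0` to `p`. -/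
noncomputable def expChart (p κ w : ℂ) : ℂ := p * Complex.exp (κ * w)

theorem norm_expChart_mem {p κ w : ℂ} (hκ : ‖κ‖ = 1) (hw : ‖w‖ ≤ 1 / 4) :
    ‖p‖ / 2 ≤ ‖expChart p κ w‖ ∧ ‖expChart p κ w‖ ≤ 2 * ‖p‖ := by
  have h1 : |(κ * w).re| ≤ 1 / 4 := (Complex.abs_re_le_norm _).trans (by rwa [norm_mul, hκ, one_mul])
  have h2 := abs_le.1 h1
  have h3 := Real.add_one_le_exp (κ * w).re
  have h4 := Real.add_one_le_exp (-(κ * w).re)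
  rw [expChart, norm_mul, Complex.norm_exp]
  have h5 : Real.exp (κ * w).re ≤ 2 := by
    have h6 : Real.exp (κ * w).re * Real.exp (-(κ * w).re) = 1 := by
      rw [← Real.exp_add, add_neg_cancel, Real.exp_zero]
    nlinarith [Real.exp_pos (κ * w).re]
  have := norm_nonneg p
  constructor <;> nlinarith

/-- For `x = κ(w - ζ)` one has `|x| ≤ 1/2`, so `|e^x - 1 - x| ≤ |x|²` puts `|e^x - 1|` between
`|x|/2` and `2|x|`. The outer factor has modulus between `|p|/2` and `2|p|`. -/
theorem norm_expChart_sub {p κ w ζ : ℂ} (hκ : ‖κ‖ = 1) (hw : ‖w‖ ≤ 1 / 4) (hζ : ‖ζ‖ ≤ 1 / 4) :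
    ‖p‖ / 4 * ‖w - ζ‖ ≤ ‖expChart p κ w - expChart p κ ζ‖ ∧
    ‖expChart p κ w - expChart p κ ζ‖ ≤ 4 * ‖p‖ * ‖w - ζ‖ := by
  obtain ⟨h1, h2⟩ := norm_expChart_mem (p := p) hκ hζ
  have hd : ‖w - ζ‖ ≤ 1 / 2 := (norm_sub_le _ _).trans (by linarith)
  have hk : ‖κ * (w - ζ)‖ = ‖w - ζ‖ := by rw [norm_mul, hκ, one_mul]
  have h3 := Complex.norm_exp_sub_one_le (x := κ * (w - ζ)) (by rw [hk]; linarith)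
  have h4 := Complex.norm_exp_sub_one_sub_id_le (x := κ * (w - ζ)) (by rw [hk]; linarith)
  have h5 := norm_sub_norm_le (κ * (w - ζ)) (κ * (w - ζ) - (Complex.exp (κ * (w - ζ)) - 1))
  rw [sub_sub_cancel, norm_sub_rev (κ * (w - ζ))] at h5
  rw [hk] at h3 h4 h5
  have e : expChart p κ w - expChart p κ ζ =
      expChart p κ ζ * (Complex.exp (κ * (w - ζ)) - 1) := by
    rw [expChart, expChart, mul_sub, mul_assoc, ← Complex.exp_add]
    ring_nf
  rw [e, norm_mul]
  have n1 := norm_nonneg (w - ζ)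
  have n2 := norm_nonneg p
  have h6 : ‖w - ζ‖ / 2 ≤ ‖Complex.exp (κ * (w - ζ)) - 1‖ := by nlinarith
  constructor
  · calc _ = ‖p‖ / 2 * (‖w - ζ‖ / 2) := by ring
      _ ≤ _ := by gcongr
  · calc _ ≤ 2 * ‖p‖ * (2 * ‖w - ζ‖) := by gcongr
      _ = _ := by ring

/-- A quantitative open mapping statement: the image of the disc of radius `s` about `w` contains a
disc of radius `|p|s/8`. The relative error `u` is at most `s/4`, and `|log(1+u)| ≤ (3/2)|u| < s`.
-/
theorem exists_expChart_eq {p κ w l : ℂ} (hp : p ≠ 0) (hκ : ‖κ‖ = 1) (hw : ‖w‖ ≤ 1 / 4) {s : ℝ}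
    (hs0 : 0 < s) (hs : s ≤ 1) (hl : ‖l - expChart p κ w‖ ≤ ‖p‖ * s / 8) :
    ∃ ζ, expChart p κ ζ = l ∧ ‖ζ - w‖ < s := by
  obtain ⟨h1, -⟩ := norm_expChart_mem (p := p) hκ hw
  have hp0 : 0 < ‖p‖ := norm_pos_iff.2 hp
  have hκ0 : κ ≠ 0 := norm_pos_iff.1 (by rw [hκ]; exact one_pos)
  have hc : expChart p κ w ≠ 0 := mul_ne_zero hp (Complex.exp_ne_zero _)
  set u : ℂ := (l - expChart p κ w) / expChart p κ w with hu
  have hun : ‖u‖ ≤ s / 4 := by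
    rw [hu, norm_div, div_le_iff₀ (norm_pos_iff.2 hc)]
    nlinarith
  have h1u : 1 + u ≠ 0 := by
    intro h
    have : ‖u‖ = 1 := by rw [show u = -1 by linear_combination h]; simp
    linarith
  refine ⟨w + Complex.log (1 + u) / κ, ?_, ?_⟩
  · rw [expChart, mul_add, mul_div_cancel₀ _ hκ0, Complex.exp_add, Complex.exp_log h1u, ← mul_assoc]
    change expChart p κ w * (1 + u) = l
    rw [hu]
    field_simp
    ring
  · rw [add_sub_cancel_left, norm_div, hκ, div_one]
    have := Complex.norm_log_one_add_half_le_self (z := u) (by linarith)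
    linarith

theorem norm_le_of_abs_le {w : ℂ} {r : ℝ} (h1 : |w.re| ≤ r) (h2 : |w.im| ≤ r) (hr : r ≤ 1 / 8) :
    ‖w‖ ≤ 1 / 4 := (Complex.norm_le_abs_re_add_abs_im w).trans (by linarith)

theorem continuous_expChart (p κ : ℂ) : Continuous (expChart p κ) := by
  unfold expChart; fun_prop

theorem differentiable_expChart (p κ : ℂ) : Differentiable ℂ (expChart p κ) := by
  unfold expChart; fun_prop

/-- The difference of two Cauchy kernels with poles at reflected points is bounded by a Poisson
kernel. -/
theorem exists_kernel_le {D : Set ℂ} {p κ : ℂ} (hp : p ≠ 0) (hκ : ‖κ‖ = 1) {r : ℝ} (hr0 : 0 < r)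
    (hr : r ≤ 1 / 8)
    (hD : ∀ w : ℂ, |w.re| < r → |w.im| < r → w.im ≤ 0 → expChart p κ w ∉ D) {ε : ℝ}
    (hε : ε ∈ Ioo 0 (r / 4)) {l : ℂ} (hl : l ∈ D)
    (hlK : l ∉ expChart p κ '' (Icc (-(r / 2)) (r / 2) ×ℂ Icc (ε / 2) (r / 2))) :
    ∃ u : ℝ, ∀ x ∈ Icc (-(r / 4)) (r / 4),
      l ≠ expChart p κ (x + ε * Complex.I) ∧ l ≠ expChart p κ (x - ε * Complex.I) ∧
      ‖expChart p κ (x + ε * Complex.I) - expChart p κ (x - ε * Complex.I)‖ /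
        (‖l - expChart p κ (x + ε * Complex.I)‖ * ‖l - expChart p κ (x - ε * Complex.I)‖) ≤
      128 / ‖p‖ * (ε / ((x - u) ^ 2 + ε ^ 2 / 4)) + 8192 / (‖p‖ * r) := by
  obtain ⟨he0, her⟩ := hε
  have hp0 : 0 < ‖p‖ := norm_pos_iff.2 hp
  have hxa : ∀ x ∈ Icc (-(r / 4)) (r / 4), ‖(x + ε * Complex.I : ℂ)‖ ≤ 1 / 4 ∧
      ‖(x - ε * Complex.I : ℂ)‖ ≤ 1 / 4 := fun x hx => by
    have h1 : |x| ≤ r / 4 := abs_le.2 hx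
    constructor <;> refine norm_le_of_abs_le (r := r / 4) ?_ ?_ (by linarith) <;>
      simp [abs_of_pos he0, h1, her.le]
  have hab : ∀ x ∈ Icc (-(r / 4)) (r / 4),
      ‖expChart p κ (x + ε * Complex.I) - expChart p κ (x - ε * Complex.I)‖ ≤ 8 * ‖p‖ * ε := by
    intro x hx
    refine (norm_expChart_sub hκ (hxa x hx).1 (hxa x hx).2).2.trans (le_of_eq ?_)
    rw [show (x + ε * Complex.I - (x - ε * Complex.I) : ℂ) = ((2 * ε : ℝ) : ℂ) * Complex.I by
      push_cast; ring, norm_mul, Complex.norm_I, Complex.norm_real, Real.norm_of_nonneg (by linarith)]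
    ring
  -- If `l` has a coordinate `ζ` in the box, then `0 < Im ζ < ε/2`, because the lower half misses
  -- `D` and the rectangle above is excluded. Both poles then have distance at least `√((x - Re ζ)²
  -- + ε²/4)` from `ζ`. Otherwise both poles are at distance at least `|p|r/32` from `l`, and the
  -- kernel is bounded by a constant.
  by_cases hc : ∃ ζ : ℂ, |ζ.re| < r / 2 ∧ |ζ.im| < r / 2 ∧ expChart p κ ζ = l
  · obtain ⟨ζ, hζ1, hζ2, rfl⟩ := hc
    have hζn := norm_le_of_abs_le hζ1.le hζ2.le (by linarith)
    have him : 0 < ζ.im := by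
      by_contra! h
      exact hD ζ (by linarith) (by linarith) h hl
    have him2 : ζ.im < ε / 2 := by
      by_contra! h
      exact hlK ⟨ζ, ⟨abs_le.1 hζ1.le, h, (abs_lt.1 hζ2).2.le⟩, rfl⟩
    refine ⟨ζ.re, fun x hx => ?_⟩
    have q0 : 0 < (x - ζ.re) ^ 2 + ε ^ 2 / 4 := by positivity
    have s1 : Real.sqrt ((x - ζ.re) ^ 2 + ε ^ 2 / 4) ≤ ‖ζ - (x + ε * Complex.I)‖ := by
      rw [Complex.norm_def]
      apply Real.sqrt_le_sqrt
      simp [Complex.normSq_apply]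
      nlinarith
    have s2 : Real.sqrt ((x - ζ.re) ^ 2 + ε ^ 2 / 4) ≤ ‖ζ - (x - ε * Complex.I)‖ := by
      rw [Complex.norm_def]
      apply Real.sqrt_le_sqrt
      simp [Complex.normSq_apply]
      nlinarith
    have t1 := (norm_expChart_sub (p := p) hκ hζn (hxa x hx).1).1
    have t2 := (norm_expChart_sub (p := p) hκ hζn (hxa x hx).2).1
    have q1 := Real.sqrt_pos.2 q0
    have q2 := Real.mul_self_sqrt q0.le
    set q := Real.sqrt ((x - ζ.re) ^ 2 + ε ^ 2 / 4) with hq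
    have v1 : ‖p‖ / 4 * q ≤ ‖expChart p κ ζ - expChart p κ (x + ε * Complex.I)‖ :=
      le_trans (by gcongr) t1
    have v2 : ‖p‖ / 4 * q ≤ ‖expChart p κ ζ - expChart p κ (x - ε * Complex.I)‖ :=
      le_trans (by gcongr) t2
    have vq : 0 < ‖p‖ / 4 * q := by positivity
    refine ⟨sub_ne_zero.1 (norm_pos_iff.1 (vq.trans_le v1)),
      sub_ne_zero.1 (norm_pos_iff.1 (vq.trans_le v2)), ?_⟩
    calc _ ≤ 8 * ‖p‖ * ε / ((‖p‖ / 4 * q) * (‖p‖ / 4 * q)) := by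
          gcongr
          exact hab x hx
      _ = 128 / ‖p‖ * (ε / (q * q)) := by field_simp; norm_num
      _ ≤ _ := by
        rw [q2]
        have : 0 ≤ 8192 / (‖p‖ * r) := by positivity
        linarith
  · push Not at hc
    refine ⟨0, fun x hx => ?_⟩
    have far : ∀ w : ℂ, |w.re| ≤ r / 4 → |w.im| ≤ r / 4 →
        ‖p‖ * r / 32 ≤ ‖l - expChart p κ w‖ := by
      intro w hw1 hw2
      by_contra! h
      obtain ⟨ζ, hζ, hζw⟩ := exists_expChart_eq hp hκ (norm_le_of_abs_le hw1 hw2 (by linarith))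
        (s := r / 4) (by linarith) (by linarith) (h.le.trans (le_of_eq (by ring)))
      have a1 := (Complex.abs_re_le_norm (ζ - w)).trans_lt hζw
      have a2 := (Complex.abs_im_le_norm (ζ - w)).trans_lt hζw
      rw [Complex.sub_re] at a1
      rw [Complex.sub_im] at a2
      have b1 := abs_sub_abs_le_abs_sub ζ.re w.re
      have b2 := abs_sub_abs_le_abs_sub ζ.im w.im
      exact hc ζ (by linarith) (by linarith) hζ
    have h1 : |x| ≤ r / 4 := abs_le.2 hx
    have v1 := far (x + ε * Complex.I) (by simpa using h1) (by simpa [abs_of_pos he0] using her.le)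
    have v2 := far (x - ε * Complex.I) (by simpa using h1) (by simpa [abs_of_pos he0] using her.le)
    have vq : 0 < ‖p‖ * r / 32 := by positivity
    refine ⟨sub_ne_zero.1 (norm_pos_iff.1 (vq.trans_le v1)),
      sub_ne_zero.1 (norm_pos_iff.1 (vq.trans_le v2)), ?_⟩
    calc _ ≤ 8 * ‖p‖ * r / ((‖p‖ * r / 32) * (‖p‖ * r / 32)) := by
          gcongr
          refine (hab x hx).trans ?_
          gcongr
          linarith
      _ = 8192 / (‖p‖ * r) := by field_simp; norm_num
      _ ≤ _ := by
        have : 0 ≤ 128 / ‖p‖ * (ε / ((x - 0) ^ 2 + ε ^ 2 / 4)) := by positivity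
        linarith


/-! ### Square means over level lines. -/

/-- Fubini's theorem: the density on the curve is integrated against a kernel whose integral in the
other variable is uniformly bounded. -/
theorem intervalIntegral_swap_le {a b B C : ℝ} (hab : a ≤ b) {h F : ℝ → ℝ} {k : ℝ × ℝ → ℝ}
    (hh : IntervalIntegrable h volume 0 1) (h0 : ∀ t, 0 ≤ h t) (hC : ∫ t in (0 : ℝ)..1, h t ≤ C)
    (hk : ContinuousOn k (Icc a b ×ˢ Icc 0 1)) (hB0 : 0 ≤ B)
    (hB : ∀ t ∈ Icc (0 : ℝ) 1, ∫ x in a..b, k (x, t) ≤ B)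
    (hF : IntervalIntegrable F volume a b)
    (hFk : ∀ x ∈ Icc a b, F x ≤ ∫ t in (0 : ℝ)..1, h t * k (x, t)) :
    ∫ x in a..b, F x ≤ C * B := by
  have hint : Integrable (Function.uncurry fun x t => h t * k (x, t))
      ((volume.restrict (Ioc a b)).prod (volume.restrict (Ioc 0 1))) := by
    have h1 : Integrable (fun z : ℝ × ℝ => h z.2)
        ((volume.restrict (Ioc a b)).prod (volume.restrict (Ioc 0 1))) :=
      ((intervalIntegrable_iff_integrableOn_Ioc_of_le zero_le_one).1 hh).comp_snd _
    obtain ⟨c, hc⟩ := (isCompact_Icc.prod isCompact_Icc).exists_bound_of_continuousOn hk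
    have hs : Ioc a b ×ˢ Ioc (0 : ℝ) 1 ⊆ Icc a b ×ˢ Icc 0 1 :=
      Set.prod_mono Ioc_subset_Icc_self Ioc_subset_Icc_self
    refine Integrable.mul_bdd (g := k) (c := c) h1 ?_ ?_
    · rw [Measure.prod_restrict]
      exact (hk.mono hs).aestronglyMeasurable (measurableSet_Ioc.prod measurableSet_Ioc)
    · rw [Measure.prod_restrict]
      exact (ae_restrict_iff' (measurableSet_Ioc.prod measurableSet_Ioc)).2
        (Eventually.of_forall fun z hz => hc z (hs hz))
  have hswap := integral_integral_swap hint
  have hx := hint.integral_prod_left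
  have ht := hint.integral_prod_right
  calc ∫ x in a..b, F x ≤ ∫ x in a..b, ∫ t in (0 : ℝ)..1, h t * k (x, t) := by
        refine intervalIntegral.integral_mono_on hab hF ?_ hFk
        rw [intervalIntegrable_iff_integrableOn_Ioc_of_le hab]
        simpa only [intervalIntegral.integral_of_le zero_le_one, IntegrableOn,
          Function.uncurry_apply_pair] using hx
    _ = ∫ t in (0 : ℝ)..1, ∫ x in a..b, h t * k (x, t) := by
        simpa only [intervalIntegral.integral_of_le zero_le_one,
          intervalIntegral.integral_of_le hab] using hswap
    _ ≤ ∫ t in (0 : ℝ)..1, h t * B := by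
        refine intervalIntegral.integral_mono_on zero_le_one ?_ (hh.mul_const _) fun t ht => ?_
        · rw [intervalIntegrable_iff_integrableOn_Ioc_of_le zero_le_one]
          simpa only [intervalIntegral.integral_of_le hab, IntegrableOn,
            Function.uncurry_apply_pair] using ht
        · rw [intervalIntegral.integral_const_mul]
          exact mul_le_mul_of_nonneg_left (hB t ht) (h0 t)
    _ ≤ C * B := by
        rw [intervalIntegral.integral_mul_const]
        gcongr

/-- The `L²` norms of a function in the Smirnoff class over level lines of a boundary chart are
bounded. -/
theorem SmirnoffData.integral_expChart_le {D : Set ℂ} {f : ℂ → ℂ} {γ : ℕ → ℝ → ℂ} {C : ℝ}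
    (h : SmirnoffData D f γ C) {p κ : ℂ} (hp : p ≠ 0) (hκ : ‖κ‖ = 1) {r : ℝ} (hr0 : 0 < r)
    (hr : r ≤ 1 / 8)
    (h1 : ∀ w : ℂ, |w.re| < r → |w.im| < r → 0 < w.im → expChart p κ w ∈ D)
    (h2 : ∀ w : ℂ, |w.re| < r → |w.im| < r → w.im ≤ 0 → expChart p κ w ∉ D) :
    ∃ M, ∀ ε ∈ Ioo 0 (r / 4),
      ∫ x in (-(r / 4))..(r / 4), ‖f (expChart p κ (x + ε * Complex.I))‖ ^ 2 ≤ M := by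
  have hp0 : 0 < ‖p‖ := norm_pos_iff.2 hp
  set B := 128 / ‖p‖ * (2 * Real.pi) + 8192 / (‖p‖ * r) * (r / 2) with hB
  have hB0 : 0 ≤ B := by have := Real.pi_pos; positivity
  refine ⟨C * B, fun ε hε => ?_⟩
  obtain ⟨he0, her⟩ := id hε
  set R := Icc (-(r / 2)) (r / 2) ×ℂ Icc (ε / 2) (r / 2) with hR
  have hKD : expChart p κ '' R ⊆ D := by
    rintro _ ⟨w, ⟨hw1, hw2⟩, rfl⟩
    have : |w.re| ≤ r / 2 := abs_le.2 hw1
    have h3 : 0 < w.im := by linarith [hw2.1]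
    exact h1 w (by linarith) (by rw [abs_of_pos h3]; linarith [hw2.2]) h3
  have hKc : IsCompact (expChart p κ '' R) :=
    (isCompact_Icc.reProdIm isCompact_Icc).image (continuous_expChart p κ)
  obtain ⟨N, hN⟩ := h.surr _ hKD hKc
  have hs := hN N le_rfl
  obtain ⟨L, hL⟩ := (h.jordan N).lipschitz
  have hγc := hL.continuousOn
  set a : ℝ → ℂ := fun x => expChart p κ (x + ε * Complex.I) with ha
  set b : ℝ → ℂ := fun x => expChart p κ (x - ε * Complex.I) with hb
  have hac : Continuous a := (continuous_expChart p κ).comp (by fun_prop)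
  have hbc : Continuous b := (continuous_expChart p κ).comp (by fun_prop)
  have haK : ∀ x ∈ Icc (-(r / 4)) (r / 4), a x ∈ expChart p κ '' R := fun x hx => by
    refine ⟨_, ⟨?_, ?_⟩, rfl⟩
    · simpa using ⟨by linarith [hx.1], by linarith [hx.2]⟩
    · simpa using ⟨by linarith, by linarith⟩
  have hbD : ∀ x ∈ Icc (-(r / 4)) (r / 4), b x ∉ D := fun x hx => by
    have : |x| ≤ r / 4 := abs_le.2 hx
    refine h2 _ ?_ ?_ ?_ <;> simp [abs_of_pos he0]
    all_goals linarith
  have hker : ∀ t ∈ Icc (0 : ℝ) 1, _ := fun t ht =>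
    exists_kernel_le hp hκ hr0 hr h2 hε (h.mem' N t ht)
      (fun hK => (hs _ hK).1 ⟨t, ht, rfl⟩)
  have hne : ∀ x ∈ Icc (-(r / 4)) (r / 4), ∀ t ∈ Icc (0 : ℝ) 1, γ N t - a x ≠ 0 ∧ γ N t - b x ≠ 0 :=
    fun x hx t ht => by
      obtain ⟨u, hu⟩ := hker t ht
      exact ⟨sub_ne_zero.2 (hu x hx).1, sub_ne_zero.2 (hu x hx).2.1⟩
  have hkc : ContinuousOn (fun z : ℝ × ℝ => ‖a z.1 - b z.1‖ / (‖γ N z.2 - a z.1‖ * ‖γ N z.2 - b z.1‖))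
      (Icc (-(r / 4)) (r / 4) ×ˢ Icc 0 1) := by
    have c1 : ContinuousOn (fun z : ℝ × ℝ => γ N z.2) (Icc (-(r / 4)) (r / 4) ×ˢ Icc 0 1) :=
      hγc.comp continuousOn_snd fun z hz => hz.2
    have c2 : Continuous (fun z : ℝ × ℝ => a z.1) := hac.comp continuous_fst
    have c3 : Continuous (fun z : ℝ × ℝ => b z.1) := hbc.comp continuous_fst
    refine ContinuousOn.div (c2.sub c3).norm.continuousOn
      ((c1.sub c2.continuousOn).norm.mul (c1.sub c3.continuousOn).norm) fun z hz => ?_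
    have := hne z.1 hz.1 z.2 hz.2
    exact mul_ne_zero (norm_ne_zero_iff.2 this.1) (norm_ne_zero_iff.2 this.2)
  refine intervalIntegral_swap_le (by linarith) (h.intervalIntegrable N) (fun t => by positivity)
    (h.bound N) hkc hB0 ?_ ?_ ?_
  · intro t ht
    obtain ⟨u, hu⟩ := hker t ht
    have hq : Continuous fun x => ε / ((x - u) ^ 2 + ε ^ 2 / 4) :=
      Continuous.div continuous_const (by fun_prop) fun x => by positivity
    calc _ ≤ ∫ x in (-(r / 4))..(r / 4),
          (128 / ‖p‖ * (ε / ((x - u) ^ 2 + ε ^ 2 / 4)) + 8192 / (‖p‖ * r)) := by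
          refine intervalIntegral.integral_mono_on (by linarith) ?_
            (((hq.const_mul _).add continuous_const).intervalIntegrable _ _)
            fun x hx => (hu x hx).2.2
          refine ContinuousOn.intervalIntegrable_of_Icc (by linarith) ?_
          exact hkc.comp (f := fun x => (x, t)) (by fun_prop) fun x hx => ⟨hx, ht⟩
      _ ≤ B := by
          rw [intervalIntegral.integral_add ((hq.const_mul _).intervalIntegrable _ _)
            (by simp), intervalIntegral.integral_const_mul, intervalIntegral.integral_const, hB]
          have := integral_poisson_le ε u (-(r / 4)) (r / 4) he0
          simp only [smul_eq_mul]
          have e : (r / 4 - -(r / 4)) * (8192 / (‖p‖ * r)) = 8192 / (‖p‖ * r) * (r / 2) := by ring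
          rw [e]
          gcongr
  · refine ContinuousOn.intervalIntegrable_of_Icc (by linarith) ?_
    exact ((h.diff.continuousOn.comp hac.continuousOn fun x hx => hKD (haK x hx)).norm).pow 2
  · intro x hx
    have k1 := (h.jordan N).integral_div_sub h.isOpen h.prim (h.mem' N) (h.diff.pow 2) hs
      (haK x hx) (hKD (haK x hx))
    -- The reflected point `b x` lies outside `D`, so its Cauchy kernel integrates `f²` to zero and
    -- may be subtracted. The difference of the two kernels has `x`-integrals bounded independently
    -- of `ε`, unlike a single Cauchy kernel.
    have hg : DifferentiableOn ℂ (fun z => f z ^ 2 / (z - b x)) D :=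
      (h.diff.pow 2).div (by fun_prop) fun z hz hzb => hbD x hx (sub_eq_zero.1 hzb ▸ hz)
    have k2 := (h.jordan N).integral_eq_zero h.isOpen h.prim (h.mem' N) hg
    have cf : ContinuousOn (fun t => f (γ N t) ^ 2) (Icc 0 1) :=
      (h.diff.continuousOn.comp hγc (h.mem' N)).pow 2
    have i1 : IntervalIntegrable (fun t => deriv (γ N) t * ((f ^ 2) (γ N t) / (γ N t - a x)))
        volume 0 1 := hL.intervalIntegrable_deriv_mul zero_le_one
      (cf.div (hγc.sub continuousOn_const) fun t ht => (hne x hx t ht).1)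
    have i2 : IntervalIntegrable (fun t => deriv (γ N) t * (f (γ N t) ^ 2 / (γ N t - b x)))
        volume 0 1 := hL.intervalIntegrable_deriv_mul zero_le_one
      (cf.div (hγc.sub continuousOn_const) fun t ht => (hne x hx t ht).2)
    have k3 : ∫ t in (0 : ℝ)..1, (deriv (γ N) t * ((f ^ 2) (γ N t) / (γ N t - a x)) -
        deriv (γ N) t * (f (γ N t) ^ 2 / (γ N t - b x))) = 2 * Real.pi * Complex.I * (f ^ 2) (a x) := by
      rw [intervalIntegral.integral_sub i1 i2, k1, k2, sub_zero]
    have k4 : ‖f (a x)‖ ^ 2 ≤ ‖(2 * Real.pi * Complex.I * (f ^ 2) (a x) : ℂ)‖ := by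
      rw [norm_mul, Pi.pow_apply, norm_pow]
      have : 1 ≤ ‖(2 * Real.pi * Complex.I : ℂ)‖ := by
        simp [abs_of_pos Real.pi_pos]
        linarith [Real.pi_gt_three]
      nlinarith [sq_nonneg ‖f (a x)‖]
    rw [← k3] at k4
    refine k4.trans (intervalIntegral.norm_integral_le_of_norm_le zero_le_one ?_ ?_)
    · refine Eventually.of_forall fun t ht => le_of_eq ?_
      obtain ⟨n1, n2⟩ := hne x hx t ⟨ht.1.le, ht.2⟩
      have e : deriv (γ N) t * ((f ^ 2) (γ N t) / (γ N t - a x)) -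
        deriv (γ N) t * (f (γ N t) ^ 2 / (γ N t - b x)) = f (γ N t) ^ 2 * deriv (γ N) t *
          ((a x - b x) / ((γ N t - a x) * (γ N t - b x))) := by
        rw [Pi.pow_apply]
        field_simp
        ring
      rw [e]
      simp only [norm_mul, norm_div, norm_pow]
    · refine (h.intervalIntegrable N).mul_continuousOn ?_
      rw [uIcc_of_le zero_le_one]
      exact hkc.comp (f := fun t => (x, t)) (by fun_prop) fun t ht => ⟨hx, ht⟩


/-! ### Functions with Smirnoff bounds near the contour -/

/-- `D` is a connected component of the complement of the contour `Y`. -/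
def IsComponentY (D : Set ℂ) : Prop :=
  D = Metric.ball 0 1 ∨ ∃ c, IsFourthRoot c ∧ D = outerQuadrant c

theorem IsComponentY.subset {D : Set ℂ} (hD : IsComponentY D) : D ⊆ contourYᶜ := by
  rcases hD with rfl | ⟨c, hc, rfl⟩
  · exact ball_subset_compl_contourY
  · rw [hc.outerQuadrant_eq]
    exact inter_subset_left

theorem IsComponentY.isOpen {D : Set ℂ} (hD : IsComponentY D) : IsOpen D := by
  rcases hD with rfl | ⟨c, hc, rfl⟩
  · exact Metric.isOpen_ball
  · exact isOpen_outerQuadrant c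

theorem IsComponentY.hasPrimitives {D : Set ℂ} (hD : IsComponentY D) : HasPrimitives D := by
  rcases hD with rfl | ⟨c, hc, rfl⟩
  · exact hasPrimitives_ball
  · exact hasPrimitives_outerQuadrant hc

theorem IsComponentY.connectedComponentIn_eq {D : Set ℂ} (hD : IsComponentY D) {z : ℂ} (hz : z ∈ D) :
    connectedComponentIn contourYᶜ z = D := by
  rcases hD with rfl | ⟨c, hc, rfl⟩
  · exact connectedComponentIn_eq_ball hz
  · exact hc.connectedComponentIn_eq hz

theorem exists_isComponentY {z : ℂ} (hz : z ∉ contourY) : ∃ D, IsComponentY D ∧ z ∈ D := by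
  rcases mem_ball_or_outerQuadrant hz with h | ⟨c, hc, h⟩
  · exact ⟨_, Or.inl rfl, h⟩
  · exact ⟨_, Or.inr ⟨c, hc, rfl⟩, h⟩

theorem IsComponentY.disjoint {D D' : Set ℂ} (hD : IsComponentY D) (hD' : IsComponentY D')
    (h : D ≠ D') : Disjoint D D' :=
  Set.disjoint_left.2 fun z hz hz' =>
    h (by rw [← hD.connectedComponentIn_eq hz, ← hD'.connectedComponentIn_eq hz'])

theorem IsComponentY.nonempty {D : Set ℂ} (hD : IsComponentY D) : D.Nonempty := by
  rcases hD with rfl | ⟨c, hc, rfl⟩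
  · exact ⟨0, by simp⟩
  · rw [← image_halfStrip hc.norm_eq]
    refine Set.Nonempty.image _ ⟨1 + Complex.I, ?_⟩
    have := Real.pi_gt_three
    simp [halfStrip]
    linarith

theorem finite_isComponentY : {D | IsComponentY D}.Finite := by
  have : {D | IsComponentY D} ⊆ {Metric.ball (0 : ℂ) 1, outerQuadrant 1, outerQuadrant Complex.I,
      outerQuadrant (-1), outerQuadrant (-Complex.I)} := by
    rintro D (rfl | ⟨c, rfl | rfl | rfl | rfl, rfl⟩) <;> simp
  exact (Set.toFinite _).subset this

theorem IsSmirnoffE2.exists_data {f : ℂ → ℂ} (hf : IsSmirnoffE2 contourYᶜ f) {D : Set ℂ}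
    (hD : IsComponentY D) : ∃ γ C, SmirnoffData D f γ C := by
  obtain ⟨z, hz⟩ := hD.nonempty
  obtain ⟨γ, h1, h2, h3, C, h4⟩ := hf.2 z (hD.subset hz)
  rw [hD.connectedComponentIn_eq hz] at h2 h3
  exact ⟨γ, C, hD.isOpen, hD.hasPrimitives, hf.1.mono hD.subset, h1, h2, h3, h4⟩

/-- `expChart p κ` is a chart at a smooth point of `Y`. -/
structure IsChartY (p κ : ℂ) (r : ℝ) : Prop where
  ne_zero : p ≠ 0
  norm_eq : ‖κ‖ = 1
  pos : 0 < r
  le : r ≤ 1 / 8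
  exists_components : ∃ D D', IsComponentY D ∧ IsComponentY D' ∧ D ≠ D' ∧
    (∀ w : ℂ, |w.re| < r → |w.im| < r → 0 < w.im → expChart p κ w ∈ D) ∧
    (∀ w : ℂ, |w.re| < r → |w.im| < r → w.im < 0 → expChart p κ w ∈ D')
  mem : ∀ w : ℂ, |w.re| < r → w.im = 0 → expChart p κ w ∈ contourY

theorem expChart_neg (p κ w : ℂ) : expChart p (-κ) w = expChart p κ (-w) := by
  simp [expChart]

theorem IsChartY.neg {p κ : ℂ} {r : ℝ} (h : IsChartY p κ r) : IsChartY p (-κ) r := by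
  obtain ⟨D, D', h1, h2, h3, h4, h5⟩ := h.exists_components
  refine ⟨h.ne_zero, by rw [norm_neg]; exact h.norm_eq, h.pos, h.le,
    ⟨D', D, h2, h1, h3.symm, fun w hw1 hw2 hw3 => ?_, fun w hw1 hw2 hw3 => ?_⟩, fun w hw1 hw2 => ?_⟩
  · rw [expChart_neg]
    exact h5 _ (by simpa) (by simpa) (by simpa)
  · rw [expChart_neg]
    exact h4 _ (by simpa) (by simpa) (by simpa)
  · rw [expChart_neg]
    exact h.mem _ (by simpa) (by simpa)

theorem IsChartY.notMem {p κ : ℂ} {r : ℝ} (h : IsChartY p κ r) {w : ℂ} (h1 : |w.re| < r)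
    (h2 : |w.im| < r) (h3 : w.im ≠ 0) : expChart p κ w ∉ contourY := by
  obtain ⟨D, D', hD, hD', -, h4, h5⟩ := h.exists_components
  rcases h3.lt_or_gt with h3 | h3
  · exact hD'.subset (h5 w h1 h2 h3)
  · exact hD.subset (h4 w h1 h2 h3)

theorem IsSmirnoffE2.integral_expChart_le {f : ℂ → ℂ} (hf : IsSmirnoffE2 contourYᶜ f) {p κ : ℂ}
    {r : ℝ} (h : IsChartY p κ r) : ∃ M, ∀ ε ∈ Ioo 0 (r / 4),
      ∫ x in (-(r / 4))..(r / 4), ‖f (expChart p κ (x + ε * Complex.I))‖ ^ 2 ≤ M := by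
  obtain ⟨D, D', hD, hD', hne, h4, h5⟩ := h.exists_components
  obtain ⟨γ, C, hC⟩ := hf.exists_data hD
  refine hC.integral_expChart_le h.ne_zero h.norm_eq h.pos h.le h4 fun w h1 h2 h3 hw => ?_
  rcases h3.lt_or_eq with h3 | h3
  · exact Set.disjoint_left.1 (hD.disjoint hD' hne) hw (h5 w h1 h2 h3)
  · exact hD.subset hw (h.mem w h1 h3)

/-- The consequences of `f ∈ Ė²(ℂ ∖ Y)` that are stable under multiplication by bounded
functions. -/
structure HasE2Bounds (f : ℂ → ℂ) : Prop where
  diff : DifferentiableOn ℂ f contourYᶜ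
  norm_le : ∃ C, ∀ z d, 0 < d → Metric.closedBall z d ⊆ contourYᶜ → ‖f z‖ ≤ C / Real.sqrt d
  integral_le : ∀ p κ r, IsChartY p κ r → ∃ M, ∀ ε ∈ Ioo 0 (r / 4),
    ∫ x in (-(r / 4))..(r / 4), ‖f (expChart p κ (x + ε * Complex.I))‖ ^ 2 ≤ M

/-- There are finitely many components, so one constant serves for all of them; a closed disc in the
complement is connected and lies in a single component. -/
theorem IsSmirnoffE2.hasE2Bounds {f : ℂ → ℂ} (hf : IsSmirnoffE2 contourYᶜ f) : HasE2Bounds f := by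
  refine ⟨hf.1, ?_, fun p κ r h => hf.integral_expChart_le h⟩
  have h1 : ∀ D, ∃ C, IsComponentY D → ∀ z d, 0 < d → Metric.closedBall z d ⊆ D →
      ‖f z‖ ≤ C / Real.sqrt d := fun D => by
    by_cases hD : IsComponentY D
    · obtain ⟨γ, C, hC⟩ := hf.exists_data hD
      refine ⟨Real.sqrt C, fun _ z d hd hz => ?_⟩
      rw [← Real.sqrt_div hC.nonneg]
      exact Real.le_sqrt_of_sq_le (hC.norm_sq_le hd hz)
    · exact ⟨0, fun h => absurd h hD⟩
  choose C hC using h1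
  obtain ⟨B, hB⟩ := (finite_isComponentY.image C).bddAbove
  refine ⟨B, fun z d hd hz => ?_⟩
  obtain ⟨D, hD, hzD⟩ := exists_isComponentY (hz (Metric.mem_closedBall_self hd.le))
  have hzD' : Metric.closedBall z d ⊆ D := by
    rw [← hD.connectedComponentIn_eq hzD]
    exact (convex_closedBall z d).isPreconnected.subset_connectedComponentIn
      (Metric.mem_closedBall_self hd.le) hz
  refine (hC D hD z d hd hzD').trans ?_
  gcongr
  exact hB ⟨D, hD, rfl⟩

theorem DifferentiableOn.continuousOn_line {f : ℂ → ℂ} (hf : DifferentiableOn ℂ f contourYᶜ)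
    {p κ : ℂ} {r : ℝ} (h : IsChartY p κ r) {ε : ℝ} (hε : ε ∈ Ioo 0 (r / 4)) :
    ContinuousOn (fun x : ℝ => f (expChart p κ (x + ε * Complex.I))) (Icc (-(r / 4)) (r / 4)) := by
  refine hf.continuousOn.comp ((continuous_expChart p κ).comp (by fun_prop)).continuousOn
    fun x hx => ?_
  have := h.pos
  have h1 : |x| ≤ r / 4 := abs_le.2 hx
  refine h.notMem ?_ ?_ ?_ <;> simp [abs_of_pos hε.1]
  · linarith
  · linarith [hε.2]
  · exact hε.1.ne'

/-- The exhausting curves of two Smirnoff functions are unrelated, so sums and products are not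
treated within the class itself. Only the bounds, which no longer mention curves, are passed on. -/
theorem HasE2Bounds.of_norm_le {f g h : ℂ → ℂ} (hf : HasE2Bounds f) (hg : HasE2Bounds g)
    (hh : DifferentiableOn ℂ h contourYᶜ) {K : ℝ} (hK : 0 ≤ K)
    (hle : ∀ z ∉ contourY, ‖h z‖ ≤ K * (‖f z‖ + ‖g z‖)) : HasE2Bounds h := by
  refine ⟨hh, ?_, fun p κ r hc => ?_⟩
  · obtain ⟨C, hC⟩ := hf.norm_le
    obtain ⟨C', hC'⟩ := hg.norm_le
    refine ⟨K * (C + C'), fun z d hd hz => ?_⟩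
    calc _ ≤ _ := hle z (hz (Metric.mem_closedBall_self hd.le))
      _ ≤ K * (C / Real.sqrt d + C' / Real.sqrt d) := by
        gcongr
        exacts [hC z d hd hz, hC' z d hd hz]
      _ = _ := by ring
  · obtain ⟨C, hC⟩ := hf.integral_le p κ r hc
    obtain ⟨C', hC'⟩ := hg.integral_le p κ r hc
    refine ⟨2 * K ^ 2 * (C + C'), fun ε hε => ?_⟩
    have hr := hc.pos
    have ii : ∀ F : ℂ → ℂ, DifferentiableOn ℂ F contourYᶜ → IntervalIntegrable
        (fun x : ℝ => ‖F (expChart p κ (x + ε * Complex.I))‖ ^ 2) volume (-(r / 4)) (r / 4) :=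
      fun F hF => ((hF.continuousOn_line hc hε).norm.pow 2).intervalIntegrable_of_Icc (by linarith)
    have i1 := ii f hf.diff
    have i2 := ii g hg.diff
    have i3 := ii h hh
    calc _ ≤ ∫ x in (-(r / 4))..(r / 4), 2 * K ^ 2 * (‖f (expChart p κ (x + ε * Complex.I))‖ ^ 2 +
          ‖g (expChart p κ (x + ε * Complex.I))‖ ^ 2) := by
          refine intervalIntegral.integral_mono_on (by linarith) i3 ((i1.add i2).const_mul _) ?_
          intro x hx
          have h1 : |x| ≤ r / 4 := abs_le.2 hx
          have h2 : expChart p κ (x + ε * Complex.I) ∉ contourY := by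
            refine hc.notMem ?_ ?_ ?_ <;> simp [abs_of_pos hε.1]
            · linarith
            · linarith [hε.2]
            · exact hε.1.ne'
          have h3 := pow_le_pow_left₀ (norm_nonneg _) (hle _ h2) 2
          rw [mul_pow] at h3
          refine h3.trans ?_
          rw [mul_assoc, mul_left_comm]
          gcongr
          nlinarith [sq_nonneg (‖f (expChart p κ (x + ε * Complex.I))‖ -
            ‖g (expChart p κ (x + ε * Complex.I))‖)]
      _ ≤ _ := by
          rw [intervalIntegral.integral_const_mul, intervalIntegral.integral_add i1 i2]
          gcongr
          exacts [hC ε hε, hC' ε hε]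


/-! ### Painlevé's theorem -/

/-- On a finite measure space, an `L²`-bounded sequence that tends to `0` almost everywhere tends to
`0` in `L¹`. -/
theorem tendsto_integral_zero_of_sq_le {α : Type*} [MeasurableSpace α] {μ : Measure α}
    [IsFiniteMeasure μ] {D : ℕ → α → ℝ} (h0 : ∀ n x, 0 ≤ D n x)
    (hm : ∀ n, AEStronglyMeasurable (D n) μ) (h2 : ∀ n, Integrable (fun x => D n x ^ 2) μ) {M : ℝ}
    (hM : ∀ n, ∫ x, D n x ^ 2 ∂μ ≤ M) (hlim : ∀ᵐ x ∂μ, Tendsto (fun n => D n x) atTop (𝓝 0)) :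
    Tendsto (fun n => ∫ x, D n x ∂μ) atTop (𝓝 0) := by
  have hmin : ∀ T : ℝ, 0 < T →
      Tendsto (fun n => ∫ x, min (D n x) T ∂μ) atTop (𝓝 (∫ _, (0 : ℝ) ∂μ)) := fun T hT => by
    refine tendsto_integral_of_dominated_convergence (fun _ => T)
      (fun n => (hm n).inf aestronglyMeasurable_const) (integrable_const T) (fun n => ?_) ?_
    · refine Eventually.of_forall fun x => ?_
      rw [Real.norm_of_nonneg (le_min (h0 n x) hT.le)]
      exact min_le_right _ _
    · filter_upwards [hlim] with x hx
      have := hx.min (tendsto_const_nhds (x := T))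
      rwa [min_eq_left hT.le] at this
  have hminI : ∀ n (T : ℝ), 0 < T → Integrable (fun x => min (D n x) T) μ := fun n T hT => by
    refine (integrable_const T).mono' ((hm n).inf aestronglyMeasurable_const) ?_
    refine Eventually.of_forall fun x => ?_
    rw [Real.norm_of_nonneg (le_min (h0 n x) hT.le)]
    exact min_le_right _ _
  have hle : ∀ n (T : ℝ), 0 < T → ∫ x, D n x ∂μ ≤ ∫ x, min (D n x) T ∂μ + M / T := by
    intro n T hT
    -- Truncation at height `T`: the truncated part tends to zero by dominated convergence, and the
    -- remainder contributes at most `M/T`.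
    have hpt : ∀ x, D n x ≤ min (D n x) T + D n x ^ 2 / T := fun x => by
      rcases le_total (D n x) T with h | h
      · rw [min_eq_left h]
        have : 0 ≤ D n x ^ 2 / T := by positivity
        linarith
      · rw [min_eq_right h]
        have : D n x ≤ D n x ^ 2 / T := by
          rw [le_div_iff₀ hT]
          nlinarith [h0 n x]
        linarith
    have hI := (hminI n T hT).add ((h2 n).div_const T)
    calc ∫ x, D n x ∂μ ≤ ∫ x, (min (D n x) T + D n x ^ 2 / T) ∂μ :=
          integral_mono_of_nonneg (Eventually.of_forall (h0 n)) hI (Eventually.of_forall hpt)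
      _ = ∫ x, min (D n x) T ∂μ + (∫ x, D n x ^ 2 ∂μ) / T := by
          rw [integral_add (hminI n T hT) ((h2 n).div_const T), integral_div]
      _ ≤ _ := by gcongr; exact hM n
  rw [Metric.tendsto_atTop]
  intro η hη
  have hM0 : 0 ≤ M := (integral_nonneg fun x => sq_nonneg _).trans (hM 0)
  set T := 2 * (M + 1) / η with hT
  have hT0 : 0 < T := by positivity
  have h1 := hmin T hT0
  rw [integral_zero] at h1
  obtain ⟨N, hN⟩ := (Metric.tendsto_atTop.1 h1) (η / 2) (by positivity)
  refine ⟨N, fun n hn => ?_⟩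
  have h3 := hN n hn
  rw [Real.dist_eq, sub_zero] at h3 ⊢
  rw [abs_of_nonneg (integral_nonneg (h0 n))]
  have h4 := hle n T hT0
  have h5 : M / T < η / 2 := by
    rw [div_lt_iff₀ hT0, hT]
    field_simp
    linarith
  linarith [le_abs_self (∫ x, min (D n x) T ∂μ)]

/-- A primitive in a half box that is continuous up to the boundary. -/
theorem exists_continuousOn_primitive {H : ℂ → ℂ} {ρ C : ℝ} (hρ : 0 < ρ) (hC : 0 ≤ C)
    (hd : ∀ w : ℂ, |w.re| < ρ → 0 < w.im → w.im < ρ → DifferentiableAt ℂ H w)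
    (hb : ∀ w : ℂ, |w.re| < ρ → 0 < w.im → w.im < ρ → ‖H w‖ ≤ C / Real.sqrt w.im) :
    ∃ P : ℂ → ℂ, ContinuousOn P {w | |w.re| < ρ ∧ 0 ≤ w.im ∧ w.im < ρ / 2} ∧
      ∀ w : ℂ, |w.re| < ρ → 0 < w.im → w.im < ρ / 2 → HasDerivAt P (H w) w := by
  have hopen : ∀ b : ℝ, IsOpen {w : ℂ | |w.re| < ρ ∧ 0 < w.im ∧ w.im < b} := fun b =>
    (isOpen_lt Complex.continuous_re.abs continuous_const).inter
      ((isOpen_lt continuous_const Complex.continuous_im).inter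
        (isOpen_lt Complex.continuous_im continuous_const))
  set U : Set ℂ := {w | |w.re| < ρ ∧ 0 < w.im ∧ w.im < ρ} with hU
  have hUc : Convex ℝ U := by
    have : U = {w | -ρ < w.re} ∩ {w | w.re < ρ} ∩ ({w | 0 < w.im} ∩ {w | w.im < ρ}) := by
      ext w; simp [hU, abs_lt]
    rw [this]
    exact ((convex_halfSpace_re_gt _).inter (convex_halfSpace_re_lt _)).inter
      ((convex_halfSpace_im_gt _).inter (convex_halfSpace_im_lt _))
  obtain ⟨P, hP⟩ := hUc.exists_forall_hasDerivWithinAt (f := H)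
    fun w hw => (hd w hw.1 hw.2.1 hw.2.2).differentiableWithinAt
  have hP' : ∀ w ∈ U, HasDerivAt P (H w) w := fun w hw =>
    (hP w hw).hasDerivAt ((hopen ρ).mem_nhds hw)
  -- On vertical segments the substitution `Im w = u²` cancels the singularity `C/√(Im w)`: the
  -- derivative in `u` is at most `2C`. Hence `P` is Hölder continuous of exponent `1/2` vertically,
  -- and its upward translates converge uniformly, also on the real edge.
  have hkey : ∀ x s t : ℝ, |x| < ρ → 0 < s → s ≤ t → t < ρ →
      ‖P (x + t * Complex.I) - P (x + s * Complex.I)‖ ≤ 2 * C * Real.sqrt (t - s) := by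
    intro x s t hx hs hst ht
    have hin : ∀ u ∈ Ioo 0 (Real.sqrt ρ), u ^ 2 < ρ := fun u hu => (Real.lt_sqrt hu.1.le).1 hu.2
    have hder : ∀ u ∈ Ioo 0 (Real.sqrt ρ), HasDerivWithinAt (fun u : ℝ => P (x + (u ^ 2 : ℝ) * Complex.I))
        (H (x + (u ^ 2 : ℝ) * Complex.I) * ((2 * u : ℝ) * Complex.I)) (Ioo 0 (Real.sqrt ρ)) u := by
      intro u hu
      have h1 : HasDerivAt (fun u : ℝ => (x + (u ^ 2 : ℝ) * Complex.I : ℂ))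
          ((2 * u : ℝ) * Complex.I) u := by
        have := ((hasDerivAt_pow 2 u).ofReal_comp.mul_const Complex.I).const_add (x : ℂ)
        simpa using this
      have h2 := hP' (x + (u ^ 2 : ℝ) * Complex.I) ⟨by simpa [-Complex.ofReal_pow] using hx,
        by have := hu.1; simp [-Complex.ofReal_pow]; positivity, by simpa [-Complex.ofReal_pow] using hin u hu⟩
      exact (HasDerivAt.comp (𝕜 := ℝ) u h2 h1).hasDerivWithinAt
    have hbd : ∀ u ∈ Ioo 0 (Real.sqrt ρ),
        ‖H (x + (u ^ 2 : ℝ) * Complex.I) * ((2 * u : ℝ) * Complex.I)‖ ≤ 2 * C := by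
      intro u hu
      have hu0 := hu.1
      have him : (x + (u ^ 2 : ℝ) * Complex.I : ℂ).im = u ^ 2 := by simp [-Complex.ofReal_pow]
      have h2 := hb (x + (u ^ 2 : ℝ) * Complex.I) (by simpa [-Complex.ofReal_pow] using hx)
        (by rw [him]; positivity) (by rw [him]; exact hin u hu)
      rw [him, Real.sqrt_sq hu0.le] at h2
      rw [norm_mul, norm_mul, Complex.norm_I, mul_one, Complex.norm_real,
        Real.norm_of_nonneg (by linarith)]
      calc _ ≤ C / u * (2 * u) := by gcongr
        _ = _ := by field_simp
    have h3 := (convex_Ioo 0 (Real.sqrt ρ)).norm_image_sub_le_of_norm_hasDerivWithin_le hder hbd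
      (x := Real.sqrt s) (y := Real.sqrt t) ⟨Real.sqrt_pos.2 hs, Real.sqrt_lt_sqrt hs.le (by linarith)⟩
      ⟨Real.sqrt_pos.2 (by linarith), Real.sqrt_lt_sqrt (by linarith) ht⟩
    rw [Real.sq_sqrt hs.le, Real.sq_sqrt (by linarith)] at h3
    refine h3.trans ?_
    gcongr
    apply Real.abs_le_sqrt
    have e1 := Real.sq_sqrt hs.le
    have e2 := Real.sq_sqrt (by linarith : (0 : ℝ) ≤ t)
    nlinarith [Real.sqrt_nonneg s, Real.sqrt_le_sqrt hst]
  set S : Set ℂ := {w | |w.re| < ρ ∧ 0 ≤ w.im ∧ w.im < ρ / 2} with hS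
  set δ : ℕ → ℝ := fun n => ρ / 2 * (1 / ((n : ℝ) + 1)) with hδ
  have hδ0 : ∀ n, 0 < δ n := fun n => by positivity
  have hδ1 : ∀ n, δ n ≤ ρ / 2 := fun n => by
    have : 1 / ((n : ℝ) + 1) ≤ 1 := by
      rw [div_le_one (by positivity)]
      linarith [(n.cast_nonneg : (0 : ℝ) ≤ n)]
    calc ρ / 2 * (1 / ((n : ℝ) + 1)) ≤ ρ / 2 * 1 := by gcongr
      _ = ρ / 2 := mul_one _
  have hδt : Tendsto δ atTop (𝓝 0) := by
    simpa [hδ] using (tendsto_one_div_add_atTop_nhds_zero_nat (𝕜 := ℝ)).const_mul (ρ / 2)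
  have hmem : ∀ w ∈ S, ∀ n, w + δ n * Complex.I ∈ U := fun w hw n => by
    refine ⟨by simpa using hw.1, ?_, ?_⟩ <;> simp
    · linarith [hw.2.1, hδ0 n]
    · linarith [hw.2.2, hδ1 n]
  have hcauchy : UniformCauchySeqOn (fun n w => P (w + δ n * Complex.I)) atTop S := by
    have hpair : ∀ w ∈ S, ∀ m n, δ n ≤ δ m →
        ‖P (w + δ m * Complex.I) - P (w + δ n * Complex.I)‖ ≤ 2 * C * Real.sqrt (δ m) := by
      intro w hw m n hmn
      have h1 := hkey w.re (w.im + δ n) (w.im + δ m) hw.1 (by linarith [hw.2.1, hδ0 n])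
        (by linarith) (by linarith [hw.2.2, hδ1 m])
      have e : ∀ k, ((w.re : ℂ) + ((w.im + δ k : ℝ) : ℂ) * Complex.I) = w + δ k * Complex.I :=
        fun k => by
          conv_rhs => rw [← Complex.re_add_im w]
          push_cast
          ring
      rw [e, e] at h1
      refine h1.trans ?_
      gcongr
      linarith [hδ0 n]
    have hlim : Tendsto (fun n => 2 * C * Real.sqrt (δ n)) atTop (𝓝 0) := by
      simpa using ((Real.continuous_sqrt.tendsto 0).comp hδt).const_mul (2 * C)
    rw [Metric.uniformCauchySeqOn_iff]
    intro η hη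
    obtain ⟨N, hN⟩ := eventually_atTop.1 (hlim.eventually_lt_const hη)
    refine ⟨N, fun m hm n hn w hw => ?_⟩
    rcases le_total (δ n) (δ m) with h | h
    · rw [dist_eq_norm]
      exact (hpair w hw m n h).trans_lt (hN m hm)
    · rw [dist_comm, dist_eq_norm]
      exact (hpair w hw n m h).trans_lt (hN n hn)
  set Q : ℂ → ℂ := fun w => limUnder atTop fun n => P (w + δ n * Complex.I) with hQ
  have hQt : ∀ w ∈ S, Tendsto (fun n => P (w + δ n * Complex.I)) atTop (𝓝 (Q w)) := fun w hw =>
    (hcauchy.cauchySeq hw).tendsto_limUnder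
  have hunif := hcauchy.tendstoUniformlyOn_of_tendsto hQt
  refine ⟨Q, hunif.continuousOn ?_, fun w h1 h2 h3 => ?_⟩
  · refine Frequently.of_forall fun n => ?_
    refine ContinuousOn.comp (t := U) (fun w hw => (hP' w hw).continuousAt.continuousWithinAt)
      (by fun_prop) fun w hw => hmem w hw n
  · have heq : ∀ w ∈ {w : ℂ | |w.re| < ρ ∧ 0 < w.im ∧ w.im < ρ / 2}, Q w = P w := fun w hw => by
      refine tendsto_nhds_unique (hQt w ⟨hw.1, hw.2.1.le, hw.2.2⟩) ?_
      have hc := (hP' w ⟨hw.1, hw.2.1, by linarith [hw.2.2]⟩).continuousAt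
      refine hc.tendsto.comp ?_
      have : Tendsto (fun n => w + δ n * Complex.I) atTop (𝓝 (w + (0 : ℝ) * Complex.I)) :=
        ((Complex.continuous_ofReal.tendsto 0).comp hδt).mul_const _ |>.const_add _
      simpa using this
    exact (hP' w ⟨h1, h2, by linarith⟩).congr_of_eventuallyEq
      (eventually_of_mem ((hopen _).mem_nhds ⟨h1, h2, h3⟩) heq)


/-- A continuous function on a disc that is analytic off the real axis is analytic. -/
theorem differentiableOn_ball_of_im_ne_zero {F : ℂ → ℂ} {r : ℝ}
    (hc : ContinuousOn F (Metric.ball 0 r))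
    (hd : ∀ w ∈ Metric.ball (0 : ℂ) r, w.im ≠ 0 → DifferentiableAt ℂ F w) :
    DifferentiableOn ℂ F (Metric.ball 0 r) := by
  refine (Complex.isConservativeOn_and_continuousOn_iff_isDifferentiableOn Metric.isOpen_ball).1
    ⟨?_, hc⟩
  have same : ∀ z w : ℂ, Complex.Rectangle z w ⊆ Metric.ball 0 r →
      (0 ≤ min z.im w.im ∨ max z.im w.im ≤ 0) →
      (∫ x : ℝ in z.re..w.re, F (x + z.im * Complex.I)) -
        (∫ x : ℝ in z.re..w.re, F (x + w.im * Complex.I)) +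
        Complex.I • (∫ y : ℝ in z.im..w.im, F (w.re + y * Complex.I)) -
        Complex.I • (∫ y : ℝ in z.im..w.im, F (z.re + y * Complex.I)) = 0 := by
    intro z w hzw him
    refine Complex.integral_boundary_rect_eq_zero_of_continuousOn_of_differentiableOn F z w
      (hc.mono hzw) fun u hu => (hd u (hzw ?_) ?_).differentiableWithinAt
    · exact ⟨Ioo_subset_Icc_self hu.1, Ioo_subset_Icc_self hu.2⟩
    · rcases him with h | h
      · exact (lt_of_le_of_lt h hu.2.1).ne'
      · exact (lt_of_lt_of_le hu.2.2 h).ne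
  intro z w hzw
  rw [← add_eq_zero_iff_eq_neg, Complex.wedgeIntegral_add_wedgeIntegral_eq]
  by_cases him : 0 ≤ min z.im w.im ∨ max z.im w.im ≤ 0
  · exact same z w hzw him
  push Not at him
  -- A rectangle that crosses the real axis is cut along it. The contributions of the common edge
  -- cancel, and Cauchy's theorem holds on each half by continuity up to the axis.
  have h0 : (0 : ℝ) ∈ uIcc z.im w.im := ⟨him.1.le, him.2.le⟩
  obtain ⟨z', hz'⟩ : ∃ z' : ℂ, z' = ((z.re : ℝ) : ℂ) := ⟨_, rfl⟩
  obtain ⟨w', hw'⟩ : ∃ w' : ℂ, w' = ((w.re : ℝ) : ℂ) := ⟨_, rfl⟩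
  have hsub1 : Complex.Rectangle z w' ⊆ Complex.Rectangle z w := fun u hu => by
    refine ⟨by simpa [hw'] using hu.1, ?_⟩
    have := hu.2
    simp only [hw', Complex.ofReal_im] at this
    exact uIcc_subset_uIcc left_mem_uIcc h0 this
  have hsub2 : Complex.Rectangle z' w ⊆ Complex.Rectangle z w := fun u hu => by
    refine ⟨by simpa [hz'] using hu.1, ?_⟩
    have := hu.2
    simp only [hz', Complex.ofReal_im] at this
    exact uIcc_subset_uIcc h0 right_mem_uIcc this
  have hor : ∀ a : ℝ, 0 ≤ min a 0 ∨ max a 0 ≤ 0 := fun a => by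
    rcases le_total a 0 with h | h
    · right; simp [h]
    · left; simp [h]
  have e1 := same z w' (hsub1.trans hzw) (by simpa [hw'] using hor z.im)
  have e2 := same z' w (hsub2.trans hzw) (by simpa [hz', min_comm, max_comm] using hor w.im)
  have hint : ∀ a ∈ uIcc z.re w.re, ∀ s t : ℝ, s ∈ uIcc z.im w.im → t ∈ uIcc z.im w.im →
      IntervalIntegrable (fun y : ℝ => F (a + y * Complex.I)) volume s t := by
    intro a ha s t hs ht
    refine ContinuousOn.intervalIntegrable (hc.comp (by fun_prop) fun y hy => hzw ⟨?_, ?_⟩)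
    · simpa using ha
    · simpa using uIcc_subset_uIcc hs ht hy
  have a1 := intervalIntegral.integral_add_adjacent_intervals
    (hint w.re right_mem_uIcc z.im 0 left_mem_uIcc h0) (hint w.re right_mem_uIcc 0 w.im h0 right_mem_uIcc)
  have a2 := intervalIntegral.integral_add_adjacent_intervals
    (hint z.re left_mem_uIcc z.im 0 left_mem_uIcc h0) (hint z.re left_mem_uIcc 0 w.im h0 right_mem_uIcc)
  simp only [hz', hw', Complex.ofReal_re, Complex.ofReal_im] at e1 e2
  rw [← a1, ← a2]
  simp only [smul_eq_mul] at e1 e2 ⊢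
  linear_combination e1 + e2

/-- A function that is analytic off the real axis, with Smirnoff bounds and equal boundary values
almost everywhere, extends analytically. -/
theorem exists_differentiableOn_extension {H : ℂ → ℂ} {ρ C M : ℝ} (hρ : 0 < ρ) (hC : 0 ≤ C)
    (hd : ∀ w : ℂ, |w.re| < 2 * ρ → |w.im| < ρ → w.im ≠ 0 → DifferentiableAt ℂ H w)
    (hb : ∀ w : ℂ, |w.re| < 2 * ρ → |w.im| < ρ → w.im ≠ 0 → ‖H w‖ ≤ C / Real.sqrt |w.im|)
    (hp : ∀ ε ∈ Ioo 0 ρ, ∫ x in (-ρ)..ρ, ‖H (x + ε * Complex.I)‖ ^ 2 ≤ M)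
    (hm : ∀ ε ∈ Ioo 0 ρ, ∫ x in (-ρ)..ρ, ‖H (x - ε * Complex.I)‖ ^ 2 ≤ M)
    (hlim : ∀ᵐ x ∂volume.restrict (Ioc (-ρ) ρ), Tendsto (fun ε : ℝ => H ((x : ℝ) + ε * Complex.I) -
      H (x - ε * Complex.I)) (𝓝[>] 0) (𝓝 0)) :
    ∃ E, DifferentiableOn ℂ E (Metric.ball 0 (ρ / 2)) ∧
      ∀ w ∈ Metric.ball (0 : ℂ) (ρ / 2), w.im ≠ 0 → E w = H w := by
  -- Unlike `H`, its primitives are continuous up to the axis. The one in the lower half is obtained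
  -- from `w ↦ H (-w)`.
  obtain ⟨P, hPc, hP⟩ := exists_continuousOn_primitive (H := H) hρ hC
    (fun w h1 h2 h3 => hd w (by linarith) (by rwa [abs_of_pos h2]) h2.ne')
    (fun w h1 h2 h3 => by
      have := hb w (by linarith) (by rwa [abs_of_pos h2]) h2.ne'
      rwa [abs_of_pos h2] at this)
  obtain ⟨P₂, hQc, hQ⟩ := exists_continuousOn_primitive (H := fun w => H (-w)) hρ hC
    (fun w h1 h2 h3 => by
      have := hd (-w) (by simp; linarith) (by simpa [abs_of_pos h2]) (by simpa using h2.ne')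
      exact DifferentiableAt.comp w this (by fun_prop))
    (fun w h1 h2 h3 => by
      have := hb (-w) (by simp; linarith) (by simpa [abs_of_pos h2]) (by simpa using h2.ne')
      simpa [abs_of_pos h2] using this)
  set Q : ℂ → ℂ := fun w => -P₂ (-w) with hQdef
  have hQc' : ContinuousOn Q {w | |w.re| < ρ ∧ w.im ≤ 0 ∧ -(ρ / 2) < w.im} := by
    refine ContinuousOn.neg (hQc.comp (by fun_prop) fun w hw => ?_)
    exact ⟨by simpa using hw.1, by simpa using hw.2.1, by simp; linarith [hw.2.2]⟩
  have hQ' : ∀ w : ℂ, |w.re| < ρ → w.im < 0 → -(ρ / 2) < w.im → HasDerivAt Q (H w) w := by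
    intro w h1 h2 h3
    have h4 := hQ (-w) (by simpa) (by simpa) (by simp; linarith)
    exact (HasDerivAt.comp w h4 (hasDerivAt_neg w)).neg.congr_deriv (by simp)
  have hcH : ∀ s : ℝ, s ≠ 0 → |s| < ρ → ContinuousOn (fun x : ℝ => H (x + s * Complex.I))
      (Icc (-ρ) ρ) := fun s hs0 hs x hx => by
    have h1 : |x| ≤ ρ := abs_le.2 hx
    have := (hd (x + s * Complex.I) (by simp; linarith) (by simpa) (by simpa)).continuousAt
    exact (ContinuousAt.comp (f := fun x : ℝ => (x + s * Complex.I : ℂ)) this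
      (by fun_prop)).continuousWithinAt
  set δ : ℕ → ℝ := fun n => ρ / 4 * (1 / ((n : ℝ) + 1)) with hδ
  have hδ0 : ∀ n, 0 < δ n := fun n => by positivity
  have hδ1 : ∀ n, δ n ≤ ρ / 4 := fun n => by
    have : 1 / ((n : ℝ) + 1) ≤ 1 := by
      rw [div_le_one (by positivity)]
      linarith [(n.cast_nonneg : (0 : ℝ) ≤ n)]
    calc ρ / 4 * (1 / ((n : ℝ) + 1)) ≤ ρ / 4 * 1 := by gcongr
      _ = ρ / 4 := mul_one _
  have hδt : Tendsto δ atTop (𝓝 0) := by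
    simpa [hδ] using (tendsto_one_div_add_atTop_nhds_zero_nat (𝕜 := ℝ)).const_mul (ρ / 4)
  have hcp : ∀ n, ContinuousOn (fun x : ℝ => H (x + δ n * Complex.I)) (Icc (-ρ) ρ) := fun n =>
    hcH _ (hδ0 n).ne' (by rw [abs_of_pos (hδ0 n)]; linarith [hδ1 n])
  have hcm : ∀ n, ContinuousOn (fun x : ℝ => H (x - δ n * Complex.I)) (Icc (-ρ) ρ) := fun n => by
    have := hcH (-δ n) (neg_ne_zero.2 (hδ0 n).ne') (by rw [abs_neg, abs_of_pos (hδ0 n)]; linarith [hδ1 n])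
    simpa [sub_eq_add_neg] using this
  set D : ℕ → ℝ → ℝ := fun n x => ‖H (x + δ n * Complex.I) - H (x - δ n * Complex.I)‖ with hD
  have hDc : ∀ n, ContinuousOn (D n) (Icc (-ρ) ρ) := fun n => ((hcp n).sub (hcm n)).norm
  have hDt : Tendsto (fun n => ∫ x in Ioc (-ρ) ρ, D n x) atTop (𝓝 0) := by
    refine tendsto_integral_zero_of_sq_le (M := 4 * M) (fun n x => norm_nonneg _)
      (fun n => ((hDc n).mono Ioc_subset_Icc_self).aestronglyMeasurable measurableSet_Ioc)
      (fun n => ((hDc n).pow 2).integrableOn_Icc.mono_set Ioc_subset_Icc_self) (fun n => ?_) ?_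
    · rw [← intervalIntegral.integral_of_le (by linarith)]
      have hI : ∀ F : ℝ → ℂ, ContinuousOn F (Icc (-ρ) ρ) →
          IntervalIntegrable (fun x => ‖F x‖ ^ 2) volume (-ρ) ρ :=
        fun F hF => (hF.norm.pow 2).intervalIntegrable_of_Icc (by linarith)
      have hn : δ n ∈ Ioo 0 ρ := ⟨hδ0 n, by linarith [hδ1 n]⟩
      calc ∫ x in (-ρ)..ρ, D n x ^ 2 ≤ ∫ x in (-ρ)..ρ, 2 * (‖H (x + δ n * Complex.I)‖ ^ 2 +
            ‖H (x - δ n * Complex.I)‖ ^ 2) := by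
            refine intervalIntegral.integral_mono_on (by linarith)
              (((hDc n).pow 2).intervalIntegrable_of_Icc (by linarith))
              (((hI _ (hcp n)).add (hI _ (hcm n))).const_mul 2) fun x _ => ?_
            have h1 := pow_le_pow_left₀ (norm_nonneg _)
              (norm_sub_le (H (x + δ n * Complex.I)) (H (x - δ n * Complex.I))) 2
            nlinarith [sq_nonneg (‖H (x + δ n * Complex.I)‖ - ‖H (x - δ n * Complex.I)‖)]
        _ ≤ 4 * M := by
            rw [intervalIntegral.integral_const_mul,
              intervalIntegral.integral_add (hI _ (hcp n)) (hI _ (hcm n))]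
            linarith [hp _ hn, hm _ hn]
    · filter_upwards [hlim] with x hx
      have := hx.comp (tendsto_nhdsWithin_iff.2 ⟨hδt, Eventually.of_forall hδ0⟩)
      simpa [hD] using this.norm
  -- Increments of `P` and `Q` along the lines of height `±δ_n` are integrals of `H`. The difference
  -- of the two integrands tends to zero in `L¹` by `hDt`, so in the limit `P - Q` is constant on
  -- the axis.
  have hjump : ∀ x : ℝ, |x| < ρ → P x - Q x = P 0 - Q 0 := by
    intro x hx
    have hxu : uIcc 0 x ⊆ Ioo (-ρ) ρ := by
      have h1 := abs_lt.1 hx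
      intro s hs
      rcases mem_uIcc.1 hs with h | h <;> constructor <;> linarith [h.1, h.2, h1.1, h1.2]
    have hPt : ∀ x : ℝ, |x| < ρ → Tendsto (fun n => P (x + δ n * Complex.I)) atTop (𝓝 (P x)) := by
      intro x hx
      refine (hPc x ⟨by simpa, by simp, by simpa⟩).tendsto.comp (tendsto_nhdsWithin_iff.2 ⟨?_, ?_⟩)
      · have : Tendsto (fun n => (x : ℂ) + δ n * Complex.I) atTop (𝓝 (x + (0 : ℝ) * Complex.I)) :=
          ((Complex.continuous_ofReal.tendsto 0).comp hδt).mul_const _ |>.const_add _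
        simpa using this
      · exact Eventually.of_forall fun n => ⟨by simpa, by simpa using (hδ0 n).le,
          by simpa using (by linarith [hδ1 n] : δ n < ρ / 2)⟩
    have hQt : ∀ x : ℝ, |x| < ρ → Tendsto (fun n => Q (x - δ n * Complex.I)) atTop (𝓝 (Q x)) := by
      intro x hx
      refine (hQc' x ⟨by simpa, by simp, by simpa⟩).tendsto.comp (tendsto_nhdsWithin_iff.2 ⟨?_, ?_⟩)
      · have : Tendsto (fun n => (x : ℂ) - δ n * Complex.I) atTop (𝓝 (x - (0 : ℝ) * Complex.I)) :=
          ((Complex.continuous_ofReal.tendsto 0).comp hδt).mul_const _ |>.const_sub _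
        simpa using this
      · exact Eventually.of_forall fun n => ⟨by simpa, by simpa using (hδ0 n).le,
          by simpa using (by linarith [hδ1 n] : δ n < ρ / 2)⟩
    have hFP : ∀ n, ∫ s in (0 : ℝ)..x, H (s + δ n * Complex.I) =
        P (x + δ n * Complex.I) - P ((0 : ℝ) + δ n * Complex.I) := fun n => by
      refine intervalIntegral.integral_eq_sub_of_hasDerivAt (f := fun s : ℝ => P (s + δ n * Complex.I))
        (f' := fun s : ℝ => H (s + δ n * Complex.I)) (fun s hs => ?_)
        (((hcp n).mono (hxu.trans Ioo_subset_Icc_self)).intervalIntegrable)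
      have h1 := hP (s + δ n * Complex.I) (by simpa using abs_lt.2 (hxu hs)) (by simpa using hδ0 n)
        (by simpa using (by linarith [hδ1 n] : δ n < ρ / 2))
      have h2 : HasDerivAt (fun s : ℝ => (s + δ n * Complex.I : ℂ)) 1 s :=
        (hasDerivAt_id s).ofReal_comp.add_const _
      exact (HasDerivAt.comp (𝕜 := ℝ) s h1 h2).congr_deriv (by simp)
    have hFQ : ∀ n, ∫ s in (0 : ℝ)..x, H (s - δ n * Complex.I) =
        Q (x - δ n * Complex.I) - Q ((0 : ℝ) - δ n * Complex.I) := fun n => by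
      refine intervalIntegral.integral_eq_sub_of_hasDerivAt (f := fun s : ℝ => Q (s - δ n * Complex.I))
        (f' := fun s : ℝ => H (s - δ n * Complex.I)) (fun s hs => ?_)
        (((hcm n).mono (hxu.trans Ioo_subset_Icc_self)).intervalIntegrable)
      have h1 := hQ' (s - δ n * Complex.I) (by simpa using abs_lt.2 (hxu hs)) (by simpa using hδ0 n)
        (by simpa using (by linarith [hδ1 n] : δ n < ρ / 2))
      have h2 : HasDerivAt (fun s : ℝ => (s - δ n * Complex.I : ℂ)) 1 s :=
        (hasDerivAt_id s).ofReal_comp.sub_const _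
      have h3 := HasDerivAt.comp (𝕜 := ℝ) (h₂ := Q) s h1 h2
      rw [mul_one] at h3
      exact h3
    have hle : ∀ n, ‖(P (x + δ n * Complex.I) - Q (x - δ n * Complex.I)) -
        (P ((0 : ℝ) + δ n * Complex.I) - Q ((0 : ℝ) - δ n * Complex.I))‖ ≤
        ∫ s in Ioc (-ρ) ρ, D n s := fun n => by
      have e : (P (x + δ n * Complex.I) - Q (x - δ n * Complex.I)) -
        (P ((0 : ℝ) + δ n * Complex.I) - Q ((0 : ℝ) - δ n * Complex.I)) =
          ∫ s in (0 : ℝ)..x, (H (s + δ n * Complex.I) - H (s - δ n * Complex.I)) := by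
        rw [intervalIntegral.integral_sub
          (((hcp n).mono (hxu.trans Ioo_subset_Icc_self)).intervalIntegrable)
          (((hcm n).mono (hxu.trans Ioo_subset_Icc_self)).intervalIntegrable), hFP, hFQ]
        ring
      rw [e]
      refine intervalIntegral.norm_integral_le_integral_norm_uIoc.trans ?_
      refine setIntegral_mono_set ((hDc n).integrableOn_Icc.mono_set Ioc_subset_Icc_self)
        (Eventually.of_forall fun s => norm_nonneg _) (LE.le.eventuallyLE fun s hs => ?_)
      exact Ioo_subset_Ioc_self (hxu (uIoc_subset_uIcc hs))
    have h3 := (((hPt x hx).sub (hQt x hx)).sub ((hPt 0 (by simpa)).sub (hQt 0 (by simpa)))).norm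
    have h4 := le_of_tendsto_of_tendsto' h3 hDt hle
    have h5 := norm_le_zero_iff.1 h4
    simpa [sub_eq_zero] using h5
  set c := P 0 - Q 0 with hcdef
  -- The glued primitive is continuous, hence analytic by Morera's theorem, and its derivative is
  -- the desired extension of `H`.
  set F : ℂ → ℂ := fun w => if 0 ≤ w.im then P w else Q w + c with hF
  have hball : ∀ w ∈ Metric.ball (0 : ℂ) (ρ / 2), |w.re| < ρ / 2 ∧ |w.im| < ρ / 2 := fun w hw => by
    rw [mem_ball_zero_iff] at hw
    exact ⟨(Complex.abs_re_le_norm w).trans_lt hw, (Complex.abs_im_le_norm w).trans_lt hw⟩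
  have hFm : ∀ w ∈ Metric.ball (0 : ℂ) (ρ / 2), w.im ≤ 0 → F w = Q w + c := fun w hw him => by
    rcases him.lt_or_eq with h | h
    · simp [hF, not_le.2 h]
    · have h1 : w = (w.re : ℂ) := Complex.ext (by simp) (by simpa using h)
      have h2 := hjump w.re (by linarith [(hball w hw).1])
      rw [← h1] at h2
      simp only [hF, h, le_refl, if_true]
      linear_combination h2
  have hFc : ContinuousOn F (Metric.ball 0 (ρ / 2)) := by
    have c1 : ContinuousOn F (Metric.ball 0 (ρ / 2) ∩ {w | 0 ≤ w.im}) := by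
      refine (hPc.mono fun w hw => ?_).congr fun w hw => if_pos hw.2
      have := hball w hw.1
      exact ⟨by linarith [this.1], hw.2, (abs_lt.1 this.2).2⟩
    have c2 : ContinuousOn F (Metric.ball 0 (ρ / 2) ∩ {w | w.im ≤ 0}) := by
      refine ((hQc'.mono fun w hw => ?_).add continuousOn_const).congr fun w hw => hFm w hw.1 hw.2
      have := hball w hw.1
      exact ⟨by linarith [this.1], hw.2, (abs_lt.1 this.2).1⟩
    intro w hw
    rcases lt_trichotomy w.im 0 with h | h | h
    · refine (c2 w ⟨hw, h.le⟩).mono_of_mem_nhdsWithin ?_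
      exact inter_mem self_mem_nhdsWithin (mem_nhdsWithin_of_mem_nhds
        (mem_of_superset ((isOpen_lt Complex.continuous_im continuous_const).mem_nhds h)
          fun u (hu : u.im < 0) => hu.le))
    · refine ((c1 w ⟨hw, h.ge⟩).union (c2 w ⟨hw, h.le⟩)).mono fun u hu => ?_
      rcases le_total 0 u.im with h | h
      · exact Or.inl ⟨hu, h⟩
      · exact Or.inr ⟨hu, h⟩
    · refine (c1 w ⟨hw, h.le⟩).mono_of_mem_nhdsWithin ?_
      exact inter_mem self_mem_nhdsWithin (mem_nhdsWithin_of_mem_nhds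
        (mem_of_superset ((isOpen_lt continuous_const Complex.continuous_im).mem_nhds h)
          fun u (hu : 0 < u.im) => hu.le))
  have hFd : ∀ w ∈ Metric.ball (0 : ℂ) (ρ / 2), w.im ≠ 0 → HasDerivAt F (H w) w := by
    intro w hw him
    have hb := hball w hw
    rcases him.lt_or_gt with h | h
    · refine ((hQ' w (by linarith [hb.1]) h (abs_lt.1 hb.2).1).add_const c).congr_of_eventuallyEq ?_
      exact mem_of_superset ((isOpen_lt Complex.continuous_im continuous_const).mem_nhds h)
          fun u (hu : u.im < 0) => if_neg (not_le.2 hu)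
    · refine (hP w (by linarith [hb.1]) h (abs_lt.1 hb.2).2).congr_of_eventuallyEq ?_
      exact mem_of_superset ((isOpen_lt continuous_const Complex.continuous_im).mem_nhds h)
          fun u (hu : 0 < u.im) => if_pos hu.le
  have hFa := differentiableOn_ball_of_im_ne_zero hFc fun w hw him => (hFd w hw him).differentiableAt
  exact ⟨deriv F, hFa.deriv Metric.isOpen_ball, fun w hw him => (hFd w hw him).deriv⟩


/-! ### Local extension across the contour -/

/-- `f` extends analytically from the complement of `Y` to a neighbourhood of `p`. -/
def ExtendsAt (f : ℂ → ℂ) (p : ℂ) : Prop :=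
  ∃ s > 0, ∃ E, DifferentiableOn ℂ E (Metric.ball p s) ∧
    ∀ l ∈ Metric.ball p s, l ∉ contourY → E l = f l

/-- By `exists_expChart_eq` the disc of radius `|p||Im w|/8` about the point with coordinate `w`
does not meet the contour. -/
theorem IsChartY.norm_le {p κ : ℂ} {r : ℝ} (h : IsChartY p κ r) {f : ℂ → ℂ} {C : ℝ}
    (hC : ∀ z d, 0 < d → Metric.closedBall z d ⊆ contourYᶜ → ‖f z‖ ≤ C / Real.sqrt d) {w : ℂ}
    (h1 : |w.re| < r / 2) (h2 : |w.im| < r / 2) (h3 : w.im ≠ 0) :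
    ‖f (expChart p κ w)‖ ≤ C / Real.sqrt (‖p‖ / 8) / Real.sqrt |w.im| := by
  have hp0 : 0 < ‖p‖ := norm_pos_iff.2 h.ne_zero
  have hi : 0 < |w.im| := abs_pos.2 h3
  have hr := h.le
  refine (hC _ (‖p‖ / 8 * |w.im|) (by positivity) fun l hl => ?_).trans (le_of_eq ?_)
  · rw [mem_closedBall_iff_norm] at hl
    obtain ⟨ζ, rfl, hζ⟩ := exists_expChart_eq h.ne_zero h.norm_eq
      (norm_le_of_abs_le h1.le h2.le (by linarith)) hi (by linarith) (hl.trans (le_of_eq (by ring)))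
    have a1 := (Complex.abs_re_le_norm (ζ - w)).trans_lt hζ
    have a2 := (Complex.abs_im_le_norm (ζ - w)).trans_lt hζ
    rw [Complex.sub_re] at a1
    rw [Complex.sub_im] at a2
    have b1 := abs_sub_abs_le_abs_sub ζ.re w.re
    have b2 := abs_sub_abs_le_abs_sub ζ.im w.im
    refine h.notMem (by linarith) (by linarith) fun h0 => ?_
    rw [h0, zero_sub, abs_neg] at a2
    exact lt_irrefl _ a2
  · rw [Real.sqrt_mul (by positivity), div_div]

/-- A function with Smirnoff bounds, whose boundary values from both sides are equal almost
everywhere, extends across the contour. -/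
theorem HasE2Bounds.extendsAt {f : ℂ → ℂ} (hf : HasE2Bounds f) {p κ : ℂ} {r : ℝ}
    (h : IsChartY p κ r)
    (hlim : ∀ᵐ x ∂volume.restrict (Ioc (-(r / 4)) (r / 4)),
      Tendsto (fun ε : ℝ => f (expChart p κ ((x : ℝ) + ε * Complex.I)) -
        f (expChart p κ (x - ε * Complex.I))) (𝓝[>] 0) (𝓝 0)) : ExtendsAt f p := by
  have hr := h.pos
  have hr8 := h.le
  have hp0 : 0 < ‖p‖ := norm_pos_iff.2 h.ne_zero
  obtain ⟨C, hC⟩ := hf.norm_le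
  obtain ⟨M, hM⟩ := hf.integral_le p κ r h
  obtain ⟨M', hM'⟩ := hf.integral_le p (-κ) r h.neg
  have hκ0 : κ ≠ 0 := norm_pos_iff.1 (by rw [h.norm_eq]; exact one_pos)
  obtain ⟨E, hE, hEH⟩ : ∃ E, DifferentiableOn ℂ E (Metric.ball 0 (r / 4 / 2)) ∧
      ∀ w ∈ Metric.ball (0 : ℂ) (r / 4 / 2), w.im ≠ 0 → E w = f (expChart p κ w) := by
    refine exists_differentiableOn_extension (H := fun w => f (expChart p κ w))
      (ρ := r / 4) (C := |C| / Real.sqrt (‖p‖ / 8)) (M := max M M') (by linarith) (by positivity)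
      (fun w h1 h2 h3 => ?_) (fun w h1 h2 h3 => ?_) (fun ε hε => (hM ε hε).trans (le_max_left _ _))
      (fun ε hε => ?_) hlim
    · have h4 := h.notMem (w := w) (by linarith) (by linarith) h3
      have := hf.diff.differentiableAt (isOpen_compl_contourY.mem_nhds h4)
      exact DifferentiableAt.comp w this (differentiable_expChart p κ w)
    · refine (h.norm_le hC (by linarith) (by linarith) h3).trans ?_
      gcongr
      exact le_abs_self C
    · refine le_trans (le_of_eq ?_) ((hM' ε hε).trans (le_max_right _ _))
      have := intervalIntegral.integral_comp_neg (a := -(r / 4)) (b := r / 4)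
        (fun x : ℝ => ‖f (expChart p (-κ) (x + ε * Complex.I))‖ ^ 2)
      rw [neg_neg] at this
      rw [← this]
      refine intervalIntegral.integral_congr fun x _ => ?_
      simp only [expChart_neg]
      congr 4
      push_cast
      ring
  refine ⟨‖p‖ * (r / 16), by positivity, fun l => E (Complex.log (l / p) / κ), ?_, ?_⟩
  all_goals
    have key : ∀ l ∈ Metric.ball p (‖p‖ * (r / 16)), l / p ∈ Complex.slitPlane ∧
        Complex.log (l / p) / κ ∈ Metric.ball 0 (r / 4 / 2) ∧
        expChart p κ (Complex.log (l / p) / κ) = l := fun l hl => by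
      rw [mem_ball_iff_norm] at hl
      obtain ⟨u, hu⟩ : ∃ u, u = (l - p) / p := ⟨_, rfl⟩
      have hun : ‖u‖ < r / 16 := by
        rw [hu, norm_div, div_lt_iff₀ hp0]
        linarith
      have hlp : l / p = 1 + u := by rw [hu]; have := h.ne_zero; field_simp; ring
      have hs : l / p ∈ Complex.slitPlane := by
        rw [hlp]
        left
        have := (abs_le.1 (Complex.abs_re_le_norm u)).1
        simp
        linarith
      refine ⟨hs, ?_, ?_⟩
      · rw [mem_ball_zero_iff, norm_div, h.norm_eq, div_one, hlp]
        have := Complex.norm_log_one_add_half_le_self (z := u) (by linarith)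
        linarith
      · rw [expChart, mul_div_cancel₀ _ hκ0, Complex.exp_log (Complex.slitPlane_ne_zero hs),
          mul_div_cancel₀ _ h.ne_zero]
  · intro l hl
    obtain ⟨k1, k2, -⟩ := key l hl
    have e1 : DifferentiableAt ℂ (fun l => Complex.log (l / p) / κ) l :=
      ((differentiableAt_id.div_const p).clog k1).div_const _
    have e2 := hE.differentiableAt (Metric.isOpen_ball.mem_nhds k2)
    exact (DifferentiableAt.comp l e2 e1).differentiableWithinAt
  · intro l hl hlY
    obtain ⟨k1, k2, k3⟩ := key l hl
    simp only
    rw [hEH _ k2, k3]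
    intro h0
    rw [mem_ball_zero_iff] at k2
    have := (Complex.abs_re_le_norm _).trans_lt k2
    exact hlY (k3 ▸ h.mem _ (by linarith) h0)

/-! ### One-sided limits and absence of jumps. -/

/-- The normal path in a chart stays in a sector. -/
theorem tendsto_expChart_sector {p κ τ : ℂ} {x k : ℝ} (hk : 0 < k) (hτ : ‖τ‖ = 1)
    (h : κ * expChart p κ x = k * τ) :
    Tendsto (fun ε : ℝ => expChart p κ (x + ε * Complex.I)) (𝓝[>] 0)
      (𝓝[{z | 1 / 2 * ‖z - expChart p κ x‖ <
        ((z - expChart p κ x) * (starRingEnd ℂ) τ).im}] (expChart p κ x)) := by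
  have hττ : τ * (starRingEnd ℂ) τ = 1 := by
    rw [Complex.mul_conj, Complex.normSq_eq_norm_sq, hτ]; simp
  have hd : HasDerivAt (fun ε : ℝ => expChart p κ (x + ε * Complex.I)) (Complex.I * k * τ) 0 := by
    have h1 : HasDerivAt (fun ε : ℝ => (κ * (x + ε * Complex.I) : ℂ)) (κ * Complex.I) 0 := by
      have := (((hasDerivAt_id (0 : ℝ)).ofReal_comp.mul_const Complex.I).const_add (x : ℂ)).const_mul κ
      exact this.congr_deriv (by simp)
    refine (h1.cexp.const_mul p).congr_deriv ?_
    rw [mul_assoc, ← h, expChart]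
    simp
    ring
  refine tendsto_nhdsWithin_iff.2 ⟨?_, ?_⟩
  · have := hd.continuousAt.tendsto
    simp only [Complex.ofReal_zero, zero_mul, add_zero] at this
    exact this.mono_left nhdsWithin_le_nhds
  · have ho := (hasDerivAt_iff_isLittleO.1 hd).bound (show 0 < k / 8 by positivity)
    filter_upwards [nhdsWithin_le_nhds ho, self_mem_nhdsWithin] with ε h1 h2
    have h2 : 0 < ε := h2
    simp only [Complex.ofReal_zero, zero_mul, add_zero, sub_zero, Complex.real_smul] at h1
    rw [Real.norm_of_nonneg h2.le] at h1
    obtain ⟨e, he⟩ : ∃ e, e = expChart p κ (x + ε * Complex.I) - expChart p κ x -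
      ε * (Complex.I * k * τ) := ⟨_, rfl⟩
    rw [← he] at h1
    have he' : expChart p κ (x + ε * Complex.I) - expChart p κ x = ε * (Complex.I * k * τ) + e := by
      rw [he]; ring
    change 1 / 2 * ‖_‖ < _
    rw [he', add_mul, show (ε * (Complex.I * k * τ) : ℂ) * (starRingEnd ℂ) τ =
      ((ε * k : ℝ) : ℂ) * Complex.I by push_cast; linear_combination (ε * k * Complex.I : ℂ) * hττ]
    have n1 : ‖(ε * (Complex.I * k * τ) : ℂ)‖ = ε * k := by
      simp [hτ, abs_of_pos h2, abs_of_pos hk]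
    have n2 := norm_add_le (ε * (Complex.I * k * τ) : ℂ) e
    have n3 := (abs_le.1 (Complex.abs_im_le_norm (e * (starRingEnd ℂ) τ))).1
    rw [norm_mul, RCLike.norm_conj, hτ, mul_one] at n3
    rw [Complex.add_im, show ((((ε * k : ℝ) : ℂ) * Complex.I)).im = ε * k by simp [-Complex.ofReal_mul]]
    nlinarith [mul_pos h2 hk]


/-- A sector at `q`, symmetric about the left normal of the direction `τ`. -/
def leftSector (q τ : ℂ) : Set ℂ := {z | 1 / 2 * ‖z - q‖ < ((z - q) * (starRingEnd ℂ) τ).im}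

/-- The limits of `f` at `q` from both sides of the direction `τ` are equal. -/
def HasEqualSides (f : ℂ → ℂ) (q τ : ℂ) : Prop :=
  ∃ L, Tendsto f (𝓝[leftSector q τ] q) (𝓝 L) ∧ Tendsto f (𝓝[leftSector q (-τ)] q) (𝓝 L)

theorem neBot_leftSector {q τ : ℂ} (hτ : ‖τ‖ = 1) : (𝓝[leftSector q τ] q).NeBot := by
  have h1 : Tendsto (fun ε : ℝ => q + ε * (Complex.I * τ)) (𝓝[>] 0) (𝓝[leftSector q τ] q) := by
    refine tendsto_nhdsWithin_iff.2 ⟨?_, ?_⟩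
    · refine (Continuous.tendsto' (by fun_prop) _ _ (by simp)).mono_left nhdsWithin_le_nhds
    · filter_upwards [self_mem_nhdsWithin] with ε hε
      have hε : 0 < ε := hε
      have hττ : τ * (starRingEnd ℂ) τ = 1 := by
        rw [Complex.mul_conj, Complex.normSq_eq_norm_sq, hτ]; simp
      change 1 / 2 * ‖_‖ < _
      rw [add_sub_cancel_left, show (ε * (Complex.I * τ) * (starRingEnd ℂ) τ : ℂ) = ε * Complex.I by
        linear_combination (ε * Complex.I) * hττ]
      simp [hτ, abs_of_pos hε]
      linarith
  exact h1.neBot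

/-- The quotient of two solutions with the same jumps has no jump. -/
theorem hasEqualSides_of_jump {m m' : ℂ → Matrix (Fin 2) (Fin 2) ℂ} (hdet : ∀ l, (m' l).det = 1)
    {q τ : ℂ} (hτ : ‖τ‖ = 1) {v A B A' B' : Matrix (Fin 2) (Fin 2) ℂ}
    (hA : HasLeftBoundaryValue m q τ A) (hB : HasLeftBoundaryValue m q (-τ) B) (hAB : A = B * v)
    (hA' : HasLeftBoundaryValue m' q τ A') (hB' : HasLeftBoundaryValue m' q (-τ) B')
    (hAB' : A' = B' * v) (i k : Fin 2) :
    HasEqualSides (fun l => ((m l - m' l) * (m' l).adjugate) i k) q τ := by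
  have hhalf : (1 / 2 : ℝ) ∈ Ioo (0 : ℝ) 1 := by norm_num
  have hlim : ∀ (F : Filter ℂ) (X X' : Matrix (Fin 2) (Fin 2) ℂ), Tendsto m F (𝓝 X) →
      Tendsto m' F (𝓝 X') → Tendsto (fun l => ((m l - m' l) * (m' l).adjugate) i k) F
        (𝓝 (((X - X') * X'.adjugate) i k)) := fun F X X' hX hX' => by
    have h1 : Tendsto (fun l => (m' l).adjugate) F (𝓝 X'.adjugate) :=
      (continuous_id.matrix_adjugate.tendsto X').comp hX'
    exact ((continuous_apply_apply i k).tendsto _).comp ((hX.sub hX').mul h1)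
  have hdetlim : ∀ (F : Filter ℂ) [F.NeBot] (X' : Matrix (Fin 2) (Fin 2) ℂ),
      Tendsto m' F (𝓝 X') → X'.det = 1 := fun F _ X' hX' => by
    have h1 : Tendsto (fun l => (m' l).det) F (𝓝 X'.det) :=
      (continuous_id.matrix_det.tendsto X').comp hX'
    simp only [hdet] at h1
    exact tendsto_nhds_unique h1 tendsto_const_nhds
  have := neBot_leftSector (q := q) hτ
  have := neBot_leftSector (q := q) (τ := -τ) (by rwa [norm_neg])
  have dA := hdetlim (𝓝[leftSector q τ] q) A' (hA' _ hhalf)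
  have dB := hdetlim (𝓝[leftSector q (-τ)] q) B' (hB' _ hhalf)
  -- Both one-sided limits of `m'` have determinant `1`, hence so does `v`. Then `v` times its
  -- adjugate is the identity and cancels in the quotient.
  have dv : v.det = 1 := by
    rw [hAB', Matrix.det_mul, dB, one_mul] at dA
    exact dA
  refine ⟨_, hlim _ A A' (hA _ hhalf) (hA' _ hhalf), ?_⟩
  have e : (A - A') * A'.adjugate = (B - B') * B'.adjugate := by
    rw [hAB, hAB', ← sub_mul, Matrix.adjugate_mul_distrib, ← mul_assoc, mul_assoc (B - B') v,
      Matrix.mul_adjugate, dv, one_smul, mul_one]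
  rw [e]
  exact hlim _ B B' (hB _ hhalf) (hB' _ hhalf)

/-- Transfers an almost everywhere statement from the parameter of the arc to the coordinate of the
chart: the exceptional coordinates lie in the image of a null set under the differentiable map `t`.
The condition with `k > 0` says that the chart follows the orientation of the arc. -/
theorem HasE2Bounds.extendsAt_of_arc {f : ℂ → ℂ} (hf : HasE2Bounds f) {p κ : ℂ} {r : ℝ}
    (h : IsChartY p κ r) {Γ : OrientedArc} (hdom : MeasurableSet Γ.dom)
    (hj : ∀ᵐ s ∂volume.restrict Γ.dom, HasEqualSides f (Γ.param s) (deriv Γ.param s))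
    {σ t : ℝ → ℝ} (hσ : ∀ x, |x| ≤ r / 4 → σ x ∈ Γ.dom ∧ Γ.param (σ x) = expChart p κ x ∧
      t (σ x) = x ∧ ‖deriv Γ.param (σ x)‖ = 1 ∧
      ∃ k : ℝ, 0 < k ∧ κ * expChart p κ x = k * deriv Γ.param (σ x))
    (ht : DifferentiableOn ℝ t Γ.dom) : ExtendsAt f p := by
  refine hf.extendsAt h ?_
  rw [ae_restrict_iff' hdom, ae_iff] at hj
  have hnull := addHaar_image_eq_zero_of_differentiableOn_of_addHaar_eq_zero (f := t) volume
    (ht.mono fun s hs => by simp only [mem_ofPred_eq] at hs; push Not at hs; exact hs.1) hj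
  rw [ae_restrict_iff' measurableSet_Ioc, ae_iff]
  refine measure_mono_null (fun x hx => ?_) hnull
  simp only [mem_ofPred_eq] at hx
  push Not at hx
  obtain ⟨hx1, hx2⟩ := hx
  have hxr : |x| ≤ r / 4 := abs_le.2 ⟨hx1.1.le, hx1.2⟩
  obtain ⟨h1, h2, h3, h4, k, hk, h5⟩ := hσ x hxr
  refine ⟨σ x, ?_, h3⟩
  simp only [mem_ofPred_eq]
  push Not
  refine ⟨h1, fun hE => hx2 ?_⟩
  obtain ⟨L, hL1, hL2⟩ := hE
  rw [h2] at hL1 hL2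
  have p1 := hL1.comp (tendsto_expChart_sector hk h4 h5)
  have e0 : expChart p (-κ) (-x : ℝ) = expChart p κ x := by
    rw [expChart_neg]; push_cast; rw [neg_neg]
  have p2 := tendsto_expChart_sector (p := p) (κ := -κ) (τ := -deriv Γ.param (σ x)) (x := -x) hk
    (by rwa [norm_neg]) (by rw [e0]; linear_combination -h5)
  rw [e0] at p2
  have p3 := hL2.comp p2
  have := p1.sub p3
  rw [sub_self] at this
  refine this.congr fun ε => ?_
  simp only [Function.comp_apply, expChart_neg]
  congr 3
  push_cast
  ring


/-! ### Charts of the contour -/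

/-- In logarithmic coordinates the ray is the real axis, the upper half belongs to the quadrant
following the ray counterclockwise and the lower half to the preceding one. The condition `r ≤ log
t` keeps the chart outside the unit circle. -/
theorem IsFourthRoot.isChartY {c : ℂ} (hc : IsFourthRoot c) {t r : ℝ} (ht : 1 < t) (hr0 : 0 < r)
    (hr : r ≤ 1 / 8) (hrt : r ≤ Real.log t) : IsChartY (c * t) 1 r := by
  have hc0 := hc.ne_zero
  have ht0 : (0 : ℝ) < t := by linarith
  have htc : (t : ℂ) ≠ 0 := by exact_mod_cast ht0.ne'
  have hpi := Real.pi_gt_three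
  have hq : ∀ w, expChart (c * t) 1 w / c = t * Complex.exp w := fun w => by
    rw [expChart, one_mul]; field_simp
  have hn : ∀ w : ℂ, |w.re| < r → 1 < ‖expChart (c * t) 1 w‖ := fun w hw => by
    have h1 := (abs_lt.1 hw).1
    rw [expChart, norm_mul, norm_mul, hc.norm_eq, Complex.norm_exp, one_mul, one_mul,
      Complex.norm_of_nonneg ht0.le]
    nth_rewrite 1 [← Real.exp_log ht0]
    rw [← Real.exp_add, Real.one_lt_exp_iff]
    linarith
  have hcI : IsFourthRoot (-Complex.I * c) := by
    rcases hc with rfl | rfl | rfl | rfl <;> simp [IsFourthRoot]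
  have hdiv : ∀ z, z / (-Complex.I * c) = Complex.I * (z / c) := fun z => by
    have := Complex.I_ne_zero
    field_simp
    simp
  have hre : ∀ w : ℂ, |w.im| < r → 0 < (t * Complex.exp w).re := fun w hw => by
    rw [Complex.re_ofReal_mul, Complex.exp_re]
    have h1 := abs_lt.1 hw
    have := Real.cos_pos_of_mem_Ioo (x := w.im) ⟨by linarith, by linarith⟩
    have := Real.exp_pos w.re
    positivity
  refine ⟨mul_ne_zero hc0 htc, by simp, hr0, hr, ⟨outerQuadrant c, outerQuadrant (-Complex.I * c),
    Or.inr ⟨c, hc, rfl⟩, Or.inr ⟨_, hcI, rfl⟩, ?_, fun w h1 h2 h3 => ⟨hn w h1, ?_, ?_⟩,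
    fun w h1 h2 h3 => ⟨hn w h1, ?_, ?_⟩⟩, fun w h1 h2 => ?_⟩
  · intro h
    obtain ⟨z, hz⟩ := IsComponentY.nonempty (Or.inr ⟨c, hc, rfl⟩)
    have h2 := h ▸ hz
    have h3 := h2.2.1
    rw [hdiv] at h3
    simp at h3
    linarith [hz.2.2]
  · rw [hq]; exact hre w h2
  · rw [hq, Complex.im_ofReal_mul, Complex.exp_im]
    have := Real.sin_pos_of_pos_of_lt_pi h3 (by linarith [(abs_lt.1 h2).2])
    have := Real.exp_pos w.re
    positivity
  · rw [hdiv, hq, Complex.I_mul_re, Complex.im_ofReal_mul, Complex.exp_im]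
    have h5 := Real.sin_neg_of_neg_of_neg_pi_lt h3 (by linarith [(abs_lt.1 h2).1])
    have h6 := mul_pos ht0 (Real.exp_pos w.re)
    nlinarith
  · rw [hdiv, hq, Complex.I_mul_im]; exact hre w h2
  · rw [mem_contourY_iff]
    have hw : w = (w.re : ℂ) := Complex.ext (by simp) (by simpa using h2)
    refine Or.inr ⟨(hn w h1).le, ?_⟩
    rw [expChart, hw, one_mul, ← Complex.ofReal_exp, mul_assoc, ← Complex.ofReal_mul]
    rcases hc with rfl | rfl | rfl | rfl <;> simp [-Complex.ofReal_mul, -Complex.ofReal_exp]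

/-- Since `|pe^{iw}| = e^{-Im w}`, the upper half is mapped into the disc. The quadrant on the other
side is that of `2p`, which is off the contour. -/
theorem exists_isChartY_circle {p : ℂ} (hp : ‖p‖ = 1) (hre : p.re ≠ 0) (him : p.im ≠ 0) {b : ℝ}
    (hb : 0 < b) : ∃ r ≤ b, IsChartY p Complex.I r := by
  have hp0 : p ≠ 0 := norm_pos_iff.1 (by rw [hp]; exact one_pos)
  obtain ⟨c, hc, h1, h2⟩ : ∃ c, IsFourthRoot c ∧ 0 < (p / c).re ∧ 0 < (p / c).im := by
    have h2p : (2 * p) ∉ contourY := (notMem_contourY_iff _).2 (Or.inr ⟨by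
      rw [norm_mul, hp]; norm_num, by simpa using hre, by simpa using him⟩)
    rcases mem_ball_or_outerQuadrant h2p with h | ⟨c, hc, -, h1, h2⟩
    · rw [mem_ball_zero_iff, norm_mul, hp] at h; norm_num at h
    · rw [mul_div_assoc] at h1 h2
      exact ⟨c, hc, by simpa using h1, by simpa using h2⟩
  have hn : ∀ w : ℂ, ‖expChart p Complex.I w‖ = Real.exp (-w.im) := fun w => by
    rw [expChart, norm_mul, hp, one_mul, Complex.norm_exp]; simp
  have hcont : Continuous fun w => expChart p Complex.I w / c :=
    (continuous_expChart p Complex.I).div_const c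
  have h00 : expChart p Complex.I 0 = p := by simp [expChart]
  have hev : ∀ᶠ w in 𝓝 (0 : ℂ), 0 < (expChart p Complex.I w / c).re ∧
      0 < (expChart p Complex.I w / c).im := by
    refine ((Complex.continuous_re.comp hcont).tendsto 0).eventually_const_lt ?_ |>.and
      (((Complex.continuous_im.comp hcont).tendsto 0).eventually_const_lt ?_)
    · simpa [h00] using h1
    · simpa [h00] using h2
  obtain ⟨s, hs, hball⟩ := Metric.eventually_nhds_iff_ball.1 hev
  have hmin : 0 < min (min b (1 / 8)) (s / 2) := by positivity
  refine ⟨min (min b (1 / 8)) (s / 2), (min_le_left _ _).trans (min_le_left _ _), hp0, by simp, hmin,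
    (min_le_left _ _).trans (min_le_right _ _), ⟨Metric.ball 0 1, outerQuadrant c, Or.inl rfl,
      Or.inr ⟨c, hc, rfl⟩, ?_, fun w _ _ h3 => ?_, fun w a1 a2 h3 => ?_⟩, fun w _ h => ?_⟩
  · intro h
    have h3 : (0 : ℂ) ∈ outerQuadrant c := h ▸ Metric.mem_ball_self one_pos
    have := h3.1
    simp at this
    linarith
  · rw [mem_ball_zero_iff, hn, Real.exp_lt_one_iff]
    linarith
  · have hw : ‖w‖ < s := by
      have e1 := a1.trans_le (min_le_right _ _)
      have e2 := a2.trans_le (min_le_right _ _)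
      linarith [Complex.norm_le_abs_re_add_abs_im w]
    refine ⟨?_, hball w (by simpa using hw)⟩
    rw [hn, Real.one_lt_exp_iff]
    linarith
  · rw [mem_contourY_iff, hn, h]
    simp

/-- The sign `e` treats outgoing and incoming rays together. For `e = -1` the chart with `κ = -1`
runs towards the origin, as does the ray. -/
theorem HasE2Bounds.extendsAt_ray {f : ℂ → ℂ} (hf : HasE2Bounds f) {u : ℂ}
    (hu : u = 1 ∨ u = Complex.I) {e : ℝ} (he : e = 1 ∨ e = -1) {Γ : OrientedArc}
    (hΓ : Γ.param = fun s : ℝ => (s : ℂ) * u) (hdom : Γ.dom = {s | 1 ≤ e * s}) {s₀ : ℝ}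
    (hs : 1 < e * s₀)
    (hj : ∀ᵐ s ∂volume.restrict Γ.dom, HasEqualSides f (Γ.param s) (deriv Γ.param s)) :
    ExtendsAt f (s₀ * u) := by
  have hee : e * e = 1 := by rcases he with rfl | rfl <;> norm_num
  have heec : (e : ℂ) * e = 1 := by exact_mod_cast hee
  have hc : IsFourthRoot (e * u) := by
    rcases he with rfl | rfl <;> rcases hu with rfl | rfl <;> simp [IsFourthRoot]
  have hlog : 0 < Real.log (e * s₀) := Real.log_pos hs
  have hs0 : s₀ ≠ 0 := by rintro rfl; norm_num at hs
  have hun : ‖u‖ = 1 := by rcases hu with rfl | rfl <;> simp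
  have hd : ∀ s, deriv Γ.param s = u := fun s => by
    rw [hΓ]
    have := ((hasDerivAt_id s).ofReal_comp.mul_const u).deriv
    simpa using this
  set r := min (1 / 8) (Real.log (e * s₀)) with hr
  have hr0 : 0 < r := lt_min (by norm_num) hlog
  have hch := hc.isChartY hs hr0 (min_le_left _ _) (min_le_right _ _)
  have hpe : (e * u * ((e * s₀ : ℝ) : ℂ) : ℂ) = s₀ * u := by
    push_cast
    linear_combination (s₀ * u : ℂ) * heec
  rw [hpe] at hch
  have hch' : IsChartY (s₀ * u) e r := by
    rcases he with rfl | rfl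
    · simpa using hch
    · simpa using hch.neg
  have hmeas : MeasurableSet Γ.dom := by
    rw [hdom]
    exact (isClosed_le continuous_const (by fun_prop)).measurableSet
  refine hf.extendsAt_of_arc hch' hmeas hj (σ := fun x => s₀ * Real.exp (e * x))
    (t := fun s => e * Real.log (s / s₀)) (fun x hx => ⟨?_, ?_, ?_, ?_, ?_⟩) ?_
  · rw [hdom]
    change 1 ≤ e * (s₀ * Real.exp (e * x))
    rw [← mul_assoc]
    nth_rewrite 1 [← Real.exp_log (by linarith : 0 < e * s₀)]
    rw [← Real.exp_add, Real.one_le_exp_iff]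
    have h1 : |e * x| ≤ r / 4 := by
      rcases he with rfl | rfl <;> simpa
    have h2 := (abs_le.1 h1).1
    have h3 : r ≤ Real.log (e * s₀) := min_le_right _ _
    linarith
  · rw [hΓ, expChart]
    push_cast
    ring
  · rw [mul_div_cancel_left₀ _ hs0, Real.log_exp, ← mul_assoc, hee, one_mul]
  · rw [hd]; exact hun
  · rw [hd]
    refine ⟨e * s₀ * Real.exp (e * x), mul_pos (by linarith) (Real.exp_pos _), ?_⟩
    rw [expChart]
    push_cast
    ring
  · intro s hs'
    rw [hdom] at hs'
    have hs1 : s ≠ 0 := by rintro rfl; norm_num at hs'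
    exact ((((differentiableAt_id.div_const s₀).log (div_ne_zero hs1 hs0)).const_mul
      e)).differentiableWithinAt

theorem HasE2Bounds.extendsAt_circle {f : ℂ → ℂ} (hf : HasE2Bounds f) {Γ : OrientedArc} {a b : ℝ}
    (hΓ : Γ.param = fun s : ℝ => Complex.exp (s * Complex.I)) (hdom : Γ.dom = Icc a b) {s₀ : ℝ}
    (hs : s₀ ∈ Ioo a b) (hre : (Complex.exp (s₀ * Complex.I)).re ≠ 0)
    (him : (Complex.exp (s₀ * Complex.I)).im ≠ 0)
    (hj : ∀ᵐ s ∂volume.restrict Γ.dom, HasEqualSides f (Γ.param s) (deriv Γ.param s)) :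
    ExtendsAt f (Complex.exp (s₀ * Complex.I)) := by
  obtain ⟨r, hr, hch⟩ := exists_isChartY_circle (Complex.norm_exp_ofReal_mul_I s₀) hre him
    (b := min (s₀ - a) (b - s₀)) (lt_min (by linarith [hs.1]) (by linarith [hs.2]))
  have hr0 := hch.pos
  have r1 := hr.trans (min_le_left _ _)
  have r2 := hr.trans (min_le_right _ _)
  have hd : ∀ s, deriv Γ.param s = Complex.exp (s * Complex.I) * Complex.I := fun s => by
    rw [hΓ]
    have := ((hasDerivAt_id s).ofReal_comp.mul_const Complex.I).cexp.deriv
    simpa using this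
  have hadd : ∀ x : ℝ, Complex.exp (((s₀ + x : ℝ) : ℂ) * Complex.I) =
      expChart (Complex.exp (s₀ * Complex.I)) Complex.I x := fun x => by
    rw [expChart, ← Complex.exp_add]
    push_cast
    ring_nf
  refine hf.extendsAt_of_arc hch (by rw [hdom]; exact measurableSet_Icc) hj (σ := fun x => s₀ + x)
    (t := fun s => s - s₀) (fun x hx => ⟨?_, ?_, ?_, ?_, 1, one_pos, ?_⟩) (by fun_prop)
  · rw [hdom]
    have := abs_le.1 hx
    constructor <;> linarith
  · rw [hΓ]
    exact hadd x
  · simp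
  · rw [hd, norm_mul, Complex.norm_exp_ofReal_mul_I, Complex.norm_I, mul_one]
  · rw [hd, hadd]
    push_cast
    ring

/-- The points of the contour at which its arcs meet. -/
def cornersY : Set ℂ :=
  {1, Complex.I, -1, -Complex.I, Complex.exp (5 * Real.pi / 4 * Complex.I)}

theorem HasE2Bounds.extendsAt_of_mem {f : ℂ → ℂ} (hf : HasE2Bounds f)
    (hj : ∀ j, ∀ᵐ s ∂volume.restrict (arcY j).dom,
      HasEqualSides f ((arcY j).param s) (deriv (arcY j).param s)) {l : ℂ} (hl : l ∈ contourY)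
    (hc : l ∉ cornersY) : ExtendsAt f l := by
  simp only [cornersY, mem_insert_iff, mem_singleton_iff, not_or] at hc
  obtain ⟨c1, c2, c3, c4, c5⟩ := hc
  obtain ⟨j, s, hs, rfl⟩ := mem_iUnion.1 hl
  have hray : ∀ (u : ℂ) (e : ℝ), (u = 1 ∨ u = Complex.I) → (e = 1 ∨ e = -1) →
      (arcY j).param = (fun s : ℝ => (s : ℂ) * u) → (arcY j).dom = {s | 1 ≤ e * s} →
      (e : ℂ) * u ≠ (arcY j).param s → ExtendsAt f ((arcY j).param s) := by
    intro u e hu he hΓ hdom hne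
    have h2 : (arcY j).param s = s * u := by rw [hΓ]
    rw [h2]
    refine hf.extendsAt_ray hu he hΓ hdom (lt_of_le_of_ne (by rwa [hdom] at hs) fun h => hne ?_) (hj j)
    have : s = e := by rcases he with rfl | rfl <;> linarith
    rw [h2, this]
  have hcirc : ∀ a b : ℝ, (arcY j).param = (fun s : ℝ => Complex.exp (s * Complex.I)) →
      (arcY j).dom = Icc a b → Complex.exp (a * Complex.I) ≠ (arcY j).param s →
      Complex.exp (b * Complex.I) ≠ (arcY j).param s → ExtendsAt f ((arcY j).param s) := by
    intro a b hΓ hdom ha hb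
    have h2 : (arcY j).param s = Complex.exp (s * Complex.I) := by rw [hΓ]
    rw [h2] at ha hb c1 c2 c3 c4 ⊢
    rw [hdom] at hs
    have hn := Complex.norm_exp_ofReal_mul_I s
    rw [Complex.norm_def, Real.sqrt_eq_one, Complex.normSq_apply] at hn
    refine hf.extendsAt_circle hΓ hdom ⟨lt_of_le_of_ne hs.1 ?_, lt_of_le_of_ne hs.2 ?_⟩ ?_ ?_ (hj j)
    · rintro rfl; exact ha rfl
    · rintro rfl; exact hb rfl
    · intro h
      rw [h] at hn
      rcases mul_self_eq_one_iff.1 (by linarith : (Complex.exp (s * Complex.I)).im *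
        (Complex.exp (s * Complex.I)).im = 1) with h' | h'
      · exact c2 (Complex.ext (by simp [h]) (by simp [h']))
      · exact c4 (Complex.ext (by simp [h]) (by simp [h']))
    · intro h
      rw [h] at hn
      rcases mul_self_eq_one_iff.1 (by linarith : (Complex.exp (s * Complex.I)).re *
        (Complex.exp (s * Complex.I)).re = 1) with h' | h'
      · exact c1 (Complex.ext (by simp [h']) (by simp [h]))
      · exact c3 (Complex.ext (by simp [h']) (by simp [h]))
  have x1 : Complex.exp ((-(Real.pi / 2) : ℝ) * Complex.I) = -Complex.I := by
    push_cast
    rw [neg_mul, Complex.exp_neg, Complex.exp_pi_div_two_mul_I]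
    simp
  have x2 : Complex.exp ((0 : ℝ) * Complex.I) = 1 := by simp
  have x3 : Complex.exp ((Real.pi / 2 : ℝ) * Complex.I) = Complex.I := by
    push_cast
    exact Complex.exp_pi_div_two_mul_I
  have x4 : Complex.exp ((Real.pi : ℝ) * Complex.I) = -1 := Complex.exp_pi_mul_I
  have x5 : Complex.exp ((5 * Real.pi / 4 : ℝ) * Complex.I) =
    Complex.exp (5 * Real.pi / 4 * Complex.I) := by push_cast; rfl
  have x6 : Complex.exp ((-(3 * Real.pi / 4) : ℝ) * Complex.I) =
      Complex.exp (5 * Real.pi / 4 * Complex.I) := by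
    rw [show ((-(3 * Real.pi / 4) : ℝ) * Complex.I : ℂ) = 5 * Real.pi / 4 * Complex.I -
      2 * Real.pi * Complex.I by push_cast; ring, Complex.exp_sub, Complex.exp_two_pi_mul_I, div_one]
  fin_cases j
  · exact hray 1 1 (by simp) (by simp) (by simp [arcY]) (by ext; simp [arcY]) (by simpa using Ne.symm c1)
  · exact hray Complex.I 1 (by simp) (by simp) (by simp [arcY]) (by ext; simp [arcY])
      (by simpa using Ne.symm c2)
  · exact hray 1 (-1) (by simp) (by simp) (by simp [arcY]) (by ext; simp [arcY, le_neg])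
      (by simpa using Ne.symm c3)
  · exact hray Complex.I (-1) (by simp) (by simp) (by simp [arcY]) (by ext; simp [arcY, le_neg])
      (by simpa using Ne.symm c4)
  · exact hcirc _ _ rfl rfl (by rw [x1]; exact Ne.symm c4) (by rw [x2]; exact Ne.symm c1)
  · exact hcirc _ _ rfl rfl (by rw [x2]; exact Ne.symm c1) (by rw [x3]; exact Ne.symm c2)
  · exact hcirc _ _ rfl rfl (by rw [x3]; exact Ne.symm c2) (by rw [x4]; exact Ne.symm c3)
  · exact hcirc _ _ rfl rfl (by rw [x4]; exact Ne.symm c3) (by rw [x5]; exact Ne.symm c5)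
  · exact hcirc _ _ rfl rfl (by rw [x6]; exact Ne.symm c5) (by rw [x1]; exact Ne.symm c4)


/-! ### Isolated singularities and Liouville's theorem -/

/-- On `|w| = r` one has `w⁴ - r⁴ = w²(w² - w̄²) = 4i w² Re w Im w`. The zeros of this factor on the
axes outweigh the blow-up of `h` there. -/
theorem norm_pow_four_sub_mul_le {w : ℂ} {r C : ℝ} {h : ℂ} (hw : ‖w‖ = r) (hC : 0 ≤ C)
    (hh : w.re ≠ 0 → w.im ≠ 0 → ‖h‖ ≤ C / Real.sqrt (min |w.re| |w.im|)) :
    ‖(w ^ 4 - (r : ℂ) ^ 4) * h‖ ≤ 4 * C * (r ^ 3 * Real.sqrt r) := by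
  have hr : 0 ≤ r := hw ▸ norm_nonneg w
  have h1 : w ^ 4 - (r : ℂ) ^ 4 = w ^ 2 * (4 * (w.re * w.im : ℝ) * Complex.I) := by
    have e1 : w * (starRingEnd ℂ) w = (r : ℂ) ^ 2 := by
      rw [Complex.mul_conj, Complex.normSq_eq_norm_sq, hw]; push_cast; ring
    have e2 : w ^ 4 - (r : ℂ) ^ 4 = w ^ 2 * (w ^ 2 - (starRingEnd ℂ) w ^ 2) := by
      rw [show (r : ℂ) ^ 4 = ((r : ℂ) ^ 2) ^ 2 by ring, ← e1]; ring
    rw [e2]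
    congr 1
    have e3 := Complex.re_add_im w
    have e4 : (starRingEnd ℂ) w = w.re - w.im * Complex.I := by
      apply Complex.ext <;> simp
    rw [e4]
    nth_rewrite 1 [← e3]
    push_cast
    ring
  have h2 : ‖w ^ 4 - (r : ℂ) ^ 4‖ = r ^ 2 * (4 * (|w.re| * |w.im|)) := by
    rw [h1]
    simp [hw, -Complex.ofReal_mul]
  rw [norm_mul, h2]
  by_cases h0 : w.re = 0 ∨ w.im = 0
  · have : |w.re| * |w.im| = 0 := by rcases h0 with h | h <;> simp [h]
    rw [this]
    simp only [mul_zero, zero_mul]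
    positivity
  · push Not at h0
    have h3 := hh h0.1 h0.2
    set a := min |w.re| |w.im| with ha
    have ha0 : 0 < a := lt_min (abs_pos.2 h0.1) (abs_pos.2 h0.2)
    have hre : |w.re| ≤ r := hw ▸ Complex.abs_re_le_norm w
    have him : |w.im| ≤ r := hw ▸ Complex.abs_im_le_norm w
    have har : a ≤ r := (min_le_left _ _).trans hre
    have hm : |w.re| * |w.im| ≤ r * a := by
      rw [← min_mul_max |w.re| |w.im|, mul_comm]
      exact mul_le_mul_of_nonneg_right (max_le hre him) ha0.le
    calc r ^ 2 * (4 * (|w.re| * |w.im|)) * ‖h‖ ≤ r ^ 2 * (4 * (r * a)) * (C / Real.sqrt a) := by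
          gcongr
      _ = 4 * C * (r ^ 3 * Real.sqrt a) := by
          have := Real.sqrt_pos.2 ha0
          have e := Real.mul_self_sqrt ha0.le
          rw [mul_div_assoc', div_eq_iff this.ne']
          linear_combination (-(4 * C * r ^ 3)) * e
      _ ≤ _ := by gcongr

/-- A function in a punctured disc that is bounded by `1 / √dist` from the axes. -/
theorem exists_norm_le_of_norm_le_sqrt {H : ℂ → ℂ} {R C : ℝ} (hC : 0 ≤ C)
    (hd : ∀ w : ℂ, w ≠ 0 → ‖w‖ < R → DifferentiableAt ℂ H w)
    (hb : ∀ w : ℂ, ‖w‖ < R → w.re ≠ 0 → w.im ≠ 0 →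
      ‖H w‖ ≤ C / Real.sqrt (min |w.re| |w.im|)) {w : ℂ} (hw0 : w ≠ 0) (hw : 2 * ‖w‖ < R) :
    ‖H w‖ ≤ 256 * C / Real.sqrt ‖w‖ := by
  set ρ := ‖w‖ with hρ
  have hρ0 : 0 < ρ := norm_pos_iff.2 hw0
  set r₁ := ρ / 2 with hr₁
  set r₂ := 2 * ρ with hr₂
  -- Maximum principle on the annulus `ρ/2 < |z| < 2ρ`. One factor for each boundary circle makes
  -- `Q` bounded there, while at `|w| = ρ` the factors are at least `ρ⁴/2` and `15ρ⁴`.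
  set Q : ℂ → ℂ := fun z => (z ^ 4 - (r₁ : ℂ) ^ 4) * (z ^ 4 - (r₂ : ℂ) ^ 4) * H z with hQ
  set U : Set ℂ := {z | r₁ < ‖z‖} ∩ {z | ‖z‖ < r₂} with hU
  have hUb : Bornology.IsBounded U := (Metric.isBounded_ball (x := (0 : ℂ)) (r := r₂)).subset
    fun z hz => by simpa using hz.2
  have hUc : closure U ⊆ {z | r₁ ≤ ‖z‖} ∩ {z | ‖z‖ ≤ r₂} :=
    closure_minimal (fun z hz => ⟨(show r₁ < ‖z‖ from hz.1).le, (show ‖z‖ < r₂ from hz.2).le⟩)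
      ((isClosed_le continuous_const continuous_norm).inter
        (isClosed_le continuous_norm continuous_const))
  have hUf : ∀ z ∈ frontier U, ‖z‖ = r₁ ∨ ‖z‖ = r₂ := by
    intro z hz
    have hUo : IsOpen U := (isOpen_lt continuous_const continuous_norm).inter
      (isOpen_lt continuous_norm continuous_const)
    rw [hUo.frontier_eq] at hz
    have h1 : r₁ ≤ ‖z‖ ∧ ‖z‖ ≤ r₂ := hUc hz.1
    by_contra! h
    exact hz.2 ⟨lt_of_le_of_ne h1.1 h.1.symm, lt_of_le_of_ne h1.2 h.2⟩
  have hQd : DiffContOnCl ℂ Q U := by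
    refine DifferentiableOn.diffContOnCl fun z hz => ?_
    have h1 : r₁ ≤ ‖z‖ ∧ ‖z‖ ≤ r₂ := hUc hz
    have hz0 : z ≠ 0 := norm_pos_iff.1 (by linarith [h1.1])
    exact (DifferentiableAt.mul (by fun_prop) (hd z hz0 (by linarith [h1.2]))).differentiableWithinAt
  have hfac : ∀ (z : ℂ) (s : ℝ), ‖z‖ ≤ r₂ → 0 ≤ s → s ≤ r₂ → ‖z ^ 4 - (s : ℂ) ^ 4‖ ≤ 2 * r₂ ^ 4 := by
    intro z s hz hs0 hs
    refine (norm_sub_le _ _).trans ?_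
    rw [norm_pow, norm_pow, Complex.norm_of_nonneg hs0]
    have := pow_le_pow_left₀ (norm_nonneg z) hz 4
    have := pow_le_pow_left₀ hs0 hs 4
    linarith
  have hQf : ∀ z ∈ frontier U, ‖Q z‖ ≤ 8 * C * r₂ ^ 7 * Real.sqrt r₂ := by
    intro z hz
    have key : ∀ r s : ℝ, ‖z‖ = r → 0 ≤ r → r ≤ r₂ → 0 ≤ s → s ≤ r₂ →
        ‖(z ^ 4 - (s : ℂ) ^ 4) * ((z ^ 4 - (r : ℂ) ^ 4) * H z)‖ ≤ 8 * C * r₂ ^ 7 * Real.sqrt r₂ := by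
      intro r s hz hr0 hr hs0 hs
      rw [norm_mul]
      calc _ ≤ 2 * r₂ ^ 4 * (4 * C * (r ^ 3 * Real.sqrt r)) := by
            gcongr
            · exact hfac z s (hz.le.trans hr) hs0 hs
            · exact norm_pow_four_sub_mul_le hz hC fun h1 h2 => hb z (by linarith) h1 h2
        _ ≤ 2 * r₂ ^ 4 * (4 * C * (r₂ ^ 3 * Real.sqrt r₂)) := by gcongr
        _ = _ := by ring
    rcases hUf z hz with h | h
    · have := key r₁ r₂ h (by linarith) (by linarith) (by linarith) le_rfl
      refine le_trans (le_of_eq ?_) this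
      rw [hQ]; congr 1; ring
    · have := key r₂ r₁ h (by linarith) le_rfl (by linarith) (by linarith)
      refine le_trans (le_of_eq ?_) this
      rw [hQ]; congr 1; ring
  have hmax := Complex.norm_le_of_forall_mem_frontier_norm_le hUb hQd hQf
    (subset_closure (⟨by change r₁ < ‖w‖; linarith, by change ‖w‖ < r₂; linarith⟩ : w ∈ U))
  have low₁ : ρ ^ 4 / 2 ≤ ‖w ^ 4 - (r₁ : ℂ) ^ 4‖ := by
    refine le_trans ?_ (norm_sub_norm_le _ _)
    rw [norm_pow, norm_pow, Complex.norm_of_nonneg (by linarith : 0 ≤ r₁), ← hρ, hr₁]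
    have := pow_pos hρ0 4
    ring_nf
    linarith
  have low₂ : 15 * ρ ^ 4 ≤ ‖w ^ 4 - (r₂ : ℂ) ^ 4‖ := by
    rw [norm_sub_rev]
    refine le_trans ?_ (norm_sub_norm_le _ _)
    rw [norm_pow, norm_pow, Complex.norm_of_nonneg (by linarith : 0 ≤ r₂), ← hρ, hr₂]
    ring_nf
    exact le_rfl
  have hsq : Real.sqrt r₂ ≤ 3 / 2 * Real.sqrt ρ := by
    rw [hr₂, Real.sqrt_mul (by norm_num)]
    gcongr
    rw [Real.sqrt_le_left (by norm_num)]
    norm_num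
  have h1 : ρ ^ 4 / 2 * (15 * ρ ^ 4) * ‖H w‖ ≤ 8 * C * (2 * ρ) ^ 7 * (3 / 2 * Real.sqrt ρ) := by
    calc _ ≤ ‖w ^ 4 - (r₁ : ℂ) ^ 4‖ * ‖w ^ 4 - (r₂ : ℂ) ^ 4‖ * ‖H w‖ := by gcongr
      _ = ‖Q w‖ := by rw [hQ]; simp only [norm_mul]
      _ ≤ _ := hmax
      _ ≤ _ := by gcongr
  have hs0 := Real.sqrt_pos.2 hρ0
  have hss := Real.mul_self_sqrt hρ0.le
  rw [le_div_iff₀ hs0]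
  have h2 : ρ ^ 7 * (15 / 2 * (ρ * ‖H w‖)) ≤ ρ ^ 7 * (1536 * C * Real.sqrt ρ) := by
    calc _ = ρ ^ 4 / 2 * (15 * ρ ^ 4) * ‖H w‖ := by ring
      _ ≤ _ := h1
      _ = _ := by ring
  have h3 := le_of_mul_le_mul_left h2 (pow_pos hρ0 7)
  have h4 : Real.sqrt ρ * (‖H w‖ * Real.sqrt ρ) ≤ Real.sqrt ρ * (256 * C) := by
    calc _ = ρ * ‖H w‖ := by linear_combination ‖H w‖ * hss
      _ ≤ _ := by nlinarith
  exact le_of_mul_le_mul_left h4 hs0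

/-- A Liouville theorem for a bound that degenerates at the axes. The factor `z⁴ - R⁴` repairs it on
the circle `|z| = R`, and the maximum principle yields `E(w) = O(R^{-1/2})`. -/
theorem eq_zero_of_norm_le_sqrt {E : ℂ → ℂ} (hE : Differentiable ℂ E) {C : ℝ} (hC : 0 ≤ C)
    (hb : ∀ w : ℂ, 4 ≤ ‖w‖ → w.re ≠ 0 → w.im ≠ 0 →
      ‖E w‖ ≤ C / Real.sqrt (min |w.re| |w.im|)) (w : ℂ) : E w = 0 := by
  have key : ∀ R : ℝ, 4 ≤ R → 2 * ‖w‖ ≤ R → ‖E w‖ ≤ 8 * C / Real.sqrt R := by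
    intro R hR4 hR
    have hR0 : 0 < R := by linarith
    have hmax := Complex.norm_le_of_forall_mem_frontier_norm_le
      (f := fun z => (z ^ 4 - (R : ℂ) ^ 4) * E z) (U := Metric.ball 0 R) (z := w)
      (C := 4 * C * (R ^ 3 * Real.sqrt R))
      Metric.isBounded_ball (Differentiable.diffContOnCl (by fun_prop)) (fun z hz => ?_)
      (subset_closure (by rw [mem_ball_zero_iff]; linarith))
    · have h1 : R ^ 4 / 2 ≤ ‖w ^ 4 - (R : ℂ) ^ 4‖ := by
        rw [norm_sub_rev]
        refine le_trans ?_ (norm_sub_norm_le _ _)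
        rw [norm_pow, norm_pow, Complex.norm_of_nonneg hR0.le]
        have := pow_le_pow_left₀ (norm_nonneg w) (by linarith : ‖w‖ ≤ R / 2) 4
        have := pow_pos hR0 4
        ring_nf at *
        linarith
      rw [norm_mul] at hmax
      have h2 := (mul_le_mul_of_nonneg_right h1 (norm_nonneg (E w))).trans hmax
      have hs0 := Real.sqrt_pos.2 hR0
      have hss := Real.mul_self_sqrt hR0.le
      rw [le_div_iff₀ hs0]
      have h3 : (R ^ 3 * Real.sqrt R) * (‖E w‖ * Real.sqrt R) ≤ (R ^ 3 * Real.sqrt R) * (8 * C) := by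
        calc _ = 2 * (R ^ 4 / 2 * ‖E w‖) := by linear_combination R ^ 3 * ‖E w‖ * hss
          _ ≤ 2 * (4 * C * (R ^ 3 * Real.sqrt R)) := by linarith
          _ = _ := by ring
      exact le_of_mul_le_mul_left h3 (by positivity)
    · rw [frontier_ball _ hR0.ne', mem_sphere_zero_iff_norm] at hz
      exact norm_pow_four_sub_mul_le hz hC fun h1 h2 => hb z (by linarith) h1 h2
  have hlim : Tendsto (fun R => 8 * C / Real.sqrt R) atTop (𝓝 0) :=
    tendsto_const_nhds.div_atTop Real.tendsto_sqrt_atTop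
  have h0 : ‖E w‖ ≤ 0 := by
    refine ge_of_tendsto hlim ?_
    filter_upwards [eventually_ge_atTop 4, eventually_ge_atTop (2 * ‖w‖)] with R h1 h2
    exact key R h1 h2
  exact norm_le_zero_iff.1 h0


/-! ### Uniqueness -/

theorem dense_compl_contourY : Dense contourYᶜ := by
  have d1 : Dense {z : ℂ | z.re ≠ 0} := (dense_compl_singleton (0 : ℝ)).preimage Complex.isOpenMap_re
  have d2 : Dense {z : ℂ | z.im ≠ 0} := (dense_compl_singleton (0 : ℝ)).preimage Complex.isOpenMap_im
  have d3 : Dense (Metric.sphere (0 : ℂ) 1)ᶜ :=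
    interior_eq_empty_iff_dense_compl.1 (interior_sphere' 0 1)
  refine ((d1.inter_of_isOpen_left d2 (isOpen_ne_fun Complex.continuous_re continuous_const)).inter_of_isOpen_right
    d3 Metric.isClosed_sphere.isOpen_compl).mono fun z hz => ?_
  obtain ⟨⟨h1, h2⟩, h3⟩ := hz
  rw [mem_compl_iff, notMem_contourY_iff]
  rcases lt_trichotomy ‖z‖ 1 with h | h | h
  · exact Or.inl h
  · exact absurd (by simpa using h) h3
  · exact Or.inr ⟨h, h1, h2⟩

theorem extendsAt_of_notMem {f : ℂ → ℂ} (hf : DifferentiableOn ℂ f contourYᶜ) {l : ℂ}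
    (hl : l ∉ contourY) : ExtendsAt f l := by
  obtain ⟨s, hs, hball⟩ := Metric.isOpen_iff.1 isOpen_compl_contourY l hl
  exact ⟨s, hs, f, hf.mono hball, fun _ _ _ => rfl⟩

/-- The complement of `Y` is dense, so every local extension coincides with the extension by limits,
and the local extensions fit together. -/
theorem ExtendsAt.differentiableAt {f : ℂ → ℂ} {p : ℂ} (h : ExtendsAt f p) :
    DifferentiableAt ℂ (extendFrom contourYᶜ f) p := by
  obtain ⟨s, hs, E, hE, hEf⟩ := h
  refine (hE.differentiableAt (Metric.ball_mem_nhds p hs)).congr_of_eventuallyEq ?_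
  filter_upwards [Metric.ball_mem_nhds p hs] with q hq
  refine extendFrom_eq (dense_compl_contourY q) ?_
  have hc := (hE.differentiableAt (Metric.isOpen_ball.mem_nhds hq)).continuousAt
  refine (hc.mono_left (nhdsWithin_le_nhds (s := contourYᶜ))).congr' ?_
  filter_upwards [self_mem_nhdsWithin, nhdsWithin_le_nhds (Metric.isOpen_ball.mem_nhds hq)] with l h1 h2
  exact hEf l h2 h1

theorem extendFrom_eq_of_notMem {f : ℂ → ℂ} (hf : DifferentiableOn ℂ f contourYᶜ) {l : ℂ}
    (hl : l ∉ contourY) : extendFrom contourYᶜ f l = f l :=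
  extendFrom_eq (dense_compl_contourY l) (hf.continuousOn l hl)

/-- In logarithmic coordinates the circle becomes `Re w = 0` and a ray through the corner lies in
`Im w = 0`. At `e^{5πi/4}` only the circle passes through, and the statement is weaker than what
holds. -/
theorem exists_chart_corner {p : ℂ} (hp : p ∈ cornersY) : ‖p‖ = 1 ∧ ∃ r > 0, r ≤ 1 / 8 ∧
    ∀ w : ℂ, ‖w‖ < r → w.re ≠ 0 → w.im ≠ 0 → expChart p 1 w ∉ contourY := by
  have hpi := Real.pi_pos
  have hn : ‖p‖ = 1 := by
    simp only [cornersY, mem_insert_iff, mem_singleton_iff] at hp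
    rcases hp with rfl | rfl | rfl | rfl | rfl <;> try simp
    rw [show (5 * Real.pi / 4 * Complex.I : ℂ) = ((5 * Real.pi / 4 : ℝ) : ℂ) * Complex.I by
      push_cast; rfl, Complex.norm_exp_ofReal_mul_I]
  refine ⟨hn, ?_⟩
  have hnorm : ∀ w : ℂ, ‖expChart p 1 w‖ = Real.exp w.re := fun w => by
    rw [expChart, norm_mul, hn, one_mul, one_mul, Complex.norm_exp]
  suffices h : ∃ r > 0, r ≤ 1 / 8 ∧ ∀ w : ℂ, ‖w‖ < r → w.im ≠ 0 →
      (expChart p 1 w).re ≠ 0 ∧ (expChart p 1 w).im ≠ 0 by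
    obtain ⟨r, hr, hr8, h⟩ := h
    refine ⟨r, hr, hr8, fun w hw h1 h2 => ?_⟩
    rw [notMem_contourY_iff, hnorm]
    rcases h1.lt_or_gt with h1 | h1
    · exact Or.inl (Real.exp_lt_one_iff.2 h1)
    · exact Or.inr ⟨Real.one_lt_exp_iff.2 h1, h w hw h2⟩
  by_cases hc : IsFourthRoot p
  · refine ⟨1 / 8, by norm_num, le_rfl, fun w hw him => ?_⟩
    have hi := (Complex.abs_im_le_norm w).trans_lt hw
    have hi' := abs_lt.1 hi
    have h3 := Real.pi_gt_three
    have hcos : Real.cos w.im ≠ 0 :=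
      (Real.cos_pos_of_mem_Ioo ⟨by linarith, by linarith⟩).ne'
    have hsin : Real.sin w.im ≠ 0 := by
      rcases him.lt_or_gt with h | h
      · exact (Real.sin_neg_of_neg_of_neg_pi_lt h (by linarith)).ne
      · exact (Real.sin_pos_of_pos_of_lt_pi h (by linarith)).ne'
    have he := Real.exp_pos w.re
    rcases hc with rfl | rfl | rfl | rfl <;>
      simp [expChart, Complex.exp_re, Complex.exp_im, hcos, hsin]
  · have hp5 : p = Complex.exp (5 * Real.pi / 4 * Complex.I) := by
      simp only [cornersY, mem_insert_iff, mem_singleton_iff] at hp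
      simp only [IsFourthRoot] at hc
      tauto
    have hs2 : (0 : ℝ) < Real.sqrt 2 := by positivity
    have h0 : p.re ≠ 0 ∧ p.im ≠ 0 := by
      have : p = -((Real.sqrt 2 / 2 : ℝ) : ℂ) - ((Real.sqrt 2 / 2 : ℝ) : ℂ) * Complex.I := by
        rw [hp5, show (5 * Real.pi / 4 * Complex.I : ℂ) = Real.pi * Complex.I +
          ((Real.pi / 4 : ℝ) : ℂ) * Complex.I by push_cast; ring, Complex.exp_add, Complex.exp_pi_mul_I,
          Complex.exp_mul_I, ← Complex.ofReal_cos, ← Complex.ofReal_sin, Real.cos_pi_div_four,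
          Real.sin_pi_div_four]
        ring
      rw [this]
      simp [-Complex.ofReal_div]
    have h00 : expChart p 1 0 = p := by simp [expChart]
    have hcont := continuous_expChart p 1
    have hev : ∀ᶠ w in 𝓝 (0 : ℂ), (expChart p 1 w).re ≠ 0 ∧ (expChart p 1 w).im ≠ 0 :=
      (((Complex.continuous_re.comp hcont).continuousAt (x := 0)).eventually_ne
        (by simpa [h00] using h0.1)).and
      (((Complex.continuous_im.comp hcont).continuousAt (x := 0)).eventually_ne
        (by simpa [h00] using h0.2))
    obtain ⟨s, hs, hball⟩ := Metric.eventually_nhds_iff_ball.1 hev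
    exact ⟨min s (1 / 8), by positivity, min_le_right _ _, fun w hw _ =>
      hball w (by simpa using hw.trans_le (min_le_left _ _))⟩

/-- In the logarithmic chart `exists_norm_le_of_norm_le_sqrt` improves the bound by the distance to
the axes to `O(|λ - p|^{-1/2})`. This is `o(1/|λ - p|)`, so the singularity is removable. -/
theorem HasE2Bounds.extendsAt_corner {f : ℂ → ℂ} (hf : HasE2Bounds f)
    (hext : ∀ l ∉ cornersY, ExtendsAt f l) {p : ℂ} (hp : p ∈ cornersY) : ExtendsAt f p := by
  obtain ⟨hpn, r, hr, hr8, hrY⟩ := exists_chart_corner hp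
  have hp0 : p ≠ 0 := norm_pos_iff.1 (by rw [hpn]; exact one_pos)
  have hpY : p ∈ contourY := (mem_contourY_iff p).2 (Or.inl hpn)
  obtain ⟨C, hC⟩ := hf.norm_le
  set E := extendFrom contourYᶜ f with hE
  have hfin : (cornersY \ {p}).Finite := by
    have : cornersY.Finite := by unfold cornersY; exact Set.toFinite _
    exact this.sdiff
  obtain ⟨s, hs, hball⟩ := Metric.isOpen_iff.1 hfin.isClosed.isOpen_compl p (by simp)
  have hEd : ∀ l ∈ Metric.ball p s, l ≠ p → DifferentiableAt ℂ E l := fun l hl hlp =>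
    (hext l fun h => hball hl ⟨h, hlp⟩).differentiableAt
  set R := min (r / 2) (s / 4) with hR
  have hR0 : 0 < R := by positivity
  have hRr : R ≤ r / 2 := min_le_left _ _
  have hRs : R ≤ s / 4 := min_le_right _ _
  have hchart : ∀ w : ℂ, ‖w‖ < R → ‖w‖ / 4 ≤ ‖expChart p 1 w - p‖ ∧
      ‖expChart p 1 w - p‖ ≤ 4 * ‖w‖ := fun w hw => by
    have := norm_expChart_sub (p := p) (κ := 1) (w := w) (ζ := 0) (by simp) (by linarith) (by simp)
    have h00 : expChart p 1 0 = p := by simp [expChart]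
    rw [h00, sub_zero, hpn] at this
    exact ⟨by linarith [this.1], by linarith [this.2]⟩
  have hbound : ∀ w : ℂ, w ≠ 0 → 2 * ‖w‖ < R →
      ‖E (expChart p 1 w)‖ ≤ 256 * (|C| * Real.sqrt 8) / Real.sqrt ‖w‖ := by
    intro w hw0 hw
    refine exists_norm_le_of_norm_le_sqrt (H := fun w => E (expChart p 1 w)) (R := R)
      (C := |C| * Real.sqrt 8) (by positivity) (fun w hw0 hw => ?_) (fun w hw h1 h2 => ?_) hw0 hw
    · obtain ⟨c1, c2⟩ := hchart w hw
      have h0 : 0 < ‖w‖ := norm_pos_iff.2 hw0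
      have := hEd (expChart p 1 w) (by rw [mem_ball_iff_norm]; linarith)
        (sub_ne_zero.1 (norm_pos_iff.1 (by linarith)))
      exact DifferentiableAt.comp w this (differentiable_expChart p 1 w)
    · have hwY := hrY w (by linarith) h1 h2
      rw [hE, extendFrom_eq_of_notMem hf.diff hwY]
      set a := min |w.re| |w.im| with ha
      have ha0 : 0 < a := lt_min (abs_pos.2 h1) (abs_pos.2 h2)
      have haw : a ≤ ‖w‖ := (min_le_left _ _).trans (Complex.abs_re_le_norm w)
      refine (hC _ (a / 8) (by positivity) fun l hl => ?_).trans ?_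
      · rw [mem_closedBall_iff_norm] at hl
        obtain ⟨ζ, rfl, hζ⟩ := exists_expChart_eq (p := p) (κ := 1) (w := w) (l := l) hp0 (by simp)
          (by linarith) ha0 (by linarith) (by rw [hpn]; linarith)
        have a1 := (Complex.abs_re_le_norm (ζ - w)).trans_lt hζ
        have a2 := (Complex.abs_im_le_norm (ζ - w)).trans_lt hζ
        rw [Complex.sub_re] at a1
        rw [Complex.sub_im] at a2
        refine hrY ζ ?_ ?_ ?_
        · have := norm_add_le (ζ - w) w
          rw [sub_add_cancel] at this
          linarith
        · intro h0
          rw [h0, zero_sub, abs_neg] at a1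
          linarith [min_le_left |w.re| |w.im|]
        · intro h0
          rw [h0, zero_sub, abs_neg] at a2
          linarith [min_le_right |w.re| |w.im|]
      · rw [Real.sqrt_div ha0.le, ← div_mul, mul_comm_div, mul_div_assoc']
        gcongr
        exact le_abs_self C
  set B := 256 * (|C| * Real.sqrt 8) with hB
  have hB0 : 0 ≤ B := by positivity
  have hEb : ∀ l : ℂ, l ≠ p → ‖l - p‖ < R / 16 → ‖E l‖ ≤ 2 * B / Real.sqrt ‖l - p‖ := by
    intro l hlp hl
    obtain ⟨w, rfl, h2⟩ := exists_expChart_eq (p := p) (κ := 1) (w := 0) (l := l) hp0 (by simp)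
      (by simp) (s := R / 2) (by positivity) (by linarith)
      (by rw [hpn]; simp only [expChart, mul_zero, Complex.exp_zero, mul_one]; linarith)
    rw [sub_zero] at h2
    have h3 := (hchart w (by linarith)).2
    have h4 : 0 < ‖expChart p 1 w - p‖ := norm_pos_iff.2 (sub_ne_zero.2 hlp)
    have hw0 : w ≠ 0 := by rintro rfl; rw [norm_zero] at h3; linarith
    refine (hbound w hw0 (by linarith)).trans ?_
    have h5 : Real.sqrt ‖expChart p 1 w - p‖ ≤ 2 * Real.sqrt ‖w‖ := by
      rw [show (2 : ℝ) = Real.sqrt 4 by rw [show (4 : ℝ) = 2 ^ 2 by norm_num]; simp,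
        ← Real.sqrt_mul (by norm_num)]
      exact Real.sqrt_le_sqrt h3
    have h6 := Real.sqrt_pos.2 h4
    have h7 := Real.sqrt_pos.2 (norm_pos_iff.2 hw0)
    rw [div_le_div_iff₀ h7 h6]
    nlinarith
  have hlittle : (fun z => E z - E p) =o[𝓝[≠] p] fun z => (z - p)⁻¹ := by
    refine (Asymptotics.isLittleO_iff_tendsto' ?_).2 ?_
    · filter_upwards [self_mem_nhdsWithin] with z hz h
      exact absurd (sub_eq_zero.1 (inv_eq_zero.1 h)) hz
    · have hlim : Tendsto (fun z : ℂ => 2 * B * Real.sqrt ‖z - p‖ + ‖E p‖ * ‖z - p‖) (𝓝[≠] p) (𝓝 0) :=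
        (Continuous.tendsto' (by fun_prop) _ _ (by simp)).mono_left nhdsWithin_le_nhds
      refine squeeze_zero_norm' ?_ hlim
      filter_upwards [self_mem_nhdsWithin, nhdsWithin_le_nhds
        (Metric.ball_mem_nhds p (by positivity : 0 < R / 16))] with z hz hzb
      rw [mem_ball_iff_norm] at hzb
      have h1 := hEb z hz hzb
      have h2 : 0 < ‖z - p‖ := norm_pos_iff.2 (sub_ne_zero.2 hz)
      have h3 := Real.sqrt_pos.2 h2
      have h4 := Real.mul_self_sqrt h2.le
      rw [div_inv_eq_mul, norm_mul]
      calc _ ≤ (2 * B / Real.sqrt ‖z - p‖ + ‖E p‖) * ‖z - p‖ := by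
            gcongr
            exact (norm_sub_le _ _).trans (by linarith)
        _ = _ := by
            rw [add_mul, div_mul_eq_mul_div, add_left_inj, div_eq_iff h3.ne']
            linear_combination (-(2 * B)) * h4
  have hR16 : R / 16 ≤ s := by linarith
  refine ⟨R / 16, by positivity, Function.update E p (limUnder (𝓝[≠] p) E), ?_, fun l hl hlY => ?_⟩
  · refine Complex.differentiableOn_update_limUnder_of_isLittleO
      (Metric.ball_mem_nhds p (by positivity)) (fun z hz => ?_) hlittle
    exact (hEd z (Metric.ball_subset_ball hR16 hz.1) hz.2).differentiableWithinAt
  · rw [Function.update_of_ne (by rintro rfl; exact hlY hpY), hE, extendFrom_eq_of_notMem hf.diff hlY]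

/-- After extension across the arcs and the corners the function is entire. Far from the origin the
contour consists of the axes, so the pointwise bound is the one required by
`eq_zero_of_norm_le_sqrt`. -/
theorem HasE2Bounds.eq_zero {f : ℂ → ℂ} (hf : HasE2Bounds f)
    (hj : ∀ j, ∀ᵐ s ∂volume.restrict (arcY j).dom,
      HasEqualSides f ((arcY j).param s) (deriv (arcY j).param s)) {l : ℂ} (hl : l ∉ contourY) :
    f l = 0 := by
  have h1 : ∀ p ∉ cornersY, ExtendsAt f p := fun p hp => by
    by_cases hY : p ∈ contourY
    · exact hf.extendsAt_of_mem hj hY hp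
    · exact extendsAt_of_notMem hf.diff hY
  have h2 : ∀ p, ExtendsAt f p := fun p => by
    by_cases hp : p ∈ cornersY
    · exact hf.extendsAt_corner h1 hp
    · exact h1 p hp
  obtain ⟨C, hC⟩ := hf.norm_le
  rw [← extendFrom_eq_of_notMem hf.diff hl]
  refine eq_zero_of_norm_le_sqrt (C := |C| * Real.sqrt 2) (fun p => (h2 p).differentiableAt)
    (by positivity) (fun w hw hre him => ?_) l
  have hwY : w ∉ contourY := (notMem_contourY_iff w).2 (Or.inr ⟨by linarith, hre, him⟩)
  rw [extendFrom_eq_of_notMem hf.diff hwY]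
  set a := min |w.re| |w.im| with ha
  have ha0 : 0 < a := lt_min (abs_pos.2 hre) (abs_pos.2 him)
  have haw : a ≤ ‖w‖ := (min_le_left _ _).trans (Complex.abs_re_le_norm w)
  refine (hC w (a / 2) (by positivity) fun l hl => ?_).trans ?_
  · rw [mem_closedBall_iff_norm] at hl
    have a1 := (Complex.abs_re_le_norm (l - w)).trans hl
    have a2 := (Complex.abs_im_le_norm (l - w)).trans hl
    rw [Complex.sub_re] at a1
    rw [Complex.sub_im] at a2
    refine (notMem_contourY_iff l).2 (Or.inr ⟨?_, ?_, ?_⟩)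
    · have := norm_sub_norm_le w (w - l)
      rw [sub_sub_cancel, norm_sub_rev w l] at this
      linarith
    · intro h0
      rw [h0, zero_sub, abs_neg] at a1
      linarith [min_le_left |w.re| |w.im|]
    · intro h0
      rw [h0, zero_sub, abs_neg] at a2
      linarith [min_le_right |w.re| |w.im|]
  · rw [Real.sqrt_div ha0.le, ← div_mul, mul_comm_div, mul_div_assoc']
    gcongr
    exact le_abs_self C

theorem norm_deriv_arcY (j : Fin 9) (s : ℝ) : ‖deriv (arcY j).param s‖ = 1 := by
  have h1 : ∀ u : ℂ, deriv (fun s : ℝ => (s : ℂ) * u) s = u := fun u => by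
    have := ((hasDerivAt_id s).ofReal_comp.mul_const u).deriv
    simpa using this
  have h2 : deriv (fun s : ℝ => Complex.exp (s * Complex.I)) s = Complex.exp (s * Complex.I) * Complex.I := by
    have := ((hasDerivAt_id s).ofReal_comp.mul_const Complex.I).cexp.deriv
    simpa using this
  have h3 := h1 1
  simp only [mul_one] at h3
  fin_cases j <;> simp [arcY, h1, h2, h3, Complex.norm_exp_ofReal_mul_I]

/-- As `det m^Y = 1`, the adjugate is the inverse and is bounded. The entries of `(m - m^Y) adj m^Y`
therefore inherit the Smirnoff bounds; they have no jump and vanish. -/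
theorem eqOn_mY_of_isRHSolution {ν : ℂ} (hν : ∀ n : ℤ, ν ≠ Complex.I * n) (y : ℝ)
    {m : ℂ → Matrix (Fin 2) (Fin 2) ℂ} (hm : IsRHSolution arcY (jumpY y ν) m) :
    Set.EqOn m (mY y ν) contourYᶜ := by
  have hs := isRHSolution_mY hν y
  obtain ⟨C, hC0, hC⟩ := exists_norm_mY_sub_one_le hν y
  have hmY : ∀ i k, DifferentiableOn ℂ (fun l => mY y ν l i k) contourYᶜ := fun i k l hl =>
    (differentiableAt_mY hν y hl i k).differentiableWithinAt
  have hmYb : ∀ l ∉ contourY, ∀ i k, ‖mY y ν l i k‖ ≤ C + 1 := fun l hl i k => by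
    have h1 := (hC l hl i k).1
    have h2 : ‖(1 : Matrix (Fin 2) (Fin 2) ℂ) i k‖ ≤ 1 := by fin_cases i <;> fin_cases k <;> simp
    have h3 := norm_add_le (mY y ν l i k - (1 : Matrix (Fin 2) (Fin 2) ℂ) i k)
      ((1 : Matrix (Fin 2) (Fin 2) ℂ) i k)
    rw [sub_add_cancel] at h3
    linarith
  have hadj : ∀ j k, DifferentiableOn ℂ (fun l => (mY y ν l).adjugate j k) contourYᶜ ∧
      ∀ l ∉ contourY, ‖(mY y ν l).adjugate j k‖ ≤ C + 1 := by
    intro j k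
    simp only [Matrix.adjugate_fin_two]
    fin_cases j <;> fin_cases k <;> simp
    · exact ⟨hmY 1 1, fun l hl => hmYb l hl 1 1⟩
    · exact ⟨hmY 0 1, fun l hl => hmYb l hl 0 1⟩
    · exact ⟨hmY 1 0, fun l hl => hmYb l hl 1 0⟩
    · exact ⟨hmY 0 0, fun l hl => hmYb l hl 0 0⟩
  have hD : ∀ i k, HasE2Bounds fun l => m l i k - mY y ν l i k := fun i k => by
    have s1 : IsSmirnoffE2 contourYᶜ _ := hm.smirnoff i k
    have s2 : IsSmirnoffE2 contourYᶜ _ := hs.smirnoff i k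
    have e : ∀ l, m l i k - mY y ν l i k = (m l i k - (1 : Matrix (Fin 2) (Fin 2) ℂ) i k) -
      (mY y ν l i k - (1 : Matrix (Fin 2) (Fin 2) ℂ) i k) := fun l => by ring
    simp only [e]
    refine s1.hasE2Bounds.of_norm_le s2.hasE2Bounds (s1.1.sub s2.1) zero_le_one fun l _ => ?_
    rw [one_mul]
    exact norm_sub_le _ _
  have hG : ∀ i k, HasE2Bounds fun l => ((m l - mY y ν l) * (mY y ν l).adjugate) i k := fun i k => by
    simp only [Matrix.mul_apply, Fin.sum_univ_two, Matrix.sub_apply]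
    refine (hD i 0).of_norm_le (hD i 1) (((hD i 0).diff.mul (hadj 0 k).1).add
      ((hD i 1).diff.mul (hadj 1 k).1)) (by linarith : 0 ≤ C + 1) fun l hl => ?_
    refine (norm_add_le _ _).trans ?_
    rw [norm_mul, norm_mul, mul_add, mul_comm (C + 1), mul_comm (C + 1)]
    gcongr
    exacts [(hadj 0 k).2 l hl, (hadj 1 k).2 l hl]
  have hzero : ∀ i k, ∀ l ∉ contourY, ((m l - mY y ν l) * (mY y ν l).adjugate) i k = 0 := by
    intro i k l hl
    refine (hG i k).eq_zero (fun j => ?_) hl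
    filter_upwards [hm.jump j, hs.jump j] with s h1 h2
    obtain ⟨A, B, hA, hB, hAB⟩ := h1
    obtain ⟨A', B', hA', hB', hAB'⟩ := h2
    exact hasEqualSides_of_jump (det_mY hν y) (norm_deriv_arcY j s) hA hB hAB hA' hB' hAB' i k
  intro l hl
  have h1 : (m l - mY y ν l) * (mY y ν l).adjugate = 0 := by
    ext i k
    exact hzero i k l hl
  have h2 := congrArg (· * mY y ν l) h1
  simp only [mul_assoc, Matrix.adjugate_mul, det_mY hν y l, one_smul, mul_one, zero_mul] at h2
  exact sub_eq_zero.1 h2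


theorem mainTheorem5 :
    (∀ (y : ℝ) (ν : ℂ), (∀ n : ℤ, ν ≠ Complex.I * n) →
      IsRHSolution arcY (jumpY y ν) (mY y ν) ∧
      ∀ m : ℂ → Matrix (Fin 2) (Fin 2) ℂ, IsRHSolution arcY (jumpY y ν) m →
        Set.EqOn m (mY y ν) contourYᶜ) ∧
    (∀ (K₁ : Set ℝ) (K₂ : Set ℂ), IsCompact K₁ → IsCompact K₂ →
      (∀ ν ∈ K₂, ∀ n : ℤ, ν ≠ Complex.I * n) →
      ∃ C R : ℝ, 0 < R ∧ ∀ y ∈ K₁, ∀ ν ∈ K₂, ∀ l ∈ contourYᶜ, R ≤ ‖l‖ → ∀ i k : Fin 2,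
        ‖mY y ν l i k - ((1 : Matrix (Fin 2) (Fin 2) ℂ) i k + m1Y y ν i k / l)‖
          ≤ C / ‖l‖ ^ 2) ∧
    (∀ (K₁ : Set ℝ) (K₂ : Set ℂ), IsCompact K₁ → IsCompact K₂ →
      (∀ ν ∈ K₂, ∀ n : ℤ, ν ≠ Complex.I * n) →
      ∃ C : ℝ, ∀ y ∈ K₁, ∀ ν ∈ K₂, ∀ l ∈ contourYᶜ, ∀ i k : Fin 2, ‖mY y ν l i k‖ ≤ C) := by
  refine ⟨fun y ν hν => ⟨isRHSolution_mY hν y, fun m hm => eqOn_mY_of_isRHSolution hν y hm⟩,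
    fun K₁ K₂ h₁ h₂ hK => ?_, fun K₁ K₂ h₁ h₂ hK => exists_norm_mY_le h₁ h₂ hK⟩
  obtain ⟨C, -, hC⟩ := exists_norm_mY_sub_le h₁ h₂ hK
  exact ⟨C, 1, one_pos, hC⟩
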